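/- \textbf{Setting.} For $j=1,2,3$ let $E_j=\mathbb C/\langle 1,\tau_j\rangle$ with $\operatorname{Im}\tau_j>0$, and let $T=E_1\times E_2\times E_3$. Let $\mathcal L_j\colon E_j\to\mathbb P^1$ be the Legendre function of $E_j$: the elliptic function of order two with simple zeros at $\pm\frac14$, simple poles at $\frac{\tau_j}2\pm\frac14$ and $\mathcal L_j(0)=1$, that is $$\mathcal L_j(z)=\frac{\wp_j(z)-\wp_j(\frac14)}{\wp_j(z)-\wp_j(\frac14+\frac{\tau_j}2)}.$$ Put $b_j=\mathcal L_j(\frac{\tau_j}4)$ and $b=b_1b_2b_3$. Consider the hypersurfaces of $T$ (equations understood in homogeneous coordinates of the values $\mathcal L_j(z_j)\in\mathbb P^1$) $$\hat X_\nu:\ \nu_1(\mathcal L_1\mathcal L_2\mathcal L_3+b_1b_2b_3)+\nu_2(\mathcal L_1b_2b_3+b_1\mathcal L_2\mathcal L_3)=0,\qquad \nu=(\nu_1:\nu_2)\in\mathbb P^1,\ \nu_1\neq\pm\nu_2,$$ $$\hat X_\mu:\ \mathcal L_1\mathcal L_2\mathcal L_3=\mu\quad(\mu\in\mathbb C\setminus\{0\}),\qquad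 \hat X_b:\ \mathcal L_1\mathcal L_2\mathcal L_3=b.$$ Let $(\zeta_j,\eta_j,\epsilon_j)\in(\mathbb Z/2)^3$ act on $E_j$ so that $(1,0,0),(0,1,0),(0,0,1)$ act by $z\mapsto -z$, $z\mapsto -z+\frac{\tau_j}2$, $z\mapsto -z+\frac12$; then $\mathcal G=(\mathbb Z/2)^9$, with elements written $(\zeta_1\eta_1\epsilon_1|\zeta_2\eta_2\epsilon_2|\zeta_3\eta_3\epsilon_3)$, acts on $T$. Let $$\mathcal G_0=\{\eta_1=\eta_2=\eta_3,\ \epsilon_1+\epsilon_2+\epsilon_3=0\},\quad \mathcal G_1'=\mathcal G_0\cap\{\epsilon_1=0\},\quad \mathcal G_1=\mathcal G_0\cap\{\eta_1=0\},$$ $$\begin{aligned}G_1&=\langle(100|100|100),(010|110|110),(000|001|101)\rangle,& G_2&=\langle(100|001|101),(001|000|101),(000|101|001)\rangle,\\ G_3&=\langle(100|001|101),(010|010|110),(001|101|100)\rangle,& G_4&=\langle(101|001|100),(010|010|110),(000|101|101)\rangle,\end{aligned}$$ $$\begin{aligned} &g_1=(000|000|100),&&g_2=(000|100|000),&&g_3=(100|000|000),&&g_4=(000|100|100),&&g_5=(100|000|100),\\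 &g_6=(100|100|000),&&g_7=(000|001|001),&&g_8=(001|000|001),&&g_9=(001|001|000),&&g_{11}=(100|001|001),\\ &g_{12}=(001|100|001),&&g_{13}=(001|001|100),&&g_{14}=(010|010|010),&&g_{15}=(010|111|111). \end{aligned}$$ For a hypersurface $\hat X$ as above let $\mathrm{Fix}(g)=\{x\in\hat X: gx=x\}$. "$p$ points, $n$ nodes, $e$ elliptic curves, $c$ genus $5$ curves" means that $\mathrm{Fix}(g)$ is the disjoint union of $p$ smooth points of $\hat X$, $n$ nodes of $\hat X$, $e$ elliptic curves and $c$ smooth connected compact curves of genus $5$, all these curves being pairwise disjoint and contained in the smooth locus of $\hat X$. \textbf{Lemma.} (1) Suppose that $G_1$ acts freely on $\hat X=\hat X_\nu$. The elements $g\ne0$ of $\mathcal G_1'$ with a fixed point on $\hat X_\nu$ are exactly $g_1,\dots,g_7,g_{11},g_{14},g_{15}$, and their fixed loci on $\hat X_\nu$ are: \begin{itemize} \item $g_1,g_2$: $4$ genus $5$ curves; \item $g_3$: $4$ genus $5$ curves if $\hat X_\nu$ is smooth; if $\hat X_\nu$ is singular, a disjoint union $C_1\sqcup C_2\sqcup D$,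 where $C_1,C_2$ are genus $5$ curves and $D$ is the union of $8$ elliptic curves, each passing through exactly two nodes of $\hat X_\nu$, and such that a point belongs to two of them if and only if it is a node of $\hat X_\nu$; \item $g_4,g_5,g_6$: $32$ points; \item $g_7$: $16$ points and $8$ elliptic curves if $\hat X_\nu$ is smooth; $8$ nodes and $8$ elliptic curves if it is singular; \item $g_{11}$: $32$ points if $\hat X_\nu$ is smooth; $32$ points and $8$ nodes if it is singular; \item $g_{14},g_{15}$: $32$ points. \end{itemize} (2) Suppose that $G_2$ acts freely on $\hat X=\hat X_\mu$. The elements $g\neq0$ of $\mathcal G_1$ with a fixed point on $\hat X_\mu$ are exactly $g_1,\dots,g_9,g_{11},g_{12},g_{13}$, and their fixed loci on $\hat X_\mu$ are: $4$ genus $5$ curves for $g_1,g_2,g_3$; $32$ points for $g_4,g_5,g_6$; $16$ points and $8$ elliptic curves for $g_7,g_8,g_9$; $32$ points for $g_{11},g_{12},g_{13}$. (3) Suppose that $G_3$ or $G_4$ acts freely on $\hat X=\hat X_b$. The elements of $\mathcal G_0$ whose fixed locus on $T$ has dimension one are exactly $g_4,\dots,g_9$, and their fixed loci on $\hat X_b$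 are: \begin{itemize} \item $g_4,g_5,g_6$: $32$ points if $\hat X_b$ is smooth; $16$ points and $8$ nodes if it is singular; \item $g_7,g_8,g_9$: $16$ points and $8$ elliptic curves (whether $\hat X_b$ is smooth or singular). \end{itemize} -/

import Mathlib

open scoped Topology

noncomputable section

namespace Burniat

/-! ### Elliptic curves and the Legendre function -/

/-- The pair of periods `1, τ`. -/
def periods (τ : UpperHalfPlane) : PeriodPair where
  ω₁ := 1
  ω₂ := τ
  indep := by
    rw [LinearIndependent.pair_iff]
    intro s t h
    have him := congrArg Complex.im h
    have hre := congrArg Complex.re h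
    have ht : t = 0 := by
      have : t * τ.im = 0 := by simpa using him
      rcases mul_eq_zero.mp this with h0 | h0
      · exact h0
      · exact absurd h0 τ.im_pos.ne'
    subst ht
    exact ⟨by simpa using hre, rfl⟩

/-- The elliptic curve `E = ℂ / ⟨1, τ⟩`, with its group structure and quotient topology. -/
abbrev E (τ : UpperHalfPlane) : Type := ℂ ⧸ (periods τ).lattice

/-- The class in `E` of a complex number. -/
def cls (τ : UpperHalfPlane) (z : ℂ) : E τ := Submodule.Quotient.mk z

open Classical in
/-- Homogeneous coordinates `(ℒ₀(z) : ℒ₁(z))` of the value at `z` of the Legendre function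
`ℒ(z) = (℘(z) - ℘(1/4)) / (℘(z) - ℘(1/4 + τ/2))`, on the universal cover `ℂ` of `E`. This is the
elliptic function of order two with simple zeros at `± 1/4`, simple poles at `τ/2 ± 1/4` and
`ℒ(0) = 1`; at the lattice points, where `℘` has its poles, its value is `(1 : 1)`. -/
def legendreAux (τ : UpperHalfPlane) (z : ℂ) : ℂ × ℂ :=
  if z ∈ (periods τ).lattice then (1, 1)
  else
    ((periods τ).weierstrassP z - (periods τ).weierstrassP (1 / 4),
      (periods τ).weierstrassP z - (periods τ).weierstrassP (1 / 4 + (τ : ℂ) / 2))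

theorem legendreAux_eq (τ : UpperHalfPlane) {z w : ℂ} (h : z - w ∈ (periods τ).lattice) :
    legendreAux τ z = legendreAux τ w := by
  have hP : (periods τ).weierstrassP z = (periods τ).weierstrassP w := by
    have := (periods τ).weierstrassP_add_coe w ⟨z - w, h⟩
    simpa using this
  have hm : z ∈ (periods τ).lattice ↔ w ∈ (periods τ).lattice := by
    constructor
    · intro hz
      simpa using sub_mem hz h
    · intro hw
      simpa using add_mem h hw
  unfold legendreAux
  by_cases hw : w ∈ (periods τ).lattice
  · rw [if_pos hw, if_pos (hm.mpr hw)]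
  · rw [if_neg hw, if_neg (fun h => hw (hm.mp h)), hP]

/-- Homogeneous coordinates `(ℒ₀(x) : ℒ₁(x))` of the value of the Legendre function
`ℒ : E → ℙ¹`, normalised by `ℒ(0) = 1`. -/
def legendre (τ : UpperHalfPlane) (x : E τ) : ℂ × ℂ :=
  Quotient.liftOn' x (legendreAux τ)
    (fun _ _ h => legendreAux_eq τ ((Submodule.quotientRel_def _).mp h))

/-- The constant `b = ℒ(τ/4)`. -/
def bConst (τ : UpperHalfPlane) : ℂ :=
  (legendre τ (cls τ ((τ : ℂ) / 4))).1 / (legendre τ (cls τ ((τ : ℂ) / 4))).2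

/-! ### The torus `T = E₁ × E₂ × E₃` and the group `𝒢 = (ℤ/2)⁹`

The factors are indexed by `0, 1, 2`. -/

/-- `T = E₁ × E₂ × E₃`. -/
abbrev T (τ : Fin 3 → UpperHalfPlane) : Type := ∀ j : Fin 3, E (τ j)

/-- The universal covering `ℂ³ → T`. -/
def proj (τ : Fin 3 → UpperHalfPlane) (z : Fin 3 → ℂ) : T τ := fun j => cls (τ j) (z j)

/-- The group `𝒢 = (ℤ/2)³ × (ℤ/2)³ × (ℤ/2)³`; the `j`-th component of `g` is
`(ζ, η, ε) = (g j 0, g j 1, g j 2)`. -/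
abbrev G : Type := Fin 3 → Fin 3 → ZMod 2

/-- The action of `(ζ, η, ε) ∈ (ℤ/2)³` on `E`, in which `(1,0,0)`, `(0,1,0)`, `(0,0,1)` act by
`z ↦ -z`, `z ↦ -z + τ/2`, `z ↦ -z + 1/2` (three commuting involutions). -/
def actE (τ : UpperHalfPlane) (s : Fin 3 → ZMod 2) (x : E τ) : E τ :=
  (fun y => -y)^[(s 0).val]
    ((fun y => -y + cls τ ((τ : ℂ) / 2))^[(s 1).val]
      ((fun y => -y + cls τ (1 / 2))^[(s 2).val] x))

/-- The induced action of `𝒢` on `T`. -/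
def act (τ : Fin 3 → UpperHalfPlane) (g : G) (x : T τ) : T τ := fun j => actE (τ j) (g j) (x j)

/-- `𝒢₀`: `η₁ = η₂ = η₃` and `ε₁ + ε₂ + ε₃ = 0`. -/
def calG0 : Set G :=
  {g | g 0 1 = g 1 1 ∧ g 1 1 = g 2 1 ∧ g 0 2 + g 1 2 + g 2 2 = 0}

/-- `𝒢₁'`: the elements of `𝒢₀` with `ε₁ = 0`. -/
def calG1' : Set G :=
  {g | g 0 1 = g 1 1 ∧ g 1 1 = g 2 1 ∧ g 0 2 = 0 ∧ g 1 2 + g 2 2 = 0}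

/-- `𝒢₁`: the elements of `𝒢₀` with `η₁ = η₂ = η₃ = 0`. -/
def calG1 : Set G :=
  {g | g 0 1 = 0 ∧ g 1 1 = 0 ∧ g 2 1 = 0 ∧ g 0 2 + g 1 2 + g 2 2 = 0}

/-! The groups `G₁, G₂, G₃, G₄ ≅ (ℤ/2)³` of the four families of regular surfaces. -/

def G₁ : AddSubgroup G := AddSubgroup.closure
  {![![1, 0, 0], ![1, 0, 0], ![1, 0, 0]],
   ![![0, 1, 0], ![1, 1, 0], ![1, 1, 0]],
   ![![0, 0, 0], ![0, 0, 1], ![1, 0, 1]]}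

def G₂ : AddSubgroup G := AddSubgroup.closure
  {![![1, 0, 0], ![0, 0, 1], ![1, 0, 1]],
   ![![0, 0, 1], ![0, 0, 0], ![1, 0, 1]],
   ![![0, 0, 0], ![1, 0, 1], ![0, 0, 1]]}

def G₃ : AddSubgroup G := AddSubgroup.closure
  {![![1, 0, 0], ![0, 0, 1], ![1, 0, 1]],
   ![![0, 1, 0], ![0, 1, 0], ![1, 1, 0]],
   ![![0, 0, 1], ![1, 0, 1], ![1, 0, 0]]}

def G₄ : AddSubgroup G := AddSubgroup.closure
  {![![1, 0, 1], ![0, 0, 1], ![1, 0, 0]],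
   ![![0, 1, 0], ![0, 1, 0], ![1, 1, 0]],
   ![![0, 0, 0], ![1, 0, 1], ![1, 0, 1]]}

/-! The elements `(ζ₁,η₁,ε₁,ζ₂,η₂,ε₂,ζ₃,η₃,ε₃)` named in the tables. -/

def g₁ : G := ![![0, 0, 0], ![0, 0, 0], ![1, 0, 0]]
def g₂ : G := ![![0, 0, 0], ![1, 0, 0], ![0, 0, 0]]
def g₃ : G := ![![1, 0, 0], ![0, 0, 0], ![0, 0, 0]]
def g₄ : G := ![![0, 0, 0], ![1, 0, 0], ![1, 0, 0]]
def g₅ : G := ![![1, 0, 0], ![0, 0, 0], ![1, 0, 0]]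
def g₆ : G := ![![1, 0, 0], ![1, 0, 0], ![0, 0, 0]]
def g₇ : G := ![![0, 0, 0], ![0, 0, 1], ![0, 0, 1]]
def g₈ : G := ![![0, 0, 1], ![0, 0, 0], ![0, 0, 1]]
def g₉ : G := ![![0, 0, 1], ![0, 0, 1], ![0, 0, 0]]
def g₁₁ : G := ![![1, 0, 0], ![0, 0, 1], ![0, 0, 1]]
def g₁₂ : G := ![![0, 0, 1], ![1, 0, 0], ![0, 0, 1]]
def g₁₃ : G := ![![0, 0, 1], ![0, 0, 1], ![1, 0, 0]]
def g₁₄ : G := ![![0, 1, 0], ![0, 1, 0], ![0, 1, 0]]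
def g₁₅ : G := ![![0, 1, 0], ![1, 1, 1], ![1, 1, 1]]

/-! ### Burniat hypersurfaces -/

/-- `X̂_ν`, `ν = (ν₁ : ν₂)`:
`ν₁ (ℒ₁ℒ₂ℒ₃ + b₁b₂b₃) + ν₂ (ℒ₁ b₂b₃ + b₁ ℒ₂ℒ₃) = 0`, in homogeneous coordinates. -/
def XNu (τ : Fin 3 → UpperHalfPlane) (ν₁ ν₂ : ℂ) : Set (T τ) :=
  {x | let p := fun j => legendre (τ j) (x j)
       let b := fun j => bConst (τ j)
       ν₁ * ((p 0).1 * (p 1).1 * (p 2).1 + b 0 * b 1 * b 2 * ((p 0).2 * (p 1).2 * (p 2).2)) +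
         ν₂ * (b 1 * b 2 * ((p 0).1 * (p 1).2 * (p 2).2) +
           b 0 * ((p 0).2 * (p 1).1 * (p 2).1)) = 0}

/-- `X̂_μ`: `ℒ₁ℒ₂ℒ₃ = μ`, in homogeneous coordinates. -/
def XMu (τ : Fin 3 → UpperHalfPlane) (μ : ℂ) : Set (T τ) :=
  {x | let p := fun j => legendre (τ j) (x j)
       (p 0).1 * (p 1).1 * (p 2).1 = μ * ((p 0).2 * (p 1).2 * (p 2).2)}

/-- `X̂_b = X̂_μ` for `μ = b₁b₂b₃`. -/
def XB (τ : Fin 3 → UpperHalfPlane) : Set (T τ) :=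
  XMu τ (bConst (τ 0) * bConst (τ 1) * bConst (τ 2))

variable {τ : Fin 3 → UpperHalfPlane}

/-- The subgroup `H` acts freely on `X`. -/
def ActsFreely (H : AddSubgroup G) (X : Set (T τ)) : Prop :=
  ∀ g ∈ H, g ≠ 0 → ∀ x ∈ X, act τ g x ≠ x

/-- The fixed locus of `g` on `X`. -/
def fixOn (X : Set (T τ)) (g : G) : Set (T τ) := {x | x ∈ X ∧ act τ g x = x}

/-! ### Submanifolds, smooth points, nodes -/

/-- Near `x`, the set `X` is a complex submanifold of `T` of codimension `k`: the zero set of a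
holomorphic submersion to `ℂᵏ`. -/
def IsSubmanifoldAt (k : ℕ) (X : Set (T τ)) (x : T τ) : Prop :=
  x ∈ X ∧ ∃ (z : Fin 3 → ℂ) (F : (Fin 3 → ℂ) → (Fin k → ℂ)),
    proj τ z = x ∧ AnalyticAt ℂ F z ∧ Function.Surjective (fderiv ℂ F z) ∧
      ∀ᶠ w in 𝓝 z, (proj τ w ∈ X ↔ F w = 0)

/-- `x` is a smooth point of the hypersurface `X ⊂ T`. -/
def IsSmoothPoint (X : Set (T τ)) (x : T τ) : Prop := IsSubmanifoldAt 1 X x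

/-- The hypersurface `X ⊂ T` is smooth. It is called singular otherwise. -/
def IsSmooth (X : Set (T τ)) : Prop := ∀ x ∈ X, IsSmoothPoint X x

/-- `x` is a node (ordinary double point) of the hypersurface `X ⊂ T`: a local equation of `X` at
`x` has vanishing differential and nondegenerate Hessian. -/
def IsNode (X : Set (T τ)) (x : T τ) : Prop :=
  x ∈ X ∧ ∃ (z : Fin 3 → ℂ) (F : (Fin 3 → ℂ) → ℂ),
    proj τ z = x ∧ AnalyticAt ℂ F z ∧ fderiv ℂ F z = 0 ∧
      (∀ v, (∀ w, fderiv ℂ (fderiv ℂ F) z v w = 0) → v = 0) ∧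
      ∀ᶠ w in 𝓝 z, (proj τ w ∈ X ↔ F w = 0)

/-! ### Curves in `T` and their genus -/

/-- A germ at `0` of a holomorphic map `γ` from `ℂ` to `C` (given by a lift to `ℂ³`). -/
def IsArc (C : Set (T τ)) (γ : ℂ → Fin 3 → ℂ) : Prop :=
  AnalyticAt ℂ γ 0 ∧ ∀ᶠ t in 𝓝 0, proj τ (γ t) ∈ C

/-- The tangent vectors at `x` to `C`; the tangent space of `T` at `x` is identified with `ℂ³` by
the covering `ℂ³ → T`. -/
def tangentVectors (C : Set (T τ)) (x : T τ) : Set (Fin 3 → ℂ) :=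
  {v | ∃ γ, IsArc C γ ∧ proj τ (γ 0) = x ∧ deriv γ 0 = v}

/-- The space of holomorphic `1`-forms on a complex submanifold `C` of `T`: functions `ω` on the
tangent bundle of `C` (extended by zero), linear on each tangent space, such that the pullback of
`ω` by every holomorphic germ `γ : ℂ → C` is holomorphic. -/
def holomorphicForms (C : Set (T τ)) : Submodule ℂ (T τ → (Fin 3 → ℂ) → ℂ) where
  carrier := {ω |
    (∀ x v, v ∉ tangentVectors C x → ω x v = 0) ∧
    (∀ x, ∀ v ∈ tangentVectors C x, ∀ w ∈ tangentVectors C x, ω x (v + w) = ω x v + ω x w) ∧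
    (∀ x, ∀ v ∈ tangentVectors C x, ∀ c : ℂ, ω x (c • v) = c * ω x v) ∧
    (∀ γ, IsArc C γ → AnalyticAt ℂ (fun t => ω (proj τ (γ t)) (deriv γ t)) 0)}
  zero_mem' := by
    refine ⟨fun _ _ _ => rfl, fun _ _ _ _ _ => by simp, fun _ _ _ _ => by simp, fun _ _ => ?_⟩
    exact analyticAt_const
  add_mem' := by
    rintro ω ω' ⟨h1, h2, h3, h4⟩ ⟨k1, k2, k3, k4⟩
    refine ⟨fun x v hv => ?_, fun x v hv w hw => ?_, fun x v hv c => ?_, fun γ hγ => ?_⟩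
    · simp [h1 x v hv, k1 x v hv]
    · simp only [Pi.add_apply, h2 x v hv w hw, k2 x v hv w hw]
      ring
    · simp only [Pi.add_apply, h3 x v hv c, k3 x v hv c]
      ring
    · exact (h4 γ hγ).add (k4 γ hγ)
  smul_mem' := by
    rintro a ω ⟨h1, h2, h3, h4⟩
    refine ⟨fun x v hv => ?_, fun x v hv w hw => ?_, fun x v hv c => ?_, fun γ hγ => ?_⟩
    · simp [h1 x v hv]
    · simp only [Pi.smul_apply, smul_eq_mul, h2 x v hv w hw]
      ring
    · simp only [Pi.smul_apply, smul_eq_mul, h3 x v hv c]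
      ring
    · exact analyticAt_const.mul (h4 γ hγ)

/-- `C ⊂ T` is a smooth compact connected complex curve of genus `n`, the genus being the dimension
of the space of holomorphic `1`-forms (so `n ≠ 0` is required, `finrank` being `0` by convention
for spaces of infinite dimension; only `n = 1` and `n = 5` are used). -/
def IsCurveOfGenus (n : ℕ) (C : Set (T τ)) : Prop :=
  IsCompact C ∧ IsConnected C ∧ (∀ x ∈ C, IsSubmanifoldAt 2 C x) ∧
    n ≠ 0 ∧ Module.finrank ℂ (holomorphicForms C) = n

/-- An elliptic curve in `T`: a smooth compact connected curve of genus one. -/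
def IsEllipticCurve (C : Set (T τ)) : Prop := IsCurveOfGenus 1 C

/-! ### Shapes of fixed loci -/

/-- The subset `F` of `X` is the disjoint union of `p` smooth points of `X`, `n` nodes of `X`,
`e` elliptic curves and `c` curves of genus `5`, the curves lying in the smooth locus of `X`. -/
def HasShape (X F : Set (T τ)) (p n e c : ℕ) : Prop :=
  ∃ (P N : Set (T τ)) (Es Cs : Set (Set (T τ))),
    P.encard = p ∧ (∀ x ∈ P, IsSmoothPoint X x) ∧
    N.encard = n ∧ (∀ x ∈ N, IsNode X x) ∧
    Es.encard = e ∧ (∀ C ∈ Es, IsEllipticCurve C) ∧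
    Cs.encard = c ∧ (∀ C ∈ Cs, IsCurveOfGenus 5 C) ∧
    (∀ x ∈ ⋃₀ (Es ∪ Cs), IsSmoothPoint X x) ∧
    (Es ∪ Cs).PairwiseDisjoint id ∧
    Disjoint P N ∧ Disjoint (P ∪ N) (⋃₀ (Es ∪ Cs)) ∧
    F = P ∪ N ∪ ⋃₀ (Es ∪ Cs)

/-- The configuration `Γ = C₁ ⊔ C₂ ⊔ D`: two curves `C₁, C₂` of genus `5` and a union `D` of `8`
elliptic curves, each passing through exactly two nodes of `X` and such that a point belongs to two
of them if and only if it is a node of `X`. -/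
def IsGamma (X F : Set (T τ)) : Prop :=
  ∃ (C₁ C₂ : Set (T τ)) (Ds : Set (Set (T τ))),
    IsCurveOfGenus 5 C₁ ∧ IsCurveOfGenus 5 C₂ ∧
    Ds.encard = 8 ∧ (∀ D ∈ Ds, IsEllipticCurve D) ∧
    (∀ D ∈ Ds, {x | x ∈ D ∧ IsNode X x}.encard = 2) ∧
    (∀ x, (∃ D ∈ Ds, ∃ D' ∈ Ds, D ≠ D' ∧ x ∈ D ∧ x ∈ D') ↔ IsNode X x) ∧
    Disjoint C₁ C₂ ∧ Disjoint C₁ (⋃₀ Ds) ∧ Disjoint C₂ (⋃₀ Ds) ∧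
    F = C₁ ∪ C₂ ∪ ⋃₀ Ds

/-- The fixed locus of `g` on `T` is nonempty and of (pure) dimension one. -/
def HasFixDimOne (τ : Fin 3 → UpperHalfPlane) (g : G) : Prop :=
  (fixOn (Set.univ : Set (T τ)) g).Nonempty ∧
    ∀ x ∈ fixOn (Set.univ : Set (T τ)) g, IsSubmanifoldAt 2 (fixOn Set.univ g) x

end Burniat

end

open Burniat

/-! The Legendre function `ℒ = legendre τ` of an elliptic curve has degree two and is branched
exactly at the four points of order two, over the values `±1` and `±b²`
(`add_self_eq_zero_iff_legendre`); translation by `1/2` and by `τ/2` replaces it by `-ℒ` and by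
`b²/ℒ`. These facts are derived from the Weierstrass function `℘` by means of Liouville's theorem,
which also shows that an elliptic function with no poles outside the lattice, and with poles of
order at most four there, is a linear combination of `1, ℘, ℘², ℘'` (`elliptic_eq`).

In homogeneous coordinates of the values of the three Legendre functions, every hypersurface in
question is the zero locus of a trilinear form (`IsTri`). Its singular points are found by
differentiating, and the Hessian at each of them is nondegenerate, so they are nodes (`isNode_iff`).
The groups `G₁` and `G₂` contain `-1`, and freeness enters through this element alone: the
hypersurface has no point of order two (`noTwoTorsion_of_actsFreely`). The last part of the theorem
does not depend on freeness.

A component of a group element that has a fixed point is either trivial or of the form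
`z ↦ -z + c` (`hasParity_of_nonempty`), and in the second case the fixed points of the component
form a coset of the group of points of order two. There remain finitely many elements to inspect
(see also `hasFixDimOne_iff`), and the fixed locus depends on the number of trivial components.

* If two components are trivial, the fixed locus consists of the four slices of the hypersurface at
  the points of order two of the remaining factor. A slice is given by a bilinear relation between
  two Legendre functions, that is, by an equation `(℘(x) - r)(℘(y) - s) = κ`. With `Q = ℘(y) - s`,
  the forms `dx`, `dy`, `dx/Q'`, `Q dx/Q'`, `Q² dx/Q'` are a basis of its holomorphic forms, so its
  genus is five (`isCurveOfGenus_biCurve`). Independence is seen by comparing the values at the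
  points `(±x, ±y)`; that they span follows by taking traces to the first factor, which makes a form
  into elliptic functions to which Liouville's theorem applies.
* If one component is trivial, the other two coordinates take finitely many pairs of values. Over
  each pair the hypersurface is a linear equation for the third Legendre function. If the equation
  is identically satisfied, this gives an elliptic curve (`isEllipticCurve_coordCurve`); otherwise
  it has two solutions, or a single one at a branch point (`encard_linFibred`,
  `encard_linFibred_of_branch`).
* If no component is trivial, the same equation is to be solved within a coset of the points of order
  two: either all four of its points are solutions, or the solutions of the linear equation are
  compared with the coset.

When `X̂_ν` has a node, translation by `τ₁/2` exchanges the two linear forms in `ℒ₁` one of which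
vanishes at the node (`phi_add_half₂`). Hence exactly two of the four slices in the first
bullet split into elliptic curves, in the configuration `IsTri.isGamma`. When `X̂_b` has a node,
the relation between the constants `b_j` responsible for it makes eight of the sixteen pairs of
points of order two critical, and `b_j⁴ ≠ 1` excludes the relation for the other eight
(`not_sameCond_and_diffCond`). -/


/-! ### Elliptic functions and the Weierstrass `℘`-function -/

noncomputable section

namespace Burniat

open Filter

variable {L : PeriodPair}

/-- Liouville's theorem: a doubly periodic function with isolated removable singularities is
constant apart from the values at these singularities. -/
theorem periodic_eq_const {f : ℂ → ℂ} (hper : ∀ z, ∀ l ∈ L.lattice, f (z + l) = f z)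
    (hd : ∀ z, ∀ᶠ w in 𝓝[≠] z, DifferentiableAt ℂ f w)
    (hl : ∀ z, ∃ c, Tendsto f (𝓝[≠] z) (𝓝 c)) :
    ∃ c, ∀ z, f =ᶠ[𝓝[≠] z] fun _ => c := by
  -- `g` extends `f` holomorphically across its singularities
  choose g hg using hl
  have hfg : ∀ z, DifferentiableAt ℂ f z → g z = f z := fun z hz =>
    tendsto_nhds_unique (hg z) (hz.continuousAt.tendsto.mono_left nhdsWithin_le_nhds)
  have hev : ∀ z, g =ᶠ[𝓝[≠] z] f := fun z => (hd z).mono fun w hw => hfg w hw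
  have hcont : ∀ z, ContinuousAt g z := fun z =>
    continuousAt_iff_punctured_nhds.mpr ((hg z).congr' (hev z).symm)
  have han : Differentiable ℂ g := fun z => by
    refine (Complex.analyticAt_of_differentiable_on_punctured_nhds_of_continuousAt ?_
      (hcont z)).differentiableAt
    have h1 := hd z
    rw [eventually_nhdsWithin_iff, eventually_nhds_iff] at h1 ⊢
    obtain ⟨t, ht, hto, hzt⟩ := h1
    refine ⟨t, fun w hw hwz => ?_, hto, hzt⟩
    have h2 : ∀ᶠ u in 𝓝 w, u ∈ t \ {z} := (hto.sdiff isClosed_singleton).mem_nhds ⟨hw, hwz⟩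
    exact (ht w hw hwz).congr_of_eventuallyEq
      (h2.mono fun u hu => hfg u (ht u hu.1 hu.2))
  have hgper : ∀ z l, l ∈ L.lattice → g (z + l) = g z := fun z l hl => by
    have h1 : Tendsto (fun w => w + l) (𝓝[≠] z) (𝓝[≠] (z + l)) := by
      refine tendsto_nhdsWithin_iff.mpr ⟨?_, ?_⟩
      · exact (continuous_add_const l).continuousAt.tendsto.mono_left nhdsWithin_le_nhds
      · filter_upwards [self_mem_nhdsWithin] with w hw
        simpa using hw
    refine tendsto_nhds_unique (((hg (z + l)).comp h1).congr fun w => ?_) (hg z)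
    exact hper w l hl
  have hb := (IsZLattice.isCompact_range_of_periodic L.lattice g han.continuous hgper).isBounded
  refine ⟨g 0, fun z => (hev z).symm.trans (Eventually.of_forall fun w => ?_)⟩
  exact han.apply_eq_apply_of_bounded hb w 0

theorem periodic_meromorphic_eq_const {f : ℂ → ℂ}
    (hper : ∀ z, ∀ l ∈ L.lattice, f (z + l) = f z) (hm : Meromorphic f)
    (ho : ∀ z, 0 ≤ meromorphicOrderAt f z) : ∃ c, ∀ z, f =ᶠ[𝓝[≠] z] fun _ => c :=
  periodic_eq_const hper
    (fun z => ((hm z).eventually_analyticAt).mono fun _ h => h.differentiableAt)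
    (fun z => tendsto_nhds_of_meromorphicOrderAt_nonneg (hm z) (ho z))

/-- If `f = zⁿ g` with `g 0 ≠ 0` is even, then `g 0 = (-1)ⁿ g 0`. -/
theorem even_order_of_even {f : ℂ → ℂ} {n : ℤ} (hm : MeromorphicAt f 0) (hf : ∀ z, f (-z) = f z)
    (hn : meromorphicOrderAt f 0 = n) : Even n := by
  obtain ⟨g, hg, hg0, hfg⟩ := (meromorphicOrderAt_eq_int_iff hm).mp hn
  by_contra hodd
  rw [Int.not_even_iff_odd] at hodd
  have hneg : Tendsto (fun z : ℂ => -z) (𝓝[≠] 0) (𝓝[≠] 0) := by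
    refine tendsto_nhdsWithin_iff.mpr ⟨?_, ?_⟩
    · simpa using (continuous_neg (G := ℂ)).continuousAt.tendsto.mono_left
        (nhdsWithin_le_nhds (a := (0 : ℂ)) (s := {0}ᶜ))
    · filter_upwards [self_mem_nhdsWithin] with w hw
      simpa using hw
  have h1 : ∀ᶠ z in 𝓝[≠] (0 : ℂ), g z = -g (-z) := by
    filter_upwards [hfg, hneg.eventually hfg, self_mem_nhdsWithin] with z h2 h3 hz
    have hz0 : z ≠ 0 := hz
    rw [hf, h2] at h3
    simp only [sub_zero, smul_eq_mul, hodd.neg_zpow] at h3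
    have : z ^ n ≠ 0 := zpow_ne_zero n hz0
    have h4 : z ^ n * g z = z ^ n * (-g (-z)) := by rw [h3]; ring
    exact mul_left_cancel₀ this h4
  have h2 : Tendsto g (𝓝[≠] 0) (𝓝 (g 0)) :=
    hg.continuousAt.tendsto.mono_left nhdsWithin_le_nhds
  have h3 : Tendsto (fun z => -g (-z)) (𝓝[≠] 0) (𝓝 (-g 0)) := (h2.comp hneg).neg
  have h4 := tendsto_nhds_unique h2 (h3.congr' (h1.mono fun z h => h.symm))
  exact hg0 (self_eq_neg.mp h4)

/-- An even meromorphic function of order at least `2k - 1` at `0` has order at least `2k`. -/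
theorem le_order_of_even {f : ℂ → ℂ} (hm : MeromorphicAt f 0) (hf : ∀ z, f (-z) = f z) (k : ℤ)
    (h : ((2 * k - 1 : ℤ) : WithTop ℤ) ≤ meromorphicOrderAt f 0) :
    ((2 * k : ℤ) : WithTop ℤ) ≤ meromorphicOrderAt f 0 := by
  cases hn : meromorphicOrderAt f 0 with
  | top => exact le_top
  | coe n =>
    have he := even_order_of_even hm hf hn
    rw [hn] at h
    have h1 : 2 * k - 1 ≤ n := by exact_mod_cast h
    obtain ⟨m, hm⟩ := he
    exact_mod_cast (by omega : 2 * k ≤ n)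

theorem order_shift (f : ℂ → ℂ) (a z : ℂ) :
    meromorphicOrderAt (fun w => f (w + a)) z = meromorphicOrderAt f (z + a) :=
  meromorphicOrderAt_comp_add_const_eq_meromorphicOrderAt

theorem meromorphic_shift {f : ℂ → ℂ} (hf : Meromorphic f) (a : ℂ) :
    Meromorphic fun w => f (w + a) := fun z =>
  (hf (z + a)).comp_analyticAt (g := fun w => w + a) (by fun_prop)

theorem order_of_periodic {f : ℂ → ℂ} (hper : ∀ z, ∀ l ∈ L.lattice, f (z + l) = f z)
    {l : ℂ} (hl : l ∈ L.lattice) (z : ℂ) :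
    meromorphicOrderAt f (z + l) = meromorphicOrderAt f z := by
  rw [← order_shift]
  congr 1
  ext w
  exact hper w l hl

theorem order_weierstrassP' {z : ℂ} (hz : z ∈ L.lattice) :
    meromorphicOrderAt L.weierstrassP z = ((-2 : ℤ) : WithTop ℤ) :=
  L.order_weierstrassP z hz

theorem meromorphicNFAt_weierstrassP (z : ℂ) : MeromorphicNFAt L.weierstrassP z := by
  rw [meromorphicNFAt_iff_analyticAt_or]
  by_cases hz : z ∈ L.lattice
  · right
    refine ⟨L.meromorphic_weierstrassP z, ?_, L.weierstrassP_coe ⟨z, hz⟩⟩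
    rw [order_weierstrassP' hz]
    exact_mod_cast (by norm_num : (-2 : ℤ) < 0)
  · exact Or.inl (L.analyticOnNhd_weierstrassP z hz)

/-- The reciprocal of `℘` is holomorphic at the lattice points, even at these points themselves,
since `0⁻¹ = 0` and `℘` is given the value `0` there. -/
theorem analyticAt_weierstrassP_inv {z : ℂ} (hz : z ∈ L.lattice) :
    AnalyticAt ℂ (L.weierstrassP)⁻¹ z := by
  rw [← (meromorphicNFAt_weierstrassP z).inv.meromorphicOrderAt_nonneg_iff_analyticAt,
    meromorphicOrderAt_inv, order_weierstrassP' hz]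
  exact_mod_cast (by norm_num : (0 : ℤ) ≤ -(-2))

theorem order_weierstrassP_zero : meromorphicOrderAt L.weierstrassP 0 = ((-2 : ℤ) : WithTop ℤ) :=
  order_weierstrassP' (zero_mem _)

/-- An even function with a pole of order at most `2(n+1)` at `0` becomes, after subtraction of a
multiple of `℘ ^ (n+1)`, a function with a pole of order at most `2n`. -/
theorem exists_sub_weierstrassP_pow {f : ℂ → ℂ} (hm : MeromorphicAt f 0)
    (hf : ∀ z, f (-z) = f z) (n : ℕ)
    (h : ((-2 * (n + 1) : ℤ) : WithTop ℤ) ≤ meromorphicOrderAt f 0) :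
    ∃ c : ℂ, ((-2 * n : ℤ) : WithTop ℤ) ≤
      meromorphicOrderAt (fun z => f z - c * L.weierstrassP z ^ (n + 1)) 0 := by
  have hP : MeromorphicAt L.weierstrassP 0 := L.meromorphic_weierstrassP 0
  have hq : MeromorphicAt (f * (L.weierstrassP ^ (n + 1))⁻¹) 0 := by fun_prop
  have ho : 0 ≤ meromorphicOrderAt (f * (L.weierstrassP ^ (n + 1))⁻¹) 0 := by
    rw [meromorphicOrderAt_mul hm (by fun_prop), meromorphicOrderAt_inv,
      meromorphicOrderAt_pow hP, order_weierstrassP_zero]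
    cases hn : meromorphicOrderAt f 0 with
    | top => simp
    | coe m =>
      rw [hn] at h
      have h1 : -2 * ((n : ℤ) + 1) ≤ m := by exact_mod_cast h
      have : (0 : ℤ) ≤ m + -(((n + 1 : ℕ) : ℤ) * (-2)) := by push_cast; linarith
      exact_mod_cast this
  obtain ⟨c, hc⟩ := tendsto_nhds_of_meromorphicOrderAt_nonneg hq ho
  refine ⟨c, ?_⟩
  have hpos : 0 < meromorphicOrderAt (fun z => (f * (L.weierstrassP ^ (n + 1))⁻¹) z - c) 0 := by
    rw [← tendsto_zero_iff_meromorphicOrderAt_pos (by fun_prop)]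
    simpa using hc.sub_const c
  have h2 : (fun z => f z - c * L.weierstrassP z ^ (n + 1)) =ᶠ[𝓝[≠] 0]
      (fun z => (f * (L.weierstrassP ^ (n + 1))⁻¹) z - c) * L.weierstrassP ^ (n + 1) := by
    have h3 : ∀ᶠ z in 𝓝[≠] (0 : ℂ), L.weierstrassP z ≠ 0 := by
      rw [← meromorphicOrderAt_ne_top_iff_eventually_ne_zero hP, order_weierstrassP_zero]
      simp
    filter_upwards [h3] with z hz
    simp only [Pi.mul_apply, Pi.inv_apply, Pi.pow_apply]
    field_simp
  have hm2 : MeromorphicAt (fun z => f z - c * L.weierstrassP z ^ (n + 1)) 0 := by fun_prop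
  have h5 : ∀ z, f (-z) - c * L.weierstrassP (-z) ^ (n + 1) =
      f z - c * L.weierstrassP z ^ (n + 1) := fun z => by simp [hf]
  have := le_order_of_even hm2 h5 (-n) ?_
  · convert this using 2; ring
  · rw [meromorphicOrderAt_congr h2, meromorphicOrderAt_mul (by fun_prop) (by fun_prop),
      meromorphicOrderAt_pow hP, order_weierstrassP_zero]
    cases hn : meromorphicOrderAt (fun z => (f * (L.weierstrassP ^ (n + 1))⁻¹) z - c) 0 with
    | top => simp
    | coe m =>
      rw [hn] at hpos
      have h1 : 0 < m := by exact_mod_cast hpos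
      have : 2 * -(n : ℤ) - 1 ≤ m + (((n + 1 : ℕ) : ℤ) * (-2)) := by push_cast; linarith
      exact_mod_cast this

theorem order_sub_nonneg {f g : ℂ → ℂ} {z : ℂ} (hf : MeromorphicAt f z) (hg : MeromorphicAt g z)
    (h1 : 0 ≤ meromorphicOrderAt f z) (h2 : 0 ≤ meromorphicOrderAt g z) :
    0 ≤ meromorphicOrderAt (fun w => f w - g w) z := by
  rw [← tendsto_nhds_iff_meromorphicOrderAt_nonneg (by fun_prop)]
  obtain ⟨a, ha⟩ := tendsto_nhds_of_meromorphicOrderAt_nonneg hf h1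
  obtain ⟨b, hb⟩ := tendsto_nhds_of_meromorphicOrderAt_nonneg hg h2
  exact ⟨a - b, ha.sub hb⟩

/-- An even elliptic function whose only poles are lattice points, of order at most `4`, is a
quadratic polynomial in `℘`. -/
theorem even_elliptic_eq {f : ℂ → ℂ} (hper : ∀ z, ∀ l ∈ L.lattice, f (z + l) = f z)
    (hm : Meromorphic f) (hf : ∀ z, f (-z) = f z)
    (ho : ∀ z ∉ L.lattice, 0 ≤ meromorphicOrderAt f z)
    (h0 : ((-4 : ℤ) : WithTop ℤ) ≤ meromorphicOrderAt f 0) :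
    ∃ a b c : ℂ, ∀ z, f =ᶠ[𝓝[≠] z]
      fun w => a + b * L.weierstrassP w + c * L.weierstrassP w ^ 2 := by
  have hP : Meromorphic L.weierstrassP := L.meromorphic_weierstrassP
  obtain ⟨c, hc⟩ := exists_sub_weierstrassP_pow (L := L) (hm 0) hf 1 (by simpa using h0)
  have hm1 : Meromorphic fun z => f z - c * L.weierstrassP z ^ (1 + 1) := fun z => by
    have := hm z; have := hP z; fun_prop
  obtain ⟨b, hb⟩ := exists_sub_weierstrassP_pow (L := L) (hm1 0)
    (fun z => by simp [hf]) 0 (by simpa using hc)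
  have hm2 : Meromorphic fun z => f z - c * L.weierstrassP z ^ (1 + 1) -
      b * L.weierstrassP z ^ (0 + 1) := fun z => by
    have := hm z; have := hP z; fun_prop
  have hper2 : ∀ z, ∀ l ∈ L.lattice, f (z + l) - c * L.weierstrassP (z + l) ^ (1 + 1) -
      b * L.weierstrassP (z + l) ^ (0 + 1) = f z - c * L.weierstrassP z ^ (1 + 1) -
      b * L.weierstrassP z ^ (0 + 1) := fun z l hl => by
    rw [hper z l hl, L.weierstrassP_add_coe z ⟨l, hl⟩]
  obtain ⟨a, ha⟩ := periodic_meromorphic_eq_const hper2 hm2 fun z => by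
    by_cases hz : z ∈ L.lattice
    · have := order_of_periodic (f := fun z => f z - c * L.weierstrassP z ^ (1 + 1) -
        b * L.weierstrassP z ^ (0 + 1)) hper2 hz 0
      rw [show (0 : ℂ) + z = z from zero_add z] at this
      rw [this]
      simpa using hb
    · have h1 := hP z
      have h2 := hm z
      have han := L.analyticOnNhd_weierstrassP z hz
      refine order_sub_nonneg (by fun_prop) (by fun_prop) (order_sub_nonneg (by fun_prop)
        (by fun_prop) (ho z hz) ?_) ?_
      · exact AnalyticAt.meromorphicOrderAt_nonneg (by fun_prop)
      · exact AnalyticAt.meromorphicOrderAt_nonneg (by fun_prop)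
  refine ⟨a, b, c, fun z => (ha z).mono fun w hw => ?_⟩
  have hw' : f w - c * L.weierstrassP w ^ (1 + 1) - b * L.weierstrassP w ^ (0 + 1) = a := hw
  linear_combination hw'

end Burniat

end

/-! ### Half periods and branch values of `℘` -/

noncomputable section

namespace Burniat

open Filter

variable {L : PeriodPair}

theorem eq_of_eventuallyEq_nhdsNE {f g : ℂ → ℂ} {z : ℂ} (hf : ContinuousAt f z)
    (hg : ContinuousAt g z) (h : f =ᶠ[𝓝[≠] z] g) : f z = g z :=
  tendsto_nhds_unique (hf.tendsto.mono_left nhdsWithin_le_nhds)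
    ((hg.tendsto.mono_left nhdsWithin_le_nhds).congr' h.symm)

theorem weierstrassP_periodic (z : ℂ) {l : ℂ} (hl : l ∈ L.lattice) :
    L.weierstrassP (z + l) = L.weierstrassP z := L.weierstrassP_add_coe z ⟨l, hl⟩

theorem derivWeierstrassP_periodic (z : ℂ) {l : ℂ} (hl : l ∈ L.lattice) :
    L.derivWeierstrassP (z + l) = L.derivWeierstrassP z := L.derivWeierstrassP_add_coe z ⟨l, hl⟩

theorem weierstrassP_congr {z w : ℂ} (h : z - w ∈ L.lattice) :
    L.weierstrassP z = L.weierstrassP w := by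
  simpa using weierstrassP_periodic w h

theorem derivWeierstrassP_congr {z w : ℂ} (h : z - w ∈ L.lattice) :
    L.derivWeierstrassP z = L.derivWeierstrassP w := by
  simpa using derivWeierstrassP_periodic w h

theorem analyticAt_weierstrassP {z : ℂ} (hz : z ∉ L.lattice) : AnalyticAt ℂ L.weierstrassP z :=
  L.analyticOnNhd_weierstrassP z hz

theorem analyticAt_derivWeierstrassP {z : ℂ} (hz : z ∉ L.lattice) :
    AnalyticAt ℂ L.derivWeierstrassP z :=
  L.analyticOnNhd_derivWeierstrassP z hz

theorem hasDerivAt_weierstrassP {z : ℂ} (hz : z ∉ L.lattice) :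
    HasDerivAt L.weierstrassP (L.derivWeierstrassP z) z := by
  have := (analyticAt_weierstrassP hz).differentiableAt.hasDerivAt
  rwa [L.deriv_weierstrassP] at this

theorem eventually_notMem_lattice {z : ℂ} (hz : z ∉ L.lattice) : ∀ᶠ w in 𝓝 z, w ∉ L.lattice :=
  L.isClosed_lattice.isOpen_compl.mem_nhds hz

theorem eventually_notMem_lattice' (z : ℂ) : ∀ᶠ w in 𝓝[≠] z, w ∉ L.lattice := by
  filter_upwards [mem_nhdsWithin_of_mem_nhds (L.compl_lattice_sdiff_singleton_mem_nhds z),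
    self_mem_nhdsWithin] with w h1 h2 h3
  exact h1 ⟨h3, h2⟩

theorem neg_mem_lattice {z : ℂ} : -z ∈ L.lattice ↔ z ∈ L.lattice := neg_mem_iff

/-- `℘` is not constant near any point. -/
theorem order_weierstrassP_sub_ne_top (c z : ℂ) :
    meromorphicOrderAt (fun w => L.weierstrassP w - c) z ≠ ⊤ := by
  have hm : MeromorphicOn (fun w => L.weierstrassP w - c) Set.univ := fun w _ => by
    have := L.meromorphic_weierstrassP w
    fun_prop
  refine hm.meromorphicOrderAt_ne_top_of_isPreconnected (x := 0) isPreconnected_univ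
    trivial trivial fun h => ?_
  rw [meromorphicOrderAt_eq_top_iff] at h
  have h1 : Tendsto L.weierstrassP (𝓝[≠] 0) (𝓝 c) :=
    tendsto_const_nhds.congr' (h.mono fun w hw => (sub_eq_zero.mp hw).symm)
  have h2 := (tendsto_nhds_iff_meromorphicOrderAt_nonneg (L.meromorphic_weierstrassP 0)).mp ⟨c, h1⟩
  rw [order_weierstrassP_zero] at h2
  have : (0 : ℤ) ≤ -2 := by exact_mod_cast h2
  norm_num at this

theorem analyticAt_weierstrassP_shift {z a : ℂ} (hz : z + a ∉ L.lattice) :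
    AnalyticAt ℂ (fun w => L.weierstrassP (w + a)) z :=
  (analyticAt_weierstrassP hz).fun_comp (f := fun w => w + a) (by fun_prop)

theorem order_le_weierstrassP_sub (c : ℂ) :
    ((-2 : ℤ) : WithTop ℤ) ≤ meromorphicOrderAt (fun w => L.weierstrassP w - c) 0 := by
  have h := meromorphicOrderAt_add (L.meromorphic_weierstrassP 0) (MeromorphicAt.const (-c) 0)
  refine le_trans (le_min order_weierstrassP_zero.ge ?_) (h.trans (le_of_eq ?_))
  · refine le_trans ?_ (analyticAt_const (v := -c)).meromorphicOrderAt_nonneg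
    exact_mod_cast (by norm_num : (-2 : ℤ) ≤ 0)
  · congr 1

/-- A zero at `0` of an even function is at least double. -/
theorem two_le_order {f : ℂ → ℂ} (hf : AnalyticAt ℂ f 0) (he : ∀ z, f (-z) = f z)
    (h0 : f 0 = 0) : ((2 : ℤ) : WithTop ℤ) ≤ meromorphicOrderAt f 0 := by
  have h1 : 0 < meromorphicOrderAt f 0 := by
    rw [← tendsto_zero_iff_meromorphicOrderAt_pos hf.meromorphicAt]
    simpa [h0] using hf.continuousAt.tendsto.mono_left (nhdsWithin_le_nhds (s := {0}ᶜ))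
  refine le_order_of_even hf.meromorphicAt he 1 ?_
  cases hn : meromorphicOrderAt f 0 with
  | top => exact le_top
  | coe m =>
    rw [hn] at h1
    have : 0 < m := by exact_mod_cast h1
    exact_mod_cast (by omega : 2 * 1 - 1 ≤ m)

/-- Translation by a half period `ω` acts on the values of `℘` by an involution of `ℙ¹` that
exchanges `℘ ω` and `∞`. The product on the left has no poles: the double pole of each factor is
cancelled by the zero of the other one, which is double because `z ↦ ℘ (z + ω)` is even. -/
theorem exists_weierstrassP_half_period {ω : ℂ} (hω : ω ∉ L.lattice) (h2 : ω + ω ∈ L.lattice) :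
    ∃ K : ℂ, K ≠ 0 ∧ ∀ z, z ∉ L.lattice → z + ω ∉ L.lattice →
      (L.weierstrassP (z + ω) - L.weierstrassP ω) * (L.weierstrassP z - L.weierstrassP ω) = K := by
  have hP : Meromorphic L.weierstrassP := L.meromorphic_weierstrassP
  set e := L.weierstrassP ω with he
  set f : ℂ → ℂ := (fun z => L.weierstrassP (z + ω) - e) * fun z => L.weierstrassP z - e with hf
  have hm1 : Meromorphic fun z => L.weierstrassP (z + ω) - e := fun z => by
    have := meromorphic_shift hP ω z; fun_prop
  have hm2 : Meromorphic fun z => L.weierstrassP z - e := fun z => by have := hP z; fun_prop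
  have hm : Meromorphic f := fun z => (hm1 z).mul (hm2 z)
  have hperω : ∀ z, f (z + ω) = f z := fun z => by
    simp only [hf, Pi.mul_apply]
    rw [add_assoc, weierstrassP_periodic z h2]
    ring
  have hper : ∀ z, ∀ l ∈ L.lattice, f (z + l) = f z := fun z l hl => by
    simp only [hf, Pi.mul_apply]
    rw [show z + l + ω = z + ω + l by ring, weierstrassP_periodic _ hl, weierstrassP_periodic _ hl]
  -- the zero of the first factor at `0` cancels the pole of the second one
  have ho0 : ((2 : ℤ) : WithTop ℤ) ≤ meromorphicOrderAt (fun z => L.weierstrassP (z + ω) - e) 0 := by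
    refine two_le_order ?_ (fun z => ?_) (by simp [he])
    · have := analyticAt_weierstrassP_shift (L := L) (z := 0) (a := ω) (by simpa using hω)
      fun_prop
    · rw [← L.weierstrassP_neg (z + ω), weierstrassP_congr]
      convert h2 using 1; ring
  have hord0 : 0 ≤ meromorphicOrderAt f 0 := by
    rw [hf, meromorphicOrderAt_mul (hm1 0) (hm2 0)]
    have := add_le_add ho0 (order_le_weierstrassP_sub (L := L) e)
    refine le_trans ?_ this
    exact_mod_cast (by norm_num : (0 : ℤ) ≤ 2 + -2)
  have hordΛ : ∀ z ∈ L.lattice, 0 ≤ meromorphicOrderAt f z := fun z hz => by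
    have := order_of_periodic hper hz 0
    rw [zero_add] at this
    rwa [this]
  obtain ⟨K, hK⟩ := periodic_meromorphic_eq_const hper hm fun z => by
    by_cases hz : z ∈ L.lattice
    · exact hordΛ z hz
    by_cases hz' : z + ω ∈ L.lattice
    -- the translation by `ω` exchanges the factors and so reduces this to the previous case
    · have h1 := order_shift f ω z
      rw [funext hperω] at h1
      rw [h1]
      exact hordΛ _ hz'
    · have h1 := analyticAt_weierstrassP hz
      have h2 := analyticAt_weierstrassP_shift hz'
      exact AnalyticAt.meromorphicOrderAt_nonneg (by fun_prop)
  refine ⟨K, fun h0 => ?_, fun z hz hz' => ?_⟩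
  · have h1 : meromorphicOrderAt f 0 = ⊤ := by
      rw [meromorphicOrderAt_eq_top_iff]
      filter_upwards [hK 0] with w hw
      rw [hw, h0]
    rw [hf, meromorphicOrderAt_mul (hm1 0) (hm2 0), WithTop.add_eq_top] at h1
    rcases h1 with h1 | h1
    · rw [order_shift (fun z => L.weierstrassP z - e)] at h1
      exact order_weierstrassP_sub_ne_top _ _ h1
    · exact order_weierstrassP_sub_ne_top _ _ h1
  · have h1 := analyticAt_weierstrassP hz
    have h2 := analyticAt_weierstrassP_shift hz'
    have h3 : AnalyticAt ℂ f z := by fun_prop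
    exact eq_of_eventuallyEq_nhdsNE h3.continuousAt continuousAt_const (hK z)

theorem sub_mem_lattice_of_eq_half_period {z ω : ℂ} (hω : ω ∉ L.lattice) (h2 : ω + ω ∈ L.lattice)
    (hz : z ∉ L.lattice) (h : L.weierstrassP z = L.weierstrassP ω) : z - ω ∈ L.lattice := by
  obtain ⟨K, hK, hK'⟩ := exists_weierstrassP_half_period hω h2
  by_contra hc
  refine hK ?_
  rw [← hK' z hz fun h' => hc ?_, h]
  · ring
  · have := sub_mem h' h2
    convert this using 1; ring

theorem half_period_sum_notMem : (L.ω₁ + L.ω₂) / 2 ∉ L.lattice := by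
  have := (L.mul_ω₁_add_mul_ω₂_mem_lattice (α := 1 / 2) (β := 1 / 2)).not.mpr (by norm_num)
  convert this using 2
  push_cast; ring

/-- The half periods `ω₁/2, ω₂/2, (ω₁+ω₂)/2`. -/
def halfPeriod (L : PeriodPair) : Fin 3 → ℂ := ![L.ω₁ / 2, L.ω₂ / 2, (L.ω₁ + L.ω₂) / 2]

theorem halfPeriod_notMem (i : Fin 3) : halfPeriod L i ∉ L.lattice := by
  fin_cases i
  · exact L.ω₁_div_two_notMem_lattice
  · exact L.ω₂_div_two_notMem_lattice
  · exact half_period_sum_notMem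

theorem halfPeriod_add_self (i : Fin 3) : halfPeriod L i + halfPeriod L i ∈ L.lattice := by
  fin_cases i <;> simp only [halfPeriod] <;> simp
  · exact L.ω₁_mem_lattice
  · exact L.ω₂_mem_lattice
  · exact add_mem L.ω₁_mem_lattice L.ω₂_mem_lattice

theorem halfPeriod_sub_notMem {i j : Fin 3} (h : i ≠ j) :
    halfPeriod L i - halfPeriod L j ∉ L.lattice := by
  have h1 := L.ω₁_mem_lattice
  have h2 := L.ω₂_mem_lattice
  have k1 := L.ω₁_div_two_notMem_lattice
  have k2 := L.ω₂_div_two_notMem_lattice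
  have k3 := half_period_sum_notMem (L := L)
  intro hc
  fin_cases i <;> fin_cases j <;> simp [halfPeriod] at h hc
  · exact k3 (by convert add_mem hc h2 using 1; ring)
  · exact k2 (by convert neg_mem hc using 1; ring)
  · exact k3 (by convert add_mem hc h1 using 1; ring)
  · exact k1 (by convert neg_mem hc using 1; ring)
  · exact k2 (by convert hc using 1; ring)
  · exact k1 (by convert hc using 1; ring)

/-- The branch values of `℘`. -/
def branchValue (L : PeriodPair) (i : Fin 3) : ℂ := L.weierstrassP (halfPeriod L i)

theorem branchValue_injective : Function.Injective (branchValue L) := by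
  intro i j h
  by_contra hij
  exact halfPeriod_sub_notMem hij (sub_mem_lattice_of_eq_half_period (halfPeriod_notMem j)
    (halfPeriod_add_self j) (halfPeriod_notMem i) h)

/-- `℘'` is odd, so it vanishes at the half periods. -/
theorem derivWeierstrassP_half_period {ω : ℂ} (h2 : ω + ω ∈ L.lattice) :
    L.derivWeierstrassP ω = 0 := by
  have h1 := L.derivWeierstrassP_neg ω
  rw [derivWeierstrassP_congr (z := -ω) (w := ω)] at h1
  · exact self_eq_neg.mp h1
  · convert neg_mem h2 using 1; ring

theorem branchValue_root (i : Fin 3) :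
    4 * branchValue L i ^ 3 - L.g₂ * branchValue L i - L.g₃ = 0 := by
  rw [branchValue, ← L.derivWeierstrassP_sq _ (halfPeriod_notMem i),
    derivWeierstrassP_half_period (halfPeriod_add_self i)]
  ring

theorem cubic_eq (x : ℂ) : 4 * x ^ 3 - L.g₂ * x - L.g₃ =
    4 * (x - branchValue L 0) * (x - branchValue L 1) * (x - branchValue L 2) ∧
    branchValue L 0 + branchValue L 1 + branchValue L 2 = 0 := by
  have h0 := branchValue_root (L := L) 0
  have h1 := branchValue_root (L := L) 1
  have h2 := branchValue_root (L := L) 2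
  have n01 : branchValue L 0 - branchValue L 1 ≠ 0 :=
    sub_ne_zero.mpr fun h => by simpa using branchValue_injective h
  have n02 : branchValue L 0 - branchValue L 2 ≠ 0 :=
    sub_ne_zero.mpr fun h => by simpa using branchValue_injective h
  have n12 : branchValue L 1 - branchValue L 2 ≠ 0 :=
    sub_ne_zero.mpr fun h => by simpa using branchValue_injective h
  generalize branchValue L 0 = a at *
  generalize branchValue L 1 = b at *
  generalize branchValue L 2 = c at *
  have k1 : 4 * (a ^ 2 + a * b + b ^ 2) = L.g₂ := by
    apply mul_left_cancel₀ n01; linear_combination h0 - h1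
  have k2 : 4 * (a ^ 2 + a * c + c ^ 2) = L.g₂ := by
    apply mul_left_cancel₀ n02; linear_combination h0 - h2
  have k3 : a + b + c = 0 := by
    apply mul_left_cancel₀ n12; linear_combination (k1 - k2) / 4
  refine ⟨?_, k3⟩
  linear_combination h0 + (x - a) * k1 + 4 * (x - a) * (x - b) * k3

end Burniat

end

/-! ### The zeros of `℘'` and the fibres of `℘` -/

noncomputable section

namespace Burniat

open Filter

variable {L : PeriodPair}

theorem add_self_mem_of_sub_mem {z ω : ℂ} (h2 : ω + ω ∈ L.lattice) (h : z - ω ∈ L.lattice) :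
    z + z ∈ L.lattice := by
  have := add_mem (add_mem h h) h2
  convert this using 1; ring

/-- The zeros of `℘'` are the half periods. -/
theorem exists_halfPeriod_of_deriv_eq_zero {z : ℂ} (hz : z ∉ L.lattice)
    (h : L.derivWeierstrassP z = 0) : ∃ i, z - halfPeriod L i ∈ L.lattice := by
  have h1 := L.derivWeierstrassP_sq z hz
  rw [h, (cubic_eq _).1] at h1
  have h2 : ∃ i, L.weierstrassP z = branchValue L i := by
    have : (L.weierstrassP z - branchValue L 0) * (L.weierstrassP z - branchValue L 1) *
      (L.weierstrassP z - branchValue L 2) = 0 := by linear_combination -h1 / 4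
    rcases mul_eq_zero.mp this with h | h
    · rcases mul_eq_zero.mp h with h | h
      · exact ⟨0, sub_eq_zero.mp h⟩
      · exact ⟨1, sub_eq_zero.mp h⟩
    · exact ⟨2, sub_eq_zero.mp h⟩
  obtain ⟨i, hi⟩ := h2
  exact ⟨i, sub_mem_lattice_of_eq_half_period (halfPeriod_notMem i) (halfPeriod_add_self i) hz hi⟩

theorem derivWeierstrassP_eq_zero_iff {z : ℂ} (hz : z ∉ L.lattice) :
    L.derivWeierstrassP z = 0 ↔ z + z ∈ L.lattice := by
  refine ⟨fun h => ?_, derivWeierstrassP_half_period⟩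
  obtain ⟨i, hi⟩ := exists_halfPeriod_of_deriv_eq_zero hz h
  exact add_self_mem_of_sub_mem (halfPeriod_add_self i) hi

theorem exists_halfPeriod {z : ℂ} (hz : z ∉ L.lattice) (h : z + z ∈ L.lattice) :
    ∃ i, z - halfPeriod L i ∈ L.lattice :=
  exists_halfPeriod_of_deriv_eq_zero hz (derivWeierstrassP_half_period h)

/-- The second order differential equation `℘'' = 6 ℘² - g₂ / 2`. -/
theorem hasDerivAt_derivWeierstrassP {z : ℂ} (hz : z ∉ L.lattice) :
    HasDerivAt L.derivWeierstrassP (6 * L.weierstrassP z ^ 2 - L.g₂ / 2) z := by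
  have hd := (analyticAt_derivWeierstrassP hz).differentiableAt.hasDerivAt
  suffices key : 6 * L.weierstrassP z ^ 2 - L.g₂ / 2 = deriv L.derivWeierstrassP z by rwa [← key] at hd
  -- the differential equation gives the formula where `℘' ≠ 0`, and continuity gives the rest
  have han : ∀ w ∉ L.lattice, AnalyticAt ℂ (fun w => 6 * L.weierstrassP w ^ 2 - L.g₂ / 2) w :=
    fun w hw => by have := analyticAt_weierstrassP hw; fun_prop
  refine eq_of_eventuallyEq_nhdsNE (han z hz).continuousAt
    (analyticAt_derivWeierstrassP hz).deriv.continuousAt ?_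
  -- otherwise `℘` would be constant near `z`
  have hne : ∀ᶠ w in 𝓝[≠] z, L.derivWeierstrassP w ≠ 0 := by
    rcases (analyticAt_derivWeierstrassP hz).eventually_eq_zero_or_eventually_ne_zero with h | h
    · exfalso
      refine order_weierstrassP_sub_ne_top (L := L) (L.weierstrassP z) z ?_
      rw [meromorphicOrderAt_eq_top_iff]
      have h1 : ∀ᶠ w in 𝓝 z, L.weierstrassP w - L.weierstrassP z = 0 := by
        have h2 : ∀ᶠ w in 𝓝 z, HasDerivAt L.weierstrassP 0 w := by
          filter_upwards [h, eventually_notMem_lattice hz] with w hw hw'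
          have := hasDerivAt_weierstrassP hw'
          rwa [hw] at this
        obtain ⟨r, hr, hball⟩ := Metric.eventually_nhds_iff_ball.mp h2
        filter_upwards [Metric.ball_mem_nhds z hr] with w hw
        rw [sub_eq_zero]
        refine (convex_ball z r).is_const_of_fderivWithin_eq_zero (𝕜 := ℂ)
          (fun u hu => (hball u hu).differentiableAt.differentiableWithinAt)
          (fun u hu => ?_) hw (Metric.mem_ball_self hr)
        rw [fderivWithin_eq_fderiv (Metric.isOpen_ball.uniqueDiffWithinAt hu)
          (hball u hu).differentiableAt]
        ext
        simp [(hball u hu).deriv]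
      exact h1.filter_mono nhdsWithin_le_nhds
    · exact h
  filter_upwards [hne, mem_nhdsWithin_of_mem_nhds (eventually_notMem_lattice hz)] with w hw hw'
  have h1 : HasDerivAt (fun u => L.derivWeierstrassP u ^ 2)
      (2 * L.derivWeierstrassP w * deriv L.derivWeierstrassP w) w := by
    simpa using (analyticAt_derivWeierstrassP hw').differentiableAt.hasDerivAt.fun_pow 2
  have hP := hasDerivAt_weierstrassP hw'
  have h2 : HasDerivAt (fun u => 4 * L.weierstrassP u ^ 3 - L.g₂ * L.weierstrassP u - L.g₃)
      (4 * (3 * L.weierstrassP w ^ 2 * L.derivWeierstrassP w) - L.g₂ * L.derivWeierstrassP w) w := by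
    simpa using (((hP.fun_pow 3).const_mul 4).sub (hP.const_mul L.g₂)).sub_const L.g₃
  have h3 := h1.unique (h2.congr_of_eventuallyEq
    ((eventually_notMem_lattice hw').mono fun u hu => L.derivWeierstrassP_sq u hu))
  have h4 : (2 * L.derivWeierstrassP w) * (6 * L.weierstrassP w ^ 2 - L.g₂ / 2) =
      (2 * L.derivWeierstrassP w) * deriv L.derivWeierstrassP w := by linear_combination -h3
  exact mul_left_cancel₀ (mul_ne_zero two_ne_zero hw) h4

/-- The zeros of `℘'` are simple: if `e₁, e₂, e₃` are the branch values of `℘`, then `℘''` at the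
first half period is `2 (e₁ - e₂)(e₁ - e₃)`, and similarly at the other ones. -/
theorem deriv_derivWeierstrassP_ne_zero {z : ℂ} (hz : z ∉ L.lattice) (h2 : z + z ∈ L.lattice) :
    deriv L.derivWeierstrassP z ≠ 0 := by
  rw [(hasDerivAt_derivWeierstrassP hz).deriv]
  obtain ⟨i, hi⟩ := exists_halfPeriod hz h2
  rw [weierstrassP_congr hi]
  change 6 * branchValue L i ^ 2 - _ ≠ 0
  have h0 := branchValue_root (L := L) 0
  have h1 := branchValue_root (L := L) 1
  have h3 := (cubic_eq (L := L) 0).2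
  have n01 : branchValue L 0 - branchValue L 1 ≠ 0 :=
    sub_ne_zero.mpr fun h => by simpa using branchValue_injective h
  have n02 : branchValue L 0 - branchValue L 2 ≠ 0 :=
    sub_ne_zero.mpr fun h => by simpa using branchValue_injective h
  have n12 : branchValue L 1 - branchValue L 2 ≠ 0 :=
    sub_ne_zero.mpr fun h => by simpa using branchValue_injective h
  have k1 : 4 * (branchValue L 0 ^ 2 + branchValue L 0 * branchValue L 1 + branchValue L 1 ^ 2) =
      L.g₂ := by
    apply mul_left_cancel₀ n01; linear_combination h0 - h1
  have hc : branchValue L 2 = -(branchValue L 0 + branchValue L 1) := by linear_combination h3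
  intro h
  fin_cases i
  · refine mul_ne_zero n01 n02 ?_
    rw [hc]
    have h' : 6 * branchValue L 0 ^ 2 - L.g₂ / 2 = 0 := h
    linear_combination h' / 2 - k1 / 4
  · refine mul_ne_zero n01 n12 ?_
    rw [hc]
    have h' : 6 * branchValue L 1 ^ 2 - L.g₂ / 2 = 0 := h
    linear_combination -h' / 2 + k1 / 4
  · refine mul_ne_zero n02 n12 ?_
    simp only [Fin.reduceFinMk, hc] at h ⊢
    linear_combination h / 2 - k1 / 4

/-- `℘` has order two: its fibres are the pairs `{z, -z}`. For the proof consider the even elliptic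
function `f w = (℘ w - ℘ a)² (℘ (w + a) + ℘ (w - a))`. Its only poles are the lattice points, so it is
a quadratic polynomial in `℘`, and it takes the same value at `z` as at `a`. This value is `(℘' a)²`
at `a`, and `0` at a point `z` that is not congruent to `± a`, so `a` is a half period. -/
theorem sub_mem_or_add_mem_of_weierstrassP_eq {z a : ℂ} (hz : z ∉ L.lattice) (ha : a ∉ L.lattice)
    (h : L.weierstrassP z = L.weierstrassP a) : z - a ∈ L.lattice ∨ z + a ∈ L.lattice := by
  by_cases h2 : a + a ∈ L.lattice
  · exact Or.inl (sub_mem_lattice_of_eq_half_period ha h2 hz h)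
  by_contra! hc
  refine h2 ((derivWeierstrassP_eq_zero_iff ha).mp ?_)
  have hP : Meromorphic L.weierstrassP := L.meromorphic_weierstrassP
  set N : ℂ → ℂ := fun w => L.weierstrassP w - L.weierstrassP a with hN
  set B : ℂ → ℂ := fun w => L.weierstrassP (w + a) + L.weierstrassP (w + -a) with hB
  have hmN : Meromorphic N := fun w => by have := hP w; fun_prop
  have hmB : Meromorphic B := fun w => by
    have h1 := meromorphic_shift hP a w
    have h2 := meromorphic_shift hP (-a) w
    exact h1.add h2
  set f : ℂ → ℂ := fun w => N w ^ 2 * B w with hf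
  have hmf : Meromorphic f := fun w => by have := hmN w; have := hmB w; fun_prop
  have hperN : ∀ w, ∀ l ∈ L.lattice, N (w + l) = N w := fun w l hl => by
    simp only [hN, weierstrassP_periodic w hl]
  have hperB : ∀ w, ∀ l ∈ L.lattice, B (w + l) = B w := fun w l hl => by
    simp only [hB]
    rw [add_right_comm, weierstrassP_periodic _ hl, add_right_comm, weierstrassP_periodic _ hl]
  have hper : ∀ w, ∀ l ∈ L.lattice, f (w + l) = f w := fun w l hl => by
    simp only [hf, hperN w l hl, hperB w l hl]
  have hNneg : ∀ w, N (-w) = N w := fun w => by simp [hN]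
  have hBneg : ∀ w, B (-w) = B w := fun w => by
    simp only [hB]
    rw [← L.weierstrassP_neg (-w + a), ← L.weierstrassP_neg (-w + -a), add_comm]
    congr 2 <;> ring
  have hneg : ∀ w, f (-w) = f w := fun w => by simp only [hf, hNneg, hBneg]
  have hanN : ∀ w ∉ L.lattice, AnalyticAt ℂ N w := fun w hw => by
    have := analyticAt_weierstrassP hw; fun_prop
  -- near `a` the double pole of `℘ (w - a)` is cancelled by the double zero of `N ^ 2`
  have hlim : Tendsto f (𝓝[≠] a) (𝓝 (L.derivWeierstrassP a ^ 2)) := by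
    have t1 : Tendsto (fun w => N w / (w - a)) (𝓝[≠] a) (𝓝 (L.derivWeierstrassP a)) := by
      have := (hasDerivAt_weierstrassP ha).tendsto_slope
      refine this.congr fun w => ?_
      simp [slope_def_field, hN]
    have t2 : Tendsto (fun w => (w - a) ^ 2 * L.weierstrassP (w + -a)) (𝓝[≠] a) (𝓝 1) := by
      have hE : AnalyticAt ℂ (L.weierstrassPExcept 0) 0 := L.analyticAt_weierstrassPExcept 0
      have h1 : ContinuousAt (fun w : ℂ => w ^ 2 * L.weierstrassPExcept 0 w + 1) 0 := by
        have := hE.continuousAt; fun_prop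
      have h2 : Tendsto (fun w : ℂ => w - a) (𝓝[≠] a) (𝓝 0) := by
        have : ContinuousAt (fun w : ℂ => w - a) a := by fun_prop
        simpa using this.tendsto.mono_left (nhdsWithin_le_nhds (s := {a}ᶜ))
      have h3 := h1.tendsto.comp h2
      simp only [ne_eq, OfNat.ofNat_ne_zero, not_false_eq_true, zero_pow, zero_mul, zero_add] at h3
      refine h3.congr' ?_
      filter_upwards [self_mem_nhdsWithin] with w hw
      have hw' : w - a ≠ 0 := sub_ne_zero.mpr hw
      have := L.ite_eq_one_sub_sq_mul_weierstrassP 0 (zero_mem _) (w - a)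
      simp only [hw', if_false, sub_zero] at this
      simp only [Function.comp]
      rw [← sub_eq_add_neg, this]
      simp
    have t3 : Tendsto (fun w => N w ^ 2 * L.weierstrassP (w + a)) (𝓝[≠] a) (𝓝 0) := by
      have h1 := (hanN a ha).continuousAt
      have h3 := (analyticAt_weierstrassP_shift (L := L) (z := a) (a := a) h2).continuousAt
      have h4 : ContinuousAt (fun w => N w ^ 2 * L.weierstrassP (w + a)) a := by fun_prop
      have := h4.tendsto.mono_left (nhdsWithin_le_nhds (s := {a}ᶜ))
      simpa [hN] using this
    have t4 := ((t1.pow 2).mul t2).add t3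
    simp only [mul_one, add_zero] at t4
    refine t4.congr' ?_
    filter_upwards [self_mem_nhdsWithin] with w hw
    have hw' : w - a ≠ 0 := sub_ne_zero.mpr hw
    simp only [hf, hB]
    field_simp
    ring
  have ha0 : 0 ≤ meromorphicOrderAt f a :=
    (tendsto_nhds_iff_meromorphicOrderAt_nonneg (hmf a)).mp ⟨_, hlim⟩
  have hna0 : 0 ≤ meromorphicOrderAt f (-a) := by
    have h1 := meromorphicOrderAt_comp_of_deriv_ne_zero (f := f) (g := fun w : ℂ => -w) (x := -a)
      (by fun_prop) (by simp)
    have h3 : f ∘ (fun w => -w) = f := funext hneg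
    rw [h3, neg_neg] at h1
    rwa [h1]
  have hanB : ∀ w, w + a ∉ L.lattice → w + -a ∉ L.lattice → AnalyticAt ℂ B w := fun w h1 h2 => by
    have k1 := analyticAt_weierstrassP_shift h1
    have k2 := analyticAt_weierstrassP_shift h2
    exact k1.add k2
  obtain ⟨A, B', C, hABC⟩ := even_elliptic_eq hper hmf hneg
    (fun w hw => by
      by_cases h1 : w + a ∈ L.lattice
      · have := order_of_periodic hper h1 (-a)
        rw [show -a + (w + a) = w by ring] at this
        rwa [this]
      by_cases h2 : w + -a ∈ L.lattice
      · have := order_of_periodic hper h2 a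
        rw [show a + (w + -a) = w by ring] at this
        rwa [this]
      have h3 := hanN w hw
      have h4 := hanB w h1 h2
      exact AnalyticAt.meromorphicOrderAt_nonneg (by fun_prop))
    (by
      have h3 := hmN 0
      have h4 := hmB 0
      have h5 := order_le_weierstrassP_sub (L := L) (L.weierstrassP a)
      have h6 : 0 ≤ meromorphicOrderAt B 0 :=
        (hanB 0 (by simpa using ha) (by simpa [neg_mem_lattice] using ha)).meromorphicOrderAt_nonneg
      have h7 : meromorphicOrderAt f 0 = meromorphicOrderAt (N ^ 2) 0 + meromorphicOrderAt B 0 :=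
        meromorphicOrderAt_mul (h3.pow 2) h4
      rw [h7, pow_two, meromorphicOrderAt_mul h3 h3]
      change ((-2 : ℤ) : WithTop ℤ) ≤ meromorphicOrderAt N 0 at h5
      cases hn : meromorphicOrderAt N 0 with
      | top => simp
      | coe n =>
        rw [hn] at h5
        cases hb : meromorphicOrderAt B 0 with
        | top => simp
        | coe m =>
          rw [hb] at h6
          have h8 : (-2 : ℤ) ≤ n := by exact_mod_cast h5
          have h9 : (0 : ℤ) ≤ m := by exact_mod_cast h6
          have : (-4 : ℤ) ≤ n + n + m := by linarith
          exact_mod_cast this)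
  have hanR : ∀ w ∉ L.lattice, ContinuousAt
      (fun w => A + B' * L.weierstrassP w + C * L.weierstrassP w ^ 2) w := fun w hw => by
    have := (analyticAt_weierstrassP hw).continuousAt
    fun_prop
  have e1 : L.derivWeierstrassP a ^ 2 =
      A + B' * L.weierstrassP a + C * L.weierstrassP a ^ 2 :=
    tendsto_nhds_unique hlim (((hanR a ha).tendsto.mono_left nhdsWithin_le_nhds).congr'
      (hABC a).symm)
  have e2 : f z = A + B' * L.weierstrassP z + C * L.weierstrassP z ^ 2 := by
    refine eq_of_eventuallyEq_nhdsNE ?_ (hanR z hz) (hABC z)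
    have h3 := (hanN z hz).continuousAt
    have h4 := (hanB z hc.2 (by simpa [← sub_eq_add_neg] using hc.1)).continuousAt
    fun_prop
  rw [h, ← e1] at e2
  have : f z = 0 := by simp [hf, hN, h]
  rw [this] at e2
  exact pow_eq_zero_iff (two_ne_zero) |>.mp e2.symm

/-- `℘` takes every value: otherwise `1 / (℘ - c)` would have no poles. -/
theorem exists_weierstrassP_eq (c : ℂ) : ∃ z, z ∉ L.lattice ∧ L.weierstrassP z = c := by
  by_contra! h
  have hP : Meromorphic L.weierstrassP := L.meromorphic_weierstrassP
  have hm : Meromorphic fun z => (L.weierstrassP z - c) := fun z => by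
    have := hP z; fun_prop
  have hm' : Meromorphic (fun z => (L.weierstrassP z - c))⁻¹ := fun z => (hm z).inv
  obtain ⟨d, hd⟩ := periodic_meromorphic_eq_const (L := L) (f := (fun z => (L.weierstrassP z - c))⁻¹)
    (fun z l hl => by simp only [Pi.inv_apply, weierstrassP_periodic z hl]) hm'
    (fun z => by
      by_cases hz : z ∈ L.lattice
      · have h1 := order_of_periodic (L := L) (f := (fun z => (L.weierstrassP z - c))⁻¹)
          (fun z l hl => by simp only [Pi.inv_apply, weierstrassP_periodic z hl]) hz 0
        rw [zero_add] at h1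
        have h2 : meromorphicOrderAt (fun w => L.weierstrassP w - c) 0 < 0 := by
          rw [← not_le, ← tendsto_nhds_iff_meromorphicOrderAt_nonneg (hm 0)]
          rintro ⟨b, hb⟩
          have h2 := (tendsto_nhds_iff_meromorphicOrderAt_nonneg (hP 0)).mp
            ⟨b + c, by simpa using hb.add_const c⟩
          rw [order_weierstrassP_zero] at h2
          have : (0 : ℤ) ≤ -2 := by exact_mod_cast h2
          norm_num at this
        rw [h1, meromorphicOrderAt_inv]
        cases hn : meromorphicOrderAt (fun w => L.weierstrassP w - c) 0 with
        | top => simp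
        | coe n =>
          rw [hn] at h2
          have h3 : n < 0 := by exact_mod_cast h2
          have : 0 ≤ -n := by linarith
          exact_mod_cast this
      · have h1 := analyticAt_weierstrassP hz
        refine AnalyticAt.meromorphicOrderAt_nonneg (AnalyticAt.inv (by fun_prop) ?_)
        exact sub_ne_zero.mpr (h z hz))
  refine order_weierstrassP_sub_ne_top (L := L) (c + d⁻¹) 0 ?_
  rw [meromorphicOrderAt_eq_top_iff]
  filter_upwards [hd 0] with w hw
  have : L.weierstrassP w - c = d⁻¹ := by
    rw [← hw]; simp
  linear_combination this

end Burniat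

end

/-! ### Elliptic functions with a pole at the origin only -/

noncomputable section

namespace Burniat

open Filter

variable {L : PeriodPair}

theorem order_derivWeierstrassP_zero :
    meromorphicOrderAt L.derivWeierstrassP 0 = ((-3 : ℤ) : WithTop ℤ) := by
  rw [← L.deriv_weierstrassP]
  exact meromorphicOrderAt_deriv_eq_sub_one (n := -2) (by norm_num) order_weierstrassP_zero

theorem order_derivWeierstrassP_half_period {ω : ℂ} (hω : ω ∉ L.lattice)
    (h2 : ω + ω ∈ L.lattice) : meromorphicOrderAt L.derivWeierstrassP ω = ((1 : ℤ) : WithTop ℤ) := by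
  have han := analyticAt_derivWeierstrassP hω
  have h1 := han.analyticOrderAt_sub_eq_one_of_deriv_ne_zero (deriv_derivWeierstrassP_ne_zero hω h2)
  simp only [derivWeierstrassP_half_period h2, sub_zero] at h1
  rw [han.meromorphicOrderAt_eq, h1]
  rfl

theorem meromorphic_comp_neg {f : ℂ → ℂ} (hm : Meromorphic f) : Meromorphic fun z => f (-z) :=
  fun z => (hm (-z)).comp_analyticAt (g := fun w => -w) (by fun_prop)

theorem order_comp_neg (f : ℂ → ℂ) (z : ℂ) :
    meromorphicOrderAt (fun z => f (-z)) z = meromorphicOrderAt f (-z) :=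
  meromorphicOrderAt_comp_of_deriv_ne_zero (f := f) (g := fun w : ℂ => -w) (by fun_prop) (by simp)

theorem eventually_derivWeierstrassP_ne_zero (z : ℂ) :
    ∀ᶠ w in 𝓝[≠] z, L.derivWeierstrassP w ≠ 0 := by
  rw [← meromorphicOrderAt_ne_top_iff_eventually_ne_zero (L.meromorphic_derivWeierstrassP z)]
  refine MeromorphicOn.meromorphicOrderAt_ne_top_of_isPreconnected (U := Set.univ) (x := 0)
    (fun w _ => L.meromorphic_derivWeierstrassP w) isPreconnected_univ trivial trivial ?_
  rw [order_derivWeierstrassP_zero]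
  simp

/-- An odd elliptic function whose only poles are lattice points, of order at most `4`, is a
multiple of `℘'`: its quotient by `℘'` is even, and has no poles because an odd elliptic function
vanishes at the half periods. -/
theorem odd_elliptic_eq {f : ℂ → ℂ} (hper : ∀ z, ∀ l ∈ L.lattice, f (z + l) = f z)
    (hm : Meromorphic f) (hf : ∀ z, f (-z) = -f z)
    (ho : ∀ z ∉ L.lattice, 0 ≤ meromorphicOrderAt f z)
    (h0 : ((-4 : ℤ) : WithTop ℤ) ≤ meromorphicOrderAt f 0) :
    ∃ d : ℂ, ∀ z, f =ᶠ[𝓝[≠] z] fun w => d * L.derivWeierstrassP w := by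
  have hP' : Meromorphic L.derivWeierstrassP := L.meromorphic_derivWeierstrassP
  set g : ℂ → ℂ := f * (L.derivWeierstrassP)⁻¹ with hg
  have hmg : Meromorphic g := fun z => (hm z).mul (hP' z).inv
  have hpg : ∀ z, ∀ l ∈ L.lattice, g (z + l) = g z := fun z l hl => by
    simp only [hg, Pi.mul_apply, Pi.inv_apply, hper z l hl, derivWeierstrassP_periodic z hl]
  have heg : ∀ z, g (-z) = g z := fun z => by
    simp [hg, hf, inv_neg]
  have hord : ∀ z, meromorphicOrderAt g z =
      meromorphicOrderAt f z + -meromorphicOrderAt L.derivWeierstrassP z := fun z => by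
    rw [hg, meromorphicOrderAt_mul (hm z) (hP' z).inv, meromorphicOrderAt_inv]
  have hzero : 0 ≤ meromorphicOrderAt g 0 := by
    have := le_order_of_even (hmg 0) heg 0 ?_
    · simpa using this
    · rw [hord, order_derivWeierstrassP_zero]
      cases hn : meromorphicOrderAt f 0 with
      | top => simp
      | coe n =>
        rw [hn] at h0
        have h1 : (-4 : ℤ) ≤ n := by exact_mod_cast h0
        have : (2 * 0 - 1 : ℤ) ≤ n + -(-3) := by linarith
        exact_mod_cast this
  obtain ⟨d, hd⟩ := periodic_meromorphic_eq_const hpg hmg fun z => by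
    by_cases hz : z ∈ L.lattice
    · have := order_of_periodic hpg hz 0
      rw [zero_add] at this
      rwa [this]
    by_cases h2 : z + z ∈ L.lattice
    · rw [hord, order_derivWeierstrassP_half_period hz h2]
      have hme : MeromorphicAt (fun t => f (t + z)) 0 := meromorphic_shift hm z 0
      -- `f` is odd about the half period `z`, so `t * f (t + z)` is even in `t`
      have hev := le_order_of_even (f := id * fun t => f (t + z)) (MeromorphicAt.id 0 |>.mul hme)
        (fun t => by
          simp only [Pi.mul_apply, id_eq]
          have h3 : f (-t + z) = -f (t - z) := by rw [← hf]; congr 1; ring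
          have h4 : f (t - z) = f (t + z) := by rw [← hper (t - z) _ h2]; congr 1; ring
          rw [h3, h4]; ring) 1
      rw [meromorphicOrderAt_mul (MeromorphicAt.id 0) hme, order_shift, meromorphicOrderAt_id,
        zero_add] at hev
      have h5 := ho z hz
      cases hn : meromorphicOrderAt f z with
      | top => simp
      | coe n =>
        rw [hn] at hev h5
        have h6 : (0 : ℤ) ≤ n := by exact_mod_cast h5
        have h7 : (2 * 1 - 1 : ℤ) ≤ 1 + n → (2 * 1 : ℤ) ≤ 1 + n := fun h => by
          exact_mod_cast hev (by exact_mod_cast h)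
        have h8 : (0 : ℤ) ≤ n + -1 := by
          have := h7 (by linarith)
          linarith
        exact_mod_cast h8
    · have h1 := analyticAt_derivWeierstrassP hz
      have h3 : L.derivWeierstrassP z ≠ 0 := fun h => h2 ((derivWeierstrassP_eq_zero_iff hz).mp h)
      rw [hg, mul_comm, meromorphicOrderAt_mul_of_ne_zero (h1.inv h3) (inv_ne_zero h3)]
      exact ho z hz
  refine ⟨d, fun z => ?_⟩
  filter_upwards [hd z, eventually_derivWeierstrassP_ne_zero (L := L) z] with w hw h1
  rw [← hw, hg]
  simp [h1]

theorem order_nonneg_add {f g : ℂ → ℂ} {z : ℂ} {n : WithTop ℤ} (hf : MeromorphicAt f z)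
    (hg : MeromorphicAt g z) (h1 : n ≤ meromorphicOrderAt f z) (h2 : n ≤ meromorphicOrderAt g z)
    (c d : ℂ) : n ≤ meromorphicOrderAt (fun w => c * f w + d * g w) z := by
  have key : ∀ (c : ℂ) (f : ℂ → ℂ), MeromorphicAt f z → n ≤ meromorphicOrderAt f z →
      n ≤ meromorphicOrderAt (fun w => c * f w) z := fun c f hf h => by
    have h3 := meromorphicOrderAt_mul (MeromorphicAt.const c z) hf
    have h4 : 0 ≤ meromorphicOrderAt (fun _ : ℂ => c) z := analyticAt_const.meromorphicOrderAt_nonneg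
    have h5 : n ≤ meromorphicOrderAt ((fun _ : ℂ => c) * f) z := by
      rw [h3]
      exact le_trans (by simpa using h) (add_le_add_left h4 _)
    exact h5
  have h3 := meromorphicOrderAt_add (f₁ := fun w => c * f w) (f₂ := fun w => d * g w) (x := z)
    (by fun_prop) (by fun_prop)
  exact (le_min (key c f hf h1) (key d g hg h2)).trans h3

/-- An elliptic function whose only poles are lattice points, of order at most `4`, is a linear
combination of `1, ℘, ℘ ^ 2, ℘'`. -/
theorem elliptic_eq {f : ℂ → ℂ} (hper : ∀ z, ∀ l ∈ L.lattice, f (z + l) = f z)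
    (hm : Meromorphic f) (ho : ∀ z ∉ L.lattice, 0 ≤ meromorphicOrderAt f z)
    (h0 : ((-4 : ℤ) : WithTop ℤ) ≤ meromorphicOrderAt f 0) :
    ∃ a b c d : ℂ, ∀ z, f =ᶠ[𝓝[≠] z] fun w =>
      a + b * L.weierstrassP w + c * L.weierstrassP w ^ 2 + d * L.derivWeierstrassP w := by
  have hmn := meromorphic_comp_neg hm
  have hpn : ∀ z, ∀ l ∈ L.lattice, f (-(z + l)) = f (-z) := fun z l hl => by
    rw [neg_add, hper _ _ (neg_mem hl)]
  have hon : ∀ z ∉ L.lattice, 0 ≤ meromorphicOrderAt (fun w => f (-w)) z := fun z hz => by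
    rw [order_comp_neg]
    exact ho _ (by rwa [neg_mem_lattice])
  have h0n : ((-4 : ℤ) : WithTop ℤ) ≤ meromorphicOrderAt (fun w => f (-w)) 0 := by
    rw [order_comp_neg, neg_zero]
    exact h0
  have hmc : ∀ c d : ℂ, Meromorphic fun w => c * f w + d * f (-w) := fun c d z => by
    have h1 := hm z
    have h2 := hmn z
    fun_prop
  obtain ⟨a, b, c, habc⟩ := even_elliptic_eq (f := fun w => 1 / 2 * f w + 1 / 2 * f (-w))
    (fun z l hl => by simp only [hper z l hl, hpn z l hl]) (hmc _ _)
    (fun z => by simp only [neg_neg]; ring)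
    (fun z hz => order_nonneg_add (hm z) (hmn z) (ho z hz) (hon z hz) _ _)
    (order_nonneg_add (hm 0) (hmn 0) h0 h0n _ _)
  obtain ⟨d, hd⟩ := odd_elliptic_eq (f := fun w => 1 / 2 * f w + -(1 / 2) * f (-w))
    (fun z l hl => by simp only [hper z l hl, hpn z l hl]) (hmc _ _)
    (fun z => by simp only [neg_neg]; ring)
    (fun z hz => order_nonneg_add (hm z) (hmn z) (ho z hz) (hon z hz) _ _)
    (order_nonneg_add (hm 0) (hmn 0) h0 h0n _ _)
  refine ⟨a, b, c, d, fun z => ?_⟩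
  filter_upwards [habc z, hd z] with w h1 h2
  linear_combination h1 + h2

end Burniat

end

/-! ### The elliptic curve `E` and its Legendre function -/

noncomputable section

namespace Burniat

open Filter

section Curve

variable {τ : UpperHalfPlane}

theorem cls_eq_iff {z w : ℂ} : cls τ z = cls τ w ↔ z - w ∈ (periods τ).lattice :=
  Submodule.Quotient.eq _

theorem cls_eq_zero_iff {z : ℂ} : cls τ z = 0 ↔ z ∈ (periods τ).lattice :=
  Submodule.Quotient.mk_eq_zero _

theorem cls_add (z w : ℂ) : cls τ (z + w) = cls τ z + cls τ w := rfl

theorem cls_neg (z : ℂ) : cls τ (-z) = -cls τ z := rfl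

theorem cls_sub (z w : ℂ) : cls τ (z - w) = cls τ z - cls τ w := rfl

theorem cls_surjective : Function.Surjective (cls τ) := Submodule.Quotient.mk_surjective _

theorem isOpenQuotientMap_cls : IsOpenQuotientMap (cls τ) :=
  (periods τ).lattice.isOpenQuotientMap_mkQ

theorem continuous_cls : Continuous (cls τ) := isOpenQuotientMap_cls.continuous

theorem cls_rat {α β : ℚ} {z : ℂ} (h : z = α + β * τ) : cls τ z = 0 ↔ α.den = 1 ∧ β.den = 1 := by
  rw [cls_eq_zero_iff, ← PeriodPair.mul_ω₁_add_mul_ω₂_mem_lattice (L := periods τ)]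
  simp [periods, h]

instance : CompactSpace (E τ) := by
  have h := IsZLattice.isCompact_range_of_periodic (periods τ).lattice (cls τ) continuous_cls
    (fun z w hw => by rw [cls_add, cls_eq_zero_iff.mpr hw, add_zero])
  rw [cls_surjective.range_eq] at h
  exact ⟨h⟩

instance : ConnectedSpace (E τ) := cls_surjective.connectedSpace continuous_cls

instance : T2Space (E τ) := by
  have : IsClosed ((periods τ).lattice : Set ℂ) := (periods τ).isClosed_lattice
  have : T3Space (E τ) := Submodule.t3_quotient_of_isClosed (periods τ).lattice
  infer_instance

/-- The class of `1/2`. -/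
def half₁ (τ : UpperHalfPlane) : E τ := cls τ (1 / 2)

/-- The class of `τ/2`. -/
def half₂ (τ : UpperHalfPlane) : E τ := cls τ ((τ : ℂ) / 2)

theorem half₁_add_self : half₁ τ + half₁ τ = 0 := by
  rw [half₁, ← cls_add, cls_rat (α := 1) (β := 0) (by push_cast; ring)]
  simp

theorem half₂_add_self : half₂ τ + half₂ τ = 0 := by
  rw [half₂, ← cls_add, cls_rat (α := 0) (β := 1) (by push_cast; ring)]
  simp

theorem half₁_ne_zero : half₁ τ ≠ 0 := by
  rw [half₁, Ne, cls_rat (α := 1 / 2) (β := 0) (by push_cast; ring)]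
  norm_num

theorem half₂_ne_zero : half₂ τ ≠ 0 := by
  rw [half₂, Ne, cls_rat (α := 0) (β := 1 / 2) (by push_cast; ring)]
  norm_num

theorem half_sum_ne_zero : half₁ τ + half₂ τ ≠ 0 := by
  rw [half₁, half₂, ← cls_add, Ne, cls_rat (α := 1 / 2) (β := 1 / 2) (by push_cast; ring)]
  norm_num

theorem neg_half₁ : -half₁ τ = half₁ τ := by
  rw [neg_eq_iff_add_eq_zero, half₁_add_self]

theorem neg_half₂ : -half₂ τ = half₂ τ := by
  rw [neg_eq_iff_add_eq_zero, half₂_add_self]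

theorem half₁_ne_half₂ : half₁ τ ≠ half₂ τ := fun h => half_sum_ne_zero (τ := τ) (by
  rw [h, half₂_add_self])

theorem add_self_eq_zero_iff {x : E τ} :
    x + x = 0 ↔ x = 0 ∨ x = half₁ τ ∨ x = half₂ τ ∨ x = half₁ τ + half₂ τ := by
  constructor
  · intro h
    obtain ⟨z, rfl⟩ := cls_surjective x
    by_cases hz : z ∈ (periods τ).lattice
    · exact Or.inl (cls_eq_zero_iff.mpr hz)
    rw [← cls_add, cls_eq_zero_iff] at h
    obtain ⟨i, hi⟩ := exists_halfPeriod hz h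
    rw [← cls_eq_iff] at hi
    right
    rw [hi, half₁, half₂, ← cls_add]
    fin_cases i
    · exact Or.inl rfl
    · exact Or.inr (Or.inl rfl)
    · refine Or.inr (Or.inr (congrArg (cls τ) ?_))
      simp [halfPeriod, periods]
      ring
  · rintro (rfl | rfl | rfl | rfl)
    · simp
    · exact half₁_add_self
    · exact half₂_add_self
    · rw [add_add_add_comm, half₁_add_self, half₂_add_self, add_zero]

theorem encard_two_torsion : {x : E τ | x + x = 0}.encard = 4 := by
  have h : {x : E τ | x + x = 0} = {0, half₁ τ, half₂ τ, half₁ τ + half₂ τ} := by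
    ext x
    simpa using add_self_eq_zero_iff
  have h1 := half₁_ne_zero (τ := τ)
  have h2 := half₂_ne_zero (τ := τ)
  have h3 := half_sum_ne_zero (τ := τ)
  have h4 := half₁_ne_half₂ (τ := τ)
  rw [h, Set.encard_insert_of_notMem, Set.encard_insert_of_notMem, Set.encard_pair]
  · rfl
  · simpa using h1
  · simp [h4, h2]
  · simp [h1.symm, h2.symm, h3.symm]

/-- The Weierstrass function on `E` (with value `0` at the origin). -/
def wp (τ : UpperHalfPlane) (x : E τ) : ℂ :=
  Quotient.liftOn' x (periods τ).weierstrassP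
    (fun _ _ h => weierstrassP_congr ((Submodule.quotientRel_def _).mp h))

/-- The derivative of the Weierstrass function on `E` (with value `0` at the origin). -/
def wp' (τ : UpperHalfPlane) (x : E τ) : ℂ :=
  Quotient.liftOn' x (periods τ).derivWeierstrassP
    (fun _ _ h => derivWeierstrassP_congr ((Submodule.quotientRel_def _).mp h))

@[simp] theorem wp_cls (z : ℂ) : wp τ (cls τ z) = (periods τ).weierstrassP z := rfl

@[simp] theorem wp'_cls (z : ℂ) : wp' τ (cls τ z) = (periods τ).derivWeierstrassP z := rfl

@[simp] theorem wp_neg (x : E τ) : wp τ (-x) = wp τ x := by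
  obtain ⟨z, rfl⟩ := cls_surjective x
  rw [← cls_neg, wp_cls, wp_cls, (periods τ).weierstrassP_neg]

@[simp] theorem wp'_neg (x : E τ) : wp' τ (-x) = -wp' τ x := by
  obtain ⟨z, rfl⟩ := cls_surjective x
  rw [← cls_neg, wp'_cls, wp'_cls, (periods τ).derivWeierstrassP_neg]

theorem wp'_eq_zero_iff {x : E τ} : wp' τ x = 0 ↔ x + x = 0 := by
  obtain ⟨z, rfl⟩ := cls_surjective x
  by_cases hz : z ∈ (periods τ).lattice
  · rw [cls_eq_zero_iff.mpr hz, ← cls_eq_zero_iff.mpr (zero_mem _), wp'_cls,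
      (periods τ).derivWeierstrassP_zero, ← cls_add, add_zero]
    simp
  · rw [wp'_cls, derivWeierstrassP_eq_zero_iff hz, ← cls_add, cls_eq_zero_iff]

theorem wp_eq_iff {x y : E τ} (hx : x ≠ 0) (hy : y ≠ 0) : wp τ x = wp τ y ↔ x = y ∨ x = -y := by
  constructor
  · obtain ⟨z, rfl⟩ := cls_surjective x
    obtain ⟨w, rfl⟩ := cls_surjective y
    intro h
    rw [← cls_neg, cls_eq_iff, cls_eq_iff, sub_neg_eq_add]
    exact sub_mem_or_add_mem_of_weierstrassP_eq (fun h => hx (cls_eq_zero_iff.mpr h))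
      (fun h => hy (cls_eq_zero_iff.mpr h)) h
  · rintro (rfl | rfl) <;> simp

theorem exists_wp_eq (c : ℂ) : ∃ x : E τ, x ≠ 0 ∧ wp τ x = c := by
  obtain ⟨z, hz, h⟩ := exists_weierstrassP_eq (L := periods τ) c
  exact ⟨cls τ z, fun h => hz (cls_eq_zero_iff.mp h), h⟩

/-- Translation by a point of order two, in the coordinate `℘`. -/
theorem exists_wp_add_half {h : E τ} (h0 : h ≠ 0) (h2 : h + h = 0) :
    ∃ K : ℂ, K ≠ 0 ∧ ∀ x, x ≠ 0 → x + h ≠ 0 → (wp τ (x + h) - wp τ h) * (wp τ x - wp τ h) = K := by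
  obtain ⟨w, rfl⟩ := cls_surjective h
  obtain ⟨K, hK, hK'⟩ := exists_weierstrassP_half_period (L := periods τ)
    (fun h => h0 (cls_eq_zero_iff.mpr h)) (by rwa [← cls_add, cls_eq_zero_iff] at h2)
  refine ⟨K, hK, fun x hx hxh => ?_⟩
  obtain ⟨z, rfl⟩ := cls_surjective x
  exact hK' z (fun h => hx (cls_eq_zero_iff.mpr h))
    (fun h => hxh (by rw [← cls_add]; exact cls_eq_zero_iff.mpr h))

/-! #### The Legendre function -/

/-- The class of `1/4`. -/
def quarter (τ : UpperHalfPlane) : E τ := cls τ (1 / 4)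

theorem quarter_add_self : quarter τ + quarter τ = half₁ τ := by
  rw [quarter, ← cls_add, half₁]; norm_num

theorem quarter_ne_zero : quarter τ ≠ 0 := fun h => half₁_ne_zero (τ := τ) (by
  rw [← quarter_add_self, h, add_zero])

theorem quarter_add_half₂_ne_zero : quarter τ + half₂ τ ≠ 0 := fun h =>
  half₁_ne_zero (τ := τ) (by
    have : (quarter τ + half₂ τ) + (quarter τ + half₂ τ) = half₁ τ := by
      rw [add_add_add_comm, quarter_add_self, half₂_add_self, add_zero]
    rw [← this, h, add_zero])

/-- The value of `℘` at the zeros of the Legendre function. -/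
def zeroVal (τ : UpperHalfPlane) : ℂ := wp τ (quarter τ)

/-- The value of `℘` at the poles of the Legendre function. -/
def poleVal (τ : UpperHalfPlane) : ℂ := wp τ (quarter τ + half₂ τ)

theorem zeroVal_ne_poleVal : zeroVal τ ≠ poleVal τ := by
  intro h
  rcases (wp_eq_iff quarter_ne_zero quarter_add_half₂_ne_zero).mp h with h | h
  · exact half₂_ne_zero (τ := τ) (by simpa using h)
  · apply half_sum_ne_zero (τ := τ)
    rw [← quarter_add_self, add_assoc]
    nth_rw 1 [h]
    simp

theorem legendre_zero : legendre τ 0 = (1, 1) := by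
  change legendreAux τ 0 = (1, 1)
  simp [legendreAux]

theorem legendre_of_ne_zero {x : E τ} (hx : x ≠ 0) :
    legendre τ x = (wp τ x - zeroVal τ, wp τ x - poleVal τ) := by
  obtain ⟨z, rfl⟩ := cls_surjective x
  change legendreAux τ z = _
  have : z ∉ (periods τ).lattice := fun h => hx (cls_eq_zero_iff.mpr h)
  rw [legendreAux, if_neg this]
  rfl

theorem legendre_neg (x : E τ) : legendre τ (-x) = legendre τ x := by
  by_cases hx : x = 0
  · simp [hx]
  · rw [legendre_of_ne_zero hx, legendre_of_ne_zero (neg_ne_zero.mpr hx), wp_neg]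

theorem legendre_fst_ne_zero {x : E τ} (h : (legendre τ x).2 = 0) : (legendre τ x).1 ≠ 0 := by
  by_cases hx : x = 0
  · simp [hx, legendre_zero]
  · rw [legendre_of_ne_zero hx] at h ⊢
    simp only at h ⊢
    intro h'
    exact zeroVal_ne_poleVal (τ := τ) (by linear_combination h - h')

theorem legendre_parallel_iff {x y : E τ} :
    (legendre τ x).1 * (legendre τ y).2 = (legendre τ x).2 * (legendre τ y).1 ↔
      x = y ∨ x = -y := by
  have hne := sub_ne_zero.mpr (zeroVal_ne_poleVal (τ := τ))
  by_cases hx : x = 0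
  · subst hx
    by_cases hy : y = 0
    · subst hy; simp [mul_comm]
    · rw [legendre_zero, legendre_of_ne_zero hy]
      simp only [one_mul]
      constructor
      · intro h
        exact absurd (by linear_combination h) hne
      · rintro (h | h)
        · exact absurd h.symm hy
        · exact absurd (neg_eq_zero.mp h.symm) hy
  by_cases hy : y = 0
  · subst hy
    rw [legendre_zero, legendre_of_ne_zero hx]
    simp only [mul_one, neg_zero, or_self]
    constructor
    · intro h
      exact absurd (by linear_combination -h) hne
    · intro h
      exact absurd h hx
  rw [← wp_eq_iff hx hy, legendre_of_ne_zero hx, legendre_of_ne_zero hy]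
  simp only
  constructor
  · intro h
    have : (zeroVal τ - poleVal τ) * (wp τ x - wp τ y) = 0 := by linear_combination h
    rcases mul_eq_zero.mp this with h | h
    · exact absurd h hne
    · exact sub_eq_zero.mp h
  · intro h
    rw [h]; ring

theorem exists_legendre_parallel (a b : ℂ) :
    ∃ x : E τ, (legendre τ x).1 * b = (legendre τ x).2 * a := by
  by_cases hab : a = b
  · exact ⟨0, by simp [legendre_zero, hab]⟩
  · obtain ⟨x, hx, h⟩ := exists_wp_eq (τ := τ) ((zeroVal τ * b - poleVal τ * a) / (b - a))
    have hba : b - a ≠ 0 := sub_ne_zero.mpr (Ne.symm hab)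
    refine ⟨x, ?_⟩
    rw [legendre_of_ne_zero hx, h]
    field_simp
    ring

/-- The involution of `ℙ¹` induced by translation by `1/2` exchanges `℘ (1/2)` and `∞`, and it fixes
`zeroVal` and `poleVal` because `-1/4 + 1/2 = 1/4`. -/
theorem two_mul_wp_half₁ : 2 * wp τ (half₁ τ) = zeroVal τ + poleVal τ := by
  obtain ⟨K, -, hK⟩ := exists_wp_add_half (τ := τ) half₁_ne_zero half₁_add_self
  have e1 : -quarter τ + half₁ τ = quarter τ := by rw [← quarter_add_self]; abel
  have e2 : -quarter τ + half₂ τ + half₁ τ = quarter τ + half₂ τ := by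
    rw [← quarter_add_self]; abel
  have e3 : -quarter τ + half₂ τ = -(quarter τ + half₂ τ) := by
    rw [neg_add, neg_half₂]
  have h1 := hK (-quarter τ) (neg_ne_zero.mpr quarter_ne_zero) (by rw [e1]; exact quarter_ne_zero)
  have h2 := hK (-quarter τ + half₂ τ)
    (by rw [e3]; exact neg_ne_zero.mpr quarter_add_half₂_ne_zero)
    (by rw [e2]; exact quarter_add_half₂_ne_zero)
  rw [e1, wp_neg] at h1
  rw [e2, e3, wp_neg] at h2
  change (zeroVal τ - _) * (zeroVal τ - _) = K at h1
  change (poleVal τ - _) * (poleVal τ - _) = K at h2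
  apply mul_left_cancel₀ (sub_ne_zero.mpr (zeroVal_ne_poleVal (τ := τ)))
  linear_combination h2 - h1

/-- `ℒ (x + 1/2) = -ℒ x`. -/
theorem legendre_add_half₁ (x : E τ) :
    (legendre τ (x + half₁ τ)).1 * (legendre τ x).2 =
      -((legendre τ (x + half₁ τ)).2 * (legendre τ x).1) := by
  have h := two_mul_wp_half₁ (τ := τ)
  by_cases hx : x = 0
  · subst hx
    rw [zero_add, legendre_zero, legendre_of_ne_zero half₁_ne_zero]
    linear_combination h
  by_cases hx' : x + half₁ τ = 0
  · have : x = half₁ τ := by rw [← neg_half₁]; exact eq_neg_of_add_eq_zero_left hx'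
    rw [hx', this, legendre_zero, legendre_of_ne_zero half₁_ne_zero]
    linear_combination h
  obtain ⟨K, -, hK⟩ := exists_wp_add_half (τ := τ) half₁_ne_zero half₁_add_self
  have e1 : -quarter τ + half₁ τ = quarter τ := by rw [← quarter_add_self]; abel
  have h1 := hK (-quarter τ) (neg_ne_zero.mpr quarter_ne_zero) (by rw [e1]; exact quarter_ne_zero)
  rw [e1, wp_neg] at h1
  change (zeroVal τ - _) * (zeroVal τ - _) = K at h1
  have h2 := hK x hx hx'
  rw [legendre_of_ne_zero hx, legendre_of_ne_zero hx']
  simp only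
  have hp : poleVal τ = 2 * wp τ (half₁ τ) - zeroVal τ := by linear_combination -h
  rw [hp]
  linear_combination 2 * h2 - 2 * h1

/-- Translation by `τ/2` exchanges the zeros and the poles of `ℒ`; the product `ℒ (x + τ/2) ℒ x` is
constant. -/
theorem exists_legendre_add_half₂ : ∃ a : ℂ, a ≠ 0 ∧ ∀ x : E τ,
    (legendre τ (x + half₂ τ)).1 * (legendre τ x).1 =
      a * ((legendre τ (x + half₂ τ)).2 * (legendre τ x).2) := by
  obtain ⟨K, hK0, hK⟩ := exists_wp_add_half (τ := τ) half₂_ne_zero half₂_add_self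
  have h1 := hK (quarter τ) quarter_ne_zero quarter_add_half₂_ne_zero
  change (poleVal τ - _) * (zeroVal τ - _) = K at h1
  have hp : poleVal τ - wp τ (half₂ τ) ≠ 0 := fun h => hK0 (by rw [← h1, h, zero_mul])
  have hz : zeroVal τ - wp τ (half₂ τ) ≠ 0 := fun h => hK0 (by rw [← h1, h, mul_zero])
  refine ⟨(zeroVal τ - wp τ (half₂ τ)) / (poleVal τ - wp τ (half₂ τ)), div_ne_zero hz hp,
    fun x => ?_⟩
  by_cases hx : x = 0
  · subst hx
    rw [zero_add, legendre_zero, legendre_of_ne_zero half₂_ne_zero]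
    field_simp
    ring
  by_cases hx' : x + half₂ τ = 0
  · have : x = half₂ τ := by rw [← neg_half₂]; exact eq_neg_of_add_eq_zero_left hx'
    rw [hx', this, legendre_zero, legendre_of_ne_zero half₂_ne_zero]
    field_simp
    ring
  have h2 := hK x hx hx'
  rw [legendre_of_ne_zero hx, legendre_of_ne_zero hx']
  simp only
  field_simp
  linear_combination (poleVal τ - zeroVal τ) * (h2 - h1)

/-- The constant `ℒ (x + τ/2) ℒ x` is found at `x = -τ/4`, where both factors are `b`. -/
theorem legendre_quarter_tau :
    (legendre τ (cls τ ((τ : ℂ) / 4))).2 ≠ 0 ∧ bConst τ ≠ 0 ∧ ∀ x : E τ,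
      (legendre τ (x + half₂ τ)).1 * (legendre τ x).1 =
        bConst τ ^ 2 * ((legendre τ (x + half₂ τ)).2 * (legendre τ x).2) := by
  obtain ⟨a, ha, h⟩ := exists_legendre_add_half₂ (τ := τ)
  have e1 : -cls τ ((τ : ℂ) / 4) + half₂ τ = cls τ ((τ : ℂ) / 4) := by
    rw [half₂, ← cls_neg, ← cls_add]; congr 1; ring
  have h1 := h (-cls τ ((τ : ℂ) / 4))
  rw [e1, legendre_neg] at h1
  have h2 : (legendre τ (cls τ ((τ : ℂ) / 4))).2 ≠ 0 := fun h0 => by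
    rw [h0] at h1
    have := legendre_fst_ne_zero h0
    simp_all
  have hb : bConst τ ^ 2 = a := by
    rw [bConst]
    field_simp
    linear_combination h1
  refine ⟨h2, fun h0 => ha ?_, ?_⟩
  · rw [← hb, h0]; ring
  · rw [hb]; exact h

theorem bConst_ne_zero : bConst τ ≠ 0 := legendre_quarter_tau.2.1

/-- `ℒ (x + τ/2) = b² / ℒ x`. -/
theorem legendre_add_half₂ (x : E τ) : (legendre τ (x + half₂ τ)).1 * (legendre τ x).1 =
    bConst τ ^ 2 * ((legendre τ (x + half₂ τ)).2 * (legendre τ x).2) :=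
  legendre_quarter_tau.2.2 x

/-- `ℒ (x + 1/2 + τ/2) = -b² / ℒ x`. -/
theorem legendre_add_half_sum (x : E τ) :
    (legendre τ (x + (half₁ τ + half₂ τ))).1 * (legendre τ x).1 =
      -(bConst τ ^ 2 * ((legendre τ (x + (half₁ τ + half₂ τ))).2 * (legendre τ x).2)) := by
  have h1 := legendre_add_half₁ x
  have h2 := legendre_add_half₂ (x + half₁ τ)
  rw [add_assoc] at h2
  generalize legendre τ (x + (half₁ τ + half₂ τ)) = p at *
  have h3 := legendre_fst_ne_zero (x := x + half₁ τ)
  generalize legendre τ (x + half₁ τ) = q at *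
  have h4 := legendre_fst_ne_zero (x := x)
  generalize legendre τ x = r at *
  by_cases hq : q.2 = 0
  · have hq1 := h3 hq
    rw [hq, zero_mul, neg_zero] at h1
    rw [hq, mul_zero, mul_zero] at h2
    have hr := (mul_eq_zero.mp h1).resolve_left hq1
    have hp := (mul_eq_zero.mp h2).resolve_right hq1
    rw [hr, hp]; ring
  · apply mul_left_cancel₀ hq
    linear_combination -r.2 * h2 + p.1 * h1

theorem bConst_sq_ne_one : bConst τ ^ 2 ≠ 1 := fun h => by
  have h1 := legendre_add_half₂ (0 : E τ)
  rw [h, one_mul, zero_add, legendre_zero] at h1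
  have h2 := (legendre_parallel_iff (x := half₂ τ) (y := 0)).mp (by
    rw [legendre_zero]; simpa using h1)
  exact half₂_ne_zero (τ := τ) (by simpa using h2)

theorem bConst_sq_ne_neg_one : bConst τ ^ 2 ≠ -1 := fun h => by
  have h1 := legendre_add_half_sum (0 : E τ)
  rw [h, zero_add, legendre_zero] at h1
  have h2 := (legendre_parallel_iff (x := half₁ τ + half₂ τ) (y := 0)).mp (by
    rw [legendre_zero]; linear_combination h1)
  exact half_sum_ne_zero (τ := τ) (by simpa using h2)

theorem legendre_half₁ : (legendre τ (half₁ τ)).1 = -(legendre τ (half₁ τ)).2 := by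
  simpa [legendre_zero] using legendre_add_half₁ (0 : E τ)

theorem legendre_half₂ :
    (legendre τ (half₂ τ)).1 = bConst τ ^ 2 * (legendre τ (half₂ τ)).2 := by
  simpa [legendre_zero] using legendre_add_half₂ (0 : E τ)

theorem legendre_half_sum : (legendre τ (half₁ τ + half₂ τ)).1 =
    -(bConst τ ^ 2 * (legendre τ (half₁ τ + half₂ τ)).2) := by
  simpa [legendre_zero] using legendre_add_half_sum (0 : E τ)

/-- The branch values of the Legendre function are `± 1` and `± b²`. -/
theorem add_self_eq_zero_iff_legendre {x : E τ} : x + x = 0 ↔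
    (legendre τ x).1 = (legendre τ x).2 ∨ (legendre τ x).1 = -(legendre τ x).2 ∨
    (legendre τ x).1 = bConst τ ^ 2 * (legendre τ x).2 ∨
    (legendre τ x).1 = -(bConst τ ^ 2 * (legendre τ x).2) := by
  have key : ∀ {y : E τ}, y + y = 0 →
      (legendre τ x).1 * (legendre τ y).2 = (legendre τ x).2 * (legendre τ y).1 → x + x = 0 := by
    intro y hy h
    rcases legendre_parallel_iff.mp h with rfl | rfl
    · exact hy
    · rw [← neg_add, hy, neg_zero]
  constructor
  · rw [add_self_eq_zero_iff]
    rintro (rfl | rfl | rfl | rfl)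
    · simp [legendre_zero]
    · exact Or.inr (Or.inl legendre_half₁)
    · exact Or.inr (Or.inr (Or.inl legendre_half₂))
    · exact Or.inr (Or.inr (Or.inr legendre_half_sum))
  · rintro (h | h | h | h)
    · exact key (y := 0) (add_zero 0) (by rw [h, legendre_zero])
    · exact key half₁_add_self (by rw [h, legendre_half₁]; ring)
    · exact key half₂_add_self (by rw [h, legendre_half₂]; ring)
    · exact key (y := half₁ τ + half₂ τ)
        (by rw [add_add_add_comm, half₁_add_self, half₂_add_self, add_zero])
        (by rw [h, legendre_half_sum]; ring)

theorem legendre_ne_zero_of_add_self {x : E τ} (h : x + x = 0) :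
    (legendre τ x).1 ≠ 0 ∧ (legendre τ x).2 ≠ 0 := by
  have hb := bConst_ne_zero (τ := τ)
  have h0 := legendre_fst_ne_zero (x := x)
  rw [add_self_eq_zero_iff_legendre] at h
  constructor
  · intro h1
    rw [h1] at h
    have h2 : (legendre τ x).2 = 0 := by
      rcases h with h | h | h | h
      · exact h.symm
      · exact neg_eq_zero.mp h.symm
      · exact (mul_eq_zero.mp h.symm).resolve_left (pow_ne_zero 2 hb)
      · exact (mul_eq_zero.mp (neg_eq_zero.mp h.symm)).resolve_left (pow_ne_zero 2 hb)
    exact h0 h2 h1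
  · intro h2
    rw [h2] at h
    exact h0 h2 (by rcases h with h | h | h | h <;> simp_all)

/-- `2x = 1/2` means `ℒ (x + 1/2) = ℒ x`, that is, `-ℒ x = ℒ x`. -/
theorem add_self_eq_half₁_iff {x : E τ} :
    x + x = half₁ τ ↔ (legendre τ x).1 = 0 ∨ (legendre τ x).2 = 0 := by
  have h := legendre_add_half₁ x
  constructor
  · intro hx
    have e : x + half₁ τ = -x := by
      rw [← neg_half₁, ← hx]; abel
    rw [e, legendre_neg] at h
    have : (legendre τ x).1 * (legendre τ x).2 = 0 := by linear_combination h / 2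
    exact mul_eq_zero.mp this
  · intro hx
    have h2 : (legendre τ (x + half₁ τ)).1 * (legendre τ x).2 =
        (legendre τ (x + half₁ τ)).2 * (legendre τ x).1 := by
      rcases hx with hx | hx
      · rw [hx, mul_zero, neg_zero] at h
        rw [hx, h, mul_zero]
      · rw [hx, mul_zero] at h ⊢
        linear_combination -h
    rcases legendre_parallel_iff.mp h2 with h3 | h3
    · exact absurd (by simpa using h3) (half₁_ne_zero (τ := τ))
    · have : half₁ τ = -x - x := by rw [← h3]; abel
      rw [← neg_half₁, this]; abel

/-- `2x = τ/2` means `ℒ (x + τ/2) = ℒ x`, that is, `b² / ℒ x = ℒ x`. -/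
theorem add_self_eq_half₂_iff {x : E τ} :
    x + x = half₂ τ ↔ (legendre τ x).1 ^ 2 = bConst τ ^ 2 * (legendre τ x).2 ^ 2 := by
  have h := legendre_add_half₂ x
  constructor
  · intro hx
    have e : x + half₂ τ = -x := by
      rw [← neg_half₂, ← hx]; abel
    rw [e, legendre_neg] at h
    linear_combination h
  · intro hx
    have hb := bConst_ne_zero (τ := τ)
    have h2 : (legendre τ (x + half₂ τ)).1 * (legendre τ x).2 =
        (legendre τ (x + half₂ τ)).2 * (legendre τ x).1 := by
      have h0 := legendre_fst_ne_zero (x := x)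
      have h1 : (legendre τ x).1 ≠ 0 := fun h1 => h0 (by
        rw [h1] at hx
        have : bConst τ ^ 2 * (legendre τ x).2 ^ 2 = 0 := by rw [← hx]; ring
        simpa [hb] using this) h1
      apply mul_left_cancel₀ h1
      linear_combination (legendre τ x).2 * h - (legendre τ (x + half₂ τ)).2 * hx
    rcases legendre_parallel_iff.mp h2 with h3 | h3
    · exact absurd (by simpa using h3) (half₂_ne_zero (τ := τ))
    · have : half₂ τ = -x - x := by rw [← h3]; abel
      rw [← neg_half₂, this]; abel

/-- `2x = 1/2 + τ/2` means `ℒ (x + 1/2 + τ/2) = ℒ x`, that is, `-b² / ℒ x = ℒ x`. -/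
theorem add_self_eq_half_sum_iff {x : E τ} :
    x + x = half₁ τ + half₂ τ ↔ (legendre τ x).1 ^ 2 = -(bConst τ ^ 2 * (legendre τ x).2 ^ 2) := by
  have h := legendre_add_half_sum x
  have hneg : -(half₁ τ + half₂ τ) = half₁ τ + half₂ τ := by rw [neg_add, neg_half₁, neg_half₂]
  constructor
  · intro hx
    have e : x + (half₁ τ + half₂ τ) = -x := by
      rw [← hneg, ← hx]; abel
    rw [e, legendre_neg] at h
    linear_combination h
  · intro hx
    have hb := bConst_ne_zero (τ := τ)
    have h2 : (legendre τ (x + (half₁ τ + half₂ τ))).1 * (legendre τ x).2 =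
        (legendre τ (x + (half₁ τ + half₂ τ))).2 * (legendre τ x).1 := by
      have h0 := legendre_fst_ne_zero (x := x)
      have h1 : (legendre τ x).1 ≠ 0 := fun h1 => h0 (by
        rw [h1] at hx
        have : bConst τ ^ 2 * (legendre τ x).2 ^ 2 = 0 := by linear_combination hx
        simpa [hb] using this) h1
      apply mul_left_cancel₀ h1
      linear_combination (legendre τ x).2 * h - (legendre τ (x + (half₁ τ + half₂ τ))).2 * hx
    rcases legendre_parallel_iff.mp h2 with h3 | h3
    · exact absurd (by simpa using h3) (half_sum_ne_zero (τ := τ))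
    · have : half₁ τ + half₂ τ = -x - x := by rw [← h3]; abel
      rw [← hneg, this]; abel

/-- Points of `ℙ¹` in homogeneous coordinates: if `q = (a : b)`, then `p = (a : b)` means `p = q`.
-/
theorem parallel_iff {p q : ℂ × ℂ} {a b : ℂ} (hq : q.1 * b = q.2 * a) (hab : a ≠ 0 ∨ b ≠ 0)
    (hq0 : q.2 = 0 → q.1 ≠ 0) : p.1 * b = p.2 * a ↔ p.1 * q.2 = p.2 * q.1 := by
  constructor
  · intro h
    rcases hab with ha | hb
    · apply mul_left_cancel₀ ha
      linear_combination q.1 * h - p.1 * hq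
    · apply mul_left_cancel₀ hb
      linear_combination q.2 * h - p.2 * hq
  · intro h
    by_cases h2 : q.2 = 0
    · have h1 := hq0 h2
      apply mul_left_cancel₀ h1
      linear_combination p.1 * hq + a * h
    · apply mul_left_cancel₀ h2
      linear_combination p.2 * hq + b * h

/-- A value of the Legendre function other than a branch value is taken at two points. -/
theorem encard_legendre_fibre {a b : ℂ}
    (h : ∀ x : E τ, (legendre τ x).1 * b = (legendre τ x).2 * a → x + x ≠ 0)
    (hab : a ≠ 0 ∨ b ≠ 0) :
    {x : E τ | (legendre τ x).1 * b = (legendre τ x).2 * a}.encard = 2 := by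
  obtain ⟨x₀, hx₀⟩ := exists_legendre_parallel (τ := τ) a b
  rw [show {x : E τ | (legendre τ x).1 * b = (legendre τ x).2 * a} = {x₀, -x₀} from ?_,
    Set.encard_pair]
  · intro h'
    exact h x₀ hx₀ (by nth_rw 1 [h']; simp)
  · ext x
    simp only [Set.mem_ofPred_eq, Set.mem_insert_iff, Set.mem_singleton_iff]
    rw [← legendre_parallel_iff]
    exact parallel_iff hx₀ hab (legendre_fst_ne_zero (x := x₀))

theorem encard_legendre_branch_fibre {a b : ℂ} {x₀ : E τ}
    (h : (legendre τ x₀).1 * b = (legendre τ x₀).2 * a) (hx₀ : x₀ + x₀ = 0)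
    (hab : a ≠ 0 ∨ b ≠ 0) :
    {x : E τ | (legendre τ x).1 * b = (legendre τ x).2 * a}.encard = 1 := by
  rw [show {x : E τ | (legendre τ x).1 * b = (legendre τ x).2 * a} = {x₀} from ?_,
    Set.encard_singleton]
  ext x
  simp only [Set.mem_ofPred_eq, Set.mem_singleton_iff]
  rw [parallel_iff h hab (legendre_fst_ne_zero (x := x₀)), legendre_parallel_iff,
    neg_eq_of_add_eq_zero_left hx₀, or_self]

end Curve

end Burniat

end

/-! ### Local expressions of the Legendre function -/

noncomputable section

namespace Burniat

open Filter

section Charts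

/-- Simple ramification is preserved by composition with a local biholomorphism `g`. -/
theorem deriv_comp_chart {g h : ℂ → ℂ} {z : ℂ} (hg : AnalyticAt ℂ g (h z))
    (hg' : deriv g (h z) ≠ 0) (hh : AnalyticAt ℂ h z) :
    (deriv (fun w => g (h w)) z = 0 ↔ deriv h z = 0) ∧
    (deriv h z = 0 → deriv (deriv h) z ≠ 0 → deriv (deriv fun w => g (h w)) z ≠ 0) := by
  have h1 : ∀ᶠ w in 𝓝 z, deriv (fun w => g (h w)) w = deriv g (h w) * deriv h w := by
    filter_upwards [hh.continuousAt.eventually hg.eventually_analyticAt,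
      hh.eventually_analyticAt] with w h1 h2
    exact (h1.differentiableAt.hasDerivAt.comp w h2.differentiableAt.hasDerivAt).deriv
  refine ⟨?_, fun h0 h2 => ?_⟩
  · rw [h1.self_of_nhds]
    simp [hg']
  · have h3 : HasDerivAt (fun w => deriv g (h w) * deriv h w)
        (deriv (deriv g) (h z) * deriv h z * deriv h z + deriv g (h z) * deriv (deriv h) z) z :=
      (hg.deriv.differentiableAt.hasDerivAt.comp z hh.differentiableAt.hasDerivAt).mul
        hh.deriv.differentiableAt.hasDerivAt
    rw [EventuallyEq.deriv_eq (f := fun w => deriv g (h w) * deriv h w) h1, h3.deriv, h0]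
    simpa using ⟨hg', h2⟩

variable {L : PeriodPair}

/-- `1 / ℘` has a double zero at the lattice points (where `℘` has the value `0`). -/
theorem weierstrassP_inv_derivs {z : ℂ} (hz : z ∈ L.lattice) :
    deriv (L.weierstrassP)⁻¹ z = 0 ∧ deriv (deriv (L.weierstrassP)⁻¹) z ≠ 0 := by
  have han := analyticAt_weierstrassP_inv hz
  have h1 : meromorphicOrderAt (L.weierstrassP)⁻¹ z = ((2 : ℤ) : WithTop ℤ) := by
    rw [meromorphicOrderAt_inv, order_weierstrassP' hz]
    rfl
  rw [han.meromorphicOrderAt_eq] at h1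
  have h2 : analyticOrderAt (L.weierstrassP)⁻¹ z = ((2 : ℕ) : ℕ∞) := by
    cases hn : analyticOrderAt (L.weierstrassP)⁻¹ z with
    | top => rw [hn] at h1; simp at h1
    | coe n =>
      rw [hn] at h1
      have : (n : ℤ) = 2 := WithTop.coe_injective h1
      congr 1
      omega
  have h3 := (natCast_le_analyticOrderAt_iff_iteratedDeriv_eq_zero (n := 2) han).mp h2.ge
  refine ⟨by simpa using h3 1 (by norm_num), fun h4 => ?_⟩
  have h5 : ((3 : ℕ) : ℕ∞) ≤ analyticOrderAt (L.weierstrassP)⁻¹ z := by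
    rw [natCast_le_analyticOrderAt_iff_iteratedDeriv_eq_zero han]
    intro i hi
    interval_cases i
    · exact h3 0 (by norm_num)
    · exact h3 1 (by norm_num)
    · rw [iteratedDeriv_succ, iteratedDeriv_one]; exact h4
  rw [h2] at h5
  norm_cast at h5

theorem hasDerivAt_mobius (a b u : ℂ) (hu : u - b ≠ 0) :
    HasDerivAt (fun u => (u - a) / (u - b)) ((a - b) / (u - b) ^ 2) u := by
  refine (((hasDerivAt_id u).sub_const a).div ((hasDerivAt_id u).sub_const b) hu).congr_deriv ?_
  simp only [id]
  ring

theorem hasDerivAt_mobius' (a b : ℂ) :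
    HasDerivAt (fun u => (1 - a * u) / (1 - b * u)) (b - a) 0 := by
  refine ((((hasDerivAt_id (0 : ℂ)).const_mul a).const_sub 1).div
    (((hasDerivAt_id (0 : ℂ)).const_mul b).const_sub 1) (by simp)).congr_deriv ?_
  simp only [id]
  ring

variable {τ : UpperHalfPlane}

/-- Local coordinate expressions of the Möbius transform `(℘ - a) / (℘ - b)` of `℘`: it is
ramified exactly at the points of order two, and the ramification is simple. -/
theorem exists_mobius_chart {a b : ℂ} (hab : a ≠ b) {z : ℂ}
    (hz : z ∈ (periods τ).lattice ∨ (periods τ).weierstrassP z ≠ b) :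
    ∃ l : ℂ → ℂ, AnalyticAt ℂ l z ∧ (deriv l z = 0 ↔ cls τ z + cls τ z = 0) ∧
      (cls τ z + cls τ z = 0 → deriv (deriv l) z ≠ 0) ∧
      ∀ᶠ w in 𝓝 z, (w ∈ (periods τ).lattice → l w = 1) ∧ (w ∉ (periods τ).lattice →
        (periods τ).weierstrassP w - b ≠ 0 ∧
        (periods τ).weierstrassP w - a = l w * ((periods τ).weierstrassP w - b)) := by
  have hcls : cls τ z + cls τ z = 0 ↔ z + z ∈ (periods τ).lattice := by
    rw [← cls_add, cls_eq_zero_iff]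
  rw [hcls]
  by_cases hzΛ : z ∈ (periods τ).lattice
  · have han := analyticAt_weierstrassP_inv hzΛ
    have h0 : (periods τ).weierstrassP⁻¹ z = 0 := by
      simp [(periods τ).weierstrassP_coe ⟨z, hzΛ⟩]
    have hg : AnalyticAt ℂ (fun u : ℂ => (1 - a * u) / (1 - b * u))
        ((periods τ).weierstrassP⁻¹ z) := by
      rw [h0]
      exact AnalyticAt.div (by fun_prop) (by fun_prop) (by simp)
    have hg' : deriv (fun u : ℂ => (1 - a * u) / (1 - b * u))
        ((periods τ).weierstrassP⁻¹ z) ≠ 0 := by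
      rw [h0, (hasDerivAt_mobius' a b).deriv]
      exact sub_ne_zero.mpr hab.symm
    have hd := weierstrassP_inv_derivs hzΛ
    have hc := deriv_comp_chart hg hg' han
    have hzz : z + z ∈ (periods τ).lattice := add_mem hzΛ hzΛ
    refine ⟨_, AnalyticAt.fun_comp (f := (periods τ).weierstrassP⁻¹) hg han, ?_, ?_, ?_⟩
    · simp only [hc.1, hd.1, hzz]
    · exact fun _ => hc.2 hd.1 hd.2
    · have hne : ∀ᶠ w in 𝓝 z, w ≠ z → (periods τ).weierstrassP w ≠ 0 := by
        have := (meromorphicOrderAt_ne_top_iff_eventually_ne_zero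
          ((periods τ).meromorphic_weierstrassP z)).mp (by rw [order_weierstrassP' hzΛ]; simp)
        exact eventually_nhdsWithin_iff.mp this
      have hb : ∀ᶠ w in 𝓝 z, 1 - b * (periods τ).weierstrassP⁻¹ w ≠ 0 := by
        have h1 : ContinuousAt (fun w => 1 - b * (periods τ).weierstrassP⁻¹ w) z := by
          have := han.continuousAt
          fun_prop
        exact h1.eventually_ne (by rw [h0]; simp)
      filter_upwards [hne, hb] with w hw hb
      constructor
      · intro hw'
        simp [(periods τ).weierstrassP_coe ⟨w, hw'⟩]
      · intro hw'
        have hw0 := hw (fun h => hw' (h ▸ hzΛ))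
        simp only [Pi.inv_apply] at hb ⊢
        have : (periods τ).weierstrassP w - b ≠ 0 := fun h => hb (by
          rw [sub_eq_zero.mp h] at hw0 ⊢
          field_simp
          ring)
        refine ⟨this, ?_⟩
        field_simp
  · have hzb := hz.resolve_left hzΛ
    have han := analyticAt_weierstrassP hzΛ
    have hb0 : (periods τ).weierstrassP z - b ≠ 0 := sub_ne_zero.mpr hzb
    have hg : AnalyticAt ℂ (fun u : ℂ => (u - a) / (u - b)) ((periods τ).weierstrassP z) :=
      AnalyticAt.div (by fun_prop) (by fun_prop) hb0
    have hg' : deriv (fun u : ℂ => (u - a) / (u - b)) ((periods τ).weierstrassP z) ≠ 0 := by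
      rw [(hasDerivAt_mobius a b _ hb0).deriv]
      exact div_ne_zero (sub_ne_zero.mpr hab) (pow_ne_zero 2 hb0)
    have hc := deriv_comp_chart hg hg' han
    rw [(periods τ).deriv_weierstrassP, derivWeierstrassP_eq_zero_iff hzΛ] at hc
    refine ⟨_, AnalyticAt.fun_comp (f := (periods τ).weierstrassP) hg han, hc.1, ?_, ?_⟩
    · exact fun h => hc.2 h (deriv_derivWeierstrassP_ne_zero hzΛ h)
    · filter_upwards [eventually_notMem_lattice hzΛ,
        han.continuousAt.eventually_ne hzb] with w h1 h2
      have h3 := sub_ne_zero.mpr h2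
      refine ⟨fun h => absurd h h1, fun _ => ⟨h3, ?_⟩⟩
      field_simp

/-- Near a point that is not a pole, `ℒ` is a holomorphic function. -/
theorem exists_legendre_chart {z : ℂ} (hz : (legendre τ (cls τ z)).2 ≠ 0) :
    ∃ l : ℂ → ℂ, AnalyticAt ℂ l z ∧ (deriv l z = 0 ↔ cls τ z + cls τ z = 0) ∧
      (cls τ z + cls τ z = 0 → deriv (deriv l) z ≠ 0) ∧
      ∀ᶠ w in 𝓝 z, (legendre τ (cls τ w)).2 ≠ 0 ∧
        (legendre τ (cls τ w)).1 = l w * (legendre τ (cls τ w)).2 := by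
  obtain ⟨l, h1, h2, h3, h4⟩ := exists_mobius_chart (τ := τ) (zeroVal_ne_poleVal (τ := τ)) (z := z)
    (by
      by_cases h : z ∈ (periods τ).lattice
      · exact Or.inl h
      · right
        rw [legendre_of_ne_zero (fun h' => h (cls_eq_zero_iff.mp h'))] at hz
        exact sub_ne_zero.mp hz)
  refine ⟨l, h1, h2, h3, h4.mono fun w hw => ?_⟩
  by_cases h : w ∈ (periods τ).lattice
  · rw [cls_eq_zero_iff.mpr h, legendre_zero]
    simp [hw.1 h]
  · rw [legendre_of_ne_zero (fun h' => h (cls_eq_zero_iff.mp h'))]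
    exact hw.2 h

/-- Near a point that is not a zero, `1 / ℒ` is a holomorphic function. -/
theorem exists_legendre_chart_inv {z : ℂ} (hz : (legendre τ (cls τ z)).1 ≠ 0) :
    ∃ l : ℂ → ℂ, AnalyticAt ℂ l z ∧ (deriv l z = 0 ↔ cls τ z + cls τ z = 0) ∧
      (cls τ z + cls τ z = 0 → deriv (deriv l) z ≠ 0) ∧
      ∀ᶠ w in 𝓝 z, (legendre τ (cls τ w)).1 ≠ 0 ∧
        (legendre τ (cls τ w)).2 = l w * (legendre τ (cls τ w)).1 := by
  obtain ⟨l, h1, h2, h3, h4⟩ := exists_mobius_chart (τ := τ) (zeroVal_ne_poleVal (τ := τ)).symm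
    (z := z)
    (by
      by_cases h : z ∈ (periods τ).lattice
      · exact Or.inl h
      · right
        rw [legendre_of_ne_zero (fun h' => h (cls_eq_zero_iff.mp h'))] at hz
        exact sub_ne_zero.mp hz)
  refine ⟨l, h1, h2, h3, h4.mono fun w hw => ?_⟩
  by_cases h : w ∈ (periods τ).lattice
  · rw [cls_eq_zero_iff.mpr h, legendre_zero]
    simp [hw.1 h]
  · rw [legendre_of_ne_zero (fun h' => h (cls_eq_zero_iff.mp h'))]
    exact hw.2 h

/-- Near any point, the value of `ℒ` has holomorphic homogeneous coordinates `(n : d)`. A linear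
form in the value of `ℒ` that vanishes at the point has non-vanishing derivative there, unless the
point has order two. -/
theorem exists_legendre_lift (z : ℂ) : ∃ n d : ℂ → ℂ, AnalyticAt ℂ n z ∧ AnalyticAt ℂ d z ∧
    (∀ᶠ w in 𝓝 z, ∃ c : ℂ, c ≠ 0 ∧
      (legendre τ (cls τ w)).1 = c * n w ∧ (legendre τ (cls τ w)).2 = c * d w) ∧
    ∀ A B : ℂ, (A ≠ 0 ∨ B ≠ 0) →
      A * (legendre τ (cls τ z)).1 + B * (legendre τ (cls τ z)).2 = 0 →
      cls τ z + cls τ z ≠ 0 → A * deriv n z + B * deriv d z ≠ 0 := by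
  by_cases hz : (legendre τ (cls τ z)).2 = 0
  · obtain ⟨l, h1, h2, -, h4⟩ := exists_legendre_chart_inv (legendre_fst_ne_zero hz)
    refine ⟨fun _ => 1, l, analyticAt_const, h1, h4.mono fun w hw => ⟨_, hw.1, by simp, ?_⟩, ?_⟩
    · rw [hw.2]; ring
    · intro A B hAB h0 hne
      have hB : B ≠ 0 := by
        rintro rfl
        rw [zero_mul, add_zero] at h0
        have hA := (mul_eq_zero.mp h0).resolve_right (legendre_fst_ne_zero hz)
        simp [hA] at hAB
      have := mt h2.mp hne
      simpa using ⟨hB, this⟩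
  · obtain ⟨l, h1, h2, -, h4⟩ := exists_legendre_chart hz
    refine ⟨l, fun _ => 1, h1, analyticAt_const, h4.mono fun w hw => ⟨_, hw.1, ?_, by simp⟩, ?_⟩
    · rw [hw.2]; ring
    · intro A B hAB h0 hne
      have hA : A ≠ 0 := by
        rintro rfl
        rw [zero_mul, zero_add] at h0
        have hB := (mul_eq_zero.mp h0).resolve_right hz
        simp [hB] at hAB
      have := mt h2.mp hne
      simpa using ⟨hA, this⟩

end Charts

end Burniat

end

/-! ### Submanifolds and nodes -/

noncomputable section

namespace Burniat

open Filter

/-- Through a point of the zero set of a holomorphic submersion passes a holomorphic arc with any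
prescribed tangent vector in the kernel of the differential. -/
theorem exists_arc_of_submersion {k : ℕ} {F : (Fin 3 → ℂ) → (Fin k → ℂ)} {z v : Fin 3 → ℂ}
    (hF : AnalyticAt ℂ F z) (hs : Function.Surjective (fderiv ℂ F z)) (hv : fderiv ℂ F z v = 0)
    (h0 : F z = 0) :
    ∃ γ : ℂ → Fin 3 → ℂ, AnalyticAt ℂ γ 0 ∧ γ 0 = z ∧ deriv γ 0 = v ∧
      ∀ᶠ t in 𝓝 0, F (γ t) = 0 := by
  obtain ⟨B₀, hB₀⟩ := (fderiv ℂ F z).toLinearMap.exists_rightInverse_of_surjective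
    (LinearMap.range_eq_top.mpr hs)
  set B : (Fin k → ℂ) →L[ℂ] (Fin 3 → ℂ) := LinearMap.toContinuousLinearMap B₀ with hB
  have hAB : ∀ c, fderiv ℂ F z (B c) = c := fun c => LinearMap.congr_fun hB₀ c
  set m : (ℂ × (Fin k → ℂ)) →L[ℂ] (Fin 3 → ℂ) :=
    (ContinuousLinearMap.fst ℂ ℂ (Fin k → ℂ)).smulRight v +
      B.comp (ContinuousLinearMap.snd ℂ ℂ (Fin k → ℂ)) with hm
  -- the map `(t, c) ↦ (t, F (z + t v + B c))` has the identity as its differential at the origin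
  set Ψ : ℂ × (Fin k → ℂ) → ℂ × (Fin k → ℂ) := fun p => (p.1, F (z + m p)) with hΨ
  have hF' : AnalyticAt ℂ F (z + m 0) := by simpa using hF
  have hanΨ : AnalyticAt ℂ Ψ 0 := by
    refine analyticAt_fst.prod ?_
    exact AnalyticAt.fun_comp (f := fun p => z + m p) hF' (analyticAt_const.add (m.analyticAt _))
  have hdΨ : HasFDerivAt Ψ ((ContinuousLinearEquiv.refl ℂ (ℂ × (Fin k → ℂ)) :
      (ℂ × (Fin k → ℂ)) ≃L[ℂ] (ℂ × (Fin k → ℂ))) :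
      (ℂ × (Fin k → ℂ)) →L[ℂ] (ℂ × (Fin k → ℂ))) 0 := by
    have h1 : HasFDerivAt (fun p : ℂ × (Fin k → ℂ) => z + m p) m 0 :=
      m.hasFDerivAt.const_add z
    have h2 := hF'.differentiableAt.hasFDerivAt.comp (0 : ℂ × (Fin k → ℂ)) h1
    have h3 := (hasFDerivAt_fst (𝕜 := ℂ) (p := (0 : ℂ × (Fin k → ℂ)))).prodMk h2
    refine h3.congr_fderiv ?_
    ext p <;> simp [hm, hv, hAB]
  have hcd : ContDiffAt ℂ (⊤ : WithTop ℕ∞) Ψ 0 := hanΨ.contDiffAt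
  have hne : (⊤ : WithTop ℕ∞) ≠ 0 := by simp
  set Φ := hcd.localInverse hdΨ hne with hΦ
  have hΨ0 : Ψ 0 = 0 := by simp [hΨ, h0]
  have hanΦ : AnalyticAt ℂ Φ 0 := by
    have := (hcd.to_localInverse hdΨ hne).analyticAt
    rwa [hΨ0] at this
  have hΦ0 : Φ 0 = 0 := by
    have := hcd.localInverse_apply_image hdΨ hne
    rwa [hΨ0] at this
  have hst := hcd.hasStrictFDerivAt' hdΨ hne
  have hright : ∀ᶠ y in 𝓝 (0 : ℂ × (Fin k → ℂ)), Ψ (Φ y) = y := by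
    have := hst.eventually_right_inverse
    rwa [hΨ0] at this
  have hdΦ : HasFDerivAt Φ (ContinuousLinearMap.id ℂ (ℂ × (Fin k → ℂ))) 0 := by
    have := hst.to_localInverse.hasFDerivAt
    rw [hΨ0] at this
    exact this
  have hi : AnalyticAt ℂ (fun t : ℂ => ((t, 0) : ℂ × (Fin k → ℂ))) 0 := by fun_prop
  have hdi : HasDerivAt (fun t : ℂ => ((t, 0) : ℂ × (Fin k → ℂ))) (1, 0) 0 :=
    (hasDerivAt_id (0 : ℂ)).prodMk (hasDerivAt_const _ _)
  have hanc : AnalyticAt ℂ (fun t : ℂ => Φ (t, 0)) 0 :=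
    AnalyticAt.fun_comp (f := fun t : ℂ => ((t, 0) : ℂ × (Fin k → ℂ))) hanΦ hi
  refine ⟨fun t => z + m (Φ (t, 0)), ?_, ?_, ?_, ?_⟩
  · have := m.analyticAt (Φ ((0 : ℂ), 0))
    exact analyticAt_const.add (AnalyticAt.fun_comp (f := fun t : ℂ => Φ (t, 0)) this hanc)
  · have : Φ ((0 : ℂ), 0) = 0 := hΦ0
    simp [this]
  · have h1 : HasDerivAt (fun t : ℂ => Φ (t, 0)) (1, 0) 0 := by
      have := HasFDerivAt.comp_hasDerivAt (x := (0 : ℂ))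
        (f := fun t : ℂ => ((t, 0) : ℂ × (Fin k → ℂ))) hdΦ hdi
      exact this
    have h2 := (m.hasFDerivAt (x := Φ ((0 : ℂ), 0))).comp_hasDerivAt (x := (0 : ℂ)) h1
    have h3 : HasDerivAt (fun t : ℂ => z + m (Φ (t, 0))) (m (1, 0)) 0 := h2.const_add z
    rw [h3.deriv]
    simp [hm]
  · filter_upwards [hi.continuousAt.eventually (hright)] with t ht
    have h1 : (Φ (t, 0)).1 = t := congrArg Prod.fst ht
    exact congrArg Prod.snd ht

variable {τ : Fin 3 → UpperHalfPlane}

theorem proj_apply (z : Fin 3 → ℂ) (j : Fin 3) : proj τ z j = cls (τ j) (z j) := rfl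

theorem continuous_proj : Continuous (proj τ) :=
  continuous_pi fun j => continuous_cls.comp (continuous_apply j)

theorem proj_surjective : Function.Surjective (proj τ) := fun x =>
  ⟨fun j => (cls_surjective (x j)).choose, funext fun j => (cls_surjective (x j)).choose_spec⟩

theorem proj_add_sub {z z' : Fin 3 → ℂ} (h : proj τ z = proj τ z') (w : Fin 3 → ℂ) :
    proj τ (w + (z - z')) = proj τ w := by
  ext j
  have hj : cls (τ j) (z j) = cls (τ j) (z' j) := congrFun h j
  simp only [proj_apply, Pi.add_apply, Pi.sub_apply, cls_add, cls_sub, hj, sub_self, add_zero]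

theorem IsArc.add_const {C : Set (T τ)} {γ : ℂ → Fin 3 → ℂ} (hγ : IsArc C γ) {z z' : Fin 3 → ℂ}
    (h : proj τ z = proj τ z') : IsArc C fun t => γ t + (z - z') := by
  refine ⟨hγ.1.add analyticAt_const, hγ.2.mono fun t ht => ?_⟩
  rwa [proj_add_sub h]

theorem mem_of_mem_tangentVectors {C : Set (T τ)} {x : T τ} {v : Fin 3 → ℂ}
    (h : v ∈ tangentVectors C x) : x ∈ C := by
  obtain ⟨γ, hγ, rfl, -⟩ := h
  exact hγ.2.self_of_nhds

/-- The tangent vectors to a submanifold form the kernel of the differential of a local equation. -/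
theorem IsSubmanifoldAt.exists_tangentVectors {k : ℕ} {C : Set (T τ)} {x : T τ}
    (h : IsSubmanifoldAt k C x) : ∃ A : (Fin 3 → ℂ) →L[ℂ] (Fin k → ℂ), Function.Surjective A ∧
      ∀ v, v ∈ tangentVectors C x ↔ A v = 0 := by
  obtain ⟨hx, z, F, rfl, hF, hs, hC⟩ := h
  refine ⟨fderiv ℂ F z, hs, fun v => ⟨?_, fun hv => ?_⟩⟩
  · rintro ⟨γ, hγ, h0, rfl⟩
    have hγ' := hγ.add_const h0.symm
    have e0 : γ 0 + (z - γ 0) = z := by abel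
    have h1 : ∀ᶠ t in 𝓝 (0 : ℂ), F (γ t + (z - γ 0)) = 0 := by
      have hc : Tendsto (fun t => γ t + (z - γ 0)) (𝓝 0) (𝓝 z) := by
        have := hγ'.1.continuousAt.tendsto
        rwa [e0] at this
      filter_upwards [hc.eventually hC, hγ'.2] with t h1 h2
      exact h1.mp h2
    have h2 : HasDerivAt (fun t => γ t + (z - γ 0)) (deriv γ 0) 0 :=
      hγ.1.differentiableAt.hasDerivAt.add_const _
    have hF' : HasFDerivAt F (fderiv ℂ F z) (γ 0 + (z - γ 0)) := by
      rw [e0]; exact hF.differentiableAt.hasFDerivAt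
    have h3 := HasFDerivAt.comp_hasDerivAt (x := (0 : ℂ)) (f := fun t => γ t + (z - γ 0)) hF' h2
    have h4 : HasDerivAt (F ∘ fun t => γ t + (z - γ 0)) 0 0 :=
      (hasDerivAt_const (0 : ℂ) (0 : Fin k → ℂ)).congr_of_eventuallyEq h1
    exact h3.unique h4
  · obtain ⟨γ, h1, h2, h3, h4⟩ := exists_arc_of_submersion hF hs hv (hC.self_of_nhds.mp hx)
    refine ⟨γ, ⟨h1, ?_⟩, by rw [h2], h3⟩
    have hc : Tendsto γ (𝓝 0) (𝓝 z) := by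
      have := h1.continuousAt.tendsto
      rwa [h2] at this
    filter_upwards [hc.eventually hC, h4] with t h1 h2
    exact h1.mpr h2

/-- The velocity of an arc is a tangent vector also at the points near its origin. -/
theorem IsArc.eventually_shift {C : Set (T τ)} {γ : ℂ → Fin 3 → ℂ} (hγ : IsArc C γ) :
    ∀ᶠ t in 𝓝 0, deriv γ t ∈ tangentVectors C (proj τ (γ t)) := by
  filter_upwards [hγ.1.eventually_analyticAt, hγ.2.eventually_nhds] with t h1 h2
  have ha : Tendsto (fun s : ℂ => t + s) (𝓝 0) (𝓝 t) := by
    have : ContinuousAt (fun s : ℂ => t + s) 0 := by fun_prop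
    simpa using this.tendsto
  refine ⟨fun s => γ (t + s), ⟨?_, ha.eventually h2⟩, by simp, ?_⟩
  · exact AnalyticAt.fun_comp_of_eq (f := fun s : ℂ => t + s) h1 (by fun_prop) (by simp)
  · rw [deriv_comp_const_add, add_zero]

/-- A smooth point is not a node: the Hessian of a local equation with vanishing differential is
isotropic on the tangent plane, hence degenerate. -/
theorem IsSmoothPoint.not_isNode {X : Set (T τ)} {x : T τ} (h : IsSmoothPoint X x) :
    ¬ IsNode X x := by
  rintro ⟨-, z, F, rfl, hF, hd, hH, hX⟩
  obtain ⟨A, hA, hT⟩ := h.exists_tangentVectors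
  have hFX : F z = 0 := hX.self_of_nhds.mp h.1
  set H := fderiv ℂ (fderiv ℂ F) z with hHdef
  have hF1 : AnalyticAt ℂ (fderiv ℂ F) z := hF.fderiv
  have hiso : ∀ v, A v = 0 → H v v = 0 := by
    intro v hv
    obtain ⟨γ₀, hγ₀, h0, hv0⟩ := (hT v).mpr hv
    obtain ⟨γ, hγ, hγ0, hγv⟩ : ∃ γ, IsArc X γ ∧ γ 0 = z ∧ deriv γ 0 = v :=
      ⟨_, hγ₀.add_const h0.symm, by abel, by rw [deriv_add_const, hv0]⟩
    have hc : Tendsto γ (𝓝 0) (𝓝 z) := by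
      have := hγ.1.continuousAt.tendsto
      rwa [hγ0] at this
    have h1 : ∀ᶠ t in 𝓝 (0 : ℂ), F (γ t) = 0 := by
      filter_upwards [hc.eventually hX, hγ.2] with t h1 h2
      exact h1.mp h2
    have h2 : ∀ᶠ t in 𝓝 (0 : ℂ), fderiv ℂ F (γ t) (deriv γ t) = 0 := by
      filter_upwards [h1.eventually_nhds, hc.eventually hF.eventually_analyticAt,
        hγ.1.eventually_analyticAt] with t h1 h2 h3
      have h4 := h2.differentiableAt.hasFDerivAt.comp_hasDerivAt t h3.differentiableAt.hasDerivAt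
      exact h4.unique ((hasDerivAt_const t (0 : ℂ)).congr_of_eventuallyEq h1)
    have h3 : HasDerivAt (fun t => fderiv ℂ F (γ t)) (H v) 0 := by
      have h4 : HasFDerivAt (fderiv ℂ F) H (γ 0) := by
        rw [hγ0]; exact hF1.differentiableAt.hasFDerivAt
      have := h4.comp_hasDerivAt (0 : ℂ) hγ.1.differentiableAt.hasDerivAt
      rwa [hγv] at this
    have h4 := h3.clm_apply hγ.1.deriv.differentiableAt.hasDerivAt
    rw [hγ0, hd, hγv] at h4
    simpa using h4.unique ((hasDerivAt_const (0 : ℂ) (0 : ℂ)).congr_of_eventuallyEq h2)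
  have hsymm : ∀ v w, H v w = H w v := by
    have : IsSymmSndFDerivAt ℂ F z :=
      (hF.contDiffAt (n := (⊤ : WithTop ℕ∞))).isSymmSndFDerivAt (by simp)
    exact fun v w => this.eq v w
  obtain ⟨n, hn⟩ := hA fun _ => 1
  -- a nonzero tangent vector that is orthogonal to a complement of the tangent plane
  set ℓ : (Fin 3 → ℂ) →ₗ[ℂ] (Fin 1 → ℂ) × ℂ := A.toLinearMap.prod (H.flip n).toLinearMap with hℓ
  obtain ⟨p, hp, hp0⟩ : ∃ p ∈ LinearMap.ker ℓ, p ≠ 0 := by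
    refine (Submodule.ne_bot_iff _).mp (LinearMap.ker_ne_bot_of_finrank_lt ?_)
    simp
  have hp' : A p = 0 ∧ H p n = 0 := by
    have := LinearMap.mem_ker.mp hp
    exact ⟨congrArg Prod.fst this, congrArg Prod.snd this⟩
  refine hp0 (hH p fun w => ?_)
  set q := w - (A w 0) • n with hq
  have hAq : A q = 0 := by
    rw [hq, map_sub, map_smul, hn]
    ext i
    fin_cases i
    simp
  have h1 := hiso (p + q) (by rw [map_add, hp'.1, hAq, add_zero])
  simp only [map_add, add_apply] at h1
  rw [hiso p hp'.1, hiso q hAq, hsymm q p] at h1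
  have h2 : H p q = 0 := by linear_combination h1 / 2
  have h3 : w = q + (A w 0) • n := by rw [hq]; abel
  rw [h3, map_add, map_smul, h2, hp'.2]
  simp

end Burniat

end

/-! ### Curves cut out by coordinates, and elliptic curves -/

noncomputable section

namespace Burniat

open Filter

section

variable {τ : UpperHalfPlane}

/-- The covering `ℂ → E` is locally injective. -/
theorem eventually_cls_eq_iff (z : ℂ) : ∀ᶠ w in 𝓝 z, cls τ w = cls τ z ↔ w = z := by
  have h1 : Tendsto (fun w => w - z) (𝓝[≠] z) (𝓝[≠] 0) := by
    refine tendsto_nhdsWithin_iff.mpr ⟨?_, ?_⟩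
    · have : ContinuousAt (fun w => w - z) z := by fun_prop
      have := this.tendsto
      rw [sub_self] at this
      exact this.mono_left nhdsWithin_le_nhds
    · filter_upwards [self_mem_nhdsWithin] with w hw
      exact sub_ne_zero.mpr hw
  have h2 := h1.eventually (eventually_notMem_lattice' (L := periods τ) 0)
  rw [eventually_nhdsWithin_iff] at h2
  filter_upwards [h2] with w hw
  refine ⟨fun h => ?_, fun h => by rw [h]⟩
  by_contra hne
  exact hw hne (cls_eq_iff.mp h)

theorem eventually_cls_add_self_eq_iff (z : ℂ) :
    ∀ᶠ w in 𝓝 z, cls τ w + cls τ w = cls τ z + cls τ z ↔ w = z := by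
  have h1 : ContinuousAt (fun w : ℂ => w + w) z := by fun_prop
  filter_upwards [h1.eventually (eventually_cls_eq_iff (τ := τ) (z + z))] with w hw
  rw [← cls_add, ← cls_add, hw]
  constructor <;> intro h
  · linear_combination h / 2
  · rw [h]

theorem eventually_add_self_ne_zero (z : ℂ) : ∀ᶠ w in 𝓝[≠] z, cls τ w + cls τ w ≠ 0 := by
  rw [eventually_nhdsWithin_iff]
  by_cases h : cls τ z + cls τ z = 0
  · filter_upwards [eventually_cls_add_self_eq_iff (τ := τ) z] with w hw hne h0
    exact hne (hw.mp (h0.trans h.symm))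
  · have hc : Continuous fun w => cls τ w + cls τ w := continuous_cls.add continuous_cls
    filter_upwards [hc.continuousAt.eventually_ne h] with w hw _
    exact hw

end

theorem eq_or_eq_or_eq_of_ne : ∀ {i j k : Fin 3}, i ≠ j → i ≠ k → j ≠ k →
    ∀ l, l = i ∨ l = j ∨ l = k := by decide

variable {τ : Fin 3 → UpperHalfPlane}

/-- A locus defined near a point by fixing two coordinates is a curve. -/
theorem isSubmanifoldAt_of_coords {C : Set (T τ)} {i j : Fin 3} (hij : i ≠ j) (z : Fin 3 → ℂ)
    (h : ∀ᶠ w in 𝓝 z, proj τ w ∈ C ↔ w i = z i ∧ w j = z j) :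
    IsSubmanifoldAt 2 C (proj τ z) := by
  refine ⟨h.self_of_nhds.mpr ⟨rfl, rfl⟩, z, fun w => ![w i - z i, w j - z j], rfl, ?_, ?_, ?_⟩
  · refine AnalyticAt.pi fun l => ?_
    fin_cases l
    · exact (ContinuousLinearMap.proj (R := ℂ) (φ := fun _ : Fin 3 => ℂ) i).analyticAt z |>.sub
        analyticAt_const
    · exact (ContinuousLinearMap.proj (R := ℂ) (φ := fun _ : Fin 3 => ℂ) j).analyticAt z |>.sub
        analyticAt_const
  · have hd : HasFDerivAt (fun w : Fin 3 → ℂ => ![w i - z i, w j - z j])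
        (ContinuousLinearMap.pi ![ContinuousLinearMap.proj (R := ℂ) (φ := fun _ : Fin 3 => ℂ) i,
          ContinuousLinearMap.proj (R := ℂ) (φ := fun _ : Fin 3 => ℂ) j]) z := by
      refine hasFDerivAt_pi.mpr fun l => ?_
      fin_cases l
      · exact (hasFDerivAt_apply i z).sub_const _
      · exact (hasFDerivAt_apply j z).sub_const _
    rw [hd.fderiv]
    intro c
    refine ⟨Function.update (Function.update 0 i (c 0)) j (c 1), ?_⟩
    ext l
    fin_cases l
    · simp [Function.update_of_ne hij]
    · simp
  · filter_upwards [h] with w hw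
    rw [hw]
    constructor
    · rintro ⟨h1, h2⟩
      ext l
      fin_cases l <;> simp [h1, h2]
    · intro h
      exact ⟨sub_eq_zero.mp (congrFun h 0), sub_eq_zero.mp (congrFun h 1)⟩

/-- An arc in a locus on which `2xᵢ` is constant has constant `i`-th coordinate. -/
theorem IsArc.eventually_coord_eq {C : Set (T τ)} {i : Fin 3} {c : E (τ i)}
    (hC : ∀ x ∈ C, x i + x i = c) {γ : ℂ → Fin 3 → ℂ} (hγ : IsArc C γ) :
    ∀ᶠ t in 𝓝 0, γ t i = γ 0 i := by
  have hc : ContinuousAt (fun t => γ t i) 0 := (continuousAt_pi.mp hγ.1.continuousAt) i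
  have h0 := hC _ hγ.2.self_of_nhds
  filter_upwards [hγ.2, hc.eventually (eventually_cls_add_self_eq_iff (τ := τ i) (γ 0 i))]
    with t h1 h2
  have := hC _ h1
  simp only [proj_apply] at this h0
  exact h2.mp (this.trans h0.symm)

theorem coord_eq_zero_of_mem_tangentVectors {C : Set (T τ)} {i : Fin 3} {c : E (τ i)}
    (hC : ∀ x ∈ C, x i + x i = c) {x : T τ} {v : Fin 3 → ℂ} (hv : v ∈ tangentVectors C x) :
    v i = 0 := by
  obtain ⟨γ, hγ, -, rfl⟩ := hv
  have h1 := hγ.eventually_coord_eq hC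
  have h2 : HasDerivAt (fun t => γ t i) (deriv γ 0 i) 0 :=
    hasDerivAt_pi.mp hγ.1.differentiableAt.hasDerivAt i
  exact h2.unique ((hasDerivAt_const (0 : ℂ) (γ 0 i)).congr_of_eventuallyEq h1)

theorem IsSubmanifoldAt.add_smul_mem {k : ℕ} {C : Set (T τ)} {x : T τ}
    (h : IsSubmanifoldAt k C x) :
    (∀ v ∈ tangentVectors C x, ∀ w ∈ tangentVectors C x, v + w ∈ tangentVectors C x) ∧
    (∀ v ∈ tangentVectors C x, ∀ c : ℂ, c • v ∈ tangentVectors C x) := by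
  obtain ⟨A, -, hT⟩ := h.exists_tangentVectors
  simp only [hT]
  exact ⟨fun v hv w hw => by rw [map_add, hv, hw, add_zero],
    fun v hv c => by rw [map_smul, hv, smul_zero]⟩

open Classical in
/-- The form on `C` that is `φ` on tangent vectors. -/
def formOf (C : Set (T τ)) (φ : T τ → (Fin 3 → ℂ) → ℂ) (x : T τ) (v : Fin 3 → ℂ) : ℂ :=
  if v ∈ tangentVectors C x then φ x v else 0

theorem formOf_of_mem {C : Set (T τ)} {φ : T τ → (Fin 3 → ℂ) → ℂ} {x : T τ} {v : Fin 3 → ℂ}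
    (h : v ∈ tangentVectors C x) : formOf C φ x v = φ x v := if_pos h

theorem formOf_mem {k : ℕ} {C : Set (T τ)} (hC : ∀ x ∈ C, IsSubmanifoldAt k C x)
    {φ : T τ → (Fin 3 → ℂ) → ℂ} (hadd : ∀ x v w, φ x (v + w) = φ x v + φ x w)
    (hsmul : ∀ x (c : ℂ) v, φ x (c • v) = c * φ x v)
    (han : ∀ γ, IsArc C γ → AnalyticAt ℂ (fun t => φ (proj τ (γ t)) (deriv γ t)) 0) :
    formOf C φ ∈ holomorphicForms C := by
  refine ⟨fun x v hv => if_neg hv, fun x v hv w hw => ?_, fun x v hv c => ?_, fun γ hγ => ?_⟩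
  · have := (hC x (mem_of_mem_tangentVectors hv)).add_smul_mem
    rw [formOf_of_mem hv, formOf_of_mem hw, formOf_of_mem (this.1 v hv w hw), hadd]
  · have := (hC x (mem_of_mem_tangentVectors hv)).add_smul_mem
    rw [formOf_of_mem hv, formOf_of_mem (this.2 v hv c), hsmul]
  · refine (han γ hγ).congr ?_
    filter_upwards [hγ.eventually_shift] with t ht
    rw [formOf_of_mem ht]

/-- Two holomorphic forms on `C` that agree on tangent vectors are equal. -/
theorem holomorphicForms_ext {C : Set (T τ)} {ω ω' : T τ → (Fin 3 → ℂ) → ℂ}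
    (hω : ω ∈ holomorphicForms C) (hω' : ω' ∈ holomorphicForms C)
    (h : ∀ x, ∀ v ∈ tangentVectors C x, ω x v = ω' x v) : ω = ω' := by
  funext x v
  by_cases hv : v ∈ tangentVectors C x
  · exact h x v hv
  · rw [hω.1 x v hv, hω'.1 x v hv]

/-- The tangent space of a curve is a line. -/
theorem IsSubmanifoldAt.tangentVectors_line {C : Set (T τ)} {x : T τ} (h : IsSubmanifoldAt 2 C x) :
    (∃ v ∈ tangentVectors C x, v ≠ 0) ∧ ∀ v ∈ tangentVectors C x, v ≠ 0 →
      ∀ w ∈ tangentVectors C x, ∃ c : ℂ, w = c • v := by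
  obtain ⟨A, hA, hT⟩ := h.exists_tangentVectors
  have h1 : Module.finrank ℂ (LinearMap.ker A.toLinearMap) = 1 := by
    have := LinearMap.finrank_range_add_finrank_ker A.toLinearMap
    rw [LinearMap.range_eq_top.mpr hA] at this
    simp at this
    omega
  constructor
  · obtain ⟨⟨v, hv⟩, hv0, -⟩ := finrank_eq_one_iff'.mp h1
    exact ⟨v, (hT v).mpr hv, fun h => hv0 (Subtype.ext h)⟩
  · intro v hv hv0 w hw
    have := (finrank_eq_one_iff_of_nonzero' (⟨v, (hT v).mp hv⟩ : LinearMap.ker A.toLinearMap)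
      (fun h => hv0 (congrArg Subtype.val h))).mp h1 ⟨w, (hT w).mp hw⟩
    obtain ⟨c, hc⟩ := this
    exact ⟨c, (congrArg Subtype.val hc).symm⟩

/-- The curve in `T` obtained by fixing two coordinates. -/
def coordCurve (i j : Fin 3) (a : E (τ i)) (b : E (τ j)) : Set (T τ) := {x | x i = a ∧ x j = b}

theorem isSubmanifoldAt_coordCurve {i j : Fin 3} (hij : i ≠ j) {a : E (τ i)} {b : E (τ j)}
    {x : T τ} (hx : x ∈ coordCurve i j a b) : IsSubmanifoldAt 2 (coordCurve i j a b) x := by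
  obtain ⟨z, rfl⟩ := proj_surjective x
  obtain ⟨rfl, rfl⟩ := hx
  refine isSubmanifoldAt_of_coords hij z ?_
  filter_upwards [(continuous_apply i).continuousAt.eventually (eventually_cls_eq_iff (τ := τ i)
    (z i)), (continuous_apply j).continuousAt.eventually (eventually_cls_eq_iff (τ := τ j) (z j))]
    with w h1 h2
  exact and_congr h1 h2

/-- A curve obtained by fixing two coordinates is an elliptic curve: a holomorphic form on it is a
holomorphic function of the third coordinate, constant by Liouville's theorem. -/
theorem isEllipticCurve_coordCurve {i j k : Fin 3} (hij : i ≠ j) (hik : i ≠ k) (hjk : j ≠ k)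
    (a : E (τ i)) (b : E (τ j)) : IsEllipticCurve (coordCurve i j a b) := by
  obtain ⟨z, hz⟩ := proj_surjective (τ := τ) (Function.update (Function.update 0 i a) j b)
  have hzi : cls (τ i) (z i) = a := by
    rw [← proj_apply, hz]; simp [Function.update_of_ne hij]
  have hzj : cls (τ j) (z j) = b := by rw [← proj_apply, hz]; simp
  set C := coordCurve i j a b with hC
  set e : Fin 3 → ℂ := Pi.single k 1 with he
  have hei : e i = 0 := by simp [he, hik]
  have hej : e j = 0 := by simp [he, hjk]
  have hek : e k = 1 := by simp [he]
  have hall := eq_or_eq_or_eq_of_ne hij hik hjk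
  have hcurve : ∀ t : ℂ, proj τ (Function.update z k t) ∈ C := fun t => by
    refine ⟨?_, ?_⟩
    · rw [proj_apply, Function.update_of_ne hik, hzi]
    · rw [proj_apply, Function.update_of_ne hjk, hzj]
  have hsub : ∀ x ∈ C, IsSubmanifoldAt 2 C x := fun x hx => isSubmanifoldAt_coordCurve hij hx
  have hupd : ∀ s, HasDerivAt (fun t : ℂ => Function.update z k t) e s := fun s => by
    refine hasDerivAt_pi.mpr fun l => ?_
    by_cases hl : l = k
    · subst hl
      simp only [Function.update_self, hek]
      exact hasDerivAt_id s
    · simpa [he, Function.update_of_ne hl, hl] using hasDerivAt_const s (z l)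
  have harc : ∀ s : ℂ, IsArc C fun t => Function.update z k (s + t) := fun s => by
    refine ⟨AnalyticAt.pi fun l => ?_, Eventually.of_forall fun t => hcurve _⟩
    by_cases hl : l = k
    · subst hl
      simp only [Function.update_self]
      fun_prop
    · simp only [Function.update_of_ne hl]
      exact analyticAt_const
  have hder : ∀ s t : ℂ, deriv (fun t => Function.update z k (s + t)) t = e := fun s t => by
    rw [deriv_comp_const_add (f := fun t => Function.update z k t)]
    exact (hupd _).deriv
  have hmem : ∀ x, ∀ v ∈ tangentVectors C x, v = v k • e := by
    intro x v hv
    have h1 := coord_eq_zero_of_mem_tangentVectors (C := C) (i := i) (c := a + a)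
      (fun x hx => by rw [hx.1]) hv
    have h2 := coord_eq_zero_of_mem_tangentVectors (C := C) (i := j) (c := b + b)
      (fun x hx => by rw [hx.2]) hv
    ext l
    rcases hall l with rfl | rfl | rfl
    · simp [h1, hei]
    · simp [h2, hej]
    · simp [hek]
  refine ⟨?_, ?_, hsub, one_ne_zero, ?_⟩
  · have : IsClosed C := (isClosed_singleton.preimage (continuous_apply i)).inter
      (isClosed_singleton.preimage (continuous_apply j))
    exact this.isCompact
  · have h1 : C = (fun t : E (τ k) => Function.update (proj τ z) k t) '' Set.univ := by
      ext x
      constructor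
      · rintro ⟨h1, h2⟩
        refine ⟨x k, trivial, ?_⟩
        ext l
        rcases hall l with rfl | rfl | rfl
        · simp only [Function.update_of_ne hik, proj_apply, hzi, h1]
        · simp only [Function.update_of_ne hjk, proj_apply, hzj, h2]
        · simp
      · rintro ⟨t, -, rfl⟩
        refine ⟨?_, ?_⟩
        · simp only [Function.update_of_ne hik, proj_apply, hzi]
        · simp only [Function.update_of_ne hjk, proj_apply, hzj]
    rw [h1]
    exact isConnected_univ.image _ (by fun_prop)
  · have hω₀ : formOf C (fun _ v => v k) ∈ holomorphicForms C := by
      refine formOf_mem hsub (fun _ _ _ => rfl) (fun _ _ _ => rfl) fun γ hγ => ?_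
      exact (analyticAt_pi_iff.mp hγ.1.deriv) k
    have htan : ∀ s, e ∈ tangentVectors C (proj τ (Function.update z k s)) := fun s =>
      ⟨_, harc s, by simp, hder s 0⟩
    refine finrank_eq_one_iff'.mpr ⟨⟨_, hω₀⟩, fun h => ?_, fun ⟨ω, hω⟩ => ?_⟩
    · have h1 := congrFun (congrFun (congrArg Subtype.val h) (proj τ (Function.update z k 0))) e
      change formOf C (fun _ v => v k) _ e = 0 at h1
      rw [formOf_of_mem (htan 0), hek] at h1
      exact one_ne_zero h1
    · set f : ℂ → ℂ := fun s => ω (proj τ (Function.update z k s)) e with hf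
      have hfan : ∀ s, AnalyticAt ℂ f s := fun s => by
        have h1 := hω.2.2.2 _ (harc s)
        simp only [hder] at h1
        have h2 : f = (fun t => f (s + t)) ∘ fun u => u - s := by
          funext u; simp
        rw [h2]
        exact AnalyticAt.comp_of_eq h1 (by fun_prop) (sub_self s)
      obtain ⟨c, hc⟩ := periodic_eq_const (L := periods (τ k)) (f := f) (fun s l hl => by
          have : proj τ (Function.update z k (s + l)) = proj τ (Function.update z k s) := by
            ext m
            by_cases hm : m = k
            · subst hm
              simp only [proj_apply, Function.update_self, cls_add, cls_eq_zero_iff.mpr hl,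
                add_zero]
            · simp only [proj_apply, Function.update_of_ne hm]
          simp only [hf, this])
        (fun s => Eventually.of_forall fun w => (hfan w).differentiableAt)
        (fun s => ⟨f s, (hfan s).continuousAt.tendsto.mono_left nhdsWithin_le_nhds⟩)
      have hc' : ∀ s, f s = c := fun s =>
        (eq_of_eventuallyEq_nhdsNE (hfan s).continuousAt continuousAt_const (hc s))
      refine ⟨c, Subtype.ext ?_⟩
      refine holomorphicForms_ext (Submodule.smul_mem _ c hω₀) hω fun x v hv => ?_
      have hx := mem_of_mem_tangentVectors hv
      obtain ⟨t, ht⟩ := cls_surjective (x k)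
      have hxt : x = proj τ (Function.update z k t) := by
        ext l
        rcases hall l with rfl | rfl | rfl
        · simp only [proj_apply, Function.update_of_ne hik, hzi, hx.1]
        · simp only [proj_apply, Function.update_of_ne hjk, hzj, hx.2]
        · simp only [proj_apply, Function.update_self, ht]
      have hex : e ∈ tangentVectors C x := by rw [hxt]; exact htan t
      change c • formOf C (fun _ v => v k) x v = ω x v
      rw [formOf_of_mem hv, hmem x v hv, hω.2.2.1 x e hex]
      have : ω x e = c := by rw [hxt]; exact hc' t
      rw [this]
      simp [hek, mul_comm]

end Burniat

end

/-! ### Bilinear correspondences between two elliptic curves -/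

noncomputable section

namespace Burniat

open Filter

/-- A bilinear form in two pairs of homogeneous coordinates. -/
def bilin (α β γ δ : ℂ) (p q : ℂ × ℂ) : ℂ :=
  α * (p.1 * q.1) + β * (p.1 * q.2) + γ * (p.2 * q.1) + δ * (p.2 * q.2)

section

variable {τ τ' : UpperHalfPlane}

/-- The correspondence `(℘(x) - r)(℘(y) - s) = κ` between two elliptic curves, including its points
at which one of the functions has a pole. -/
def WpRel (r s κ : ℂ) (x : E τ) (y : E τ') : Prop :=
  (x = 0 ∧ y ≠ 0 ∧ wp τ' y = s) ∨ (x ≠ 0 ∧ y = 0 ∧ wp τ x = r) ∨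
    (x ≠ 0 ∧ y ≠ 0 ∧ (wp τ x - r) * (wp τ' y - s) = κ)

variable {r s κ : ℂ} {x x' : E τ} {y y' : E τ'}

theorem WpRel.symm (h : WpRel r s κ x y) : WpRel s r κ y x := by
  rcases h with ⟨h1, h2, h3⟩ | ⟨h1, h2, h3⟩ | ⟨h1, h2, h3⟩
  · exact Or.inr (Or.inl ⟨h2, h1, h3⟩)
  · exact Or.inl ⟨h2, h1, h3⟩
  · exact Or.inr (Or.inr ⟨h2, h1, by rw [mul_comm, h3]⟩)

theorem WpRel.neg_right (h : WpRel r s κ x y) : WpRel r s κ x (-y) := by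
  simpa [WpRel] using h

theorem WpRel.mul_eq (h : WpRel r s κ x y) (hx : x ≠ 0) (hy : y ≠ 0) :
    (wp τ x - r) * (wp τ' y - s) = κ := by
  rcases h with ⟨h1, h2, h3⟩ | ⟨h1, h2, h3⟩ | ⟨h1, h2, h3⟩
  · exact absurd h1 hx
  · exact absurd h2 hy
  · exact h3

/-- The fibres of the correspondence over the first factor. -/
theorem WpRel.eq_or_eq_neg (hκ : κ ≠ 0) (h : WpRel r s κ x y) (h' : WpRel r s κ x y') :
    y' = y ∨ y' = -y := by
  rcases h with ⟨h1, h2, h3⟩ | ⟨h1, h2, h3⟩ | ⟨h1, h2, h3⟩ <;>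
  rcases h' with ⟨k1, k2, k3⟩ | ⟨k1, k2, k3⟩ | ⟨k1, k2, k3⟩
  · exact (wp_eq_iff k2 h2).mp (k3.trans h3.symm)
  · exact absurd h1 k1
  · exact absurd h1 k1
  · exact absurd k1 h1
  · exact Or.inl (k2.trans h2.symm)
  · rw [h3, sub_self, zero_mul] at k3
    exact absurd k3.symm hκ
  · exact absurd k1 h1
  · rw [k3, sub_self, zero_mul] at h3
    exact absurd h3.symm hκ
  · have h0 : wp τ x - r ≠ 0 := fun h0 => hκ (by rw [← h3, h0, zero_mul])
    refine (wp_eq_iff k2 h2).mp ?_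
    have := mul_left_cancel₀ h0 (k3.trans h3.symm)
    linear_combination this

/-- The correspondence is surjective onto the first factor. -/
theorem exists_wpRel (x : E τ) : ∃ y : E τ', WpRel r s κ x y := by
  by_cases hx : x = 0
  · obtain ⟨y, hy, h⟩ := exists_wp_eq (τ := τ') s
    exact ⟨y, Or.inl ⟨hx, hy, h⟩⟩
  · by_cases hr : wp τ x = r
    · exact ⟨0, Or.inr (Or.inl ⟨hx, rfl, hr⟩)⟩
    · obtain ⟨y, hy, h⟩ := exists_wp_eq (τ := τ') (κ / (wp τ x - r) + s)
      refine ⟨y, Or.inr (Or.inr ⟨hx, hy, ?_⟩)⟩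
      have : wp τ x - r ≠ 0 := sub_ne_zero.mpr hr
      rw [h]
      field_simp
      ring

/-- A nondegenerate bilinear equation in the Legendre functions that does not hold at `(0, 0)` is a
correspondence `(℘(x) - r)(℘(y) - s) = κ`. -/
theorem exists_bilin_eq_zero_iff {α β γ δ : ℂ} (hdet : α * δ ≠ β * γ)
    (h0 : bilin α β γ δ (legendre τ 0) (legendre τ' 0) ≠ 0) :
    ∃ r s κ : ℂ, κ ≠ 0 ∧ ∀ (x : E τ) (y : E τ'),
      bilin α β γ δ (legendre τ x) (legendre τ' y) = 0 ↔ WpRel r s κ x y := by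
  have hA : α + β + γ + δ ≠ 0 := by simpa [bilin, legendre_zero] using h0
  have he : zeroVal τ - poleVal τ ≠ 0 := sub_ne_zero.mpr zeroVal_ne_poleVal
  have hf : zeroVal τ' - poleVal τ' ≠ 0 := sub_ne_zero.mpr zeroVal_ne_poleVal
  set A := α + β + γ + δ with hAdef
  set e := zeroVal τ
  set e' := poleVal τ
  set f := zeroVal τ'
  set f' := poleVal τ'
  -- substitute `ℒ = (℘ - e) / (℘ - e')` and complete the product; `A` is the coefficient of
  -- `℘(x)℘(y)`
  refine ⟨((α + β) * e + (γ + δ) * e') / A, ((α + γ) * f + (β + δ) * f') / A,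
    -((α * δ - β * γ) * (e - e') * (f - f')) / A ^ 2, ?_, fun x y => ?_⟩
  · exact div_ne_zero (neg_ne_zero.mpr (mul_ne_zero (mul_ne_zero (sub_ne_zero.mpr hdet) he) hf))
      (pow_ne_zero 2 hA)
  · by_cases hx : x = 0 <;> by_cases hy : y = 0
    · subst hx hy
      simp [WpRel, h0]
    · subst hx
      simp only [WpRel, legendre_zero, legendre_of_ne_zero hy, bilin, ne_eq, hy, not_true_eq_false,
        not_false_eq_true, true_and, false_and, or_false]
      rw [eq_div_iff hA, hAdef]
      constructor <;> intro h <;> linear_combination h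
    · subst hy
      simp only [WpRel, legendre_zero, legendre_of_ne_zero hx, bilin, ne_eq, hx, not_true_eq_false,
        not_false_eq_true, true_and, false_and, or_false, false_or, and_false]
      rw [eq_div_iff hA, hAdef]
      constructor <;> intro h <;> linear_combination h
    · simp only [WpRel, legendre_of_ne_zero hy, legendre_of_ne_zero hx, bilin, ne_eq, hx, hy,
        not_false_eq_true, true_and, false_and, false_or]
      have key : α * ((wp τ x - e) * (wp τ' y - f)) + β * ((wp τ x - e) * (wp τ' y - f')) +
          γ * ((wp τ x - e') * (wp τ' y - f)) + δ * ((wp τ x - e') * (wp τ' y - f')) =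
          A * ((wp τ x - ((α + β) * e + (γ + δ) * e') / A) *
            (wp τ' y - ((α + γ) * f + (β + δ) * f') / A) -
            -((α * δ - β * γ) * (e - e') * (f - f')) / A ^ 2) := by
        field_simp
        rw [hAdef]
        ring
      rw [key, mul_eq_zero, or_iff_right hA, sub_eq_zero]

end

variable {τ : Fin 3 → UpperHalfPlane}

theorem legendre_ne_zero {τ : UpperHalfPlane} {x : E τ} (h1 : (legendre τ x).1 = 0)
    (h2 : (legendre τ x).2 = 0) : False :=
  legendre_fst_ne_zero h2 h1

/-- A local equation of a bilinear correspondence. -/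
theorem exists_bilin_equation {i j : Fin 3} {α β γ δ : ℂ} (hdet : α * δ ≠ β * γ)
    (z : Fin 3 → ℂ) : ∃ f : (Fin 3 → ℂ) → ℂ, AnalyticAt ℂ f z ∧
      (∀ᶠ w in 𝓝 z, bilin α β γ δ (legendre (τ i) (cls (τ i) (w i)))
        (legendre (τ j) (cls (τ j) (w j))) = 0 ↔ f w = 0) ∧
      (f z = 0 → ∃ a b : ℂ, (∀ v, fderiv ℂ f z v = a * v i + b * v j) ∧
        (cls (τ i) (z i) + cls (τ i) (z i) ≠ 0 → a ≠ 0) ∧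
        (cls (τ j) (z j) + cls (τ j) (z j) ≠ 0 → b ≠ 0)) := by
  obtain ⟨n, d, hn, hd, he, hne⟩ := exists_legendre_lift (τ := τ i) (z i)
  obtain ⟨n', d', hn', hd', he', hne'⟩ := exists_legendre_lift (τ := τ j) (z j)
  have hcomp : ∀ (l : Fin 3) {g : ℂ → ℂ}, AnalyticAt ℂ g (z l) →
      AnalyticAt ℂ (fun w : Fin 3 → ℂ => g (w l)) z := fun l g hg =>
    AnalyticAt.fun_comp (f := fun w : Fin 3 → ℂ => w l) hg
      ((ContinuousLinearMap.proj (R := ℂ) (φ := fun _ : Fin 3 => ℂ) l).analyticAt z)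
  have hder : ∀ (l : Fin 3) {g : ℂ → ℂ}, AnalyticAt ℂ g (z l) →
      HasFDerivAt (fun w : Fin 3 → ℂ => g (w l))
        (deriv g (z l) • ContinuousLinearMap.proj (R := ℂ) (φ := fun _ : Fin 3 => ℂ) l) z :=
    fun l g hg => hg.differentiableAt.hasDerivAt.comp_hasFDerivAt z (hasFDerivAt_apply l z)
  have hfan : AnalyticAt ℂ (fun w : Fin 3 → ℂ =>
      bilin α β γ δ (n (w i), d (w i)) (n' (w j), d' (w j))) z := by
    have h1 := hcomp i hn
    have h2 := hcomp i hd
    have h3 := hcomp j hn'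
    have h4 := hcomp j hd'
    exact (((analyticAt_const.mul (h1.mul h3)).add (analyticAt_const.mul (h1.mul h4))).add
      (analyticAt_const.mul (h2.mul h3))).add (analyticAt_const.mul (h2.mul h4))
  refine ⟨_, hfan, ?_, fun h0 => ?_⟩
  · filter_upwards [(continuous_apply i).continuousAt.eventually he,
      (continuous_apply j).continuousAt.eventually he'] with w h1 h2
    obtain ⟨c, hc, e1, e2⟩ := h1
    obtain ⟨c', hc', e1', e2'⟩ := h2
    simp only [bilin, e1, e2, e1', e2']
    have : α * (c * n (w i) * (c' * n' (w j))) + β * (c * n (w i) * (c' * d' (w j))) +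
        γ * (c * d (w i) * (c' * n' (w j))) + δ * (c * d (w i) * (c' * d' (w j))) =
        c * c' * (α * (n (w i) * n' (w j)) + β * (n (w i) * d' (w j)) +
          γ * (d (w i) * n' (w j)) + δ * (d (w i) * d' (w j))) := by ring
    rw [this, mul_eq_zero, or_iff_right (mul_ne_zero hc hc')]
  · obtain ⟨c, hc, e1, e2⟩ := he.self_of_nhds
    obtain ⟨c', hc', e1', e2'⟩ := he'.self_of_nhds
    simp only [bilin] at h0
    refine ⟨(α * n' (z j) + β * d' (z j)) * deriv n (z i) +
        (γ * n' (z j) + δ * d' (z j)) * deriv d (z i),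
      (α * n (z i) + γ * d (z i)) * deriv n' (z j) +
        (β * n (z i) + δ * d (z i)) * deriv d' (z j), fun v => ?_, fun hcr => ?_, fun hcr => ?_⟩
    · have h1 := (((((hder i hn).mul (hder j hn')).const_mul α).add
        (((hder i hn).mul (hder j hd')).const_mul β)).add
        (((hder i hd).mul (hder j hn')).const_mul γ)).add
        (((hder i hd).mul (hder j hd')).const_mul δ)
      have h2 := h1.fderiv
      have h3 : (fun w : Fin 3 → ℂ => bilin α β γ δ (n (w i), d (w i)) (n' (w j), d' (w j))) =
          fun w => α * (n (w i) * n' (w j)) + β * (n (w i) * d' (w j)) +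
            γ * (d (w i) * n' (w j)) + δ * (d (w i) * d' (w j)) := rfl
      rw [h3]
      refine (DFunLike.congr_fun h2 v).trans ?_
      simp
      ring
    · refine hne _ _ ?_ ?_ hcr
      · by_contra hcon
        push Not at hcon
        refine legendre_ne_zero (τ := τ j) (x := cls (τ j) (z j)) ?_ ?_
        · rw [e1']
          have : (α * δ - β * γ) * n' (z j) = 0 := by
            linear_combination δ * hcon.1 - β * hcon.2
          rw [(mul_eq_zero.mp this).resolve_left (sub_ne_zero.mpr hdet), mul_zero]
        · rw [e2']
          have : (α * δ - β * γ) * d' (z j) = 0 := by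
            linear_combination α * hcon.2 - γ * hcon.1
          rw [(mul_eq_zero.mp this).resolve_left (sub_ne_zero.mpr hdet), mul_zero]
      · rw [e1, e2]
        linear_combination c * h0
    · refine hne' _ _ ?_ ?_ hcr
      · by_contra hcon
        push Not at hcon
        refine legendre_ne_zero (τ := τ i) (x := cls (τ i) (z i)) ?_ ?_
        · rw [e1]
          have : (α * δ - β * γ) * n (z i) = 0 := by
            linear_combination δ * hcon.1 - γ * hcon.2
          rw [(mul_eq_zero.mp this).resolve_left (sub_ne_zero.mpr hdet), mul_zero]
        · rw [e2]
          have : (α * δ - β * γ) * d (z i) = 0 := by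
            linear_combination α * hcon.2 - β * hcon.1
          rw [(mul_eq_zero.mp this).resolve_left (sub_ne_zero.mpr hdet), mul_zero]
      · rw [e1', e2']
        linear_combination c' * h0

theorem isOpenMap_proj : IsOpenMap (proj τ) :=
  IsOpenMap.piMap (fun j => (isOpenQuotientMap_cls (τ := τ j)).isOpenMap)
    (Filter.Eventually.of_forall fun _ => cls_surjective)

theorem isClosed_of_eventually {C : Set (T τ)}
    (h : ∀ z, proj τ z ∉ C → ∀ᶠ w in 𝓝 z, proj τ w ∉ C) : IsClosed C := by
  have h1 : IsOpen (proj τ ⁻¹' Cᶜ) := isOpen_iff_eventually.mpr fun z hz => h z hz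
  have h2 := isOpenMap_proj (τ := τ) _ h1
  rw [Set.image_preimage_eq _ proj_surjective] at h2
  exact ⟨h2⟩

/-- `C` is the curve in `T` with constant `k`-th coordinate on which the coordinates `i` and `j`
satisfy `(℘ - r)(℘ - s) = κ`, never being points of order two simultaneously. The last fields say
that `C` is smooth and that the projection to a factor is unramified where the other coordinate is
not a point of order two. -/
structure IsWpCurve (C : Set (T τ)) (i j k : Fin 3) (r s κ : ℂ) : Prop where
  hij : i ≠ j
  hik : i ≠ k
  hjk : j ≠ k
  hκ : κ ≠ 0
  mem_iff : ∃ a, ∀ x, x ∈ C ↔ x k = a ∧ WpRel r s κ (x i) (x j)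
  noncrit : ∀ x ∈ C, x i + x i = 0 → x j + x j ≠ 0
  sub : ∀ x ∈ C, IsSubmanifoldAt 2 C x
  tan_left : ∀ x ∈ C, ∀ v ∈ tangentVectors C x, v i = 0 → x j + x j ≠ 0 → v = 0
  tan_right : ∀ x ∈ C, ∀ v ∈ tangentVectors C x, v j = 0 → x i + x i ≠ 0 → v = 0
  closed : IsClosed C

/-- The curve with constant `k`-th coordinate cut out by a bilinear equation in the Legendre
functions of the other two coordinates. -/
def biCurve (i j k : Fin 3) (a : E (τ k)) (α β γ δ : ℂ) : Set (T τ) :=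
  {x | x k = a ∧ bilin α β γ δ (legendre (τ i) (x i)) (legendre (τ j) (x j)) = 0}

/-- By the form of its equation, the curve is ramified over a factor only at points where the other
coordinate has order two; this does not happen for both coordinates at once, so the curve is smooth. -/
theorem isWpCurve_biCurve {i j k : Fin 3} (hij : i ≠ j) (hik : i ≠ k) (hjk : j ≠ k)
    (a : E (τ k)) {α β γ δ : ℂ} (hdet : α * δ ≠ β * γ)
    (hcr : ∀ (x : E (τ i)) (y : E (τ j)), x + x = 0 → y + y = 0 →
      bilin α β γ δ (legendre (τ i) x) (legendre (τ j) y) ≠ 0) :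
    ∃ r s κ, IsWpCurve (biCurve i j k a α β γ δ) i j k r s κ := by
  obtain ⟨r, s, κ, hκ, hrel⟩ := exists_bilin_eq_zero_iff hdet (hcr 0 0 (add_zero 0) (add_zero 0))
  have hall := eq_or_eq_or_eq_of_ne hij hik hjk
  set C := biCurve i j k a α β γ δ with hC
  have hcr' : ∀ x ∈ C, x i + x i = 0 → x j + x j ≠ 0 := fun x hx h1 h2 => hcr _ _ h1 h2 hx.2
  -- the differential of the local equation at a point of the curve
  have hmain : ∀ z, proj τ z ∈ C → ∃ F : (Fin 3 → ℂ) → (Fin 2 → ℂ), AnalyticAt ℂ F z ∧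
      (∀ᶠ w in 𝓝 z, proj τ w ∈ C ↔ F w = 0) ∧ ∃ p q : ℂ,
        (∀ v, fderiv ℂ F z v = ![v k, p * v i + q * v j]) ∧
        (cls (τ i) (z i) + cls (τ i) (z i) ≠ 0 → p ≠ 0) ∧
        (cls (τ j) (z j) + cls (τ j) (z j) ≠ 0 → q ≠ 0) := by
    intro z hz
    obtain ⟨f, hf, hfe, hfd⟩ := exists_bilin_equation (τ := τ) (i := i) (j := j) hdet z
    obtain ⟨p, q, hpq, hp, hq⟩ := hfd (hfe.self_of_nhds.mp hz.2)
    have hd : HasFDerivAt (fun w : Fin 3 → ℂ => ![w k - z k, f w])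
        (ContinuousLinearMap.pi ![ContinuousLinearMap.proj (R := ℂ) (φ := fun _ : Fin 3 => ℂ) k,
          fderiv ℂ f z]) z := by
      refine hasFDerivAt_pi.mpr fun l => ?_
      fin_cases l
      · exact (hasFDerivAt_apply k z).sub_const _
      · exact hf.differentiableAt.hasFDerivAt
    refine ⟨fun w => ![w k - z k, f w], ?_, ?_, p, q, fun v => ?_, hp, hq⟩
    · refine AnalyticAt.pi fun l => ?_
      fin_cases l
      · exact (ContinuousLinearMap.proj (R := ℂ) (φ := fun _ : Fin 3 => ℂ) k).analyticAt z |>.sub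
          analyticAt_const
      · exact hf
    · filter_upwards [hfe, (continuous_apply k).continuousAt.eventually
        (eventually_cls_eq_iff (τ := τ k) (z k))] with w h1 h2
      have hzk : cls (τ k) (z k) = a := hz.1
      rw [hzk] at h2
      refine (and_congr h2 h1).trans ⟨fun ⟨e1, e2⟩ => ?_, fun e => ?_⟩
      · ext l
        fin_cases l
        · simp [e1]
        · simp [e2]
      · exact ⟨sub_eq_zero.mp (congrFun e 0), congrFun e 1⟩
    · rw [hd.fderiv]
      ext l
      fin_cases l
      · simp
      · simpa using hpq v
  have htan : ∀ z, proj τ z ∈ C → ∀ v ∈ tangentVectors C (proj τ z), ∃ p q : ℂ,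
      v k = 0 ∧ p * v i + q * v j = 0 ∧ (cls (τ i) (z i) + cls (τ i) (z i) ≠ 0 → p ≠ 0) ∧
        (cls (τ j) (z j) + cls (τ j) (z j) ≠ 0 → q ≠ 0) := by
    intro z hz v hv
    obtain ⟨F, hF, hFe, p, q, hpq, hp, hq⟩ := hmain z hz
    obtain ⟨γ₀, hγ₀, h0, rfl⟩ := hv
    have hγ := hγ₀.add_const h0.symm
    have e0 : γ₀ 0 + (z - γ₀ 0) = z := by abel
    have h1 : ∀ᶠ t in 𝓝 (0 : ℂ), F (γ₀ t + (z - γ₀ 0)) = 0 := by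
      have hc : Tendsto (fun t => γ₀ t + (z - γ₀ 0)) (𝓝 0) (𝓝 z) := by
        have := hγ.1.continuousAt.tendsto
        rwa [e0] at this
      filter_upwards [hc.eventually hFe, hγ.2] with t h1 h2
      exact h1.mp h2
    have h2 : HasDerivAt (fun t => γ₀ t + (z - γ₀ 0)) (deriv γ₀ 0) 0 :=
      hγ₀.1.differentiableAt.hasDerivAt.add_const _
    have hF' : HasFDerivAt F (fderiv ℂ F z) (γ₀ 0 + (z - γ₀ 0)) := by
      rw [e0]; exact hF.differentiableAt.hasFDerivAt
    have h3 := HasFDerivAt.comp_hasDerivAt (x := (0 : ℂ)) (f := fun t => γ₀ t + (z - γ₀ 0)) hF' h2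
    have h4 : HasDerivAt (F ∘ fun t => γ₀ t + (z - γ₀ 0)) 0 0 :=
      (hasDerivAt_const (0 : ℂ) (0 : Fin 2 → ℂ)).congr_of_eventuallyEq h1
    have h5 := h3.unique h4
    rw [hpq] at h5
    exact ⟨p, q, congrFun h5 0, congrFun h5 1, hp, hq⟩
  refine ⟨r, s, κ, hij, hik, hjk, hκ, ⟨a, fun x => and_congr_right fun _ => hrel _ _⟩, hcr', ?_, ?_,
    ?_, ?_⟩
  · intro x hx
    obtain ⟨z, rfl⟩ := proj_surjective x
    obtain ⟨F, hF, hFe, p, q, hpq, hp, hq⟩ := hmain z hx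
    refine ⟨hx, z, F, rfl, hF, fun c => ?_, hFe⟩
    by_cases hi : cls (τ i) (z i) + cls (τ i) (z i) = 0
    · have hq0 := hq (hcr' _ hx hi)
      refine ⟨Function.update (Function.update 0 k (c 0)) j (c 1 / q), ?_⟩
      rw [hpq]
      ext l
      fin_cases l
      · simp [hjk.symm]
      · simp [hij, hik]
        field_simp
    · have hp0 := hp hi
      refine ⟨Function.update (Function.update 0 k (c 0)) i (c 1 / p), ?_⟩
      rw [hpq]
      ext l
      fin_cases l
      · simp [hik.symm]
      · simp [hij.symm, hjk]
        field_simp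
  · intro x hx v hv hvi hj
    obtain ⟨z, rfl⟩ := proj_surjective x
    obtain ⟨p, q, h1, h2, -, hq⟩ := htan z hx v hv
    rw [hvi, mul_zero, zero_add] at h2
    have hvj := (mul_eq_zero.mp h2).resolve_left (hq hj)
    ext l
    rcases hall l with rfl | rfl | rfl <;> simp [*]
  · intro x hx v hv hvj hi
    obtain ⟨z, rfl⟩ := proj_surjective x
    obtain ⟨p, q, h1, h2, hp, -⟩ := htan z hx v hv
    rw [hvj, mul_zero, add_zero] at h2
    have hvi := (mul_eq_zero.mp h2).resolve_left (hp hi)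
    ext l
    rcases hall l with rfl | rfl | rfl <;> simp [*]
  · refine isClosed_of_eventually fun z hz => ?_
    by_cases hk : cls (τ k) (z k) = a
    · obtain ⟨f, hf, hfe, -⟩ := exists_bilin_equation (τ := τ) (i := i) (j := j) hdet z
      have h0 : f z ≠ 0 := fun h0 => hz ⟨hk, hfe.self_of_nhds.mpr h0⟩
      filter_upwards [hfe, hf.continuousAt.eventually_ne h0] with w h1 h2 h3
      exact h2 (h1.mp h3.2)
    · have hc : Continuous fun w : Fin 3 → ℂ => cls (τ k) (w k) :=
        continuous_cls.comp (continuous_apply k)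
      filter_upwards [hc.continuousAt.eventually_ne hk] with w h1 h2
      exact h1 h2.1

namespace IsWpCurve

variable {C : Set (T τ)} {i j k : Fin 3} {r s κ : ℂ}

theorem symm (h : IsWpCurve C i j k r s κ) : IsWpCurve C j i k s r κ where
  hij := h.hij.symm
  hik := h.hjk
  hjk := h.hik
  hκ := h.hκ
  mem_iff := by
    obtain ⟨a, ha⟩ := h.mem_iff
    exact ⟨a, fun x => (ha x).trans (and_congr_right fun _ => ⟨WpRel.symm, WpRel.symm⟩)⟩
  noncrit := fun x hx h1 h2 => h.noncrit x hx h2 h1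
  sub := h.sub
  tan_left := h.tan_right
  tan_right := h.tan_left
  closed := h.closed

theorem wpRel (h : IsWpCurve C i j k r s κ) {x : T τ} (hx : x ∈ C) : WpRel r s κ (x i) (x j) := by
  obtain ⟨a, ha⟩ := h.mem_iff
  exact ((ha x).mp hx).2

/-- The third coordinate of an arc in the curve is constant. -/
theorem eventually_coord_eq (h : IsWpCurve C i j k r s κ) {γ : ℂ → Fin 3 → ℂ} (hγ : IsArc C γ) :
    ∀ᶠ t in 𝓝 0, γ t k = γ 0 k := by
  obtain ⟨a, ha⟩ := h.mem_iff
  exact hγ.eventually_coord_eq (c := a + a) fun x hx => by rw [((ha x).mp hx).1]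

/-- The differential of the equation `(℘(x) - r)(℘(y) - s) = κ`. -/
theorem tangent_relation (h : IsWpCurve C i j k r s κ) {x : T τ} {v : Fin 3 → ℂ}
    (hv : v ∈ tangentVectors C x) (hi : x i ≠ 0) (hj : x j ≠ 0) :
    wp' (τ i) (x i) * v i * (wp (τ j) (x j) - s) +
      (wp (τ i) (x i) - r) * (wp' (τ j) (x j) * v j) = 0 := by
  obtain ⟨γ, hγ, rfl, rfl⟩ := hv
  simp only [proj_apply, ne_eq, cls_eq_zero_iff] at hi hj
  have hd : ∀ l, HasDerivAt (fun t => γ t l) (deriv γ 0 l) 0 := fun l =>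
    hasDerivAt_pi.mp hγ.1.differentiableAt.hasDerivAt l
  have h1 := ((hasDerivAt_weierstrassP hi).comp (0 : ℂ) (hd i)).sub_const r
  have h2 := ((hasDerivAt_weierstrassP hj).comp (0 : ℂ) (hd j)).sub_const s
  have h3 := h1.mul h2
  have h4 : ∀ᶠ t in 𝓝 (0 : ℂ), ((periods (τ i)).weierstrassP (γ t i) - r) *
      ((periods (τ j)).weierstrassP (γ t j) - s) = κ := by
    filter_upwards [hγ.2, (hd i).continuousAt.eventually (eventually_notMem_lattice hi),
      (hd j).continuousAt.eventually (eventually_notMem_lattice hj)] with t k1 k2 k3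
    exact (h.wpRel k1).mul_eq (fun e => k2 (cls_eq_zero_iff.mp e)) fun e =>
      k3 (cls_eq_zero_iff.mp e)
  exact h3.unique ((hasDerivAt_const (0 : ℂ) κ).congr_of_eventuallyEq h4)

/-- The coordinates of a nonconstant arc in the curve are not constant: the fibres of the
correspondence are finite. -/
theorem eventually_ne (h : IsWpCurve C i j k r s κ) {γ : ℂ → Fin 3 → ℂ} (hγ : IsArc C γ)
    (h0 : deriv γ 0 ≠ 0) : ∀ᶠ t in 𝓝[≠] 0, γ t i ≠ γ 0 i := by
  have han : ∀ l, AnalyticAt ℂ (fun t => γ t l) 0 := analyticAt_pi_iff.mp hγ.1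
  refine ((han i).eventually_eq_or_eventually_ne analyticAt_const).resolve_left fun hi => h0 ?_
  have hj : ∀ᶠ t in 𝓝 (0 : ℂ), γ t j = γ 0 j := by
    have hc : ContinuousAt (fun t => cls (τ j) (γ t j)) 0 :=
      continuous_cls.continuousAt.comp (han j).continuousAt
    have h1 : ∀ᶠ t in 𝓝 (0 : ℂ), cls (τ j) (γ t j) = cls (τ j) (γ 0 j) := by
      have h2 : ∀ᶠ t in 𝓝 (0 : ℂ), cls (τ j) (γ t j) = cls (τ j) (γ 0 j) ∨
          cls (τ j) (γ t j) = -cls (τ j) (γ 0 j) := by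
        filter_upwards [hγ.2, hi] with t h3 h4
        have h5 := h.wpRel h3
        have h6 := h.wpRel hγ.2.self_of_nhds
        simp only [proj_apply, h4] at h5 h6
        exact h6.eq_or_eq_neg h.hκ h5
      by_cases hs : cls (τ j) (γ 0 j) = -cls (τ j) (γ 0 j)
      · filter_upwards [h2] with t h3
        exact h3.elim id fun h3 => h3.trans hs.symm
      · filter_upwards [h2, hc.eventually_ne hs] with t h3 h4
        exact h3.resolve_right h4
    filter_upwards [h1, (han j).continuousAt.eventually
      (eventually_cls_eq_iff (τ := τ j) (γ 0 j))] with t h3 h4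
    exact h4.mp h3
  have hk := h.eventually_coord_eq hγ
  have h1 : ∀ᶠ t in 𝓝 (0 : ℂ), γ t = γ 0 := by
    filter_upwards [hi, hj, hk] with t h1 h2 h3
    ext l
    rcases eq_or_eq_or_eq_of_ne h.hij h.hik h.hjk l with rfl | rfl | rfl <;> assumption
  exact ((hasDerivAt_const (0 : ℂ) (γ 0)).congr_of_eventuallyEq h1).deriv

/-- The projection of the curve to a factor is open. -/
theorem image_mem_nhds (h : IsWpCurve C i j k r s κ) {x : T τ} (hx : x ∈ C) {N : Set (T τ)}
    (hN : N ∈ 𝓝 x) : (fun p : T τ => p i) '' (N ∩ C) ∈ 𝓝 (x i) := by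
  obtain ⟨v, ⟨γ, hγ, rfl, rfl⟩, hv0⟩ := (h.sub x hx).tangentVectors_line.1
  have han : AnalyticAt ℂ (fun t => γ t i) 0 := analyticAt_pi_iff.mp hγ.1 i
  have hopen := han.eventually_constant_or_nhds_le_map_nhds.resolve_left fun hc => by
    have := (hc.filter_mono nhdsWithin_le_nhds).and (h.eventually_ne hγ hv0)
    obtain ⟨t, h1, h2⟩ := this.exists
    exact h2 h1
  have h1 : ∀ᶠ t in 𝓝 (0 : ℂ), proj τ (γ t) ∈ N ∩ C := by
    have : ContinuousAt (fun t => proj τ (γ t)) 0 :=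
      continuous_proj.continuousAt.comp hγ.1.continuousAt
    exact (this.eventually hN).and hγ.2
  have h2 : (fun t => γ t i) '' {t | proj τ (γ t) ∈ N ∩ C} ∈ 𝓝 (γ 0 i) :=
    hopen (image_mem_map h1)
  have h3 := (isOpenQuotientMap_cls (τ := τ i)).isOpenMap.image_mem_nhds h2
  refine mem_of_superset h3 ?_
  rintro _ ⟨_, ⟨t, ht, rfl⟩, rfl⟩
  exact ⟨_, ht, rfl⟩

/-- The curve is connected: its projection to a factor is open and closed, and some point of the
factor has a single preimage. -/
theorem isConnected (h : IsWpCurve C i j k r s κ) : IsConnected C := by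
  obtain ⟨a, ha⟩ := h.mem_iff
  obtain ⟨x₀, hx₀, hxr⟩ := exists_wp_eq (τ := τ i) r
  set p₀ : T τ := Function.update (Function.update 0 i x₀) k a with hp₀
  have e1 : p₀ i = x₀ := by simp [hp₀, h.hik]
  have e2 : p₀ k = a := by simp [hp₀]
  have e3 : p₀ j = 0 := by simp [hp₀, h.hjk, h.hij.symm]
  have hmem : p₀ ∈ C := (ha _).mpr ⟨e2, Or.inr (Or.inl ⟨by rwa [e1], e3, by rw [e1, hxr]⟩)⟩
  have huniq : ∀ p ∈ C, p i = x₀ → p = p₀ := by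
    intro p hp hpi
    obtain ⟨hpk, hrel⟩ := (ha p).mp hp
    have hj : p j = 0 := by
      have h1 := h.wpRel hmem
      rw [hpi] at hrel
      rw [e1, e3] at h1
      rcases h1.eq_or_eq_neg h.hκ hrel with h2 | h2
      · exact h2
      · rw [h2, neg_zero]
    ext l
    rcases eq_or_eq_or_eq_of_ne h.hij h.hik h.hjk l with rfl | rfl | rfl
    · rw [hpi, e1]
    · rw [hj, e3]
    · rw [hpk, e2]
  refine ⟨⟨p₀, hmem⟩, isPreconnected_closed_iff.mpr fun t t' ht ht' hCt h1 h2 => ?_⟩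
  by_contra hempty
  have key : ∀ t t' : Set (T τ), IsClosed t → IsClosed t' → C ⊆ t ∪ t' → (C ∩ t).Nonempty →
      ¬ (C ∩ (t ∩ t')).Nonempty → p₀ ∈ t := by
    intro t t' ht ht' hCt h1 hempty
    have hcl : IsClosed ((fun p : T τ => p i) '' (C ∩ t)) :=
      ((h.closed.inter ht).isCompact.image (continuous_apply i)).isClosed
    have hop : IsOpen ((fun p : T τ => p i) '' (C ∩ t)) := by
      rw [isOpen_iff_mem_nhds]
      rintro _ ⟨p, ⟨hp, hpt⟩, rfl⟩
      have hN : t'ᶜ ∈ 𝓝 p := ht'.isOpen_compl.mem_nhds fun hpt' => hempty ⟨p, hp, hpt, hpt'⟩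
      refine mem_of_superset (h.image_mem_nhds hp hN) (Set.image_mono ?_)
      rintro q ⟨hq1, hq2⟩
      exact ⟨hq2, (hCt hq2).resolve_right hq1⟩
    have huniv := IsClopen.eq_univ ⟨hcl, hop⟩ (h1.image _)
    obtain ⟨p, ⟨hp, hpt⟩, hpi⟩ : x₀ ∈ (fun p : T τ => p i) '' (C ∩ t) := huniv ▸ Set.mem_univ _
    rwa [huniq p hp hpi] at hpt
  refine hempty ⟨p₀, hmem, key t t' ht ht' hCt h1 hempty, key t' t ht' ht ?_ h2 ?_⟩
  · rwa [Set.union_comm]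
  · rwa [Set.inter_comm t' t]

end IsWpCurve

end Burniat

end

/-! ### Holomorphic forms on a curve of genus five -/

noncomputable section

namespace Burniat

open Filter

variable {τ : Fin 3 → UpperHalfPlane}

/-- A holomorphic form along a holomorphic curve `Γ` defined near any parameter. -/
theorem analyticAt_form_along {C : Set (T τ)} {ω : T τ → (Fin 3 → ℂ) → ℂ}
    (hω : ω ∈ holomorphicForms C) {Γ : ℂ → Fin 3 → ℂ} {t₀ : ℂ} (hΓ : AnalyticAt ℂ Γ t₀)
    (hC : ∀ᶠ t in 𝓝 t₀, proj τ (Γ t) ∈ C) :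
    AnalyticAt ℂ (fun t => ω (proj τ (Γ t)) (deriv Γ t)) t₀ ∧
      ∀ᶠ t in 𝓝 t₀, deriv Γ t ∈ tangentVectors C (proj τ (Γ t)) := by
  have ha : Tendsto (fun s : ℂ => t₀ + s) (𝓝 0) (𝓝 t₀) := by
    have : ContinuousAt (fun s : ℂ => t₀ + s) 0 := by fun_prop
    simpa using this.tendsto
  have hb : Tendsto (fun s : ℂ => s - t₀) (𝓝 t₀) (𝓝 0) := by
    have : ContinuousAt (fun s : ℂ => s - t₀) t₀ := by fun_prop
    simpa using this.tendsto
  have harc : IsArc C fun s => Γ (t₀ + s) :=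
    ⟨AnalyticAt.fun_comp_of_eq (f := fun s : ℂ => t₀ + s) hΓ (by fun_prop) (by simp),
      ha.eventually hC⟩
  have hder : ∀ s, deriv (fun s => Γ (t₀ + s)) s = deriv Γ (t₀ + s) := fun s =>
    deriv_comp_const_add _ _ _
  constructor
  · have h1 := hω.2.2.2 _ harc
    have h2 := AnalyticAt.fun_comp_of_eq (f := fun s : ℂ => s - t₀) h1 (x := t₀) (by fun_prop)
      (by simp)
    refine h2.congr (Eventually.of_forall fun t => ?_)
    simp only [hder, add_sub_cancel]
  · have h1 := hb.eventually harc.eventually_shift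
    refine h1.mono fun t ht => ?_
    simpa only [hder, add_sub_cancel] using ht

/-- A curve with a tangent vector whose `i`-th coordinate does not vanish can be parametrised
locally by the `i`-th coordinate. -/
theorem exists_graph_arc {C : Set (T τ)} {z v : Fin 3 → ℂ} {i : Fin 3}
    (hv : v ∈ tangentVectors C (proj τ z)) (hvi : v i ≠ 0) :
    ∃ Γ : ℂ → Fin 3 → ℂ, AnalyticAt ℂ Γ (z i) ∧ Γ (z i) = z ∧ (∀ᶠ t in 𝓝 (z i), Γ t i = t) ∧
      ∀ᶠ t in 𝓝 (z i), proj τ (Γ t) ∈ C := by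
  obtain ⟨γ₀, hγ₀, h0, rfl⟩ := hv
  obtain ⟨γ, hγ, hγ0, hγd⟩ : ∃ γ, IsArc C γ ∧ γ 0 = z ∧ deriv γ 0 = deriv γ₀ 0 :=
    ⟨_, hγ₀.add_const h0.symm, by abel, by rw [deriv_add_const]⟩
  have han : AnalyticAt ℂ (fun t => γ t i) 0 := analyticAt_pi_iff.mp hγ.1 i
  have hd : deriv (fun t => γ t i) 0 ≠ 0 := by
    rw [(hasDerivAt_pi.mp hγ.1.differentiableAt.hasDerivAt i).deriv, hγd]
    exact hvi
  set h := han.hasStrictDerivAt.localInverse _ _ _ hd with hh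
  have h1 : AnalyticAt ℂ h (γ 0 i) := han.analyticAt_localInverse hd
  have h2 : h (γ 0 i) = 0 := HasStrictFDerivAt.localInverse_apply_image ..
  have h3 : ∀ᶠ t in 𝓝 (γ 0 i), γ (h t) i = t :=
    HasStrictDerivAt.eventually_right_inverse han.hasStrictDerivAt hd
  rw [hγ0] at h1 h2 h3
  refine ⟨fun t => γ (h t), AnalyticAt.fun_comp_of_eq hγ.1 h1 h2, by simp only [h2, hγ0], h3, ?_⟩
  have : Tendsto h (𝓝 (z i)) (𝓝 0) := by
    have := h1.continuousAt.tendsto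
    rwa [h2] at this
  exact this.eventually hγ.2

/-- Riemann's theorem on removable singularities. -/
theorem exists_analyticAt_of_tendsto {f : ℂ → ℂ} {z c : ℂ}
    (hd : ∀ᶠ w in 𝓝[≠] z, DifferentiableAt ℂ f w) (hl : Tendsto f (𝓝[≠] z) (𝓝 c)) :
    ∃ g, AnalyticAt ℂ g z ∧ f =ᶠ[𝓝[≠] z] g := by
  have hev : f =ᶠ[𝓝[≠] z] Function.update f z c := by
    filter_upwards [self_mem_nhdsWithin] with w hw
    rw [Function.update_of_ne hw]
  refine ⟨Function.update f z c, ?_, hev⟩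
  refine Complex.analyticAt_of_differentiable_on_punctured_nhds_of_continuousAt ?_ ?_
  · filter_upwards [hd, self_mem_nhdsWithin] with w hw hne
    refine hw.congr_of_eventuallyEq ?_
    filter_upwards [isOpen_ne.mem_nhds hne] with u hu
    rw [Function.update_of_ne hu]
  · refine continuousAt_iff_punctured_nhds.mpr ?_
    rw [Function.update_self]
    exact hl.congr' hev

/-- The limit of a function along a nonconstant holomorphic reparametrisation. -/
theorem tendsto_of_tendsto_comp {β : Type*} {f : ℂ → β} {X : ℂ → ℂ} {w₀ : ℂ} (hX : AnalyticAt ℂ X w₀)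
    (hne : ∀ᶠ u in 𝓝[≠] w₀, X u ≠ X w₀) {l : Filter β}
    (h : Tendsto (fun u => f (X u)) (𝓝[≠] w₀) l) : Tendsto f (𝓝[≠] (X w₀)) l := by
  intro A hA
  have h1 : {u | f (X u) ∈ A} ∈ 𝓝[≠] w₀ := h hA
  rw [mem_nhdsWithin_iff_eventually] at h1
  have hopen := hX.eventually_constant_or_nhds_le_map_nhds.resolve_left fun hc => by
    obtain ⟨t, h1, h2⟩ := ((hc.filter_mono nhdsWithin_le_nhds).and hne).exists
    exact h2 h1
  have h2 : ∀ᶠ u in 𝓝 w₀, X u ≠ X w₀ → f (X u) ∈ A := by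
    filter_upwards [h1] with u hu hne'
    exact hu fun e => hne' (by rw [e])
  have h3 : {x | x ≠ X w₀ → f x ∈ A} ∈ 𝓝 (X w₀) := hopen h2
  exact mem_nhdsWithin_iff_eventually.mpr h3

namespace IsWpCurve

variable {C : Set (T τ)} {i j k : Fin 3} {r s κ : ℂ} {ω : T τ → (Fin 3 → ℂ) → ℂ}

/-- Where the other coordinate is not a point of order two, the curve can be parametrised by the
`i`-th coordinate. -/
theorem exists_arc_left (h : IsWpCurve C i j k r s κ) {z : Fin 3 → ℂ} (hz : proj τ z ∈ C)
    (hj : cls (τ j) (z j) + cls (τ j) (z j) ≠ 0) :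
    ∃ Γ : ℂ → Fin 3 → ℂ, AnalyticAt ℂ Γ (z i) ∧ Γ (z i) = z ∧ (∀ᶠ t in 𝓝 (z i), Γ t i = t) ∧
      ∀ᶠ t in 𝓝 (z i), proj τ (Γ t) ∈ C := by
  obtain ⟨v, hv, hv0⟩ := (h.sub _ hz).tangentVectors_line.1
  exact exists_graph_arc hv fun hvi => hv0 (h.tan_left _ hz v hv hvi hj)

/-- A form that vanishes at the points where the first coordinate is not zero and the second one is
not a point of order two is zero. -/
theorem form_eq_zero (h : IsWpCurve C i j k r s κ) (hω : ω ∈ holomorphicForms C)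
    (h0 : ∀ x ∈ C, x i ≠ 0 → x j + x j ≠ 0 → ∀ v ∈ tangentVectors C x, ω x v = 0) : ω = 0 := by
  refine holomorphicForms_ext hω (Submodule.zero_mem _) fun x v hv => ?_
  change ω x v = 0
  by_cases hv0 : v = 0
  · have := hω.2.2.1 x v hv 0
    rw [zero_smul, zero_mul] at this
    rw [hv0, this]
  obtain ⟨γ, hγ, rfl, rfl⟩ := hv
  have hai : ContinuousAt (fun t => γ t i) 0 := (analyticAt_pi_iff.mp hγ.1 i).continuousAt
  have haj : ContinuousAt (fun t => γ t j) 0 := (analyticAt_pi_iff.mp hγ.1 j).continuousAt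
  have hi := h.eventually_ne hγ hv0
  have hj := h.symm.eventually_ne hγ hv0
  have h1 : ∀ᶠ t in 𝓝[≠] (0 : ℂ), ω (proj τ (γ t)) (deriv γ t) = 0 := by
    have k1 := eventually_add_self_ne_zero (τ := τ j) (γ 0 j)
    have k2 := eventually_notMem_lattice' (L := periods (τ i)) (γ 0 i)
    rw [eventually_nhdsWithin_iff] at k1 k2
    filter_upwards [hi, hj, (haj.eventually k1).filter_mono nhdsWithin_le_nhds,
      (hai.eventually k2).filter_mono nhdsWithin_le_nhds, hγ.2.filter_mono nhdsWithin_le_nhds,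
      hγ.eventually_shift.filter_mono nhdsWithin_le_nhds] with t e1 e2 e3 e4 e5 e6
    exact h0 _ e5 (fun e => e4 e1 (cls_eq_zero_iff.mp e)) (e3 e2) _ e6
  exact eq_of_eventuallyEq_nhdsNE (f := fun t => ω (proj τ (γ t)) (deriv γ t)) (g := fun _ => 0)
    (hω.2.2.2 γ hγ).continuousAt continuousAt_const h1

/-- The form on a curve `(℘(x) - r)(℘(y) - s) = κ` with coefficients `c`, namely
`c₀ dx + c₁ dy + (c₂ + c₃ Q + c₄ Q²) dx / Q'` with `Q = ℘(y) - s`; at the zeros of `Q'` the last term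
is rewritten by means of `P' Q dx + P Q' dy = 0`, where `P = ℘(x) - r`. -/
def form (τ : Fin 3 → UpperHalfPlane) (i j : Fin 3) (r s κ : ℂ) (c : Fin 5 → ℂ) (x : T τ)
    (v : Fin 3 → ℂ) : ℂ :=
  open Classical in
  c 0 * v i + c 1 * v j + if x j + x j ≠ 0 then
    v i * ((c 2 + c 3 * (wp (τ j) (x j) - s) + c 4 * (wp (τ j) (x j) - s) ^ 2) / wp' (τ j) (x j))
  else -(v j * ((c 2 * (wp (τ i) (x i) - r) ^ 2 / κ + c 3 * (wp (τ i) (x i) - r) + c 4 * κ) /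
    wp' (τ i) (x i)))

theorem form_of_ne {c : Fin 5 → ℂ} {x : T τ} (hj : x j + x j ≠ 0) (v : Fin 3 → ℂ) :
    form τ i j r s κ c x v = c 0 * v i + c 1 * v j + v i * ((c 2 + c 3 * (wp (τ j) (x j) - s) +
      c 4 * (wp (τ j) (x j) - s) ^ 2) / wp' (τ j) (x j)) := by
  rw [form, if_pos hj]

theorem form_of_eq {c : Fin 5 → ℂ} {x : T τ} (hj : x j + x j = 0) (v : Fin 3 → ℂ) :
    form τ i j r s κ c x v = c 0 * v i + c 1 * v j +
      -(v j * ((c 2 * (wp (τ i) (x i) - r) ^ 2 / κ + c 3 * (wp (τ i) (x i) - r) + c 4 * κ) /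
        wp' (τ i) (x i))) := by
  rw [form, if_neg (not_not.mpr hj)]

/-- The forms are holomorphic: one of the two expressions in the definition of `form` is holomorphic
near each point, because `P'` and `Q'` do not vanish simultaneously. -/
theorem form_mem (h : IsWpCurve C i j k r s κ) (c : Fin 5 → ℂ) :
    formOf C (form τ i j r s κ c) ∈ holomorphicForms C := by
  refine formOf_mem h.sub (fun x v w => ?_) (fun x a v => ?_) fun γ hγ => ?_
  · simp only [form, Pi.add_apply]
    split_ifs <;> ring
  · simp only [form, Pi.smul_apply, smul_eq_mul]
    split_ifs <;> ring
  · have hd : ∀ l, AnalyticAt ℂ (fun t => deriv γ t l) 0 := analyticAt_pi_iff.mp hγ.1.deriv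
    have ha : ∀ l, AnalyticAt ℂ (fun t => γ t l) 0 := analyticAt_pi_iff.mp hγ.1
    have hcl : ∀ l, ContinuousAt (fun t => cls (τ l) (γ t l)) 0 := fun l =>
      continuous_cls.continuousAt.comp (ha l).continuousAt
    have hP : ∀ l, cls (τ l) (γ 0 l) ≠ 0 →
        AnalyticAt ℂ (fun t => wp (τ l) (cls (τ l) (γ t l))) 0 ∧
        AnalyticAt ℂ (fun t => wp' (τ l) (cls (τ l) (γ t l))) 0 := fun l hl => by
      have hl' : γ 0 l ∉ (periods (τ l)).lattice := fun e => hl (cls_eq_zero_iff.mpr e)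
      exact ⟨AnalyticAt.fun_comp (f := fun t => γ t l) (analyticAt_weierstrassP hl') (ha l),
        AnalyticAt.fun_comp (f := fun t => γ t l) (analyticAt_derivWeierstrassP hl') (ha l)⟩
    have hne : ∀ l, cls (τ l) (γ 0 l) + cls (τ l) (γ 0 l) ≠ 0 →
        cls (τ l) (γ 0 l) ≠ 0 ∧ wp' (τ l) (cls (τ l) (γ 0 l)) ≠ 0 ∧
        ∀ᶠ t in 𝓝 (0 : ℂ), cls (τ l) (γ t l) + cls (τ l) (γ t l) ≠ 0 := fun l hl =>
      ⟨fun e => hl (by rw [e, add_zero]), fun e => hl (wp'_eq_zero_iff.mp e),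
        ((hcl l).add (hcl l)).eventually_ne hl⟩
    by_cases hj : cls (τ j) (γ 0 j) + cls (τ j) (γ 0 j) = 0
    · have hi : cls (τ i) (γ 0 i) + cls (τ i) (γ 0 i) ≠ 0 := fun e =>
        h.noncrit _ hγ.2.self_of_nhds e hj
      obtain ⟨n1, n2, n3⟩ := hne i hi
      obtain ⟨p1, p2⟩ := hP i n1
      have han : AnalyticAt ℂ (fun t => c 0 * deriv γ t i + c 1 * deriv γ t j +
          -(deriv γ t j * ((c 2 * (wp (τ i) (cls (τ i) (γ t i)) - r) ^ 2 / κ +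
            c 3 * (wp (τ i) (cls (τ i) (γ t i)) - r) + c 4 * κ) /
            wp' (τ i) (cls (τ i) (γ t i))))) 0 := by
        refine ((analyticAt_const.mul (hd i)).add (analyticAt_const.mul (hd j))).add
          ((hd j).mul (AnalyticAt.div ?_ p2 n2)).neg
        exact (((analyticAt_const.mul ((p1.sub analyticAt_const).pow 2)).div analyticAt_const
          h.hκ).add (analyticAt_const.mul (p1.sub analyticAt_const))).add analyticAt_const
      refine han.congr ?_
      filter_upwards [n3, hγ.eventually_shift] with t e1 e2
      by_cases hc : cls (τ j) (γ t j) + cls (τ j) (γ t j) ≠ 0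
      · rw [form_of_ne hc]
        simp only [proj_apply]
        -- both expressions of the form agree by the differential of the equation of the curve
        have hx0 : cls (τ i) (γ t i) ≠ 0 := fun e => e1 (by rw [e, add_zero])
        have hy0 : cls (τ j) (γ t j) ≠ 0 := fun e => hc (by rw [e, add_zero])
        have t1 := h.tangent_relation e2 hx0 hy0
        have t2 := (h.wpRel (mem_of_mem_tangentVectors e2)).mul_eq hx0 hy0
        simp only [proj_apply] at t1 t2
        have hp : wp' (τ i) (cls (τ i) (γ t i)) ≠ 0 := fun e => e1 (wp'_eq_zero_iff.mp e)
        have hq : wp' (τ j) (cls (τ j) (γ t j)) ≠ 0 := fun e => hc (wp'_eq_zero_iff.mp e)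
        generalize wp' (τ i) (cls (τ i) (γ t i)) = P' at *
        generalize wp' (τ j) (cls (τ j) (γ t j)) = Q' at *
        generalize wp (τ i) (cls (τ i) (γ t i)) - r = P at *
        generalize wp (τ j) (cls (τ j) (γ t j)) - s = Q at *
        generalize deriv γ t i = vi at *
        generalize deriv γ t j = vj at *
        have hκ := h.hκ
        rw [← t2] at hκ ⊢
        have hPn : P ≠ 0 := left_ne_zero_of_mul hκ
        have hQn : Q ≠ 0 := right_ne_zero_of_mul hκ
        have hvj : vj = -(P' * vi * Q) / (P * Q') := by
          field_simp
          linear_combination t1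
        rw [hvj]
        field_simp
      · rw [form_of_eq (not_not.mp hc)]
        rfl
    · obtain ⟨n1, n2, n3⟩ := hne j hj
      obtain ⟨p1, p2⟩ := hP j n1
      have han : AnalyticAt ℂ (fun t => c 0 * deriv γ t i + c 1 * deriv γ t j +
          deriv γ t i * ((c 2 + c 3 * (wp (τ j) (cls (τ j) (γ t j)) - s) +
            c 4 * (wp (τ j) (cls (τ j) (γ t j)) - s) ^ 2) / wp' (τ j) (cls (τ j) (γ t j)))) 0 := by
        refine ((analyticAt_const.mul (hd i)).add (analyticAt_const.mul (hd j))).add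
          ((hd i).mul (AnalyticAt.div ?_ p2 n2))
        exact (analyticAt_const.add (analyticAt_const.mul (p1.sub analyticAt_const))).add
          (analyticAt_const.mul ((p1.sub analyticAt_const).pow 2))
      refine han.congr ?_
      filter_upwards [n3] with t e1
      rw [form_of_ne e1]
      rfl

/-- The linear map sending coefficients to holomorphic forms. -/
def formMap (h : IsWpCurve C i j k r s κ) : (Fin 5 → ℂ) →ₗ[ℂ] holomorphicForms C where
  toFun c := ⟨formOf C (form τ i j r s κ c), h.form_mem c⟩
  map_add' c c' := by
    refine Subtype.ext (funext fun x => funext fun v => ?_)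
    change formOf C _ x v = formOf C _ x v + formOf C _ x v
    simp only [formOf, form, Pi.add_apply]
    split_ifs <;> ring
  map_smul' a c := by
    refine Subtype.ext (funext fun x => funext fun v => ?_)
    change formOf C _ x v = a * formOf C _ x v
    simp only [formOf, form, Pi.smul_apply, smul_eq_mul]
    split_ifs <;> ring

/-- The curve has a tangent vector with `i`-th coordinate one where it is unramified over the first
factor. -/
theorem exists_tangent_one (h : IsWpCurve C i j k r s κ) {x : T τ} (hx : x ∈ C)
    (hj : x j + x j ≠ 0) : ∃ v ∈ tangentVectors C x, v i = 1 := by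
  obtain ⟨v, hv, hv0⟩ := (h.sub _ hx).tangentVectors_line.1
  have hvi : v i ≠ 0 := fun hvi => hv0 (h.tan_left _ hx v hv hvi hj)
  refine ⟨(v i)⁻¹ • v, (h.sub _ hx).add_smul_mem.2 v hv _, ?_⟩
  simp [hvi]

/-- The points of the curve correspond to the pairs in the relation `WpRel`. -/
theorem exists_mem (h : IsWpCurve C i j k r s κ) :
    (∀ (x : E (τ i)) (y : E (τ j)), WpRel r s κ x y → ∃ p ∈ C, p i = x ∧ p j = y) ∧
    ∀ p ∈ C, ∀ q ∈ C, p i = q i → p j = q j → p = q := by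
  obtain ⟨a, ha⟩ := h.mem_iff
  refine ⟨fun x y hxy => ?_, fun p hp q hq e1 e2 => ?_⟩
  · refine ⟨Function.update (Function.update (Function.update 0 i x) j y) k a, ?_, ?_, ?_⟩
    · rw [ha]
      simp [h.hik, h.hjk, h.hij, hxy]
    · simp [h.hik, h.hij]
    · simp [h.hjk]
  · ext l
    rcases eq_or_eq_or_eq_of_ne h.hij h.hik h.hjk l with rfl | rfl | rfl
    · exact e1
    · exact e2
    · rw [((ha p).mp hp).1, ((ha q).mp hq).1]

/-- The five forms are linearly independent. The values of a vanishing combination at the four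
points `(± x, ± y)` give `c₀ = c₁ = 0` and `c₂ + c₃ Q + c₄ Q² = 0`, and this polynomial in `Q` has
infinitely many roots. -/
theorem formMap_injective (h : IsWpCurve C i j k r s κ) : Function.Injective h.formMap := by
  refine (injective_iff_map_eq_zero _).mpr fun c hc => ?_
  obtain ⟨hex, -⟩ := h.exists_mem
  have hval : ∀ x, ∀ v ∈ tangentVectors C x, form τ i j r s κ c x v = 0 := fun x v hv => by
    rw [← formOf_of_mem (φ := form τ i j r s κ c) hv]
    exact congrFun (congrFun (congrArg Subtype.val hc) x) v
  -- the values at the four points `(± x, ± y)` of the curve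
  have key : ∀ (x : E (τ i)) (y : E (τ j)), x + x ≠ 0 → y + y ≠ 0 → WpRel r s κ x y →
      c 0 = 0 ∧ c 1 = 0 ∧
        c 2 + c 3 * (wp (τ j) y - s) + c 4 * (wp (τ j) y - s) ^ 2 = 0 := by
    have step : ∀ (x : E (τ i)) (y : E (τ j)), x + x ≠ 0 → y + y ≠ 0 → WpRel r s κ x y →
        c 0 * (wp (τ i) x - r) * wp' (τ j) y - c 1 * wp' (τ i) x * (wp (τ j) y - s) +
        (wp (τ i) x - r) * (c 2 + c 3 * (wp (τ j) y - s) + c 4 * (wp (τ j) y - s) ^ 2) = 0 := by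
      intro x y hx hy hxy
      obtain ⟨p, hp, rfl, rfl⟩ := hex x y hxy
      obtain ⟨v, hv, hvi⟩ := h.exists_tangent_one hp hy
      have hx0 : p i ≠ 0 := fun e => hx (by rw [e, add_zero])
      have hy0 : p j ≠ 0 := fun e => hy (by rw [e, add_zero])
      have t1 := h.tangent_relation hv hx0 hy0
      have t2 := hval p v hv
      have hq : wp' (τ j) (p j) ≠ 0 := fun e => hy (wp'_eq_zero_iff.mp e)
      rw [form_of_ne hy, hvi] at t2
      rw [hvi] at t1
      field_simp at t2
      linear_combination (wp (τ i) (p i) - r) * t2 - c 1 * t1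
    intro x y hx hy hxy
    have hx0 : x ≠ 0 := fun e => hx (by rw [e, add_zero])
    have hy0 : y ≠ 0 := fun e => hy (by rw [e, add_zero])
    have hx' : -x + -x ≠ 0 := fun e => hx (by rw [← neg_add] at e; exact neg_eq_zero.mp e)
    have hy' : -y + -y ≠ 0 := fun e => hy (by rw [← neg_add] at e; exact neg_eq_zero.mp e)
    have s1 := step x y hx hy hxy
    have s2 := step x (-y) hx hy' hxy.neg_right
    have s3 := step (-x) y hx' hy hxy.symm.neg_right.symm
    simp only [wp_neg, wp'_neg] at s2 s3
    have hκ := h.hκ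
    rw [← hxy.mul_eq hx0 hy0] at hκ
    have hPn := left_ne_zero_of_mul hκ
    have hQn := right_ne_zero_of_mul hκ
    have hp : wp' (τ i) x ≠ 0 := fun e => hx (wp'_eq_zero_iff.mp e)
    have hq : wp' (τ j) y ≠ 0 := fun e => hy (wp'_eq_zero_iff.mp e)
    have c0 : c 0 * ((wp (τ i) x - r) * wp' (τ j) y) = 0 := by linear_combination (s1 - s2) / 2
    have c1 : c 1 * (wp' (τ i) x * (wp (τ j) y - s)) = 0 := by linear_combination (s3 - s1) / 2
    refine ⟨(mul_eq_zero.mp c0).resolve_right (mul_ne_zero hPn hq),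
      (mul_eq_zero.mp c1).resolve_right (mul_ne_zero hp hQn), ?_⟩
    refine (mul_eq_zero.mp (?_ : (wp (τ i) x - r) * _ = 0)).resolve_left hPn
    linear_combination s1 - c0 + c1
  -- the finitely many values of `Q` at which one of the two coordinates is `0` or of order two
  have hfin : ∀ l, {x : E (τ l) | x + x = 0}.Finite := fun l =>
    Set.finite_of_encard_eq_coe encard_two_torsion
  have hbad : ({0} ∪ (fun y => wp (τ j) y - s) '' {y | y + y = 0} ∪
      (fun x => κ / (wp (τ i) x - r)) '' {x | x + x = 0}).Finite :=
    ((Set.finite_singleton _).union ((hfin j).image _)).union ((hfin i).image _)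
  have hq : ∀ q ∉ ({0} ∪ (fun y => wp (τ j) y - s) '' {y | y + y = 0} ∪
      (fun x => κ / (wp (τ i) x - r)) '' {x | x + x = 0} : Set ℂ),
      c 0 = 0 ∧ c 1 = 0 ∧ c 2 + c 3 * q + c 4 * q ^ 2 = 0 := by
    intro q hq
    simp only [Set.mem_union, Set.mem_singleton_iff, Set.mem_image, Set.mem_ofPred_eq, not_or,
      not_exists, not_and] at hq
    obtain ⟨⟨hq0, hq1⟩, hq2⟩ := hq
    obtain ⟨y, hy, hyq⟩ := exists_wp_eq (τ := τ j) (q + s)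
    obtain ⟨x, hx, hxq⟩ := exists_wp_eq (τ := τ i) (κ / q + r)
    have e1 : wp (τ j) y - s = q := by rw [hyq]; ring
    have e2 : wp (τ i) x - r = κ / q := by rw [hxq]; ring
    have := key x y (fun e => hq2 x e (by rw [e2]; field_simp [h.hκ]))
      (fun e => hq1 y e e1) (Or.inr (Or.inr ⟨hx, hy, by rw [e1, e2]; field_simp⟩))
    rwa [e1] at this
  have hinf : (({0} ∪ (fun y => wp (τ j) y - s) '' {y | y + y = 0} ∪
      (fun x => κ / (wp (τ i) x - r)) '' {x | x + x = 0} : Set ℂ)ᶜ).Infinite :=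
    hbad.infinite_compl
  set p : Polynomial ℂ := Polynomial.C (c 2) + Polynomial.C (c 3) * Polynomial.X +
    Polynomial.C (c 4) * Polynomial.X ^ 2 with hp
  have hp0 : p = 0 := by
    refine Polynomial.eq_zero_of_infinite_isRoot p (hinf.mono fun q hq' => ?_)
    have := (hq q hq').2.2
    simpa [hp] using this
  obtain ⟨q, hq'⟩ := hinf.nonempty
  have e2 : c 2 = 0 := by simpa [hp] using congrArg (fun p => p.coeff 0) hp0
  have e3 : c 3 = 0 := by
    simpa [hp, Polynomial.coeff_X, Polynomial.coeff_C] using congrArg (fun p => p.coeff 1) hp0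
  have e4 : c 4 = 0 := by
    simpa [hp, Polynomial.coeff_X, Polynomial.coeff_C] using congrArg (fun p => p.coeff 2) hp0
  ext l
  fin_cases l
  · exact (hq q hq').1
  · exact (hq q hq').2.1
  · exact e2
  · exact e3
  · exact e4

end IsWpCurve

end Burniat

end

/-! ### The genus of the curves `(℘ - r)(℘ - s) = κ` -/

noncomputable section

namespace Burniat

open Filter

variable {τ : Fin 3 → UpperHalfPlane}

open Classical in
/-- The value of a form on the tangent vector with `i`-th coordinate one. -/
def coeff (C : Set (T τ)) (i : Fin 3) (ω : T τ → (Fin 3 → ℂ) → ℂ) (x : T τ) : ℂ :=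
  if h : ∃ v ∈ tangentVectors C x, v i = 1 then ω x h.choose else 0

theorem coeff_eq {C : Set (T τ)} {i : Fin 3} {ω : T τ → (Fin 3 → ℂ) → ℂ}
    (hC : ∀ x ∈ C, IsSubmanifoldAt 2 C x) (hω : ω ∈ holomorphicForms C) {x : T τ} {v : Fin 3 → ℂ}
    (hv : v ∈ tangentVectors C x) (hvi : v i ≠ 0) : ω x v = v i * coeff C i ω x := by
  have hsub := hC x (mem_of_mem_tangentVectors hv)
  have hex : ∃ v ∈ tangentVectors C x, v i = 1 :=
    ⟨(v i)⁻¹ • v, hsub.add_smul_mem.2 v hv _, by simp [hvi]⟩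
  rw [coeff, dif_pos hex]
  obtain ⟨h1, h2⟩ := hex.choose_spec
  obtain ⟨c, hc⟩ := hsub.tangentVectors_line.2 _ h1 (fun h => by rw [h] at h2; simp at h2) v hv
  have hci : v i = c := by
    have := congrFun hc i
    rw [Pi.smul_apply, h2, smul_eq_mul, mul_one] at this
    exact this
  rw [hci]
  conv_lhs => rw [hc]
  exact hω.2.2.1 x _ h1 c

/-- A difference quotient at a zero. -/
theorem tendsto_div_sub {f : ℂ → ℂ} {a f' : ℂ} (hf : HasDerivAt f f' a) (h0 : f a = 0) :
    Tendsto (fun u => f u / (u - a)) (𝓝[≠] a) (𝓝 f') := by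
  refine (hasDerivAt_iff_tendsto_slope.mp hf).congr fun u => ?_
  rw [slope_def_field, h0, sub_zero]

namespace IsWpCurve

variable {C : Set (T τ)} {i j k : Fin 3} {r s κ : ℂ} {ω : T τ → (Fin 3 → ℂ) → ℂ}

/-- The two branches of the curve over a neighbourhood of a point over which it is unramified. -/
theorem exists_branches (h : IsWpCurve C i j k r s κ) (hω : ω ∈ holomorphicForms C)
    {z₀ : Fin 3 → ℂ} (hz : proj τ z₀ ∈ C) (hj : cls (τ j) (z₀ j) + cls (τ j) (z₀ j) ≠ 0) :
    ∃ Y h₁ h₂ : ℂ → ℂ, AnalyticAt ℂ Y (z₀ i) ∧ AnalyticAt ℂ h₁ (z₀ i) ∧ AnalyticAt ℂ h₂ (z₀ i) ∧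
      Y (z₀ i) = z₀ j ∧ ∀ᶠ t in 𝓝 (z₀ i), WpRel r s κ (cls (τ i) t) (cls (τ j) (Y t)) ∧
        ∀ p ∈ C, p i = cls (τ i) t → (p j = cls (τ j) (Y t) → coeff C i ω p = h₁ t) ∧
          (p j = -cls (τ j) (Y t) → coeff C i ω p = h₂ t) := by
  obtain ⟨hex, huniq⟩ := h.exists_mem
  obtain ⟨Γ, hΓ, hΓ0, hΓi, hΓC⟩ := h.exists_arc_left hz hj
  -- one branch is a graph, the other one is its image under `y ↦ -y`
  set Γ' : ℂ → Fin 3 → ℂ := fun t => Function.update (Γ t) j (-Γ t j) with hΓ'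
  have hcomp : ∀ l, AnalyticAt ℂ (fun t => Γ t l) (z₀ i) := analyticAt_pi_iff.mp hΓ
  have hΓ'an : AnalyticAt ℂ Γ' (z₀ i) := by
    refine AnalyticAt.pi fun l => ?_
    by_cases hl : l = j
    · subst hl
      simp only [Function.update_self]
      exact (hcomp l).neg
    · simp only [Function.update_of_ne hl]
      exact hcomp l
  obtain ⟨a, ha⟩ := h.mem_iff
  have hΓ'C : ∀ᶠ t in 𝓝 (z₀ i), proj τ (Γ' t) ∈ C := hΓC.mono fun t ht => by
    rw [ha] at ht ⊢
    simpa [proj_apply, hΓ', h.hjk.symm, h.hij, cls_neg] using And.intro ht.1 ht.2.neg_right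
  have hΓ'i : ∀ᶠ t in 𝓝 (z₀ i), Γ' t i = t := hΓi.mono fun t ht => by
    simpa [hΓ', h.hij] using ht
  have main : ∀ {Δ : ℂ → Fin 3 → ℂ}, AnalyticAt ℂ Δ (z₀ i) →
      (∀ᶠ t in 𝓝 (z₀ i), proj τ (Δ t) ∈ C) → (∀ᶠ t in 𝓝 (z₀ i), Δ t i = t) →
      AnalyticAt ℂ (fun t => ω (proj τ (Δ t)) (deriv Δ t)) (z₀ i) ∧
      ∀ᶠ t in 𝓝 (z₀ i), coeff C i ω (proj τ (Δ t)) = ω (proj τ (Δ t)) (deriv Δ t) := by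
    intro Δ h1 h2 h3
    obtain ⟨h4, h5⟩ := analyticAt_form_along hω h1 h2
    refine ⟨h4, ?_⟩
    filter_upwards [h5, h3.eventually_nhds, h1.eventually_analyticAt] with t e1 e2 e3
    have e4 : deriv Δ t i = 1 := by
      have e5 := hasDerivAt_pi.mp e3.differentiableAt.hasDerivAt i
      exact e5.unique ((hasDerivAt_id t).congr_of_eventuallyEq e2)
    rw [coeff_eq h.sub hω e1 (by rw [e4]; exact one_ne_zero), e4, one_mul]
  obtain ⟨m1, m2⟩ := main hΓ hΓC hΓi
  obtain ⟨m1', m2'⟩ := main hΓ'an hΓ'C hΓ'i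
  refine ⟨fun t => Γ t j, _, _, hcomp j, m1, m1', congrFun hΓ0 j, ?_⟩
  filter_upwards [hΓi, hΓC, m2, hΓ'i, hΓ'C, m2'] with t e1 e2 e3 e1' e2' e3'
  refine ⟨?_, fun p hp hpi => ⟨fun hpj => ?_, fun hpj => ?_⟩⟩
  · have := h.wpRel e2
    simpa only [proj_apply, e1] using this
  · rw [huniq p hp _ e2 (by rw [hpi, proj_apply, e1]) (by rw [hpj, proj_apply]), e3]
  · rw [huniq p hp _ e2' (by rw [hpi, proj_apply, e1'])
      (by rw [hpj, proj_apply, hΓ']; simp [cls_neg]), e3']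

/-- The curve near a branch point `z₀` of the projection to the first factor. Here `u` is the second
coordinate, `X u` the first one, and `η` a holomorphic form in the coordinate `u`. -/
theorem exists_ramified_branch (h : IsWpCurve C i j k r s κ) (hω : ω ∈ holomorphicForms C)
    {z₀ : Fin 3 → ℂ} (hz : proj τ z₀ ∈ C) (hj : cls (τ j) (z₀ j) + cls (τ j) (z₀ j) = 0) :
    ∃ X η : ℂ → ℂ, AnalyticAt ℂ X (z₀ j) ∧ AnalyticAt ℂ η (z₀ j) ∧ X (z₀ j) = z₀ i ∧
      ∀ᶠ u in 𝓝[≠] z₀ j, X u ≠ X (z₀ j) ∧ cls (τ j) u + cls (τ j) u ≠ 0 ∧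
        cls (τ i) (X u) ≠ 0 ∧ deriv X u ≠ 0 ∧
        WpRel r s κ (cls (τ i) (X u)) (cls (τ j) u) ∧
        wp' (τ i) (cls (τ i) (X u)) * deriv X u * (wp (τ j) (cls (τ j) u) - s) +
          (wp (τ i) (cls (τ i) (X u)) - r) * wp' (τ j) (cls (τ j) u) = 0 ∧
        ∀ p ∈ C, p i = cls (τ i) (X u) → (p j = cls (τ j) u → coeff C i ω p = η u / deriv X u) ∧
          (p j = -cls (τ j) u → coeff C i ω p = -(η (z₀ j + z₀ j - u) / deriv X u)) := by
  obtain ⟨hex, huniq⟩ := h.exists_mem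
  have hi : cls (τ i) (z₀ i) + cls (τ i) (z₀ i) ≠ 0 := fun e => h.noncrit _ hz e hj
  obtain ⟨Γ, hΓ, hΓ0, hΓj, hΓC⟩ := h.symm.exists_arc_left hz hi
  set w₀ := z₀ j with hw₀
  have hcomp : ∀ l, AnalyticAt ℂ (fun t => Γ t l) w₀ := analyticAt_pi_iff.mp hΓ
  obtain ⟨hη, htan⟩ := analyticAt_form_along hω hΓ hΓC
  set X : ℂ → ℂ := fun t => Γ t i with hX
  set η : ℂ → ℂ := fun t => ω (proj τ (Γ t)) (deriv Γ t) with hηdef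
  have hXan : AnalyticAt ℂ X w₀ := hcomp i
  have hX0 : X w₀ = z₀ i := by rw [hX]; simp only [hΓ0]
  have hclsX : ContinuousAt (fun u => cls (τ i) (X u)) w₀ :=
    continuous_cls.continuousAt.comp hXan.continuousAt
  have href : Tendsto (fun u : ℂ => w₀ + w₀ - u) (𝓝 w₀) (𝓝 w₀) := by
    have : ContinuousAt (fun u : ℂ => w₀ + w₀ - u) w₀ := by fun_prop
    simpa using this.tendsto
  -- the reflection at the branch point exchanges the two points of the fibre
  have hneg : ∀ u, cls (τ j) (w₀ + w₀ - u) = -cls (τ j) u := fun u => by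
    rw [cls_sub, cls_add, hj, zero_sub]
  have hrel : ∀ᶠ u in 𝓝 w₀, WpRel r s κ (cls (τ i) (X u)) (cls (τ j) u) := by
    filter_upwards [hΓC, hΓj] with u e1 e2
    have := h.wpRel e1
    simpa only [proj_apply, e2] using this
  -- the fibres over the second factor are pairs `± x`, and the sign is determined by continuity
  have heven : ∀ᶠ u in 𝓝 w₀, X (w₀ + w₀ - u) = X u := by
    have hsum : ∀ᶠ u in 𝓝 w₀, cls (τ i) (X (w₀ + w₀ - u)) + cls (τ i) (X u) ≠ 0 := by
      have hc : Tendsto (fun u => cls (τ i) (X (w₀ + w₀ - u)) + cls (τ i) (X u)) (𝓝 w₀)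
          (𝓝 (cls (τ i) (X w₀) + cls (τ i) (X w₀))) := (hclsX.tendsto.comp href).add hclsX.tendsto
      rw [hX0] at hc
      exact hc.eventually_ne hi
    have hdiff : ∀ᶠ u in 𝓝 w₀, cls (τ i) (X (w₀ + w₀ - u) - X u) = cls (τ i) 0 →
        X (w₀ + w₀ - u) - X u = 0 := by
      have hc : Tendsto (fun u => X (w₀ + w₀ - u) - X u) (𝓝 w₀) (𝓝 0) := by
        have := (hXan.continuousAt.tendsto.comp href).sub hXan.continuousAt.tendsto
        rwa [sub_self] at this
      exact (hc.eventually (eventually_cls_eq_iff (τ := τ i) 0)).mono fun u hu => hu.mp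
    filter_upwards [hrel, href.eventually hrel, hsum, hdiff] with u e1 e2 e3 e4
    rw [hneg] at e2
    have e5 := e2.neg_right
    rw [neg_neg] at e5
    rcases e1.symm.eq_or_eq_neg h.hκ e5.symm with e6 | e6
    · refine sub_eq_zero.mp (e4 ?_)
      rw [cls_sub, e6, sub_self]
      exact (cls_eq_zero_iff.mpr (zero_mem _)).symm
    · rw [e6, neg_add_cancel] at e3
      exact absurd rfl e3
  have hodd : ∀ᶠ u in 𝓝 w₀, deriv X (w₀ + w₀ - u) = -deriv X u := by
    filter_upwards [heven.eventually_nhds] with u hu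
    have h1 : deriv (fun u => X (w₀ + w₀ - u)) u = deriv X u := EventuallyEq.deriv_eq hu
    rw [deriv_comp_const_sub] at h1
    rw [← h1, neg_neg]
  have hgood : ∀ᶠ u in 𝓝[≠] w₀, cls (τ j) u + cls (τ j) u ≠ 0 := eventually_add_self_ne_zero w₀
  have hXd : ∀ᶠ u in 𝓝 w₀, deriv Γ u i = deriv X u := hΓ.eventually_analyticAt.mono fun u hu =>
    (hasDerivAt_pi.mp hu.differentiableAt.hasDerivAt i).deriv.symm
  have hjd : ∀ᶠ u in 𝓝 w₀, deriv Γ u j = 1 := by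
    filter_upwards [hΓj.eventually_nhds, hΓ.eventually_analyticAt] with u e1 e2
    exact (hasDerivAt_pi.mp e2.differentiableAt.hasDerivAt j).unique
      ((hasDerivAt_id u).congr_of_eventuallyEq e1)
  have hXne : ∀ᶠ u in 𝓝[≠] w₀, deriv X u ≠ 0 := by
    filter_upwards [hgood, hXd.filter_mono nhdsWithin_le_nhds,
      hjd.filter_mono nhdsWithin_le_nhds, htan.filter_mono nhdsWithin_le_nhds,
      hΓj.filter_mono nhdsWithin_le_nhds] with u e1 e2 e3 e4 e5 e6
    have := h.tan_left _ (mem_of_mem_tangentVectors e4) _ e4 (by rw [e2, e6])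
      (by rw [proj_apply, e5]; exact e1)
    rw [this] at e3
    exact zero_ne_one e3
  have hXnc : ∀ᶠ u in 𝓝[≠] w₀, X u ≠ X w₀ := by
    refine (hXan.eventually_eq_or_eventually_ne analyticAt_const).resolve_left fun hc => ?_
    have h1 : ∀ᶠ u in 𝓝 w₀, deriv X u = 0 := by
      filter_upwards [hc.eventually_nhds] with u hu
      exact ((hasDerivAt_const u (X w₀)).congr_of_eventuallyEq hu).deriv
    obtain ⟨u, e1, e2⟩ := ((h1.filter_mono nhdsWithin_le_nhds).and hXne).exists
    exact e2 e1
  have hXnz : ∀ᶠ u in 𝓝 w₀, cls (τ i) (X u) ≠ 0 := by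
    refine hclsX.eventually_ne ?_
    rw [hX0]
    exact fun e => hi (by rw [e, add_zero])
  have hval : ∀ᶠ u in 𝓝[≠] w₀, coeff C i ω (proj τ (Γ u)) = η u / deriv X u := by
    filter_upwards [hXne, hXd.filter_mono nhdsWithin_le_nhds,
      htan.filter_mono nhdsWithin_le_nhds] with u e1 e2 e3
    have e4 := coeff_eq h.sub hω (i := i) e3 (by rwa [e2])
    rw [e2] at e4
    rw [eq_div_iff e1, mul_comm]
    exact e4.symm
  have href' : Tendsto (fun u : ℂ => w₀ + w₀ - u) (𝓝[≠] w₀) (𝓝[≠] w₀) := by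
    refine tendsto_nhdsWithin_iff.mpr ⟨href.mono_left nhdsWithin_le_nhds, ?_⟩
    filter_upwards [self_mem_nhdsWithin] with u hu e
    refine hu ?_
    have : w₀ + w₀ - u = w₀ := e
    change u = w₀
    linear_combination -this
  refine ⟨X, η, hXan, hη, hX0, ?_⟩
  filter_upwards [hXnc, hgood, hXnz.filter_mono nhdsWithin_le_nhds, hXne,
    hrel.filter_mono nhdsWithin_le_nhds, hΓC.filter_mono nhdsWithin_le_nhds,
    hΓj.filter_mono nhdsWithin_le_nhds, hXd.filter_mono nhdsWithin_le_nhds,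
    hjd.filter_mono nhdsWithin_le_nhds, htan.filter_mono nhdsWithin_le_nhds, hval,
    href'.eventually hval, heven.filter_mono nhdsWithin_le_nhds,
    hodd.filter_mono nhdsWithin_le_nhds,
    (href.eventually hΓC).filter_mono nhdsWithin_le_nhds,
    (href.eventually hΓj).filter_mono nhdsWithin_le_nhds]
    with u e1 e2 e3 e4 e5 e6 e7 e8 e9 e10 e11 e12 e13 e14 e15 e16
  refine ⟨e1, e2, e3, e4, e5, ?_, fun p hp hpi => ⟨fun hpj => ?_, fun hpj => ?_⟩⟩
  · have := h.tangent_relation e10 e3 (by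
      rw [proj_apply, e7]
      exact fun e => e2 (by rw [e, add_zero]))
    simpa only [proj_apply, e7, e8, e9, mul_one] using this
  · rw [huniq p hp _ e6 hpi (by rw [hpj, proj_apply, e7]), e11]
  · rw [huniq p hp _ e15 (by rw [hpi, proj_apply]; exact congrArg _ e13.symm)
      (by rw [hpj, proj_apply, e16, hneg]), e12, e14, div_neg]

end IsWpCurve

end Burniat

end

/-! ### The trace of a holomorphic form -/

noncomputable section

namespace Burniat

open Filter

variable {τ : Fin 3 → UpperHalfPlane}

namespace IsWpCurve

variable {C : Set (T τ)} {i j k : Fin 3} {r s κ : ℂ} {ω : T τ → (Fin 3 → ℂ) → ℂ}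

/-- The fibre of the curve over a point of the first factor is a conjugate pair `(x, ± y)`. -/
theorem exists_pair (h : IsWpCurve C i j k r s κ) (x : E (τ i)) :
    ∃ p q : T τ, p ∈ C ∧ q ∈ C ∧ p i = x ∧ q i = x ∧ q j = -p j := by
  obtain ⟨hex, -⟩ := h.exists_mem
  obtain ⟨y, hy⟩ := exists_wpRel (τ' := τ j) (r := r) (s := s) (κ := κ) x
  obtain ⟨p, hp, hpi, hpj⟩ := hex x y hy
  obtain ⟨q, hq, hqi, hqj⟩ := hex x (-y) hy.neg_right
  exact ⟨p, q, hp, hq, hpi, hqi, by rw [hqj, hpj]⟩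

/-- A point of the curve over `x`. -/
def pt (h : IsWpCurve C i j k r s κ) (x : E (τ i)) : T τ := (h.exists_pair x).choose

/-- The conjugate of the chosen point of the curve over `x`. -/
def pt' (h : IsWpCurve C i j k r s κ) (x : E (τ i)) : T τ := (h.exists_pair x).choose_spec.choose

theorem pt_spec (h : IsWpCurve C i j k r s κ) (x : E (τ i)) :
    h.pt x ∈ C ∧ h.pt' x ∈ C ∧ h.pt x i = x ∧ h.pt' x i = x ∧ h.pt' x j = -h.pt x j :=
  (h.exists_pair x).choose_spec.choose_spec

/-- The trace of a form under the projection to the first factor. -/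
def trace (h : IsWpCurve C i j k r s κ) (ω : T τ → (Fin 3 → ℂ) → ℂ) (z : ℂ) : ℂ :=
  coeff C i ω (h.pt (cls (τ i) z)) + coeff C i ω (h.pt' (cls (τ i) z))

/-- The difference of the values of a form at the two points over `z`, multiplied by `Q' P²`, where
`P = ℘(x) - r` and `Q = ℘(y) - s`. -/
def diffTrace (h : IsWpCurve C i j k r s κ) (ω : T τ → (Fin 3 → ℂ) → ℂ) (z : ℂ) : ℂ :=
  (coeff C i ω (h.pt (cls (τ i) z)) - coeff C i ω (h.pt' (cls (τ i) z))) *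
    wp' (τ j) (h.pt (cls (τ i) z) j) * (wp (τ i) (cls (τ i) z) - r) ^ 2

/-- The traces do not depend on the choice of a point over `z`. -/
theorem trace_eq (h : IsWpCurve C i j k r s κ) {z : ℂ} {p q : T τ} (hp : p ∈ C) (hq : q ∈ C)
    (hpi : p i = cls (τ i) z) (hqi : q i = cls (τ i) z) (hpq : q j = -p j) :
    h.trace ω z = coeff C i ω p + coeff C i ω q ∧
      h.diffTrace ω z = (coeff C i ω p - coeff C i ω q) * wp' (τ j) (p j) *
        (wp (τ i) (cls (τ i) z) - r) ^ 2 ∧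
      (h.pt (cls (τ i) z) j + h.pt (cls (τ i) z) j = 0 ↔ p j + p j = 0) := by
  obtain ⟨-, huniq⟩ := h.exists_mem
  obtain ⟨h1, h2, h3, h4, h5⟩ := h.pt_spec (cls (τ i) z)
  have r1 := h.wpRel h1
  have r2 := h.wpRel hp
  rw [h3] at r1
  rw [hpi] at r2
  rcases r1.eq_or_eq_neg h.hκ r2 with e | e
  · have e1 := huniq _ h1 _ hp (by rw [h3, hpi]) e.symm
    have e2 := huniq _ h2 _ hq (by rw [h4, hqi]) (by rw [h5, hpq, e])
    rw [trace, diffTrace, e1, e2]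
    exact ⟨rfl, rfl, Iff.rfl⟩
  · have e1 := huniq _ h1 _ hq (by rw [h3, hqi]) (by rw [hpq, e, neg_neg])
    have e2 := huniq _ h2 _ hp (by rw [h4, hpi]) (by rw [h5, e])
    rw [trace, diffTrace, e1, e2, hpq, wp'_neg, ← neg_add, neg_eq_zero]
    exact ⟨by ring, by ring, Iff.rfl⟩

theorem trace_periodic (h : IsWpCurve C i j k r s κ) (z : ℂ) {l : ℂ}
    (hl : l ∈ (periods (τ i)).lattice) :
    h.trace ω (z + l) = h.trace ω z ∧ h.diffTrace ω (z + l) = h.diffTrace ω z := by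
  have : cls (τ i) (z + l) = cls (τ i) z := by rw [cls_add, cls_eq_zero_iff.mpr hl, add_zero]
  simp only [trace, diffTrace, this, and_self]

theorem exists_lift {i : Fin 3} {x : T τ} {z : ℂ} (hx : x i = cls (τ i) z) :
    ∃ Z : Fin 3 → ℂ, proj τ Z = x ∧ Z i = z := by
  obtain ⟨Z, rfl⟩ := proj_surjective x
  refine ⟨Function.update Z i z, ?_, by simp⟩
  ext l
  by_cases hl : l = i
  · subst hl
    rw [proj_apply, Function.update_self, hx]
  · rw [proj_apply, Function.update_of_ne hl, proj_apply]

/-- Away from the branch points the traces are holomorphic, up to the poles of `P²`. -/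
theorem trace_unramified (h : IsWpCurve C i j k r s κ) (hω : ω ∈ holomorphicForms C) {z : ℂ}
    (hz : h.pt (cls (τ i) z) j + h.pt (cls (τ i) z) j ≠ 0) :
    (∀ᶠ t in 𝓝 z, h.pt (cls (τ i) t) j + h.pt (cls (τ i) t) j ≠ 0) ∧
      AnalyticAt ℂ (h.trace ω) z ∧ ∃ g, AnalyticAt ℂ g z ∧
      ∀ᶠ t in 𝓝 z, h.diffTrace ω t = g t * ((periods (τ i)).weierstrassP t - r) ^ 2 := by
  obtain ⟨hex, huniq⟩ := h.exists_mem
  obtain ⟨h1, -, h3, -, -⟩ := h.pt_spec (cls (τ i) z)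
  obtain ⟨Z, hZ, hZi⟩ := exists_lift h3
  have hZj : cls (τ j) (Z j) + cls (τ j) (Z j) ≠ 0 := by
    rw [← proj_apply, hZ]
    exact hz
  obtain ⟨Y, f, f', hY, hf, hf', hY0, hev⟩ := h.exists_branches hω (by rw [hZ]; exact h1) hZj
  rw [hZi] at hY hf hf' hY0 hev
  have hYl : Y z ∉ (periods (τ j)).lattice := by
    rw [hY0, ← cls_eq_zero_iff]
    exact fun e => hZj (by rw [e, add_zero])
  have key : ∀ᶠ t in 𝓝 z, h.trace ω t = f t + f' t ∧ h.diffTrace ω t =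
      (f t - f' t) * (periods (τ j)).derivWeierstrassP (Y t) *
        ((periods (τ i)).weierstrassP t - r) ^ 2 ∧
      (h.pt (cls (τ i) t) j + h.pt (cls (τ i) t) j = 0 ↔ cls (τ j) (Y t) + cls (τ j) (Y t) = 0) := by
    filter_upwards [hev] with t ⟨e1, e2⟩
    obtain ⟨p, hp, hpi, hpj⟩ := hex _ _ e1
    obtain ⟨q, hq, hqi, hqj⟩ := hex _ _ e1.neg_right
    obtain ⟨t1, t2, t3⟩ := h.trace_eq (ω := ω) hp hq hpi hqi (by rw [hqj, hpj])
    rw [t1, t2, t3, (e2 p hp hpi).1 hpj, (e2 q hq hqi).2 hqj, hpj, wp'_cls, wp_cls]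
    exact ⟨rfl, rfl, Iff.rfl⟩
  have hYc : ContinuousAt (fun t => cls (τ j) (Y t) + cls (τ j) (Y t)) z :=
    (continuous_cls.continuousAt.comp hY.continuousAt).add
      (continuous_cls.continuousAt.comp hY.continuousAt)
  refine ⟨?_, (hf.add hf').congr (key.mono fun t ht => ht.1.symm), _,
    (hf.sub hf').mul (AnalyticAt.fun_comp (f := Y) (analyticAt_derivWeierstrassP hYl) hY),
    key.mono fun t ht => ht.2.1⟩
  filter_upwards [key, hYc.eventually_ne (by rw [hY0]; exact hZj)] with t e1 e2
  rw [ne_eq, e1.2.2]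
  exact e2

/-- At a branch point both traces have a limit. In the coordinate `u` of the second factor, centred
at the branch point `w₀`, the trace is the quotient of the odd function `η(u) - η(2w₀ - u)` by `X'`,
which has a simple zero at `w₀`. -/
theorem trace_ramified (h : IsWpCurve C i j k r s κ) (hω : ω ∈ holomorphicForms C) {z : ℂ}
    (hz : h.pt (cls (τ i) z) j + h.pt (cls (τ i) z) j = 0) :
    (∀ᶠ t in 𝓝[≠] z, h.pt (cls (τ i) t) j + h.pt (cls (τ i) t) j ≠ 0) ∧
      (∃ c, Tendsto (h.trace ω) (𝓝[≠] z) (𝓝 c)) ∧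
      ∃ c, Tendsto (h.diffTrace ω) (𝓝[≠] z) (𝓝 c) := by
  obtain ⟨hex, huniq⟩ := h.exists_mem
  obtain ⟨h1, -, h3, -, -⟩ := h.pt_spec (cls (τ i) z)
  obtain ⟨Z, hZ, hZi⟩ := exists_lift h3
  have hZj : cls (τ j) (Z j) + cls (τ j) (Z j) = 0 := by
    rw [← proj_apply, hZ]
    exact hz
  have hZC : proj τ Z ∈ C := by rw [hZ]; exact h1
  have hi : cls (τ i) z + cls (τ i) z ≠ 0 := fun e => h.noncrit _ hZC (by
    rw [proj_apply, hZi, e]) hZj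
  have hzl : z ∉ (periods (τ i)).lattice := fun e => hi (by rw [cls_eq_zero_iff.mpr e, add_zero])
  have hPz : (periods (τ i)).derivWeierstrassP z ≠ 0 := fun e =>
    hi (wp'_eq_zero_iff.mp (by rw [wp'_cls, e]))
  obtain ⟨X, η, hX, hη, hX0, hev⟩ := h.exists_ramified_branch hω hZC hZj
  rw [hZi] at hX0
  set w₀ := Z j with hw₀
  have hκ := h.hκ
  -- the traces in the coordinate `u`
  have hfib : ∀ᶠ u in 𝓝[≠] w₀,
      h.trace ω (X u) = (η u - η (w₀ + w₀ - u)) / deriv X u ∧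
      h.diffTrace ω (X u) = -((η u + η (w₀ + w₀ - u)) * κ *
        (periods (τ i)).derivWeierstrassP (X u)) ∧
      h.pt (cls (τ i) (X u)) j + h.pt (cls (τ i) (X u)) j ≠ 0 := by
    filter_upwards [hev] with u ⟨_, e2, e3, e4, e5, e6, e7⟩
    obtain ⟨p, hp, hpi, hpj⟩ := hex _ _ e5
    obtain ⟨q, hq, hqi, hqj⟩ := hex _ _ e5.neg_right
    obtain ⟨t1, t2, t3⟩ := h.trace_eq (ω := ω) hp hq hpi hqi (by rw [hqj, hpj])
    have hy0 : cls (τ j) u ≠ 0 := fun e => e2 (by rw [e, add_zero])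
    have hm := e5.mul_eq e3 hy0
    refine ⟨?_, ?_, ?_⟩
    · rw [t1, (e7 p hp hpi).1 hpj, (e7 q hq hqi).2 hqj]
      ring
    · rw [t2, (e7 p hp hpi).1 hpj, (e7 q hq hqi).2 hqj, hpj, ← wp'_cls]
      rw [← hm]
      generalize η (w₀ + w₀ - u) = η'
      field_simp
      linear_combination (wp (τ i) (cls (τ i) (X u)) - r) * (η u + η') * e6
    · rw [ne_eq, t3, hpj]
      exact e2
  have hXnc : ∀ᶠ u in 𝓝[≠] w₀, X u ≠ X w₀ := hev.mono fun u hu => hu.1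
  have hrefl : HasDerivAt (fun u : ℂ => w₀ + w₀ - u) (-1) w₀ :=
    (hasDerivAt_id w₀).const_sub _
  have hfix : w₀ + w₀ - w₀ = w₀ := by ring
  have hη' : HasDerivAt (fun u => η (w₀ + w₀ - u)) (-deriv η w₀) w₀ := by
    have h2 : HasDerivAt η (deriv η w₀) (w₀ + w₀ - w₀) := by
      rw [hfix]; exact hη.differentiableAt.hasDerivAt
    have h3 := h2.comp w₀ hrefl
    rw [mul_neg_one] at h3
    exact h3
  have hPX : ContinuousAt (fun u => (periods (τ i)).derivWeierstrassP (X u)) w₀ := by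
    have h2 : ContinuousAt (periods (τ i)).derivWeierstrassP (X w₀) := by
      rw [hX0]; exact (analyticAt_derivWeierstrassP hzl).continuousAt
    exact h2.comp hX.continuousAt
  rw [← hX0]
  refine ⟨?_, ?_, ?_⟩
  · have := tendsto_of_tendsto_comp (f := fun t => h.pt (cls (τ i) t) j + h.pt (cls (τ i) t) j)
      (l := 𝓟 {0}ᶜ) hX hXnc (tendsto_principal.mpr (hfib.mono fun u hu => hu.2.2))
    exact tendsto_principal.mp this
  · -- the chart `1 + 1 / (℘ - s)` of the second factor
    obtain ⟨l, hl, hl0, hl2, hlev⟩ := exists_mobius_chart (τ := τ j) (a := s - 1) (b := s)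
      (by simp) (z := w₀) (by
        by_cases hy : w₀ ∈ (periods (τ j)).lattice
        · exact Or.inl hy
        · refine Or.inr fun e => hκ ?_
          have hm := (h.wpRel hZC).mul_eq (by
            rw [proj_apply, hZi]
            exact fun e => hi (by rw [e, add_zero])) (by
            rw [proj_apply, ne_eq, cls_eq_zero_iff]
            exact hy)
          rw [← hm, proj_apply, proj_apply, wp_cls (τ := τ j), ← hw₀, e, sub_self, mul_zero])
    have hl0' := hl0.mpr hZj
    have hl2' := hl2 hZj
    -- differentiate `P = κ / Q = κ (l - 1)`: like `l`, the function `X` is simply ramified at `w₀`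
    have hder : ∀ᶠ u in 𝓝[≠] w₀, deriv X u =
        κ * deriv l u / (periods (τ i)).derivWeierstrassP (X u) := by
      have hP : ∀ᶠ u in 𝓝 w₀, (periods (τ i)).derivWeierstrassP (X u) ≠ 0 :=
        hPX.eventually_ne (by rwa [hX0])
      filter_upwards [hev, hlev.eventually_nhds.filter_mono nhdsWithin_le_nhds,
        hP.filter_mono nhdsWithin_le_nhds] with u ⟨_, e2, e3, e4, e5, e6, _⟩ e8 e9
      have hy0 : cls (τ j) u ≠ 0 := fun e => e2 (by rw [e, add_zero])
      have hu : u ∉ (periods (τ j)).lattice := fun e => hy0 (cls_eq_zero_iff.mpr e)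
      have hm := e5.mul_eq e3 hy0
      simp only [wp_cls, wp'_cls] at hm e6
      have hQ := (e8.self_of_nhds.2 hu).1
      have hd : HasDerivAt l (-((periods (τ j)).derivWeierstrassP u) /
          ((periods (τ j)).weierstrassP u - s) ^ 2) u := by
        have k1 := (((hasDerivAt_weierstrassP hu).sub_const s).inv hQ).const_add 1
        refine k1.congr_of_eventuallyEq ?_
        filter_upwards [e8, eventually_notMem_lattice hu] with v k2 k3
        obtain ⟨k4, k5⟩ := k2.2 k3
        simp only [Pi.inv_apply]
        field_simp
        linear_combination -k5
      rw [hd.deriv, eq_div_iff e9]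
      have hP0 : (periods (τ i)).weierstrassP (X u) - r ≠ 0 := fun e => hκ (by
        rw [← hm, e, zero_mul])
      rw [← hm]
      field_simp
      linear_combination e6
    have t1 : Tendsto (fun u => (η u - η (w₀ + w₀ - u)) / (u - w₀)) (𝓝[≠] w₀)
        (𝓝 (deriv η w₀ - -deriv η w₀)) :=
      tendsto_div_sub (hη.differentiableAt.hasDerivAt.sub hη') (by simp [hfix])
    have t2 : Tendsto (fun u => deriv l u / (u - w₀)) (𝓝[≠] w₀) (𝓝 (deriv (deriv l) w₀)) :=
      tendsto_div_sub hl.deriv.differentiableAt.hasDerivAt hl0'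
    have t3 := hPX.tendsto.mono_left (nhdsWithin_le_nhds (s := {w₀}ᶜ))
    have t4 := (t1.mul t3).div (t2.const_mul κ) (mul_ne_zero hκ hl2')
    refine ⟨_, tendsto_of_tendsto_comp hX hXnc (t4.congr' ?_)⟩
    filter_upwards [hfib, hder, hev, self_mem_nhdsWithin] with u ⟨e1, _, _⟩ e2 ⟨_, _, _, e4, _⟩ e5
    have hu : u - w₀ ≠ 0 := sub_ne_zero.mpr e5
    rw [e2] at e4
    have n1 : (periods (τ i)).derivWeierstrassP (X u) ≠ 0 := fun e => e4 (by rw [e, div_zero])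
    have n2 : deriv l u ≠ 0 := fun e => e4 (by rw [e, mul_zero, zero_div])
    simp only [Pi.div_apply]
    rw [e1, e2]
    field_simp
  · have t1 : Tendsto (fun u => -((η u + η (w₀ + w₀ - u)) * κ *
        (periods (τ i)).derivWeierstrassP (X u))) (𝓝[≠] w₀) _ :=
      ((((hη.continuousAt.add hη'.continuousAt).mul continuousAt_const).mul
        hPX).neg.tendsto.mono_left nhdsWithin_le_nhds)
    exact ⟨_, tendsto_of_tendsto_comp hX hXnc (t1.congr' (hfib.mono fun u hu => hu.2.1.symm))⟩

/-- The trace of a holomorphic form is a holomorphic elliptic function, hence constant. Multiplied by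
`Q' P²`, its anti-invariant part becomes an elliptic function whose only poles are the lattice points,
of order at most four there because of the factor `P²`. -/
theorem exists_trace_eq (h : IsWpCurve C i j k r s κ) (hω : ω ∈ holomorphicForms C) :
    ∃ e a b c d : ℂ, ∀ z, h.pt (cls (τ i) z) j + h.pt (cls (τ i) z) j ≠ 0 →
      h.trace ω z = e ∧ (z ∉ (periods (τ i)).lattice → h.diffTrace ω z =
        a + b * (periods (τ i)).weierstrassP z + c * (periods (τ i)).weierstrassP z ^ 2 +
          d * (periods (τ i)).derivWeierstrassP z) := by
  have han : ∀ {z}, h.pt (cls (τ i) z) j + h.pt (cls (τ i) z) j ≠ 0 →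
      z ∉ (periods (τ i)).lattice → AnalyticAt ℂ (h.diffTrace ω) z := fun {z} hz hl => by
    obtain ⟨-, -, g, h2, h3⟩ := h.trace_unramified hω hz
    have h4 : AnalyticAt ℂ (fun t => g t * ((periods (τ i)).weierstrassP t - r) ^ 2) z :=
      h2.mul (((analyticAt_weierstrassP hl).sub analyticAt_const).pow 2)
    exact h4.congr (h3.mono fun u hu => hu.symm)
  have hgood : ∀ z, ∀ᶠ t in 𝓝[≠] z, h.pt (cls (τ i) t) j + h.pt (cls (τ i) t) j ≠ 0 := fun z => by
    by_cases hz : h.pt (cls (τ i) z) j + h.pt (cls (τ i) z) j = 0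
    · exact (h.trace_ramified hω hz).1
    · exact (h.trace_unramified hω hz).1.filter_mono nhdsWithin_le_nhds
  obtain ⟨e, he⟩ := periodic_eq_const (f := h.trace ω) (L := periods (τ i))
    (fun z l hl => (h.trace_periodic z hl).1)
    (fun z => (hgood z).mono fun t ht => (h.trace_unramified hω ht).2.1.differentiableAt)
    (fun z => by
      by_cases hz : h.pt (cls (τ i) z) j + h.pt (cls (τ i) z) j = 0
      · exact (h.trace_ramified hω hz).2.1
      · exact ⟨_, (h.trace_unramified hω hz).2.1.continuousAt.tendsto.mono_left
          nhdsWithin_le_nhds⟩)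
  have hP : Meromorphic (periods (τ i)).weierstrassP := (periods (τ i)).meromorphic_weierstrassP
  -- over a branch point the difference extends holomorphically
  have hram : ∀ {z}, h.pt (cls (τ i) z) j + h.pt (cls (τ i) z) j = 0 →
      ∃ g, AnalyticAt ℂ g z ∧ h.diffTrace ω =ᶠ[𝓝[≠] z] g := fun {z} hz => by
    obtain ⟨h1, -, c, hc⟩ := h.trace_ramified hω hz
    refine exists_analyticAt_of_tendsto ?_ hc
    filter_upwards [h1, eventually_notMem_lattice' (L := periods (τ i)) z] with t h2 h3
    exact (han h2 h3).differentiableAt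
  have hmer : Meromorphic (h.diffTrace ω) := fun z => by
    by_cases hz : h.pt (cls (τ i) z) j + h.pt (cls (τ i) z) j = 0
    · obtain ⟨g, h1, h2⟩ := hram hz
      exact h1.meromorphicAt.congr h2.symm
    · obtain ⟨-, -, g, h2, h3⟩ := h.trace_unramified hω hz
      have h4 : MeromorphicAt (fun t => g t * ((periods (τ i)).weierstrassP t - r) ^ 2) z :=
        h2.meromorphicAt.mul (((hP z).sub (MeromorphicAt.const r z)).pow 2)
      exact h4.congr ((h3.filter_mono nhdsWithin_le_nhds).mono fun u hu => hu.symm)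
  have h00 : cls (τ i) 0 + cls (τ i) 0 = 0 := by
    rw [cls_eq_zero_iff.mpr (zero_mem _), add_zero]
  -- the origin of the first factor is not a branch point
  have h0 : h.pt (cls (τ i) 0) j + h.pt (cls (τ i) 0) j ≠ 0 := by
    obtain ⟨h1, -, h3, -, -⟩ := h.pt_spec (cls (τ i) 0)
    exact h.noncrit _ h1 (by rw [h3, h00])
  obtain ⟨a, b, c, d, habcd⟩ := elliptic_eq (f := h.diffTrace ω) (L := periods (τ i))
    (fun z l hl => (h.trace_periodic z hl).2) hmer (fun z hl => by
      by_cases hz : h.pt (cls (τ i) z) j + h.pt (cls (τ i) z) j = 0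
      · obtain ⟨g, h1, h2⟩ := hram hz
        rw [meromorphicOrderAt_congr h2]
        exact h1.meromorphicOrderAt_nonneg
      · exact (han hz hl).meromorphicOrderAt_nonneg) (by
    obtain ⟨-, -, g, h2, h3⟩ := h.trace_unramified hω h0
    rw [meromorphicOrderAt_congr (h3.filter_mono nhdsWithin_le_nhds)]
    set q : ℂ → ℂ := fun w => 1 * (periods (τ i)).weierstrassP w + (-r) * 1 with hq
    have hqm : MeromorphicAt q 0 := ((MeromorphicAt.const 1 0).mul (hP 0)).add
      ((MeromorphicAt.const (-r) 0).mul (MeromorphicAt.const 1 0))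
    have hqo : ((-2 : ℤ) : WithTop ℤ) ≤ meromorphicOrderAt q 0 := by
      refine order_nonneg_add (hP 0) (MeromorphicAt.const 1 0) order_weierstrassP_zero.ge ?_ 1 (-r)
      refine le_trans ?_ (analyticAt_const (v := (1 : ℂ))).meromorphicOrderAt_nonneg
      exact_mod_cast (by norm_num : (-2 : ℤ) ≤ 0)
    have h5 : (fun t => g t * ((periods (τ i)).weierstrassP t - r) ^ 2) = g * (q * q) := by
      funext t
      simp only [Pi.mul_apply, hq]
      ring
    have h6 : ((-4 : ℤ) : WithTop ℤ) =
        0 + (((-2 : ℤ) : WithTop ℤ) + ((-2 : ℤ) : WithTop ℤ)) := by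
      rw [zero_add, ← WithTop.coe_add]
      norm_num
    rw [h5, meromorphicOrderAt_mul h2.meromorphicAt (hqm.mul hqm), meromorphicOrderAt_mul hqm hqm,
      h6]
    exact add_le_add h2.meromorphicOrderAt_nonneg (add_le_add hqo hqo))
  refine ⟨e, a, b, c, d, fun z hz => ⟨?_, fun hl => ?_⟩⟩
  · exact eq_of_eventuallyEq_nhdsNE (h.trace_unramified hω hz).2.1.continuousAt continuousAt_const
      (he z)
  · refine eq_of_eventuallyEq_nhdsNE (han hz hl).continuousAt ?_ (habcd z)
    have k1 := (analyticAt_weierstrassP hl).continuousAt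
    have k2 := (analyticAt_derivWeierstrassP hl).continuousAt
    fun_prop

/-- Every holomorphic form on the curve is a combination of the five given ones. -/
theorem formMap_surjective (h : IsWpCurve C i j k r s κ) : Function.Surjective h.formMap := by
  rintro ⟨ω, hω⟩
  obtain ⟨e, a, b, c, d, hmain⟩ := h.exists_trace_eq hω
  obtain ⟨hex, -⟩ := h.exists_mem
  -- Half the trace is the coefficient of `dx`. The remaining part of the form is `(a + b ℘ + c ℘² +
  -- d ℘') dx / (2 Q' P²)`; expand in powers of `P = ℘ - r`, replace `1 / P` by `Q / κ`, and `P' dx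
  -- / (Q' P²)` by `-dy / κ`.
  refine ⟨![e / 2, -d / (2 * κ), c / 2, (b + 2 * c * r) / (2 * κ),
    (a + b * r + c * r ^ 2) / (2 * κ ^ 2)], Subtype.ext ?_⟩
  have hδ := h.form_eq_zero (Submodule.sub_mem _ hω (h.form_mem ![e / 2, -d / (2 * κ), c / 2,
    (b + 2 * c * r) / (2 * κ), (a + b * r + c * r ^ 2) / (2 * κ ^ 2)])) ?_
  · exact (sub_eq_zero.mp hδ).symm
  intro x hx hxi hxj v hv
  simp only [Pi.sub_apply]
  rw [formOf_of_mem hv, form_of_ne hxj, sub_eq_zero]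
  by_cases hvi : v i = 0
  · have hv0 := h.tan_left _ hx v hv hvi hxj
    have := hω.2.2.1 x v hv 0
    rw [zero_smul, zero_mul] at this
    rw [hv0, this]
    simp
  · obtain ⟨z, hz⟩ := cls_surjective (x i)
    have hzl : z ∉ (periods (τ i)).lattice := by rwa [← cls_eq_zero_iff, hz]
    obtain ⟨q, hq, hqi, hqj⟩ := hex _ _ (h.wpRel hx).neg_right
    obtain ⟨t1, t2, t3⟩ := h.trace_eq (ω := ω) hx hq hz.symm (hqi.trans hz.symm) hqj
    obtain ⟨m1, m2⟩ := hmain z (by rw [ne_eq, t3]; exact hxj)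
    have m2' := m2 hzl
    rw [m1] at t1
    rw [m2'] at t2
    rw [coeff_eq h.sub hω hv hvi]
    have hxj0 : x j ≠ 0 := fun e => hxj (by rw [e, add_zero])
    have hrel := h.tangent_relation hv hxi hxj0
    have hm := (h.wpRel hx).mul_eq hxi hxj0
    have hQ' : wp' (τ j) (x j) ≠ 0 := fun e => hxj (wp'_eq_zero_iff.mp e)
    rw [← wp_cls, ← wp'_cls, hz] at t2
    have hX : wp (τ i) (x i) = (wp (τ i) (x i) - r) + r := by ring
    rw [hX] at t2
    rw [add_sub_cancel_right] at t2
    have hκ := h.hκ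
    rw [← hm] at hκ ⊢
    have hPn := left_ne_zero_of_mul hκ
    have hQn := right_ne_zero_of_mul hκ
    simp only [Matrix.cons_val]
    generalize wp' (τ i) (x i) = P' at *
    generalize wp' (τ j) (x j) = Q' at *
    generalize wp (τ i) (x i) - r = P at *
    generalize wp (τ j) (x j) - s = Q at *
    generalize coeff C i ω x = A at *
    generalize coeff C i ω q = B at *
    have hvj : v j = -(P' * v i * Q) / (P * Q') := by
      field_simp
      linear_combination hrel
    have hA : A = (e * (Q' * P ^ 2) + (a + b * (P + r) + c * (P + r) ^ 2 + d * P')) /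
        (2 * (Q' * P ^ 2)) := by
      field_simp
      linear_combination -t2 - t1 * (Q' * P ^ 2)
    rw [hvj, hA]
    field_simp
    ring

/-- The curve is a smooth compact connected curve of genus five. -/
theorem isCurveOfGenus (h : IsWpCurve C i j k r s κ) : IsCurveOfGenus 5 C := by
  refine ⟨h.closed.isCompact, h.isConnected, h.sub, by norm_num, ?_⟩
  rw [← (LinearEquiv.ofBijective h.formMap ⟨h.formMap_injective,
    h.formMap_surjective⟩).finrank_eq]
  simp

end IsWpCurve

/-- A nondegenerate bilinear equation in two Legendre functions, not satisfied by any pair of points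
of order two, defines a curve of genus five. -/
theorem isCurveOfGenus_biCurve {i j k : Fin 3} (hij : i ≠ j) (hik : i ≠ k) (hjk : j ≠ k)
    (a : E (τ k)) {α β γ δ : ℂ} (hdet : α * δ ≠ β * γ)
    (hcr : ∀ (x : E (τ i)) (y : E (τ j)), x + x = 0 → y + y = 0 →
      bilin α β γ δ (legendre (τ i) x) (legendre (τ j) y) ≠ 0) :
    IsCurveOfGenus 5 (biCurve i j k a α β γ δ) := by
  obtain ⟨r, s, κ, h⟩ := isWpCurve_biCurve hij hik hjk a hdet hcr
  exact h.isCurveOfGenus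

end Burniat

end

/-! ### Smooth points and nodes of the hypersurfaces -/

noncomputable section

namespace Burniat

open Filter

/-- The trilinear form in three pairs of homogeneous coordinates that defines the hypersurfaces. -/
def tri (c : Fin 4 → ℂ) (p q r : ℂ × ℂ) : ℂ :=
  c 0 * (p.1 * q.1 * r.1) + c 1 * (p.2 * q.2 * r.2) + c 2 * (p.1 * q.2 * r.2) +
    c 3 * (p.2 * q.1 * r.1)

/-- A three-parameter family of hypersurfaces of `T` that contains all `X̂_ν` and `X̂_μ`. -/
def hyper (τ : Fin 3 → UpperHalfPlane) (c : Fin 4 → ℂ) : Set (T τ) :=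
  {x | tri c (legendre (τ 0) (x 0)) (legendre (τ 1) (x 1)) (legendre (τ 2) (x 2)) = 0}

theorem XNu_eq (τ : Fin 3 → UpperHalfPlane) (ν₁ ν₂ : ℂ) :
    XNu τ ν₁ ν₂ = hyper τ ![ν₁, ν₁ * (bConst (τ 0) * bConst (τ 1) * bConst (τ 2)),
      ν₂ * (bConst (τ 1) * bConst (τ 2)), ν₂ * bConst (τ 0)] := by
  ext x
  simp only [XNu, hyper, tri, Set.mem_ofPred_eq, Matrix.cons_val]
  constructor <;> intro h <;> linear_combination h

theorem XMu_eq (τ : Fin 3 → UpperHalfPlane) (μ : ℂ) : XMu τ μ = hyper τ ![1, -μ, 0, 0] := by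
  ext x
  simp only [XMu, hyper, tri, Set.mem_ofPred_eq, Matrix.cons_val]
  constructor <;> intro h <;> linear_combination h

section

/-- The product rule for functions of separate variables. -/
theorem hasFDerivAt_prod3 {A B C : ℂ → ℂ} {w : Fin 3 → ℂ} (hA : DifferentiableAt ℂ A (w 0))
    (hB : DifferentiableAt ℂ B (w 1)) (hC : DifferentiableAt ℂ C (w 2)) :
    ∃ D : (Fin 3 → ℂ) →L[ℂ] ℂ, HasFDerivAt (fun w : Fin 3 → ℂ => A (w 0) * B (w 1) * C (w 2)) D w ∧
      ∀ v, D v = deriv A (w 0) * B (w 1) * C (w 2) * v 0 + A (w 0) * deriv B (w 1) * C (w 2) * v 1 +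
        A (w 0) * B (w 1) * deriv C (w 2) * v 2 := by
  have h0 : HasFDerivAt (fun w : Fin 3 → ℂ => A (w 0))
      (deriv A (w 0) • ContinuousLinearMap.proj (R := ℂ) (φ := fun _ : Fin 3 => ℂ) 0) w :=
    hA.hasDerivAt.comp_hasFDerivAt w (hasFDerivAt_apply 0 w)
  have h1 : HasFDerivAt (fun w : Fin 3 → ℂ => B (w 1))
      (deriv B (w 1) • ContinuousLinearMap.proj (R := ℂ) (φ := fun _ : Fin 3 => ℂ) 1) w :=
    hB.hasDerivAt.comp_hasFDerivAt w (hasFDerivAt_apply 1 w)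
  have h2 : HasFDerivAt (fun w : Fin 3 → ℂ => C (w 2))
      (deriv C (w 2) • ContinuousLinearMap.proj (R := ℂ) (φ := fun _ : Fin 3 => ℂ) 2) w :=
    hC.hasDerivAt.comp_hasFDerivAt w (hasFDerivAt_apply 2 w)
  refine ⟨_, (h0.mul h1).mul h2, fun v => ?_⟩
  simp
  ring

theorem analyticAt_coord {A : ℂ → ℂ} {w : Fin 3 → ℂ} (j : Fin 3) (hA : AnalyticAt ℂ A (w j)) :
    AnalyticAt ℂ (fun w : Fin 3 → ℂ => A (w j)) w :=
  AnalyticAt.fun_comp (f := fun w : Fin 3 → ℂ => w j) hA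
    ((ContinuousLinearMap.proj (R := ℂ) (φ := fun _ : Fin 3 => ℂ) j).analyticAt w)

/-- A criterion for `A₁(w₀) y(w₁) z(w₂) + A₂(w₀)` to have a nondegenerate critical point: by `h1`, `h2`,
the Hessian consists of a `1 × 1` block, nonzero by `h00`, and a `2 × 2` block with determinant
`A₁²` times the expression in `hD`. -/
theorem hessian_prod3 {A₁ A₂ y z : ℂ → ℂ} {w₀ : Fin 3 → ℂ} (hA₁ : AnalyticAt ℂ A₁ (w₀ 0))
    (hA₂ : AnalyticAt ℂ A₂ (w₀ 0)) (hy : AnalyticAt ℂ y (w₀ 1)) (hz : AnalyticAt ℂ z (w₀ 2))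
    (h1 : deriv A₁ (w₀ 0) = 0) (h2 : deriv A₂ (w₀ 0) = 0)
    (h3 : deriv y (w₀ 1) * z (w₀ 2) = 0) (h4 : y (w₀ 1) * deriv z (w₀ 2) = 0)
    (h00 : deriv (deriv A₁) (w₀ 0) * (y (w₀ 1) * z (w₀ 2)) + deriv (deriv A₂) (w₀ 0) ≠ 0)
    (hf : A₁ (w₀ 0) ≠ 0)
    (hD : deriv (deriv y) (w₀ 1) * z (w₀ 2) * (y (w₀ 1) * deriv (deriv z) (w₀ 2)) -
      (deriv y (w₀ 1) * deriv z (w₀ 2)) ^ 2 ≠ 0) :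
    let F : (Fin 3 → ℂ) → ℂ := fun w => A₁ (w 0) * y (w 1) * z (w 2) + A₂ (w 0)
    AnalyticAt ℂ F w₀ ∧ fderiv ℂ F w₀ = 0 ∧
      ∀ v, (∀ u, fderiv ℂ (fderiv ℂ F) w₀ v u = 0) → v = 0 := by
  intro F
  have hF : AnalyticAt ℂ F w₀ := (((analyticAt_coord 0 hA₁).mul (analyticAt_coord 1 hy)).mul
    (analyticAt_coord 2 hz)).add (analyticAt_coord 0 hA₂)
  have hfd : ∀ᶠ w in 𝓝 w₀, ∀ u, fderiv ℂ F w u =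
      u 0 * (deriv A₁ (w 0) * y (w 1) * z (w 2)) + u 1 * (A₁ (w 0) * deriv y (w 1) * z (w 2)) +
      u 2 * (A₁ (w 0) * y (w 1) * deriv z (w 2)) + u 0 * (deriv A₂ (w 0) * 1 * 1) := by
    filter_upwards [(continuous_apply 0).continuousAt.eventually hA₁.eventually_analyticAt,
      (continuous_apply 0).continuousAt.eventually hA₂.eventually_analyticAt,
      (continuous_apply 1).continuousAt.eventually hy.eventually_analyticAt,
      (continuous_apply 2).continuousAt.eventually hz.eventually_analyticAt] with w k1 k2 k3 k4 u
    obtain ⟨D, hD1, hD2⟩ := hasFDerivAt_prod3 k1.differentiableAt k3.differentiableAt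
      k4.differentiableAt
    have h0 : HasFDerivAt (fun w : Fin 3 → ℂ => A₂ (w 0))
        (deriv A₂ (w 0) • ContinuousLinearMap.proj (R := ℂ) (φ := fun _ : Fin 3 => ℂ) 0) w :=
      k2.differentiableAt.hasDerivAt.comp_hasFDerivAt w (hasFDerivAt_apply 0 w)
    have h5 : fderiv ℂ F w u = _ := DFunLike.congr_fun (hD1.add h0).fderiv u
    rw [h5]
    simp [hD2]
    ring
  have hH : ∀ v u, fderiv ℂ (fderiv ℂ F) w₀ v u =
      u 0 * v 0 * (deriv (deriv A₁) (w₀ 0) * (y (w₀ 1) * z (w₀ 2)) + deriv (deriv A₂) (w₀ 0)) +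
      u 1 * (A₁ (w₀ 0) * (deriv (deriv y) (w₀ 1) * z (w₀ 2) * v 1 +
        deriv y (w₀ 1) * deriv z (w₀ 2) * v 2)) +
      u 2 * (A₁ (w₀ 0) * (deriv y (w₀ 1) * deriv z (w₀ 2) * v 1 +
        y (w₀ 1) * deriv (deriv z) (w₀ 2) * v 2)) := by
    intro v u
    have e1 : HasFDerivAt (fun w => fderiv ℂ F w u)
        ((ContinuousLinearMap.apply ℂ ℂ u).comp (fderiv ℂ (fderiv ℂ F) w₀)) w₀ :=
      (ContinuousLinearMap.apply ℂ ℂ u).hasFDerivAt.comp w₀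
        hF.fderiv.differentiableAt.hasFDerivAt
    obtain ⟨D1, hD1, hD1'⟩ := hasFDerivAt_prod3 (w := w₀) hA₁.deriv.differentiableAt
      hy.differentiableAt hz.differentiableAt
    obtain ⟨D2, hD2, hD2'⟩ := hasFDerivAt_prod3 (w := w₀) hA₁.differentiableAt
      hy.deriv.differentiableAt hz.differentiableAt
    obtain ⟨D3, hD3, hD3'⟩ := hasFDerivAt_prod3 (w := w₀) hA₁.differentiableAt
      hy.differentiableAt hz.deriv.differentiableAt
    obtain ⟨D4, hD4, hD4'⟩ := hasFDerivAt_prod3 (w := w₀) (B := fun _ => 1) (C := fun _ => 1)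
      hA₂.deriv.differentiableAt (differentiableAt_const _) (differentiableAt_const _)
    have e2 := (((hD1.const_mul (u 0)).add (hD2.const_mul (u 1))).add
      (hD3.const_mul (u 2))).add (hD4.const_mul (u 0))
    have e3 := e1.unique (e2.congr_of_eventuallyEq (hfd.mono fun w hw => hw u))
    have e4 := DFunLike.congr_fun e3 v
    simp only [ContinuousLinearMap.comp_apply, ContinuousLinearMap.apply_apply, add_apply,
      smul_apply, hD1', hD2', hD3', hD4', smul_eq_mul, deriv_const, h1] at e4
    rw [e4]
    ring
  refine ⟨hF, ?_, fun v hv => ?_⟩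
  · ext u
    rw [hfd.self_of_nhds u, h1, h2]
    simp only [zero_apply]
    linear_combination u 1 * A₁ (w₀ 0) * h3 + u 2 * A₁ (w₀ 0) * h4
  · have k0 := (hH v ![1, 0, 0]).symm.trans (hv _)
    have k1 := (hH v ![0, 1, 0]).symm.trans (hv _)
    have k2 := (hH v ![0, 0, 1]).symm.trans (hv _)
    simp only [Matrix.cons_val, zero_mul, one_mul, add_zero, zero_add] at k0 k1 k2
    have v0 : v 0 = 0 := (mul_eq_zero.mp k0).resolve_right h00
    have k1' := (mul_eq_zero.mp k1).resolve_left hf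
    have k2' := (mul_eq_zero.mp k2).resolve_left hf
    have v1 : v 1 = 0 := by
      refine (mul_eq_zero.mp (?_ : v 1 * _ = 0)).resolve_right hD
      linear_combination y (w₀ 1) * deriv (deriv z) (w₀ 2) * k1' -
        deriv y (w₀ 1) * deriv z (w₀ 2) * k2'
    have v2 : v 2 = 0 := by
      refine (mul_eq_zero.mp (?_ : v 2 * _ = 0)).resolve_right hD
      linear_combination deriv (deriv y) (w₀ 1) * z (w₀ 2) * k2' -
        deriv y (w₀ 1) * deriv z (w₀ 2) * k1'
    ext l
    fin_cases l <;> assumption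

end

variable {τ : Fin 3 → UpperHalfPlane}

/-- A local equation of a hypersurface. Its differential is nonzero if some coordinate `zⱼ` is not of
order two and the trilinear form does not vanish identically in the `j`-th argument, as then the
Legendre function of `zⱼ` is a local coordinate. -/
theorem exists_tri_equation (c : Fin 4 → ℂ) (z : Fin 3 → ℂ) :
    ∃ F : (Fin 3 → ℂ) → ℂ, AnalyticAt ℂ F z ∧ (∀ᶠ w in 𝓝 z, proj τ w ∈ hyper τ c ↔ F w = 0) ∧
      (proj τ z ∈ hyper τ c →
        let p := fun j => legendre (τ j) (cls (τ j) (z j))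
        (cls (τ 0) (z 0) + cls (τ 0) (z 0) ≠ 0 →
          tri c (1, 0) (p 1) (p 2) ≠ 0 ∨ tri c (0, 1) (p 1) (p 2) ≠ 0 → fderiv ℂ F z ≠ 0) ∧
        (cls (τ 1) (z 1) + cls (τ 1) (z 1) ≠ 0 →
          tri c (p 0) (1, 0) (p 2) ≠ 0 ∨ tri c (p 0) (0, 1) (p 2) ≠ 0 → fderiv ℂ F z ≠ 0) ∧
        (cls (τ 2) (z 2) + cls (τ 2) (z 2) ≠ 0 →
          tri c (p 0) (p 1) (1, 0) ≠ 0 ∨ tri c (p 0) (p 1) (0, 1) ≠ 0 → fderiv ℂ F z ≠ 0)) := by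
  choose n d hn hd he hne using fun j => exists_legendre_lift (τ := τ j) (z j)
  set F : (Fin 3 → ℂ) → ℂ := fun w =>
    tri c (n 0 (w 0), d 0 (w 0)) (n 1 (w 1), d 1 (w 1)) (n 2 (w 2), d 2 (w 2)) with hF
  have hN := fun j => analyticAt_coord j (hn j)
  have hD := fun j => analyticAt_coord j (hd j)
  have hFan : AnalyticAt ℂ F z :=
    (((analyticAt_const.mul (((hN 0).mul (hN 1)).mul (hN 2))).add
      (analyticAt_const.mul (((hD 0).mul (hD 1)).mul (hD 2)))).add
      (analyticAt_const.mul (((hN 0).mul (hD 1)).mul (hD 2)))).add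
      (analyticAt_const.mul (((hD 0).mul (hN 1)).mul (hN 2)))
  have hzero : ∀ᶠ w in 𝓝 z, proj τ w ∈ hyper τ c ↔ F w = 0 := by
    filter_upwards [(continuous_apply 0).continuousAt.eventually (he 0),
      (continuous_apply 1).continuousAt.eventually (he 1),
      (continuous_apply 2).continuousAt.eventually (he 2)] with w h0 h1 h2
    obtain ⟨a, ha, a1, a2⟩ := h0
    obtain ⟨b, hb, b1, b2⟩ := h1
    obtain ⟨e, he, e1, e2⟩ := h2
    have : tri c (legendre (τ 0) (proj τ w 0)) (legendre (τ 1) (proj τ w 1))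
        (legendre (τ 2) (proj τ w 2)) = a * b * e * F w := by
      simp only [tri, proj_apply, a1, a2, b1, b2, e1, e2, hF]
      ring
    change tri c _ _ _ = 0 ↔ _
    rw [this, mul_eq_zero, or_iff_right (mul_ne_zero (mul_ne_zero ha hb) he)]
  refine ⟨F, hFan, hzero, fun hz => ?_⟩
  have hF0 := hzero.self_of_nhds.mp hz
  intro p
  -- derivative along a coordinate line
  have hline : ∀ j, HasDerivAt (fun t => F (Function.update z j t)) (fderiv ℂ F z (Pi.single j 1))
      (z j) := fun j => by
    have h1 : HasFDerivAt F (fderiv ℂ F z) (Function.update z j (z j)) := by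
      rw [Function.update_eq_self]
      exact hFan.differentiableAt.hasFDerivAt
    exact h1.comp_hasDerivAt (z j) (hasDerivAt_update z j (z j))
  have key : ∀ (j : Fin 3) (A B : ℂ), (∀ t, F (Function.update z j t) = A * n j t + B * d j t) →
      cls (τ j) (z j) + cls (τ j) (z j) ≠ 0 → (A ≠ 0 ∨ B ≠ 0) → fderiv ℂ F z ≠ 0 := by
    intro j A B hAB hcr hne0 hzero
    obtain ⟨e, he0, e1, e2⟩ := (he j).self_of_nhds
    refine hne j A B hne0 ?_ hcr ?_
    · have := hAB (z j)
      rw [Function.update_eq_self, hF0] at this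
      rw [e1, e2]
      linear_combination -e * this
    · have h1 := ((hn j).differentiableAt.hasDerivAt.const_mul A).add
        ((hd j).differentiableAt.hasDerivAt.const_mul B)
      have h2 := (hline j).congr_of_eventuallyEq (f₁ := fun t => A * n j t + B * d j t)
        (Eventually.of_forall fun t => (hAB t).symm)
      rw [h1.unique h2, hzero]
      rfl
  obtain ⟨a, ha, a1, a2⟩ := (he 0).self_of_nhds
  obtain ⟨b, hb, b1, b2⟩ := (he 1).self_of_nhds
  obtain ⟨e, he0, e1, e2⟩ := (he 2).self_of_nhds
  have hp0 : p 0 = (a * n 0 (z 0), a * d 0 (z 0)) := Prod.ext a1 a2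
  have hp1 : p 1 = (b * n 1 (z 1), b * d 1 (z 1)) := Prod.ext b1 b2
  have hp2 : p 2 = (e * n 2 (z 2), e * d 2 (z 2)) := Prod.ext e1 e2
  refine ⟨fun hcr hn0 => ?_, fun hcr hn0 => ?_, fun hcr hn0 => ?_⟩
  · refine key 0 (tri c (1, 0) (n 1 (z 1), d 1 (z 1)) (n 2 (z 2), d 2 (z 2)))
      (tri c (0, 1) (n 1 (z 1), d 1 (z 1)) (n 2 (z 2), d 2 (z 2))) (fun t => ?_) hcr ?_
    · simp [hF, tri]
      ring
    · rw [hp1, hp2] at hn0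
      refine hn0.imp (fun h1 h2 => h1 ?_) (fun h1 h2 => h1 ?_) <;> simp only [tri] at h2 ⊢ <;>
        linear_combination b * e * h2
  · refine key 1 (tri c (n 0 (z 0), d 0 (z 0)) (1, 0) (n 2 (z 2), d 2 (z 2)))
      (tri c (n 0 (z 0), d 0 (z 0)) (0, 1) (n 2 (z 2), d 2 (z 2))) (fun t => ?_) hcr ?_
    · simp [hF, tri]
      ring
    · rw [hp0, hp2] at hn0
      refine hn0.imp (fun h1 h2 => h1 ?_) (fun h1 h2 => h1 ?_) <;> simp only [tri] at h2 ⊢ <;>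
        linear_combination a * e * h2
  · refine key 2 (tri c (n 0 (z 0), d 0 (z 0)) (n 1 (z 1), d 1 (z 1)) (1, 0))
      (tri c (n 0 (z 0), d 0 (z 0)) (n 1 (z 1), d 1 (z 1)) (0, 1)) (fun t => ?_) hcr ?_
    · simp [hF, tri]
      ring
    · rw [hp0, hp1] at hn0
      refine hn0.imp (fun h1 h2 => h1 ?_) (fun h1 h2 => h1 ?_) <;> simp only [tri] at h2 ⊢ <;>
        linear_combination a * b * h2

/-- The points at which a hypersurface of the family can be singular: the points of order two, and
the points with `x₀` of order two at which the other two Legendre functions have a common zero or a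
common pole. -/
def SingularAt (x : T τ) : Prop :=
  x 0 + x 0 = 0 ∧ ((x 1 + x 1 = 0 ∧ x 2 + x 2 = 0) ∨
    ((legendre (τ 1) (x 1)).1 = 0 ∧ (legendre (τ 2) (x 2)).1 = 0) ∨
    ((legendre (τ 1) (x 1)).2 = 0 ∧ (legendre (τ 2) (x 2)).2 = 0))

/-- The logic of the equations for a singular point: `kⱼ` says that the `j`-th coordinate has order
two, `q₁, q₂` that the second Legendre function has a zero or a pole, `r₁, r₂` the same for the
third one, and `φ₁, φ₂` that the coefficients of the equation as a bilinear form in the last two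
arguments vanish. The hypotheses `c0, c1, c2` express the vanishing of the partial derivatives. -/
theorem singular_cases {k₀ k₁ k₂ q₁ q₂ r₁ r₂ φ₁ φ₂ : Prop} (n1 : k₁ → ¬ q₁ ∧ ¬ q₂)
    (n2 : k₂ → ¬ r₁ ∧ ¬ r₂) (m1 : q₁ → q₂ → False) (m2 : r₁ → r₂ → False) (m0 : φ₁ → φ₂ → False)
    (c0 : k₀ ∨ ((q₁ ∨ r₁) ∧ (q₂ ∨ r₂))) (c1 : k₁ ∨ ((r₁ ∨ φ₁) ∧ (r₂ ∨ φ₂)))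
    (c2 : k₂ ∨ ((q₁ ∨ φ₁) ∧ (q₂ ∨ φ₂))) :
    k₀ ∧ ((k₁ ∧ k₂) ∨ (q₁ ∧ r₁) ∨ (q₂ ∧ r₂)) := by
  grind

theorem isSmoothPoint_of_not_singularAt {c : Fin 4 → ℂ} (hc : c 0 * c 1 ≠ c 2 * c 3) {x : T τ}
    (hx : x ∈ hyper τ c) (hs : ¬ SingularAt x) : IsSmoothPoint (hyper τ c) x := by
  obtain ⟨z, rfl⟩ := proj_surjective x
  obtain ⟨F, hF, hFe, hFd⟩ := exists_tri_equation (τ := τ) c z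
  obtain ⟨d0, d1, d2⟩ := hFd hx
  have hdF : fderiv ℂ F z ≠ 0 := by
    intro hzero
    apply hs
    have c0 : cls (τ 0) (z 0) + cls (τ 0) (z 0) = 0 ∨ _ := or_iff_not_imp_left.mpr fun h1 =>
      not_imp_not.mpr (d0 h1) (not_not.mpr hzero)
    have c1 : cls (τ 1) (z 1) + cls (τ 1) (z 1) = 0 ∨ _ := or_iff_not_imp_left.mpr fun h1 =>
      not_imp_not.mpr (d1 h1) (not_not.mpr hzero)
    have c2 : cls (τ 2) (z 2) + cls (τ 2) (z 2) = 0 ∨ _ := or_iff_not_imp_left.mpr fun h1 =>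
      not_imp_not.mpr (d2 h1) (not_not.mpr hzero)
    have n0 := fun h => legendre_ne_zero_of_add_self (τ := τ 0) (x := cls (τ 0) (z 0)) h
    have n1 := fun h => legendre_ne_zero_of_add_self (τ := τ 1) (x := cls (τ 1) (z 1)) h
    have n2 := fun h => legendre_ne_zero_of_add_self (τ := τ 2) (x := cls (τ 2) (z 2)) h
    have m0 := @legendre_ne_zero (τ 0) (cls (τ 0) (z 0))
    have m1 := @legendre_ne_zero (τ 1) (cls (τ 1) (z 1))
    have m2 := @legendre_ne_zero (τ 2) (cls (τ 2) (z 2))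
    unfold SingularAt
    simp only [proj_apply]
    push Not at c0 c1 c2
    simp only [tri, mul_one, mul_zero, zero_mul, one_mul, add_zero, zero_add] at c0 c1 c2
    clear d0 d1 d2 hs hx
    generalize legendre (τ 0) (cls (τ 0) (z 0)) = p at *
    generalize legendre (τ 1) (cls (τ 1) (z 1)) = q at *
    generalize legendre (τ 2) (cls (τ 2) (z 2)) = r at *
    have hdet : ∀ a b : ℂ, c 0 * a + c 2 * b = 0 → c 3 * a + c 1 * b = 0 → a = 0 ∧ b = 0 := by
      intro a b e1 e2
      have ha : (c 0 * c 1 - c 2 * c 3) * a = 0 := by linear_combination c 1 * e1 - c 2 * e2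
      have hb : (c 0 * c 1 - c 2 * c 3) * b = 0 := by linear_combination c 0 * e2 - c 3 * e1
      exact ⟨(mul_eq_zero.mp ha).resolve_left (sub_ne_zero.mpr hc),
        (mul_eq_zero.mp hb).resolve_left (sub_ne_zero.mpr hc)⟩
    have hdet' : c 0 * p.1 + c 3 * p.2 = 0 → c 2 * p.1 + c 1 * p.2 = 0 → False := by
      intro e1 e2
      have ha : (c 0 * c 1 - c 2 * c 3) * p.1 = 0 := by linear_combination c 1 * e1 - c 3 * e2
      have hb : (c 0 * c 1 - c 2 * c 3) * p.2 = 0 := by linear_combination c 0 * e2 - c 2 * e1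
      exact m0 ((mul_eq_zero.mp ha).resolve_left (sub_ne_zero.mpr hc))
        ((mul_eq_zero.mp hb).resolve_left (sub_ne_zero.mpr hc))
    have c0' : cls (τ 0) (z 0) + cls (τ 0) (z 0) = 0 ∨ (q.1 * r.1 = 0 ∧ q.2 * r.2 = 0) :=
      c0.imp id fun ⟨e1, e2⟩ => hdet _ _ (by linear_combination e1) (by linear_combination e2)
    have c1' : cls (τ 1) (z 1) + cls (τ 1) (z 1) = 0 ∨
        (r.1 * (c 0 * p.1 + c 3 * p.2) = 0 ∧ r.2 * (c 2 * p.1 + c 1 * p.2) = 0) :=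
      c1.imp id fun ⟨e1, e2⟩ => ⟨by linear_combination e1, by linear_combination e2⟩
    have c2' : cls (τ 2) (z 2) + cls (τ 2) (z 2) = 0 ∨
        (q.1 * (c 0 * p.1 + c 3 * p.2) = 0 ∧ q.2 * (c 2 * p.1 + c 1 * p.2) = 0) :=
      c2.imp id fun ⟨e1, e2⟩ => ⟨by linear_combination e1, by linear_combination e2⟩
    clear c0 c1 c2 hF hFe hFd
    simp only [mul_eq_zero] at c0' c1' c2'
    exact singular_cases n1 n2 m1 m2 hdet' c0' c1' c2'
  refine ⟨hx, z, fun w => ![F w], rfl, ?_, ?_, ?_⟩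
  · refine AnalyticAt.pi fun l => ?_
    fin_cases l
    exact hF
  · have hd : HasFDerivAt (fun w => ![F w]) (ContinuousLinearMap.pi ![fderiv ℂ F z]) z := by
      refine hasFDerivAt_pi.mpr fun l => ?_
      fin_cases l
      exact hF.differentiableAt.hasFDerivAt
    rw [hd.fderiv]
    obtain ⟨v, hv⟩ : ∃ v, fderiv ℂ F z v ≠ 0 := by
      by_contra hcon
      push Not at hcon
      exact hdF (ContinuousLinearMap.ext hcon)
    intro a
    refine ⟨(a 0 / fderiv ℂ F z v) • v, ?_⟩
    ext l
    fin_cases l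
    simp [hv]
  · filter_upwards [hFe] with w hw
    rw [hw]
    exact ⟨fun h => by ext l; fin_cases l; exact h, fun h => congrFun h 0⟩

/-- The first coordinate is simply ramified by its Legendre function `l`. In affine coordinates `y`,
`u` of the other two Legendre functions (or of their inverses, at a pole), the equation is `(a l +
b) y u + (a' l + b') = 0`, and `y u` has a nondegenerate critical point: either both factors have
one and do not vanish, or both have a simple zero. -/
theorem isNode_of_singularAt {c : Fin 4 → ℂ} (hc : c 0 * c 1 ≠ c 2 * c 3) {x : T τ}
    (hx : x ∈ hyper τ c) (hs : SingularAt x) : IsNode (hyper τ c) x := by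
  obtain ⟨z, rfl⟩ := proj_surjective x
  obtain ⟨k0, hs⟩ := hs
  obtain ⟨n0, n0'⟩ := legendre_ne_zero_of_add_self k0
  simp only [proj_apply] at k0 n0 n0' hs
  obtain ⟨l, hl, hl1, hl2, hle⟩ := exists_legendre_chart n0'
  have hl1' := hl1.mpr k0
  have hl2' := hl2 k0
  have hx' := hx
  change tri c (legendre (τ 0) (cls (τ 0) (z 0))) (legendre (τ 1) (cls (τ 1) (z 1)))
    (legendre (τ 2) (cls (τ 2) (z 2))) = 0 at hx'
  have haff : ∀ a b : ℂ, AnalyticAt ℂ (fun t => a * l t + b) (z 0) ∧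
      deriv (fun t => a * l t + b) (z 0) = 0 ∧
      deriv (deriv fun t => a * l t + b) (z 0) = a * deriv (deriv l) (z 0) := by
    intro a b
    have h1 : ∀ᶠ t in 𝓝 (z 0), deriv (fun t => a * l t + b) t = a * deriv l t := by
      filter_upwards [hl.eventually_analyticAt] with t ht
      exact ((ht.differentiableAt.hasDerivAt.const_mul a).add_const b).deriv
    refine ⟨(analyticAt_const.mul hl).add analyticAt_const, ?_, ?_⟩
    · rw [h1.self_of_nhds, hl1', mul_zero]
    · rw [EventuallyEq.deriv_eq h1]
      exact (hl.deriv.differentiableAt.hasDerivAt.const_mul a).deriv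
  -- a node is found from charts `y, z` of the second and third factor
  have key : ∀ (a b a' b' : ℂ) (y z' : ℂ → ℂ), AnalyticAt ℂ y (z 1) → AnalyticAt ℂ z' (z 2) →
      (∀ᶠ w in 𝓝 z, proj τ w ∈ hyper τ c ↔
        (a * l (w 0) + b) * y (w 1) * z' (w 2) + (a' * l (w 0) + b') = 0) →
      deriv y (z 1) * z' (z 2) = 0 → y (z 1) * deriv z' (z 2) = 0 →
      a * (y (z 1) * z' (z 2)) + a' ≠ 0 → a * l (z 0) + b ≠ 0 →
      deriv (deriv y) (z 1) * z' (z 2) * (y (z 1) * deriv (deriv z') (z 2)) -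
        (deriv y (z 1) * deriv z' (z 2)) ^ 2 ≠ 0 → IsNode (hyper τ c) (proj τ z) := by
    intro a b a' b' y z' hy hz' heq h3 h4 h00 hf hD
    obtain ⟨m1, m2, m3⟩ := hessian_prod3 (haff a b).1 (haff a' b').1 hy hz' (haff a b).2.1
      (haff a' b').2.1 h3 h4 (by
        rw [(haff a b).2.2, (haff a' b').2.2]
        intro e
        refine mul_ne_zero hl2' h00 ?_
        linear_combination e) hf hD
    exact ⟨hx, z, _, rfl, m1, m2, m3, heq⟩
  have l0 := hle.self_of_nhds
  rcases hs with ⟨k1, k2⟩ | ⟨q1, r1⟩ | ⟨q2, r2⟩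
  -- all three coordinates of order two
  · obtain ⟨n1, n1'⟩ := legendre_ne_zero_of_add_self k1
    obtain ⟨n2, n2'⟩ := legendre_ne_zero_of_add_self k2
    obtain ⟨y, hy, hy1, hy2, hye⟩ := exists_legendre_chart n1'
    obtain ⟨u, hu, hu1, hu2, hue⟩ := exists_legendre_chart n2'
    have y0 := hye.self_of_nhds
    have u0 := hue.self_of_nhds
    have hyn : y (z 1) ≠ 0 := fun e => n1 (by rw [y0.2, e, zero_mul])
    have hun : u (z 2) ≠ 0 := fun e => n2 (by rw [u0.2, e, zero_mul])
    have heq : (c 0 * l (z 0) + c 3) * y (z 1) * u (z 2) + (c 2 * l (z 0) + c 1) = 0 := by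
      rw [tri, l0.2, y0.2, u0.2] at hx'
      refine (mul_eq_zero.mp (?_ : _ * ((legendre (τ 0) (cls (τ 0) (z 0))).2 *
        (legendre (τ 1) (cls (τ 1) (z 1))).2 * (legendre (τ 2) (cls (τ 2) (z 2))).2) = 0)).resolve_right
        (mul_ne_zero (mul_ne_zero n0' n1') n2')
      linear_combination hx'
    refine key (c 0) (c 3) (c 2) (c 1) y u hy hu ?_ (by rw [hy1.mpr k1, zero_mul])
      (by rw [hu1.mpr k2, mul_zero]) ?_ ?_ ?_
    · filter_upwards [(continuous_apply 0).continuousAt.eventually hle,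
        (continuous_apply 1).continuousAt.eventually hye,
        (continuous_apply 2).continuousAt.eventually hue] with w e0 e1 e2
      change tri c _ _ _ = 0 ↔ _
      simp only [tri, proj_apply, e0.2, e1.2, e2.2]
      refine Iff.trans ?_ (mul_eq_zero.trans (or_iff_right
        (mul_ne_zero (mul_ne_zero e0.1 e1.1) e2.1)))
      constructor <;> intro e <;> linear_combination e
    · intro e
      refine hc ?_
      linear_combination (-(c 0 * l (z 0)) - c 3) * e + c 0 * heq
    · intro e
      refine hc ?_
      linear_combination (-c 2 - c 0 * y (z 1) * u (z 2)) * e + c 0 * heq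
    · rw [hy1.mpr k1, hu1.mpr k2]
      have := mul_ne_zero (mul_ne_zero (hy2 k1) hun) (mul_ne_zero hyn (hu2 k2))
      simpa using this
  -- two zeros
  · have n1' : (legendre (τ 1) (cls (τ 1) (z 1))).2 ≠ 0 := fun e => legendre_ne_zero q1 e
    have n2' : (legendre (τ 2) (cls (τ 2) (z 2))).2 ≠ 0 := fun e => legendre_ne_zero r1 e
    have k1 : cls (τ 1) (z 1) + cls (τ 1) (z 1) ≠ 0 := fun e =>
      (legendre_ne_zero_of_add_self e).1 q1
    have k2 : cls (τ 2) (z 2) + cls (τ 2) (z 2) ≠ 0 := fun e =>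
      (legendre_ne_zero_of_add_self e).1 r1
    obtain ⟨y, hy, hy1, hy2, hye⟩ := exists_legendre_chart n1'
    obtain ⟨u, hu, hu1, hu2, hue⟩ := exists_legendre_chart n2'
    have y0 := hye.self_of_nhds
    have u0 := hue.self_of_nhds
    have hyn : y (z 1) = 0 := by
      have := y0.2
      rw [q1] at this
      exact (mul_eq_zero.mp this.symm).resolve_right n1'
    have hun : u (z 2) = 0 := by
      have := u0.2
      rw [r1] at this
      exact (mul_eq_zero.mp this.symm).resolve_right n2'
    have heq : c 2 * l (z 0) + c 1 = 0 := by
      rw [tri, l0.2, q1, r1] at hx'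
      refine (mul_eq_zero.mp (?_ : _ * ((legendre (τ 0) (cls (τ 0) (z 0))).2 *
        (legendre (τ 1) (cls (τ 1) (z 1))).2 * (legendre (τ 2) (cls (τ 2) (z 2))).2) = 0)).resolve_right
        (mul_ne_zero (mul_ne_zero n0' n1') n2')
      linear_combination hx'
    refine key (c 0) (c 3) (c 2) (c 1) y u hy hu ?_ (by rw [hun, mul_zero])
      (by rw [hyn, zero_mul]) ?_ ?_ ?_
    · filter_upwards [(continuous_apply 0).continuousAt.eventually hle,
        (continuous_apply 1).continuousAt.eventually hye,
        (continuous_apply 2).continuousAt.eventually hue] with w e0 e1 e2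
      change tri c _ _ _ = 0 ↔ _
      simp only [tri, proj_apply, e0.2, e1.2, e2.2]
      refine Iff.trans ?_ (mul_eq_zero.trans (or_iff_right
        (mul_ne_zero (mul_ne_zero e0.1 e1.1) e2.1)))
      constructor <;> intro e <;> linear_combination e
    · intro e
      rw [hyn, zero_mul, mul_zero, zero_add] at e
      refine hc ?_
      linear_combination (-c 3 - c 0 * l (z 0)) * e + c 0 * heq
    · intro e
      refine hc ?_
      linear_combination (-c 2) * e + c 0 * heq
    · rw [hyn, hun]
      have := mul_ne_zero (mt hy1.mp k1) (mt hu1.mp k2)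
      simpa using this
  -- two poles
  · have n1' : (legendre (τ 1) (cls (τ 1) (z 1))).1 ≠ 0 := fun e => legendre_ne_zero e q2
    have n2' : (legendre (τ 2) (cls (τ 2) (z 2))).1 ≠ 0 := fun e => legendre_ne_zero e r2
    have k1 : cls (τ 1) (z 1) + cls (τ 1) (z 1) ≠ 0 := fun e =>
      (legendre_ne_zero_of_add_self e).2 q2
    have k2 : cls (τ 2) (z 2) + cls (τ 2) (z 2) ≠ 0 := fun e =>
      (legendre_ne_zero_of_add_self e).2 r2
    obtain ⟨y, hy, hy1, hy2, hye⟩ := exists_legendre_chart_inv n1'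
    obtain ⟨u, hu, hu1, hu2, hue⟩ := exists_legendre_chart_inv n2'
    have y0 := hye.self_of_nhds
    have u0 := hue.self_of_nhds
    have hyn : y (z 1) = 0 := by
      have := y0.2
      rw [q2] at this
      exact (mul_eq_zero.mp this.symm).resolve_right n1'
    have hun : u (z 2) = 0 := by
      have := u0.2
      rw [r2] at this
      exact (mul_eq_zero.mp this.symm).resolve_right n2'
    have heq : c 0 * l (z 0) + c 3 = 0 := by
      rw [tri, l0.2, q2, r2] at hx'
      refine (mul_eq_zero.mp (?_ : _ * ((legendre (τ 0) (cls (τ 0) (z 0))).2 *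
        (legendre (τ 1) (cls (τ 1) (z 1))).1 * (legendre (τ 2) (cls (τ 2) (z 2))).1) = 0)).resolve_right
        (mul_ne_zero (mul_ne_zero n0' n1') n2')
      linear_combination hx'
    refine key (c 2) (c 1) (c 0) (c 3) y u hy hu ?_ (by rw [hun, mul_zero])
      (by rw [hyn, zero_mul]) ?_ ?_ ?_
    · filter_upwards [(continuous_apply 0).continuousAt.eventually hle,
        (continuous_apply 1).continuousAt.eventually hye,
        (continuous_apply 2).continuousAt.eventually hue] with w e0 e1 e2
      change tri c _ _ _ = 0 ↔ _
      simp only [tri, proj_apply, e0.2, e1.2, e2.2]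
      refine Iff.trans ?_ (mul_eq_zero.trans (or_iff_right
        (mul_ne_zero (mul_ne_zero e0.1 e1.1) e2.1)))
      constructor <;> intro e <;> linear_combination e
    · intro e
      rw [hyn, zero_mul, mul_zero, zero_add] at e
      refine hc ?_
      linear_combination (c 2 * l (z 0) + c 1) * e - c 2 * heq
    · intro e
      refine hc ?_
      linear_combination (c 0) * e - c 2 * heq
    · rw [hyn, hun]
      have := mul_ne_zero (mt hy1.mp k1) (mt hu1.mp k2)
      simpa using this

/-- The singular points of a hypersurface of the family are nodes. -/
theorem isNode_iff {c : Fin 4 → ℂ} (hc : c 0 * c 1 ≠ c 2 * c 3) {x : T τ} :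
    IsNode (hyper τ c) x ↔ x ∈ hyper τ c ∧ SingularAt x := by
  refine ⟨fun h => ⟨h.1, ?_⟩, fun h => isNode_of_singularAt hc h.1 h.2⟩
  by_contra hs
  exact (isSmoothPoint_of_not_singularAt hc h.1 hs).not_isNode h

theorem isSmooth_iff {c : Fin 4 → ℂ} (hc : c 0 * c 1 ≠ c 2 * c 3) :
    IsSmooth (hyper τ c) ↔ ∀ x ∈ hyper τ c, ¬ SingularAt x :=
  ⟨fun h x hx hs => (h x hx).not_isNode (isNode_of_singularAt hc hx hs),
    fun h x hx => isSmoothPoint_of_not_singularAt hc hx (h x hx)⟩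

end Burniat

end

/-! ### Fixed points of the group and counting in fibres -/

noncomputable section

namespace Burniat

open Filter

section

variable {τ : UpperHalfPlane} {x : E τ}

theorem neg_add_eq_self_iff {c : E τ} : -x + c = x ↔ x + x = c := by
  rw [neg_add_eq_iff_eq_add, eq_comm]

theorem actE_zero : actE τ ![0, 0, 0] x = x := rfl

theorem actE_100 : actE τ ![1, 0, 0] x = x ↔ x + x = 0 := by
  change -x = x ↔ _
  rw [neg_eq_iff_add_eq_zero]

theorem actE_010 : actE τ ![0, 1, 0] x = x ↔ x + x = half₂ τ := neg_add_eq_self_iff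

theorem actE_001 : actE τ ![0, 0, 1] x = x ↔ x + x = half₁ τ := neg_add_eq_self_iff

theorem actE_111 : actE τ ![1, 1, 1] x = x ↔ x + x = half₁ τ + half₂ τ := by
  change -(-(-x + half₁ τ) + half₂ τ) = x ↔ _
  rw [show -(-(-x + half₁ τ) + half₂ τ) = -x + (half₁ τ + -half₂ τ) by abel, neg_half₂]
  exact neg_add_eq_self_iff

/-- The elements of `(ℤ/2)³` with a fixed point are `0` and those that act by `z ↦ -z + c`. -/
theorem eq_zero_or_sum_eq_one_of_actE_eq {s : Fin 3 → ZMod 2} (h : actE τ s x = x) :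
    s = 0 ∨ s 0 + s 1 + s 2 = 1 := by
  have key : ∀ s : Fin 3 → ZMod 2, (s = 0 ∨ s 0 + s 1 + s 2 = 1) ∨ s = ![1, 1, 0] ∨
    s = ![1, 0, 1] ∨ s = ![0, 1, 1] := by decide
  rcases key s with h0 | rfl | rfl | rfl
  · exact h0
  · change -(-x + half₂ τ) = x at h
    rw [neg_add, neg_neg, neg_half₂, add_eq_left] at h
    exact absurd h half₂_ne_zero
  · change -(-x + half₁ τ) = x at h
    rw [neg_add, neg_neg, neg_half₁, add_eq_left] at h
    exact absurd h half₁_ne_zero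
  · change -(-x + half₁ τ) + half₂ τ = x at h
    rw [neg_add, neg_neg, neg_half₁, add_assoc, add_eq_left] at h
    exact absurd h half_sum_ne_zero

/-- An element of `(ℤ/2)³` acting by `z ↦ -z + c` fixes only points with `2z = c`. -/
theorem exists_add_self_of_actE_eq {s : Fin 3 → ZMod 2} (hs : s 0 + s 1 + s 2 = 1) :
    ∃ c : E τ, ∀ x, actE τ s x = x ↔ x + x = c := by
  have key : ∀ s : Fin 3 → ZMod 2, s 0 + s 1 + s 2 = 1 → s = ![1, 0, 0] ∨ s = ![0, 1, 0] ∨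
    s = ![0, 0, 1] ∨ s = ![1, 1, 1] := by decide
  rcases key s hs with rfl | rfl | rfl | rfl
  · exact ⟨_, fun x => actE_100⟩
  · exact ⟨_, fun x => actE_010⟩
  · exact ⟨_, fun x => actE_001⟩
  · exact ⟨_, fun x => actE_111⟩

/-- The zeros of a linear form in the coordinates of the Legendre function. -/
def linFibre (τ : UpperHalfPlane) (a b : ℂ) : Set (E τ) :=
  {x | a * (legendre τ x).1 + b * (legendre τ x).2 = 0}

theorem encard_linFibre {a b : ℂ} (hab : a ≠ 0 ∨ b ≠ 0) (h : ∀ x ∈ linFibre τ a b, x + x ≠ 0) :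
    (linFibre τ a b).encard = 2 := by
  have e : linFibre τ a b = {x | (legendre τ x).1 * a = (legendre τ x).2 * -b} := by
    ext x
    change a * _ + b * _ = 0 ↔ _ * a = _ * -b
    constructor <;> intro h <;> linear_combination h
  rw [e] at h ⊢
  exact encard_legendre_fibre h (hab.symm.imp neg_ne_zero.mpr id)

theorem encard_linFibre_of_branch {a b : ℂ} (hab : a ≠ 0 ∨ b ≠ 0) {x₀ : E τ}
    (h : x₀ ∈ linFibre τ a b) (hx₀ : x₀ + x₀ = 0) : (linFibre τ a b).encard = 1 := by
  have e : linFibre τ a b = {x | (legendre τ x).1 * a = (legendre τ x).2 * -b} := by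
    ext x
    change a * _ + b * _ = 0 ↔ _ * a = _ * -b
    constructor <;> intro h <;> linear_combination h
  rw [e] at h ⊢
  exact encard_legendre_branch_fibre h hx₀ (hab.symm.imp neg_ne_zero.mpr id)

/-- The zeros of the Legendre function. -/
def zeros (τ : UpperHalfPlane) : Set (E τ) := {x | (legendre τ x).1 = 0}

/-- The poles of the Legendre function. -/
def poles (τ : UpperHalfPlane) : Set (E τ) := {x | (legendre τ x).2 = 0}

theorem encard_zeros : (zeros τ).encard = 2 := by
  have : zeros τ = linFibre τ 1 0 := by ext; simp [zeros, linFibre]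
  rw [this]
  refine encard_linFibre (Or.inl one_ne_zero) fun x hx h => (legendre_ne_zero_of_add_self h).1 ?_
  rwa [← this] at hx

theorem encard_poles : (poles τ).encard = 2 := by
  have : poles τ = linFibre τ 0 1 := by ext; simp [poles, linFibre]
  rw [this]
  refine encard_linFibre (Or.inr one_ne_zero) fun x hx h => (legendre_ne_zero_of_add_self h).2 ?_
  rwa [← this] at hx

/-- The points of order two. -/
def twoTorsion (τ : UpperHalfPlane) : Set (E τ) := {x | x + x = 0}

theorem encard_twoTorsion : (twoTorsion τ).encard = 4 := encard_two_torsion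

theorem encard_add_self_eq (c : E τ) : {x : E τ | x + x = c}.encard = 4 := by
  obtain ⟨z, rfl⟩ := cls_surjective c
  have e : {x : E τ | x + x = cls τ z} = (· + cls τ (z / 2)) '' twoTorsion τ := by
    ext x
    rw [Set.image_add_right]
    change x + x = _ ↔ x + -cls τ (z / 2) + (x + -cls τ (z / 2)) = 0
    have : cls τ z = cls τ (z / 2) + cls τ (z / 2) := by rw [← cls_add]; congr 1; ring
    rw [this, ← sub_eq_zero]
    constructor <;> intro h <;> rw [← h] <;> abel
  rw [e, (add_left_injective _).injOn.encard_image, encard_twoTorsion]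

end

variable {τ : Fin 3 → UpperHalfPlane}

section

variable {i j k : Fin 3} (hij : i ≠ j) (hik : i ≠ k) (hjk : j ≠ k)
include hij hik hjk

theorem bijective_coords :
    Function.Bijective fun x : T τ => (((x i, x j), x k) : (E (τ i) × E (τ j)) × E (τ k)) := by
  constructor
  · intro x y h
    simp only [Prod.mk.injEq] at h
    ext l
    rcases eq_or_eq_or_eq_of_ne hij hik hjk l with rfl | rfl | rfl
    exacts [h.1.1, h.1.2, h.2]
  · rintro ⟨⟨a, b⟩, e⟩
    refine ⟨Function.update (Function.update (Function.update 0 i a) j b) k e, ?_⟩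
    simp [Function.update_of_ne hij, Function.update_of_ne hik, Function.update_of_ne hjk]

/-- Counting points over pairs of coordinates. -/
theorem encard_fibred {R : Set (E (τ i) × E (τ j))} {Φ : E (τ i) × E (τ j) → Set (E (τ k))}
    {m n : ℕ} (hR : R.encard = m) (hΦ : ∀ p ∈ R, (Φ p).encard = n) :
    {x : T τ | (x i, x j) ∈ R ∧ x k ∈ Φ (x i, x j)}.encard = (m * n : ℕ) := by
  have hRf : R.Finite := Set.finite_of_encard_eq_coe hR
  have e : {x : T τ | (x i, x j) ∈ R ∧ x k ∈ Φ (x i, x j)} =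
      (fun x : T τ => (((x i, x j), x k) : (E (τ i) × E (τ j)) × E (τ k))) ⁻¹'
        ⋃ p ∈ R, Prod.mk p '' Φ p := by
    ext x
    simp only [Set.mem_ofPred_eq, Set.mem_preimage, Set.mem_iUnion, Set.mem_image, Prod.mk.injEq]
    constructor
    · exact fun h => ⟨_, h.1, _, h.2, rfl, rfl⟩
    · rintro ⟨p, hp, y, hy, rfl, rfl⟩
      exact ⟨hp, hy⟩
  rw [e, Set.encard_preimage_of_bijective (bijective_coords hij hik hjk), hRf.encard_biUnion]
  · have : ∀ p ∈ R, (Prod.mk p '' Φ p).encard = n := fun p hp => by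
      rw [(Prod.mk_right_injective p).injOn.encard_image, hΦ p hp]
    rw [finsum_mem_congr rfl this]
    have h2 : R.ncard = m := by rw [Set.ncard, hR]; rfl
    rw [finsum_mem_eq_finite_toFinset_sum _ hRf]
    simp only [Finset.sum_const, nsmul_eq_mul, Nat.cast_mul]
    rw [← Set.ncard_eq_toFinset_card R hRf, h2]
  · intro p _ q _ hpq
    refine Set.disjoint_left.mpr ?_
    rintro _ ⟨y, -, rfl⟩ ⟨z, -, h⟩
    exact hpq (Prod.ext_iff.mp h).1.symm

/-- Over each pair of a set `R` of `m` pairs, a linear equation in the remaining Legendre function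
without solutions of order two has two solutions. -/
theorem encard_linFibred {R : Set (E (τ i) × E (τ j))} {m N : ℕ} (hR : R.encard = m)
    (hN : m * 2 = N) (A B : E (τ i) × E (τ j) → ℂ) (hAB : ∀ p ∈ R, A p ≠ 0 ∨ B p ≠ 0)
    (hne : ∀ p ∈ R, ∀ y ∈ linFibre (τ k) (A p) (B p), y + y ≠ 0) :
    {x : T τ | (x i, x j) ∈ R ∧ x k ∈ linFibre (τ k) (A (x i, x j)) (B (x i, x j))}.encard = N := by
  subst hN
  exact encard_fibred hij hik hjk (Φ := fun p => linFibre (τ k) (A p) (B p)) hR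
    fun p hp => encard_linFibre (hAB p hp) (hne p hp)

theorem encard_linFibred_of_branch {R : Set (E (τ i) × E (τ j))} {m : ℕ} (hR : R.encard = m)
    (A B : E (τ i) × E (τ j) → ℂ) (hAB : ∀ p ∈ R, A p ≠ 0 ∨ B p ≠ 0)
    (hne : ∀ p ∈ R, ∃ y ∈ linFibre (τ k) (A p) (B p), y + y = 0) :
    {x : T τ | (x i, x j) ∈ R ∧ x k ∈ linFibre (τ k) (A (x i, x j)) (B (x i, x j))}.encard = m := by
  have := encard_fibred hij hik hjk (Φ := fun p => linFibre (τ k) (A p) (B p)) (n := 1) hR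
    fun p hp => by
      obtain ⟨y, h1, h2⟩ := hne p hp
      exact encard_linFibre_of_branch (hAB p hp) h1 h2
  rwa [mul_one] at this

end

/-! ### Fixed loci of dimension one -/

theorem fixOn_coord {X : Set (T τ)} {g : G} {x : T τ} (h : x ∈ fixOn X g) (l : Fin 3) :
    actE (τ l) (g l) (x l) = x l := congrFun h.2 l

theorem isSubmanifoldAt_of_add_self_eq {C : Set (T τ)} {i j : Fin 3} (hij : i ≠ j) {a : E (τ i)}
    {b : E (τ j)} (hC : ∀ x, x ∈ C ↔ x i + x i = a ∧ x j + x j = b) {x : T τ} (hx : x ∈ C) :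
    IsSubmanifoldAt 2 C x := by
  obtain ⟨z, rfl⟩ := proj_surjective x
  obtain ⟨rfl, rfl⟩ := (hC _).mp hx
  refine isSubmanifoldAt_of_coords hij z ?_
  filter_upwards [(continuous_apply i).continuousAt.eventually
    (eventually_cls_add_self_eq_iff (τ := τ i) (z i)),
    (continuous_apply j).continuousAt.eventually
      (eventually_cls_add_self_eq_iff (τ := τ j) (z j))] with w h1 h2
  rw [hC]
  exact and_congr h1 h2

theorem single_mem_tangentVectors_fixOn {g : G} {j : Fin 3} (hj : g j = 0) {x : T τ}
    (hx : x ∈ fixOn Set.univ g) :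
    (Pi.single j 1 : Fin 3 → ℂ) ∈ tangentVectors (fixOn Set.univ g) x := by
  obtain ⟨z, rfl⟩ := proj_surjective x
  have hd : ∀ t : ℂ, HasDerivAt (fun t : ℂ => z + t • (Pi.single j 1 : Fin 3 → ℂ))
      (Pi.single j 1) t := fun t => by
    simpa using ((hasDerivAt_id t).smul_const (Pi.single j 1 : Fin 3 → ℂ)).const_add z
  refine ⟨fun t => z + t • Pi.single j 1, ⟨by fun_prop, Eventually.of_forall fun t => ?_⟩, by simp,
    (hd 0).deriv⟩
  refine ⟨trivial, ?_⟩
  ext l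
  by_cases hl : l = j
  · subst hl
    change actE (τ l) (g l) _ = _
    rw [hj]
    rfl
  · have := fixOn_coord hx l
    simpa [act, proj_apply, hl] using this

/-- The fixed locus has dimension one exactly if one factor is fixed pointwise and the other two
components of `g` act by `z ↦ -z + c`. -/
theorem hasFixDimOne_iff {g : G} : HasFixDimOne τ g ↔
    ∃ i j k : Fin 3, i ≠ j ∧ i ≠ k ∧ j ≠ k ∧ g k = 0 ∧ g i 0 + g i 1 + g i 2 = 1 ∧
      g j 0 + g j 1 + g j 2 = 1 := by
  constructor
  · rintro ⟨⟨x, hx⟩, h⟩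
    have hpar := fun l => eq_zero_or_sum_eq_one_of_actE_eq (fixOn_coord hx l)
    obtain ⟨⟨v, hv, hv0⟩, hline⟩ := (h x hx).tangentVectors_line
    have h1 : ∃ k, g k = 0 := by
      by_contra! hne
      refine hv0 (funext fun l => ?_)
      obtain ⟨c, hc⟩ := exists_add_self_of_actE_eq (τ := τ l) ((hpar l).resolve_left (hne l))
      exact coord_eq_zero_of_mem_tangentVectors (C := fixOn Set.univ g) (c := c)
        (fun y hy => (hc _).mp (fixOn_coord hy l)) hv
    have h2 : ∀ i k, g i = 0 → g k = 0 → i = k := by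
      intro i k hi hk
      by_contra hik
      obtain ⟨c, hc⟩ := hline _ (single_mem_tangentVectors_fixOn hi hx)
        (fun h => one_ne_zero (α := ℂ) (by simpa using congrFun h i)) _
        (single_mem_tangentVectors_fixOn hk hx)
      have := congrFun hc k
      simp [Ne.symm hik] at this
    obtain ⟨k, hk⟩ := h1
    have h3 : ∀ k : Fin 3, ∃ i j, i ≠ j ∧ i ≠ k ∧ j ≠ k := by decide
    obtain ⟨i, j, hij, hik, hjk⟩ := h3 k
    exact ⟨i, j, k, hij, hik, hjk, hk, (hpar i).resolve_left fun h => hik (h2 _ _ h hk),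
      (hpar j).resolve_left fun h => hjk (h2 _ _ h hk)⟩
  · rintro ⟨i, j, k, hij, hik, hjk, hk, hi, hj⟩
    obtain ⟨a, ha⟩ := exists_add_self_of_actE_eq (τ := τ i) hi
    obtain ⟨b, hb⟩ := exists_add_self_of_actE_eq (τ := τ j) hj
    have hC : ∀ x : T τ, x ∈ fixOn Set.univ g ↔ x i + x i = a ∧ x j + x j = b := by
      intro x
      rw [← ha, ← hb]
      constructor
      · exact fun h => ⟨fixOn_coord h i, fixOn_coord h j⟩
      · rintro ⟨h1, h2⟩
        refine ⟨trivial, funext fun l => ?_⟩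
        rcases eq_or_eq_or_eq_of_ne hij hik hjk l with rfl | rfl | rfl
        · exact h1
        · exact h2
        · change actE _ (g l) _ = _
          rw [hk]
          rfl
    refine ⟨?_, fun x hx => isSubmanifoldAt_of_add_self_eq hij hC hx⟩
    have hne : ∀ {τ : UpperHalfPlane} (c : E τ), ∃ x, x + x = c := fun {τ} c => by
      have : {x : E τ | x + x = c}.Nonempty := by
        rw [← Set.encard_ne_zero, encard_add_self_eq]
        norm_num
      exact this
    obtain ⟨x, hx⟩ := hne a
    obtain ⟨y, hy⟩ := hne b
    obtain ⟨t, ht⟩ := (bijective_coords (τ := τ) hij hik hjk).2 ((x, y), 0)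
    simp only [Prod.mk.injEq] at ht
    exact ⟨t, (hC t).mpr ⟨by rw [ht.1.1, hx], by rw [ht.1.2, hy]⟩⟩

end Burniat

end

/-! ### Shapes of fixed loci on a hypersurface given by a trilinear form -/

noncomputable section

namespace Burniat

open Filter

variable {τ : Fin 3 → UpperHalfPlane}

section

variable {X F : Set (T τ)}

theorem HasShape.nonempty {p n e c : ℕ} (h : HasShape X F p n e c) (hpos : p + n + e + c ≠ 0) :
    F.Nonempty := by
  obtain ⟨P, N, Es, Cs, hP, -, hN, -, hE, hE', hC, hC', -, -, -, -, rfl⟩ := h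
  have hne : ∀ {α : Type} {s : Set α} {m : ℕ}, s.encard = m → m ≠ 0 → s.Nonempty :=
    fun h hm => Set.encard_ne_zero.mp (by rw [h]; exact_mod_cast hm)
  have : p ≠ 0 ∨ n ≠ 0 ∨ e ≠ 0 ∨ c ≠ 0 := by omega
  rcases this with h | h | h | h
  · exact (hne hP h).mono fun x hx => Or.inl (Or.inl hx)
  · exact (hne hN h).mono fun x hx => Or.inl (Or.inr hx)
  · obtain ⟨C, hC⟩ := hne hE h
    exact (hE' C hC).2.1.nonempty.mono fun x hx => Or.inr ⟨C, Or.inl hC, hx⟩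
  · obtain ⟨C, hC⟩ := hne hC h
    exact (hC' C hC).2.1.nonempty.mono fun x hx => Or.inr ⟨C, Or.inr hC, hx⟩

/-- A locus that consists of isolated points only. -/
theorem hasShape_points_nodes {P N : Set (T τ)} {p n : ℕ} (hP : P.encard = p)
    (hPs : ∀ x ∈ P, IsSmoothPoint X x) (hN : N.encard = n) (hNn : ∀ x ∈ N, IsNode X x)
    (hF : ∀ x, x ∈ F ↔ x ∈ P ∨ x ∈ N) : HasShape X F p n 0 0 := by
  refine ⟨P, N, ∅, ∅, hP, hPs, hN, hNn, by simp, by simp, by simp, by simp, by simp, by simp, ?_,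
    by simp, ?_⟩
  · exact Set.disjoint_left.mpr fun x h1 h2 => (hPs x h1).not_isNode (hNn x h2)
  · ext x
    simp [hF]

theorem hasShape_points {p : ℕ} (hF : F.encard = p) (hs : ∀ x ∈ F, IsSmoothPoint X x) :
    HasShape X F p 0 0 0 :=
  hasShape_points_nodes hF hs (N := ∅) (by simp) (by simp) (by simp)

/-- If the slices at the four points of order two of a factor are curves of genus five, they make up
the locus where this coordinate has order two. -/
theorem hasShape_slices (l : Fin 3) (hF : ∀ x, x ∈ F ↔ x ∈ X ∧ x l + x l = 0)
    (hs : ∀ x ∈ F, IsSmoothPoint X x)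
    (hg : ∀ a : E (τ l), a + a = 0 → IsCurveOfGenus 5 {x | x ∈ X ∧ x l = a}) :
    HasShape X F 0 0 0 4 := by
  set f : E (τ l) → Set (T τ) := fun a => {x | x ∈ X ∧ x l = a} with hf
  have hinj : Set.InjOn f (twoTorsion (τ l)) := by
    intro a ha b _ hab
    obtain ⟨x, hx⟩ := (hg a ha).2.1.nonempty
    have hx' : x ∈ f b := hab ▸ hx
    exact hx.2.symm.trans hx'.2
  have hU : ∀ x, x ∈ ⋃₀ (∅ ∪ f '' twoTorsion (τ l)) ↔ x ∈ F := by
    intro x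
    rw [hF, Set.empty_union, Set.mem_sUnion]
    constructor
    · rintro ⟨_, ⟨a, ha, rfl⟩, hx⟩
      exact ⟨hx.1, by rw [hx.2]; exact ha⟩
    · exact fun h => ⟨_, ⟨x l, h.2, rfl⟩, h.1, rfl⟩
  refine ⟨∅, ∅, ∅, f '' twoTorsion (τ l), by simp, by simp, by simp, by simp, by simp, by simp,
    ?_, ?_, fun x hx => hs x ((hU x).mp hx), ?_, by simp, by simp, ?_⟩
  · rw [hinj.encard_image, encard_twoTorsion]
    rfl
  · rintro _ ⟨a, ha, rfl⟩
    exact hg a ha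
  · rw [Set.empty_union]
    rintro _ ⟨a, -, rfl⟩ _ ⟨b, -, rfl⟩ hab
    refine Set.disjoint_left.mpr fun x h1 h2 => hab ?_
    rw [← h1.2, ← h2.2]
  · ext x
    rw [Set.mem_union, hU]
    simp

end

/-- The points at which the hypersurface `IsTri` can be singular, cf. `SingularAt`. -/
def SingAt (k i j : Fin 3) (x : T τ) : Prop :=
  x k + x k = 0 ∧ ((x i + x i = 0 ∧ x j + x j = 0) ∨
    (x i ∈ zeros (τ i) ∧ x j ∈ zeros (τ j)) ∨ (x i ∈ poles (τ i) ∧ x j ∈ poles (τ j)))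

/-- `X` is the zero locus of the trilinear form `tri c` in the Legendre functions of the coordinates
`k, i, j` (in this order), smooth outside the points `SingAt` and with nodes there. -/
structure IsTri (X : Set (T τ)) (k i j : Fin 3) (c : Fin 4 → ℂ) : Prop where
  hki : k ≠ i
  hkj : k ≠ j
  hij : i ≠ j
  det : c 0 * c 1 ≠ c 2 * c 3
  mem : ∀ x, x ∈ X ↔ tri c (legendre (τ k) (x k)) (legendre (τ i) (x i)) (legendre (τ j) (x j)) = 0
  smooth : ∀ x ∈ X, ¬ SingAt k i j x → IsSmoothPoint X x
  node : ∀ x ∈ X, SingAt k i j x → IsNode X x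

/-- No point of `X` has order two. -/
def NoTwoTorsion (X : Set (T τ)) : Prop := ∀ x ∈ X, ¬ ∀ l, x l + x l = 0

/-- The coefficient `c₀ℒ + c₃` of `ℒᵢℒⱼ` in the form `tri c`. -/
def phi₁ (c : Fin 4 → ℂ) (p : ℂ × ℂ) : ℂ := c 0 * p.1 + c 3 * p.2

/-- The coefficient `c₂ℒ + c₁` of `1` in the form `tri c`. -/
def phi₂ (c : Fin 4 → ℂ) (p : ℂ × ℂ) : ℂ := c 2 * p.1 + c 1 * p.2

namespace IsTri

variable {X F : Set (T τ)} {k i j : Fin 3} {c : Fin 4 → ℂ}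

theorem symm (h : IsTri X k i j c) : IsTri X k j i c where
  hki := h.hkj
  hkj := h.hki
  hij := h.hij.symm
  det := h.det
  mem x := by
    rw [h.mem]
    simp only [tri]
    constructor <;> intro h <;> linear_combination h
  smooth x hx hs := h.smooth x hx fun hs' => hs <| by
    unfold SingAt at hs' ⊢
    tauto
  node x hx hs := h.node x hx <| by
    unfold SingAt at hs ⊢
    tauto

theorem all (h : IsTri X k i j c) (l : Fin 3) : l = k ∨ l = i ∨ l = j :=
  eq_or_eq_or_eq_of_ne h.hki h.hkj h.hij l

theorem exists_mem (h : IsTri X k i j c) (a : E (τ k)) (b : E (τ i)) (d : E (τ j)) :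
    ∃ x : T τ, x k = a ∧ x i = b ∧ x j = d := by
  obtain ⟨x, hx⟩ := (bijective_coords (τ := τ) h.hki h.hkj h.hij).2 ((a, b), d)
  simp only [Prod.mk.injEq] at hx
  exact ⟨x, hx.1.1, hx.1.2, hx.2⟩

theorem tri_ne_zero (h : IsTri X k i j c) (hX : NoTwoTorsion X) {a : E (τ k)} {b : E (τ i)}
    {d : E (τ j)} (ha : a + a = 0) (hb : b + b = 0) (hd : d + d = 0) :
    tri c (legendre (τ k) a) (legendre (τ i) b) (legendre (τ j) d) ≠ 0 := by
  obtain ⟨x, rfl, rfl, rfl⟩ := h.exists_mem a b d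
  intro h0
  refine hX x ((h.mem x).mpr h0) fun l => ?_
  rcases h.all l with rfl | rfl | rfl <;> assumption

/-- `phi₁` and `phi₂` have no common root. -/
theorem phi_eq_zero (h : IsTri X k i j c) {p : ℂ × ℂ} (h1 : phi₁ c p = 0) (h2 : phi₂ c p = 0) :
    p.1 = 0 ∧ p.2 = 0 := by
  unfold phi₁ at h1
  unfold phi₂ at h2
  have e1 : (c 0 * c 1 - c 2 * c 3) * p.1 = 0 := by linear_combination c 1 * h1 - c 3 * h2
  have e2 : (c 0 * c 1 - c 2 * c 3) * p.2 = 0 := by linear_combination c 0 * h2 - c 2 * h1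
  have := sub_ne_zero.mpr h.det
  exact ⟨(mul_eq_zero.mp e1).resolve_left this, (mul_eq_zero.mp e2).resolve_left this⟩

/-- At a point `a` of order two of the factor `k`, the equation is `phi₁ ℒᵢ ℒⱼ + phi₂ = 0`, which is
nondegenerate if `a` is not a root of `phi₁` or `phi₂`. -/
theorem isCurveOfGenus_slice (h : IsTri X k i j c) (hX : NoTwoTorsion X) {a : E (τ k)}
    (ha : a + a = 0) (h1 : phi₁ c (legendre (τ k) a) ≠ 0) (h2 : phi₂ c (legendre (τ k) a) ≠ 0) :
    IsCurveOfGenus 5 {x | x ∈ X ∧ x k = a} := by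
  have e : ∀ q r, bilin (phi₁ c (legendre (τ k) a)) 0 0 (phi₂ c (legendre (τ k) a)) q r =
      tri c (legendre (τ k) a) q r := fun q r => by
    simp only [bilin, tri, phi₁, phi₂]
    ring
  have hs : {x | x ∈ X ∧ x k = a} =
      biCurve i j k a (phi₁ c (legendre (τ k) a)) 0 0 (phi₂ c (legendre (τ k) a)) := by
    ext x
    simp only [biCurve, Set.mem_ofPred_eq, e, h.mem]
    exact ⟨fun h => ⟨h.2, h.2 ▸ h.1⟩, fun h => ⟨h.1 ▸ h.2, h.1⟩⟩
  rw [hs]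
  refine isCurveOfGenus_biCurve h.hij h.hki.symm h.hkj.symm a ?_ fun x y hx hy => ?_
  · rw [mul_zero]
    exact mul_ne_zero h1 h2
  · rw [e]
    exact h.tri_ne_zero hX ha hx hy

/-- The slices at the points of order two of the factor `j` are always nondegenerate. -/
theorem isCurveOfGenus_slice_right (h : IsTri X k i j c) (hX : NoTwoTorsion X) {a : E (τ j)}
    (ha : a + a = 0) : IsCurveOfGenus 5 {x | x ∈ X ∧ x j = a} := by
  set r := legendre (τ j) a with hr
  have e : ∀ p q, bilin (c 0 * r.1) (c 2 * r.2) (c 3 * r.1) (c 1 * r.2) p q = tri c p q r :=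
    fun p q => by
      simp only [bilin, tri]
      ring
  have hs : {x | x ∈ X ∧ x j = a} =
      biCurve k i j a (c 0 * r.1) (c 2 * r.2) (c 3 * r.1) (c 1 * r.2) := by
    ext x
    simp only [biCurve, Set.mem_ofPred_eq, e, h.mem]
    exact ⟨fun h => ⟨h.2, by rw [hr, ← h.2]; exact h.1⟩,
      fun h => ⟨by rw [h.1]; exact h.2, h.1⟩⟩
  rw [hs]
  obtain ⟨r1, r2⟩ := legendre_ne_zero_of_add_self ha
  refine isCurveOfGenus_biCurve h.hki h.hkj h.hij a (fun h0 => h.det ?_) fun x y hx hy => ?_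
  · refine mul_left_cancel₀ (mul_ne_zero r1 r2) ?_
    linear_combination h0
  · rw [e]
    exact h.tri_ne_zero hX hx hy ha

/-- At a point of a hypersurface without points of order two one of whose coordinates `i, j` has
order two, the hypersurface is smooth. -/
theorem smooth_of_right (h : IsTri X k i j c) (hX : NoTwoTorsion X) {x : T τ} (hx : x ∈ X)
    (hj : x j + x j = 0) : IsSmoothPoint X x := by
  refine h.smooth x hx ?_
  have := legendre_ne_zero_of_add_self hj
  rintro ⟨h0, ⟨h1, h2⟩ | ⟨h1, h2⟩ | ⟨h1, h2⟩⟩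
  · refine hX x hx fun l => ?_
    rcases h.all l with rfl | rfl | rfl <;> assumption
  · exact this.1 h2
  · exact this.2 h2

theorem hasShape_slices_right (h : IsTri X k i j c) (hX : NoTwoTorsion X)
    (hF : ∀ x, x ∈ F ↔ x ∈ X ∧ x j + x j = 0) : HasShape X F 0 0 0 4 :=
  hasShape_slices j hF (fun x hx => h.smooth_of_right hX ((hF x).mp hx).1 ((hF x).mp hx).2)
    fun _ ha => h.isCurveOfGenus_slice_right hX ha

theorem hasShape_slices_left (h : IsTri X k i j c) (hX : NoTwoTorsion X)
    (hφ : ∀ a : E (τ k), a + a = 0 →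
      phi₁ c (legendre (τ k) a) ≠ 0 ∧ phi₂ c (legendre (τ k) a) ≠ 0)
    (hs : IsSmooth X) (hF : ∀ x, x ∈ F ↔ x ∈ X ∧ x k + x k = 0) : HasShape X F 0 0 0 4 :=
  hasShape_slices k hF (fun x hx => hs x ((hF x).mp hx).1)
    fun a ha => h.isCurveOfGenus_slice hX ha (hφ a ha).1 (hφ a ha).2

theorem encard_pairs {τ₁ τ₂ : UpperHalfPlane} :
    (twoTorsion τ₁ ×ˢ twoTorsion τ₂).encard = (16 : ℕ) := by
  rw [Set.encard_prod, encard_twoTorsion, encard_twoTorsion]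
  norm_num

/-- Over each pair of points of order two in the factors `i, j` there are two points of `X`. -/
theorem hasShape_pairs_right (h : IsTri X k i j c) (hX : NoTwoTorsion X)
    (hF : ∀ x, x ∈ F ↔ x ∈ X ∧ x i + x i = 0 ∧ x j + x j = 0) : HasShape X F 32 0 0 0 := by
  refine hasShape_points ?_ fun x hx => h.smooth_of_right hX ((hF x).mp hx).1 ((hF x).mp hx).2.2
  set A : E (τ i) × E (τ j) → ℂ := fun y => phi₁ ![c 0, c 1, c 3, c 2]
    ((legendre (τ i) y.1).1 * (legendre (τ j) y.2).1,
      (legendre (τ i) y.1).2 * (legendre (τ j) y.2).2) with hA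
  set B : E (τ i) × E (τ j) → ℂ := fun y => phi₂ ![c 0, c 1, c 3, c 2]
    ((legendre (τ i) y.1).1 * (legendre (τ j) y.2).1,
      (legendre (τ i) y.1).2 * (legendre (τ j) y.2).2) with hB
  have e : ∀ (y : E (τ i) × E (τ j)) (t : E (τ k)),
      A y * (legendre (τ k) t).1 + B y * (legendre (τ k) t).2 =
        tri c (legendre (τ k) t) (legendre (τ i) y.1) (legendre (τ j) y.2) := fun y t => by
    simp only [hA, hB, phi₁, phi₂, tri, Matrix.cons_val]
    ring
  have hF' : F = {x | (x i, x j) ∈ twoTorsion (τ i) ×ˢ twoTorsion (τ j) ∧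
      x k ∈ linFibre (τ k) (A (x i, x j)) (B (x i, x j))} := by
    ext x
    rw [hF, h.mem, ← e (x i, x j), and_comm]
    rfl
  rw [hF']
  refine encard_linFibred h.hij h.hki.symm h.hkj.symm encard_pairs rfl A B (fun y hy => ?_)
    fun y hy t ht hc => ?_
  · by_contra! h0
    obtain ⟨z1, z2⟩ := h0
    simp only [hA, hB, phi₁, phi₂, Matrix.cons_val] at z1 z2
    have e1 : (c 0 * c 1 - c 2 * c 3) *
        ((legendre (τ i) y.1).1 * (legendre (τ j) y.2).1) = 0 := by
      linear_combination c 1 * z1 - c 2 * z2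
    exact mul_ne_zero (sub_ne_zero.mpr h.det)
      (mul_ne_zero (legendre_ne_zero_of_add_self hy.1).1 (legendre_ne_zero_of_add_self hy.2).1) e1
  · exact h.tri_ne_zero hX hc hy.1 hy.2 ((e y t).symm.trans ht)

/-- Over each pair of points of order two in the factors `k, j` there are two points of `X`. -/
theorem hasShape_pairs_left (h : IsTri X k i j c) (hX : NoTwoTorsion X)
    (hF : ∀ x, x ∈ F ↔ x ∈ X ∧ x k + x k = 0 ∧ x j + x j = 0) : HasShape X F 32 0 0 0 := by
  refine hasShape_points ?_ fun x hx => h.smooth_of_right hX ((hF x).mp hx).1 ((hF x).mp hx).2.2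
  set A : E (τ k) × E (τ j) → ℂ := fun y => phi₁ c (legendre (τ k) y.1) * (legendre (τ j) y.2).1
    with hA
  set B : E (τ k) × E (τ j) → ℂ := fun y => phi₂ c (legendre (τ k) y.1) * (legendre (τ j) y.2).2
    with hB
  have e : ∀ (y : E (τ k) × E (τ j)) (t : E (τ i)),
      A y * (legendre (τ i) t).1 + B y * (legendre (τ i) t).2 =
        tri c (legendre (τ k) y.1) (legendre (τ i) t) (legendre (τ j) y.2) := fun y t => by
    simp only [hA, hB, phi₁, phi₂, tri]
    ring
  have hF' : F = {x | (x k, x j) ∈ twoTorsion (τ k) ×ˢ twoTorsion (τ j) ∧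
      x i ∈ linFibre (τ i) (A (x k, x j)) (B (x k, x j))} := by
    ext x
    rw [hF, h.mem, ← e (x k, x j), and_comm]
    rfl
  rw [hF']
  refine encard_linFibred h.hkj h.hki h.hij.symm encard_pairs rfl A B (fun y hy => ?_)
    fun y hy t ht hc => ?_
  · by_contra! h0
    have hr := legendre_ne_zero_of_add_self hy.2
    exact (legendre_ne_zero_of_add_self hy.1).1 (h.phi_eq_zero
      ((mul_eq_zero.mp h0.1).resolve_right hr.1) ((mul_eq_zero.mp h0.2).resolve_right hr.2)).1
  · exact h.tri_ne_zero hX hy.1 hc hy.2 ((e y t).symm.trans ht)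

/-! ### Zeros and poles -/

/-- The pairs of two zeros or of two poles. -/
def evenPairs (τ₁ τ₂ : UpperHalfPlane) : Set (E τ₁ × E τ₂) :=
  zeros τ₁ ×ˢ zeros τ₂ ∪ poles τ₁ ×ˢ poles τ₂

/-- The pairs of a zero and a pole. -/
def oddPairs (τ₁ τ₂ : UpperHalfPlane) : Set (E τ₁ × E τ₂) :=
  zeros τ₁ ×ˢ poles τ₂ ∪ poles τ₁ ×ˢ zeros τ₂

theorem encard_evenPairs {τ₁ τ₂ : UpperHalfPlane} : (evenPairs τ₁ τ₂).encard = (8 : ℕ) := by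
  rw [evenPairs, Set.encard_union_eq, Set.encard_prod, Set.encard_prod, encard_zeros, encard_zeros,
    encard_poles, encard_poles]
  · norm_num
  · exact Set.disjoint_left.mpr fun x h1 h2 => legendre_ne_zero h1.1 h2.1

theorem encard_oddPairs {τ₁ τ₂ : UpperHalfPlane} : (oddPairs τ₁ τ₂).encard = (8 : ℕ) := by
  rw [oddPairs, Set.encard_union_eq, Set.encard_prod, Set.encard_prod, encard_zeros, encard_zeros,
    encard_poles, encard_poles]
  · norm_num
  · exact Set.disjoint_left.mpr fun x h1 h2 => legendre_ne_zero h1.1 h2.1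

theorem disjoint_pairs {τ₁ τ₂ : UpperHalfPlane} {y : E τ₁ × E τ₂} (h1 : y ∈ evenPairs τ₁ τ₂)
    (h2 : y ∈ oddPairs τ₁ τ₂) : False := by
  rcases h1 with h1 | h1 <;> rcases h2 with h2 | h2
  exacts [legendre_ne_zero h1.2 h2.2, legendre_ne_zero h1.1 h2.1, legendre_ne_zero h2.1 h1.1,
    legendre_ne_zero h2.2 h1.2]

theorem add_self_eq_half₁_pair_iff {τ₁ τ₂ : UpperHalfPlane} {a : E τ₁} {b : E τ₂} :
    (a + a = half₁ τ₁ ∧ b + b = half₁ τ₂) ↔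
      (a, b) ∈ evenPairs τ₁ τ₂ ∨ (a, b) ∈ oddPairs τ₁ τ₂ := by
  rw [add_self_eq_half₁_iff, add_self_eq_half₁_iff]
  simp only [evenPairs, oddPairs, Set.mem_union, Set.mem_prod, zeros, poles, Set.mem_ofPred_eq]
  tauto

/-- Over a pair of a zero and a pole every term of the trilinear form vanishes. -/
theorem mem_of_oddPairs (h : IsTri X k i j c) {x : T τ}
    (hx : (x i, x j) ∈ oddPairs (τ i) (τ j)) : x ∈ X := by
  rw [h.mem]
  simp only [tri]
  rcases hx with ⟨h1, h2⟩ | ⟨h1, h2⟩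
  · simp only [zeros, poles, Set.mem_ofPred_eq] at h1 h2
    simp [h1, h2]
  · simp only [zeros, poles, Set.mem_ofPred_eq] at h1 h2
    simp [h1, h2]

theorem smooth_of_oddPairs (h : IsTri X k i j c) {x : T τ}
    (hx : (x i, x j) ∈ oddPairs (τ i) (τ j)) : IsSmoothPoint X x := by
  refine h.smooth x (h.mem_of_oddPairs hx) ?_
  rintro ⟨-, ⟨h1, -⟩ | h1⟩
  · have := legendre_ne_zero_of_add_self h1
    rcases hx with h2 | h2
    exacts [this.1 h2.1, this.2 h2.1]
  · exact disjoint_pairs (by exact h1) hx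

theorem singAt_iff_of_evenPairs {x : T τ} (hx : (x i, x j) ∈ evenPairs (τ i) (τ j)) :
    SingAt k i j x ↔ x k + x k = 0 :=
  ⟨fun h => h.1, fun h => ⟨h, Or.inr hx⟩⟩

open Classical in
/-- The points of `X` over pairs of two zeros or of two poles. -/
theorem mem_iff_of_evenPairs (h : IsTri X k i j c) {x : T τ}
    (hx : (x i, x j) ∈ evenPairs (τ i) (τ j)) :
    x ∈ X ↔ x k ∈ linFibre (τ k) (if (x i, x j).1 ∈ zeros (τ i) then c 2 else c 0)
      (if (x i, x j).1 ∈ zeros (τ i) then c 1 else c 3) := by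
  rw [h.mem]
  rcases hx with h1 | h1
  · have q1 : (legendre (τ i) (x i)).1 = 0 := h1.1
    have r1 : (legendre (τ j) (x j)).1 = 0 := h1.2
    have q2 := fun h => legendre_ne_zero q1 h
    have r2 := fun h => legendre_ne_zero r1 h
    rw [if_pos h1.1, if_pos h1.1]
    change _ ↔ c 2 * _ + c 1 * _ = 0
    rw [iff_comm, ← mul_left_inj' (mul_ne_zero q2 r2), zero_mul]
    simp only [tri, q1, r1]
    constructor <;> intro h <;> linear_combination h
  · have q1 : (legendre (τ i) (x i)).2 = 0 := h1.1
    have r1 : (legendre (τ j) (x j)).2 = 0 := h1.2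
    have q2 := fun h => legendre_ne_zero h q1
    have r2 := fun h => legendre_ne_zero h r1
    have hz : (x i, x j).1 ∉ zeros (τ i) := q2
    rw [if_neg hz, if_neg hz]
    change _ ↔ c 0 * _ + c 3 * _ = 0
    rw [iff_comm, ← mul_left_inj' (mul_ne_zero q2 r2), zero_mul]
    simp only [tri, q1, r1]
    constructor <;> intro h <;> linear_combination h

/-- There are `16` points of `X` over pairs of two zeros or of two poles if the roots of `phi₁` and
`phi₂` are not of order two. -/
theorem encard_evenPairs_points (h : IsTri X k i j c)
    (hφ : ∀ a : E (τ k), a + a = 0 →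
      phi₁ c (legendre (τ k) a) ≠ 0 ∧ phi₂ c (legendre (τ k) a) ≠ 0) :
    {x : T τ | x ∈ X ∧ (x i, x j) ∈ evenPairs (τ i) (τ j)}.encard = (16 : ℕ) := by
  classical
  have e : {x : T τ | x ∈ X ∧ (x i, x j) ∈ evenPairs (τ i) (τ j)} =
      {x : T τ | (x i, x j) ∈ evenPairs (τ i) (τ j) ∧
        x k ∈ linFibre (τ k) (if (x i, x j).1 ∈ zeros (τ i) then c 2 else c 0)
          (if (x i, x j).1 ∈ zeros (τ i) then c 1 else c 3)} := by
    ext x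
    simp only [Set.mem_ofPred_eq]
    rw [and_comm]
    exact and_congr_right fun hx => h.mem_iff_of_evenPairs hx
  rw [e]
  refine encard_linFibred h.hij h.hki.symm h.hkj.symm encard_evenPairs rfl
    (fun y => if y.1 ∈ zeros (τ i) then c 2 else c 0)
    (fun y => if y.1 ∈ zeros (τ i) then c 1 else c 3) (fun y _ => ?_) fun y _ t ht hc => ?_
  · have := h.det
    split_ifs <;> by_contra! h0 <;> exact this (by simp [h0])
  · split_ifs at ht
    · exact (hφ t hc).2 ht
    · exact (hφ t hc).1 ht

/-- There are `8` points of `X` over pairs of two zeros or of two poles if `phi₁` and `phi₂` both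
have a root of order two. -/
theorem encard_evenPairs_points_of_branch (h : IsTri X k i j c)
    (hφ₁ : ∃ a : E (τ k), a + a = 0 ∧ phi₁ c (legendre (τ k) a) = 0)
    (hφ₂ : ∃ a : E (τ k), a + a = 0 ∧ phi₂ c (legendre (τ k) a) = 0) :
    {x : T τ | x ∈ X ∧ (x i, x j) ∈ evenPairs (τ i) (τ j)}.encard = (8 : ℕ) ∧
      ∀ x ∈ X, (x i, x j) ∈ evenPairs (τ i) (τ j) → x k + x k = 0 := by
  classical
  obtain ⟨a₁, ha₁, h1⟩ := hφ₁
  obtain ⟨a₂, ha₂, h2⟩ := hφ₂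
  have e : {x : T τ | x ∈ X ∧ (x i, x j) ∈ evenPairs (τ i) (τ j)} =
      {x : T τ | (x i, x j) ∈ evenPairs (τ i) (τ j) ∧
        x k ∈ linFibre (τ k) (if (x i, x j).1 ∈ zeros (τ i) then c 2 else c 0)
          (if (x i, x j).1 ∈ zeros (τ i) then c 1 else c 3)} := by
    ext x
    simp only [Set.mem_ofPred_eq]
    rw [and_comm]
    exact and_congr_right fun hx => h.mem_iff_of_evenPairs hx
  have hab : ∀ y : E (τ i) × E (τ j), (if y.1 ∈ zeros (τ i) then c 2 else c 0) ≠ 0 ∨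
      (if y.1 ∈ zeros (τ i) then c 1 else c 3) ≠ 0 := fun y => by
    have := h.det
    split_ifs <;> by_contra! h0 <;> exact this (by simp [h0])
  have hbr : ∀ y : E (τ i) × E (τ j), ∃ t ∈ linFibre (τ k)
      (if y.1 ∈ zeros (τ i) then c 2 else c 0) (if y.1 ∈ zeros (τ i) then c 1 else c 3),
      t + t = 0 := fun y => by
    split_ifs
    exacts [⟨a₂, h2, ha₂⟩, ⟨a₁, h1, ha₁⟩]
  constructor
  · rw [e]
    exact encard_linFibred_of_branch h.hij h.hki.symm h.hkj.symm encard_evenPairs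
      (fun y => if y.1 ∈ zeros (τ i) then c 2 else c 0)
      (fun y => if y.1 ∈ zeros (τ i) then c 1 else c 3) (fun y _ => hab y) fun y _ => hbr y
  · intro x hx hxe
    have h3 := (h.mem_iff_of_evenPairs hxe).mp hx
    obtain ⟨t, ht, htt⟩ := hbr (x i, x j)
    obtain ⟨z, hz⟩ := Set.encard_eq_one.mp (encard_linFibre_of_branch (hab (x i, x j)) ht htt)
    rw [hz] at ht h3
    rw [Set.mem_singleton_iff.mp h3, ← Set.mem_singleton_iff.mp ht, htt]

/-- The locus over pairs of zeros or poles consists of the `8` elliptic curves over pairs of a zero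
and a pole and the points over the other pairs. -/
theorem hasShape_zeros_poles (h : IsTri X k i j c) {P N : Set (T τ)} {p n : ℕ}
    (hF : ∀ x, x ∈ F ↔ x ∈ X ∧ x i + x i = half₁ (τ i) ∧ x j + x j = half₁ (τ j))
    (hP : P.encard = p) (hPs : ∀ x ∈ P, x k + x k ≠ 0) (hN : N.encard = n)
    (hNs : ∀ x ∈ N, x k + x k = 0)
    (hPN : ∀ x, x ∈ P ∪ N ↔ x ∈ X ∧ (x i, x j) ∈ evenPairs (τ i) (τ j)) :
    HasShape X F p n 8 0 := by
  set f : E (τ i) × E (τ j) → Set (T τ) := fun y => coordCurve i j y.1 y.2 with hf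
  have hell : ∀ y, IsEllipticCurve (f y) := fun y =>
    isEllipticCurve_coordCurve h.hij h.hki.symm h.hkj.symm _ _
  have hmem : ∀ y x, x ∈ f y ↔ (x i, x j) = y := fun y x => by
    rw [Prod.ext_iff]
    rfl
  have hinj : Function.Injective f := fun y z hyz => by
    obtain ⟨x, hx⟩ := (hell y).2.1.nonempty
    have hx' := hx
    rw [hyz] at hx'
    rw [← (hmem _ _).mp hx, (hmem _ _).mp hx']
  have hU : ∀ x, x ∈ ⋃₀ (f '' oddPairs (τ i) (τ j) ∪ ∅) ↔ (x i, x j) ∈ oddPairs (τ i) (τ j) := by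
    intro x
    rw [Set.union_empty, Set.mem_sUnion]
    constructor
    · rintro ⟨_, ⟨y, hy, rfl⟩, hx⟩
      rwa [(hmem _ _).mp hx]
    · exact fun hx => ⟨_, ⟨_, hx, rfl⟩, (hmem _ _).mpr rfl⟩
  have hsing : ∀ x ∈ P ∪ N, SingAt k i j x ↔ x k + x k = 0 := fun x hx =>
    singAt_iff_of_evenPairs ((hPN x).mp hx).2
  refine ⟨P, N, f '' oddPairs (τ i) (τ j), ∅, hP, fun x hx => ?_, hN, fun x hx => ?_, ?_, ?_,
    by simp, by simp, fun x hx => h.smooth_of_oddPairs ((hU x).mp hx), ?_, ?_, ?_, ?_⟩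
  · have hx' : x ∈ P ∪ N := Or.inl hx
    exact h.smooth x ((hPN x).mp hx').1 fun hs => hPs x hx ((hsing x hx').mp hs)
  · have hx' : x ∈ P ∪ N := Or.inr hx
    exact h.node x ((hPN x).mp hx').1 ((hsing x hx').mpr (hNs x hx))
  · rw [hinj.injOn.encard_image, encard_oddPairs]
  · rintro _ ⟨y, -, rfl⟩
    exact hell y
  · rw [Set.union_empty]
    rintro _ ⟨y, -, rfl⟩ _ ⟨z, -, rfl⟩ hyz
    refine Set.disjoint_left.mpr fun x h1 h2 => hyz ?_
    rw [← (hmem _ _).mp h1, ← (hmem _ _).mp h2]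
  · exact Set.disjoint_left.mpr fun x h1 h2 => hPs x h1 (hNs x h2)
  · exact Set.disjoint_left.mpr fun x h1 h2 => disjoint_pairs ((hPN x).mp h1).2 ((hU x).mp h2)
  · ext x
    rw [hF, add_self_eq_half₁_pair_iff, Set.mem_union, hU, hPN, and_or_left,
      and_iff_right_of_imp (fun hx => h.mem_of_oddPairs hx)]

theorem hasShape_zeros_poles_of_smooth (h : IsTri X k i j c)
    (hφ : ∀ a : E (τ k), a + a = 0 →
      phi₁ c (legendre (τ k) a) ≠ 0 ∧ phi₂ c (legendre (τ k) a) ≠ 0)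
    (hF : ∀ x, x ∈ F ↔ x ∈ X ∧ x i + x i = half₁ (τ i) ∧ x j + x j = half₁ (τ j)) :
    HasShape X F 16 0 8 0 := by
  classical
  refine h.hasShape_zeros_poles (N := ∅) hF (h.encard_evenPairs_points hφ) ?_ (by simp) (by simp)
    (by simp)
  rintro x ⟨hx, hxe⟩ hc
  have := (h.mem_iff_of_evenPairs hxe).mp hx
  split_ifs at this
  exacts [(hφ _ hc).2 this, (hφ _ hc).1 this]

theorem hasShape_zeros_poles_of_singular (h : IsTri X k i j c)
    (hφ₁ : ∃ a : E (τ k), a + a = 0 ∧ phi₁ c (legendre (τ k) a) = 0)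
    (hφ₂ : ∃ a : E (τ k), a + a = 0 ∧ phi₂ c (legendre (τ k) a) = 0)
    (hF : ∀ x, x ∈ F ↔ x ∈ X ∧ x i + x i = half₁ (τ i) ∧ x j + x j = half₁ (τ j)) :
    HasShape X F 0 8 8 0 := by
  obtain ⟨h1, h2⟩ := h.encard_evenPairs_points_of_branch hφ₁ hφ₂
  exact h.hasShape_zeros_poles (P := ∅) hF (by simp) (by simp) h1 (fun x hx => h2 x hx.1 hx.2)
    (by simp)

theorem encard_oddPairs_points (h : IsTri X k i j c) :
    {x : T τ | (x i, x j) ∈ oddPairs (τ i) (τ j) ∧ x k ∈ twoTorsion (τ k)}.encard = (32 : ℕ) :=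
  encard_fibred h.hij h.hki.symm h.hkj.symm (Φ := fun _ => twoTorsion (τ k)) (n := 4)
    encard_oddPairs fun _ _ => encard_twoTorsion

/-- The locus over pairs of zeros or poles with third coordinate of order two. -/
theorem hasShape_zeros_poles_torsion (h : IsTri X k i j c) {n : ℕ}
    (hF : ∀ x, x ∈ F ↔
      x ∈ X ∧ x k + x k = 0 ∧ x i + x i = half₁ (τ i) ∧ x j + x j = half₁ (τ j))
    (hn : {x : T τ | x ∈ X ∧ (x i, x j) ∈ evenPairs (τ i) (τ j) ∧ x k + x k = 0}.encard = n) :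
    HasShape X F 32 n 0 0 := by
  refine hasShape_points_nodes h.encard_oddPairs_points (fun x hx => h.smooth_of_oddPairs hx.1) hn
    (fun x hx => h.node x hx.1 ((singAt_iff_of_evenPairs hx.2.1).mpr hx.2.2)) fun x => ?_
  rw [hF, add_self_eq_half₁_pair_iff]
  have := fun hx => h.mem_of_oddPairs (x := x) hx
  simp only [Set.mem_ofPred_eq, twoTorsion]
  tauto

theorem hasShape_zeros_poles_torsion_of_smooth (h : IsTri X k i j c)
    (hφ : ∀ a : E (τ k), a + a = 0 →
      phi₁ c (legendre (τ k) a) ≠ 0 ∧ phi₂ c (legendre (τ k) a) ≠ 0)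
    (hF : ∀ x, x ∈ F ↔
      x ∈ X ∧ x k + x k = 0 ∧ x i + x i = half₁ (τ i) ∧ x j + x j = half₁ (τ j)) :
    HasShape X F 32 0 0 0 := by
  classical
  refine h.hasShape_zeros_poles_torsion hF ?_
  rw [Nat.cast_zero, Set.encard_eq_zero, Set.eq_empty_iff_forall_notMem]
  rintro x ⟨hx, hxe, hc⟩
  have := (h.mem_iff_of_evenPairs hxe).mp hx
  split_ifs at this
  exacts [(hφ _ hc).2 this, (hφ _ hc).1 this]

theorem hasShape_zeros_poles_torsion_of_singular (h : IsTri X k i j c)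
    (hφ₁ : ∃ a : E (τ k), a + a = 0 ∧ phi₁ c (legendre (τ k) a) = 0)
    (hφ₂ : ∃ a : E (τ k), a + a = 0 ∧ phi₂ c (legendre (τ k) a) = 0)
    (hF : ∀ x, x ∈ F ↔
      x ∈ X ∧ x k + x k = 0 ∧ x i + x i = half₁ (τ i) ∧ x j + x j = half₁ (τ j)) :
    HasShape X F 32 8 0 0 := by
  obtain ⟨h1, h2⟩ := h.encard_evenPairs_points_of_branch hφ₁ hφ₂
  refine h.hasShape_zeros_poles_torsion hF ?_
  rw [← h1]
  congr 1
  ext x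
  exact ⟨fun hx => ⟨hx.1, hx.2.1⟩, fun hx => ⟨hx.1, hx.2, h2 x hx.1 hx.2⟩⟩

end IsTri

end Burniat

end

/-! ### The configuration of elliptic curves on a singular hypersurface -/

noncomputable section

namespace Burniat

open Filter

variable {τ : Fin 3 → UpperHalfPlane}

/-- The pairs of the point `a` and a pole, and of the point `b` and a zero. -/
def markedPairs {τ₁ : UpperHalfPlane} (a b : E τ₁) (τ₂ : UpperHalfPlane) : Set (E τ₁ × E τ₂) :=
  {a} ×ˢ poles τ₂ ∪ {b} ×ˢ zeros τ₂

theorem encard_markedPairs {τ₁ τ₂ : UpperHalfPlane} {a b : E τ₁} :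
    (markedPairs a b τ₂).encard = 4 := by
  rw [markedPairs, Set.encard_union_eq, Set.encard_prod, Set.encard_prod, encard_zeros,
    encard_poles, Set.encard_singleton, Set.encard_singleton]
  · norm_num
  · exact Set.disjoint_left.mpr fun x h1 h2 => legendre_ne_zero h2.2 h1.2

theorem encard_markedPairs_fibre {τ₁ τ₂ τ₃ : UpperHalfPlane} {a b : E τ₁} (hab : a ≠ b)
    {y : E τ₁ × E τ₃} (hy : y ∈ markedPairs a b τ₃) :
    {t : E τ₂ | (y.1, t) ∈ markedPairs a b τ₂}.encard = 2 := by
  obtain ⟨y, y'⟩ := y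
  rcases hy with ⟨h1, -⟩ | ⟨h1, -⟩
  · obtain rfl : y = a := h1
    rw [← encard_poles (τ := τ₂)]
    congr 1
    ext t
    simp [markedPairs, hab]
  · obtain rfl : y = b := h1
    rw [← encard_zeros (τ := τ₂)]
    congr 1
    ext t
    simp [markedPairs, hab.symm]

namespace IsTri

variable {X F : Set (T τ)} {k i j : Fin 3} {c : Fin 4 → ℂ}

theorem isNode_iff_singAt (h : IsTri X k i j c) {x : T τ} : IsNode X x ↔ x ∈ X ∧ SingAt k i j x :=
  ⟨fun hx => ⟨hx.1, by_contra fun hs => (h.smooth x hx.1 hs).not_isNode hx⟩,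
    fun hx => h.node x hx.1 hx.2⟩

/-- At a root of `phi₁` the equation reduces to `1 / (ℒᵢ ℒⱼ) = 0`. -/
theorem mem_of_phi₁_eq_zero (h : IsTri X k i j c) {x : T τ}
    (h1 : phi₁ c (legendre (τ k) (x k)) = 0) : x ∈ X ↔ x i ∈ poles (τ i) ∨ x j ∈ poles (τ j) := by
  have h2 : phi₂ c (legendre (τ k) (x k)) ≠ 0 := fun h2 =>
    legendre_ne_zero (h.phi_eq_zero h1 h2).1 (h.phi_eq_zero h1 h2).2
  have e : tri c (legendre (τ k) (x k)) (legendre (τ i) (x i)) (legendre (τ j) (x j)) =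
      phi₂ c (legendre (τ k) (x k)) * ((legendre (τ i) (x i)).2 * (legendre (τ j) (x j)).2) := by
    simp only [tri, phi₁, phi₂] at h1 ⊢
    linear_combination (legendre (τ i) (x i)).1 * (legendre (τ j) (x j)).1 * h1
  rw [h.mem, e, mul_eq_zero, or_iff_right h2, mul_eq_zero]
  rfl

/-- At a root of `phi₂` the equation reduces to `ℒᵢ ℒⱼ = 0`. -/
theorem mem_of_phi₂_eq_zero (h : IsTri X k i j c) {x : T τ}
    (h2 : phi₂ c (legendre (τ k) (x k)) = 0) : x ∈ X ↔ x i ∈ zeros (τ i) ∨ x j ∈ zeros (τ j) := by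
  have h1 : phi₁ c (legendre (τ k) (x k)) ≠ 0 := fun h1 =>
    legendre_ne_zero (h.phi_eq_zero h1 h2).1 (h.phi_eq_zero h1 h2).2
  have e : tri c (legendre (τ k) (x k)) (legendre (τ i) (x i)) (legendre (τ j) (x j)) =
      phi₁ c (legendre (τ k) (x k)) * ((legendre (τ i) (x i)).1 * (legendre (τ j) (x j)).1) := by
    simp only [tri, phi₁, phi₂] at h2 ⊢
    linear_combination (legendre (τ i) (x i)).2 * (legendre (τ j) (x j)).2 * h2
  rw [h.mem, e, mul_eq_zero, or_iff_right h1, mul_eq_zero]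
  rfl

theorem phi₁_unique (h : IsTri X k i j c) {a b : E (τ k)} (ha : a + a = 0)
    (h1 : phi₁ c (legendre (τ k) a) = 0) (h2 : phi₁ c (legendre (τ k) b) = 0) : b = a := by
  have hc : c 0 ≠ 0 ∨ c 3 ≠ 0 := by
    by_contra! h0
    exact h.det (by simp [h0])
  obtain ⟨z, hz⟩ := Set.encard_eq_one.mp (encard_linFibre_of_branch hc (x₀ := a) h1 ha)
  have ha' : a ∈ linFibre (τ k) (c 0) (c 3) := h1
  have hb' : b ∈ linFibre (τ k) (c 0) (c 3) := h2
  rw [hz] at ha' hb'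
  exact hb'.trans ha'.symm

theorem phi₂_unique (h : IsTri X k i j c) {a b : E (τ k)} (ha : a + a = 0)
    (h1 : phi₂ c (legendre (τ k) a) = 0) (h2 : phi₂ c (legendre (τ k) b) = 0) : b = a := by
  have hc : c 2 ≠ 0 ∨ c 1 ≠ 0 := by
    by_contra! h0
    exact h.det (by simp [h0])
  obtain ⟨z, hz⟩ := Set.encard_eq_one.mp (encard_linFibre_of_branch hc (x₀ := a) h1 ha)
  have ha' : a ∈ linFibre (τ k) (c 2) (c 1) := h1
  have hb' : b ∈ linFibre (τ k) (c 2) (c 1) := h2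
  rw [hz] at ha' hb'
  exact hb'.trans ha'.symm

/-- If `phi₁` and `phi₂` have roots `a` and `b` of order two, the slices of `X` at `a` and `b` split
into elliptic curves, which meet in the nodes. -/
theorem isGamma (h : IsTri X k i j c) (hX : NoTwoTorsion X)
    (hφ₁ : ∃ a : E (τ k), a + a = 0 ∧ phi₁ c (legendre (τ k) a) = 0)
    (hφ₂ : ∃ a : E (τ k), a + a = 0 ∧ phi₂ c (legendre (τ k) a) = 0)
    (hF : ∀ x, x ∈ F ↔ x ∈ X ∧ x k + x k = 0) : IsGamma X F := by
  obtain ⟨a, ha, h1⟩ := hφ₁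
  obtain ⟨b, hb, h2⟩ := hφ₂
  have hab : a ≠ b := by
    rintro rfl
    exact legendre_ne_zero (h.phi_eq_zero h1 h2).1 (h.phi_eq_zero h1 h2).2
  -- the slices at the other two points `d`, `e` of order two are the curves of genus five
  obtain ⟨d, e, hde, hde'⟩ : ∃ d e, d ≠ e ∧ twoTorsion (τ k) \ {a, b} = {d, e} := by
    refine Set.encard_eq_two.mp ?_
    have h3 : ({a, b} : Set (E (τ k))) ⊆ twoTorsion (τ k) := by
      rintro x (rfl | rfl) <;> assumption
    have h4 := Set.encard_sdiff_add_encard_of_subset h3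
    rw [encard_twoTorsion, Set.encard_pair hab] at h4
    have h5 : (twoTorsion (τ k) \ {a, b}).encard + 2 = 2 + 2 := by rw [h4]; norm_num
    exact (ENat.add_left_injective_of_ne_top (by simp)) h5
  have htor : ∀ x : E (τ k), x + x = 0 ↔ (x = d ∨ x = e) ∨ x = a ∨ x = b := by
    intro x
    have h3 : x ∈ twoTorsion (τ k) \ {a, b} ↔ x = d ∨ x = e := by rw [hde']; simp
    rw [← h3]
    simp only [Set.mem_sdiff, Set.mem_insert_iff, Set.mem_singleton_iff, twoTorsion,
      Set.mem_ofPred_eq]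
    constructor
    · intro hx
      by_cases hx' : x = a ∨ x = b
      exacts [Or.inr hx', Or.inl ⟨hx, hx'⟩]
    · rintro (hx | rfl | rfl)
      exacts [hx.1, ha, hb]
  have hd : d + d = 0 ∧ d ≠ a ∧ d ≠ b := by
    have : d ∈ twoTorsion (τ k) \ {a, b} := by rw [hde']; simp
    simpa [twoTorsion] using this
  have he : e + e = 0 ∧ e ≠ a ∧ e ≠ b := by
    have : e ∈ twoTorsion (τ k) \ {a, b} := by rw [hde']; simp
    simpa [twoTorsion] using this
  -- the elliptic curves with fixed `i`-th or fixed `j`-th coordinate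
  set f : E (τ k) × E (τ i) → Set (T τ) := fun y => coordCurve k i y.1 y.2 with hf
  set g : E (τ k) × E (τ j) → Set (T τ) := fun y => coordCurve k j y.1 y.2 with hg
  have hfmem : ∀ y x, x ∈ f y ↔ (x k, x i) = y := fun y x => by rw [Prod.ext_iff]; rfl
  have hgmem : ∀ y x, x ∈ g y ↔ (x k, x j) = y := fun y x => by rw [Prod.ext_iff]; rfl
  have hfinj : Function.Injective f := fun y z hyz => by
    obtain ⟨x, hx1, hx2, -⟩ := h.exists_mem y.1 y.2 0
    have hx : x ∈ f y := ⟨hx1, hx2⟩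
    have hx' := hx
    rw [hyz] at hx'
    rw [← (hfmem _ _).mp hx, (hfmem _ _).mp hx']
  have hginj : Function.Injective g := fun y z hyz => by
    obtain ⟨x, hx1, -, hx2⟩ := h.exists_mem y.1 0 y.2
    have hx : x ∈ g y := ⟨hx1, hx2⟩
    have hx' := hx
    rw [hyz] at hx'
    rw [← (hgmem _ _).mp hx, (hgmem _ _).mp hx']
  have hfg : ∀ y z, f y ≠ g z := fun y z hyz => by
    obtain ⟨x, hx1, hx2, hx3⟩ := h.exists_mem y.1 y.2 (z.2 + half₁ (τ j))
    have hx : x ∈ f y := ⟨hx1, hx2⟩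
    rw [hyz] at hx
    have := hx.2
    rw [hx3, add_eq_left] at this
    exact half₁_ne_zero this
  set W₁ := markedPairs a b (τ i) with hW₁
  set W₂ := markedPairs a b (τ j) with hW₂
  have hU : ∀ x, x ∈ ⋃₀ (f '' W₁ ∪ g '' W₂) ↔ (x k, x i) ∈ W₁ ∨ (x k, x j) ∈ W₂ := by
    intro x
    rw [Set.mem_sUnion]
    constructor
    · rintro ⟨_, ⟨y, hy, rfl⟩ | ⟨y, hy, rfl⟩, hx⟩
      · exact Or.inl (by rwa [(hfmem _ _).mp hx])
      · exact Or.inr (by rwa [(hgmem _ _).mp hx])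
    · rintro (hx | hx)
      · exact ⟨_, Or.inl ⟨_, hx, rfl⟩, (hfmem _ _).mpr rfl⟩
      · exact ⟨_, Or.inr ⟨_, hx, rfl⟩, (hgmem _ _).mpr rfl⟩
  have hUX : ∀ x : T τ, ((x k, x i) ∈ W₁ ∨ (x k, x j) ∈ W₂) ↔ x ∈ X ∧ (x k = a ∨ x k = b) := by
    intro x
    simp only [hW₁, hW₂, markedPairs, Set.mem_union, Set.mem_prod, Set.mem_singleton_iff]
    by_cases hxa : x k = a
    · have h3 : x k ≠ b := hxa ▸ hab
      rw [h.mem_of_phi₁_eq_zero (x := x) (by rw [hxa, h1])]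
      tauto
    · by_cases hxb : x k = b
      · rw [h.mem_of_phi₂_eq_zero (x := x) (by rw [hxb, h2])]
        tauto
      · tauto
  have hnode : ∀ x, IsNode X x ↔ (x k, x i) ∈ W₁ ∧ (x k, x j) ∈ W₂ := by
    intro x
    rw [h.isNode_iff_singAt]
    constructor
    · rintro ⟨hx, hxk, ⟨hxi, hxj⟩ | ⟨hxi, hxj⟩ | ⟨hxi, hxj⟩⟩
      · refine absurd (fun l => ?_) (hX x hx)
        rcases h.all l with rfl | rfl | rfl <;> assumption
      · have hq2 : (legendre (τ i) (x i)).2 ≠ 0 := fun h => legendre_ne_zero hxi h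
        have hr2 : (legendre (τ j) (x j)).2 ≠ 0 := fun h => legendre_ne_zero hxj h
        have hxb : x k = b := by
          refine h.phi₂_unique hb h2 ?_
          have := (h.mem x).mp hx
          simp only [zeros, Set.mem_ofPred_eq] at hxi hxj
          simp only [tri, hxi, hxj] at this
          refine (mul_eq_zero.mp (?_ : _ * ((legendre (τ i) (x i)).2 *
            (legendre (τ j) (x j)).2) = 0)).resolve_right (mul_ne_zero hq2 hr2)
          simp only [phi₂]
          linear_combination this
        exact ⟨Or.inr ⟨hxb, hxi⟩, Or.inr ⟨hxb, hxj⟩⟩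
      · have hq2 : (legendre (τ i) (x i)).1 ≠ 0 := fun h => legendre_ne_zero h hxi
        have hr2 : (legendre (τ j) (x j)).1 ≠ 0 := fun h => legendre_ne_zero h hxj
        have hxb : x k = a := by
          refine h.phi₁_unique ha h1 ?_
          have := (h.mem x).mp hx
          simp only [poles, Set.mem_ofPred_eq] at hxi hxj
          simp only [tri, hxi, hxj] at this
          refine (mul_eq_zero.mp (?_ : _ * ((legendre (τ i) (x i)).1 *
            (legendre (τ j) (x j)).1) = 0)).resolve_right (mul_ne_zero hq2 hr2)
          simp only [phi₁]
          linear_combination this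
        exact ⟨Or.inl ⟨hxb, hxi⟩, Or.inl ⟨hxb, hxj⟩⟩
    · intro hx
      refine ⟨((hUX x).mp (Or.inl hx.1)).1, ?_⟩
      obtain ⟨⟨k1, h3⟩ | ⟨k1, h3⟩, ⟨k2, h4⟩ | ⟨k2, h4⟩⟩ := hx
      · exact ⟨by rw [show x k = a from k1, ha], Or.inr (Or.inr ⟨h3, h4⟩)⟩
      · exact absurd (k1.symm.trans k2 : a = b) hab
      · exact absurd (k2.symm.trans k1 : a = b) hab
      · exact ⟨by rw [show x k = b from k1, hb], Or.inr (Or.inl ⟨h3, h4⟩)⟩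
  refine ⟨{x | x ∈ X ∧ x k = d}, {x | x ∈ X ∧ x k = e}, f '' W₁ ∪ g '' W₂,
    h.isCurveOfGenus_slice hX hd.1 (fun h0 => hd.2.1 (h.phi₁_unique ha h1 h0))
      (fun h0 => hd.2.2 (h.phi₂_unique hb h2 h0)),
    h.isCurveOfGenus_slice hX he.1 (fun h0 => he.2.1 (h.phi₁_unique ha h1 h0))
      (fun h0 => he.2.2 (h.phi₂_unique hb h2 h0)), ?_, ?_, ?_, ?_, ?_, ?_, ?_, ?_⟩
  · rw [Set.encard_union_eq, hfinj.injOn.encard_image, hginj.injOn.encard_image,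
      encard_markedPairs, encard_markedPairs]
    · norm_num
    · refine Set.disjoint_left.mpr ?_
      rintro _ ⟨y, -, rfl⟩ ⟨z, -, hz⟩
      exact hfg y z hz.symm
  · rintro _ (⟨y, -, rfl⟩ | ⟨y, -, rfl⟩)
    · exact isEllipticCurve_coordCurve h.hki h.hkj h.hij _ _
    · exact isEllipticCurve_coordCurve h.hkj h.hki h.hij.symm _ _
  · rintro _ (⟨y, hy, rfl⟩ | ⟨y, hy, rfl⟩)
    · have := encard_fibred (τ := τ) h.hki h.hkj h.hij (R := {y}) (m := 1) (n := 2)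
        (Φ := fun y => {t | (y.1, t) ∈ W₂}) (by simp) (by
          rintro _ rfl
          exact encard_markedPairs_fibre hab hy)
      refine Eq.trans (congrArg _ ?_) this
      ext x
      simp only [Set.mem_ofPred_eq, hfmem, hnode, Set.mem_singleton_iff]
      exact ⟨fun h => ⟨h.1, h.2.2⟩, fun h => ⟨h.1, by rw [h.1]; exact hy, h.2⟩⟩
    · have := encard_fibred (τ := τ) h.hkj h.hki h.hij.symm (R := {y}) (m := 1) (n := 2)
        (Φ := fun y => {t | (y.1, t) ∈ W₁}) (by simp) (by
          rintro _ rfl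
          exact encard_markedPairs_fibre hab hy)
      refine Eq.trans (congrArg _ ?_) this
      ext x
      simp only [Set.mem_ofPred_eq, hgmem, hnode, Set.mem_singleton_iff]
      exact ⟨fun h => ⟨h.1, h.2.1⟩, fun h => ⟨h.1, h.2, by rw [h.1]; exact hy⟩⟩
  · intro x
    rw [hnode]
    constructor
    · rintro ⟨_, ⟨y, hy, rfl⟩ | ⟨y, hy, rfl⟩, _, ⟨z, hz, rfl⟩ | ⟨z, hz, rfl⟩, hne, hx, hx'⟩
      · exact absurd (by rw [← (hfmem _ _).mp hx, (hfmem _ _).mp hx']) hne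
      · exact ⟨by rwa [(hfmem _ _).mp hx], by rwa [(hgmem _ _).mp hx']⟩
      · exact ⟨by rwa [(hfmem _ _).mp hx'], by rwa [(hgmem _ _).mp hx]⟩
      · exact absurd (by rw [← (hgmem _ _).mp hx, (hgmem _ _).mp hx']) hne
    · rintro ⟨hx, hx'⟩
      exact ⟨_, Or.inl ⟨_, hx, rfl⟩, _, Or.inr ⟨_, hx', rfl⟩, hfg _ _, (hfmem _ _).mpr rfl,
        (hgmem _ _).mpr rfl⟩
  · exact Set.disjoint_left.mpr fun x hx hx' => hde (hx.2.symm.trans hx'.2)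
  · refine Set.disjoint_left.mpr fun x hx hx' => ?_
    rcases ((hUX x).mp ((hU x).mp hx')).2 with h3 | h3
    exacts [hd.2.1 (hx.2.symm.trans h3), hd.2.2 (hx.2.symm.trans h3)]
  · refine Set.disjoint_left.mpr fun x hx hx' => ?_
    rcases ((hUX x).mp ((hU x).mp hx')).2 with h3 | h3
    exacts [he.2.1 (hx.2.symm.trans h3), he.2.2 (hx.2.symm.trans h3)]
  · ext x
    rw [hF, htor, Set.mem_union, hU, hUX]
    simp only [Set.mem_union, Set.mem_ofPred_eq]
    tauto

end IsTri

end Burniat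

end

/-! ### The hypersurfaces `X̂_ν` -/

noncomputable section

namespace Burniat

open Filter

variable {τ : Fin 3 → UpperHalfPlane}

theorem mem_fixOn {X : Set (T τ)} {g : G} {x : T τ} : x ∈ fixOn X g ↔
    x ∈ X ∧ actE (τ 0) (g 0) (x 0) = x 0 ∧ actE (τ 1) (g 1) (x 1) = x 1 ∧
      actE (τ 2) (g 2) (x 2) = x 2 := by
  refine and_congr_right fun _ => ?_
  rw [funext_iff, Fin.forall_fin_succ, Fin.forall_fin_two]
  rfl

section

variable {ν₁ ν₂ : ℂ}

/-- The coefficients of the trilinear form that defines `X̂_ν`. -/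
def nuCoeff (τ : Fin 3 → UpperHalfPlane) (ν₁ ν₂ : ℂ) : Fin 4 → ℂ :=
  ![ν₁, ν₁ * (bConst (τ 0) * bConst (τ 1) * bConst (τ 2)), ν₂ * (bConst (τ 1) * bConst (τ 2)),
    ν₂ * bConst (τ 0)]

theorem nuCoeff_det (h1 : ν₁ ≠ ν₂) (h2 : ν₁ ≠ -ν₂) :
    nuCoeff τ ν₁ ν₂ 0 * nuCoeff τ ν₁ ν₂ 1 ≠ nuCoeff τ ν₁ ν₂ 2 * nuCoeff τ ν₁ ν₂ 3 := by
  have hb := mul_ne_zero (mul_ne_zero (bConst_ne_zero (τ := τ 0)) (bConst_ne_zero (τ := τ 1)))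
    (bConst_ne_zero (τ := τ 2))
  intro h
  simp only [nuCoeff, Matrix.cons_val] at h
  have h3 : (ν₁ - ν₂) * (ν₁ + ν₂) = 0 := by
    refine (mul_eq_zero.mp (?_ : _ * (bConst (τ 0) * bConst (τ 1) * bConst (τ 2)) = 0)).resolve_right
      hb
    linear_combination h
  rcases mul_eq_zero.mp h3 with h4 | h4
  exacts [h1 (sub_eq_zero.mp h4), h2 (eq_neg_of_add_eq_zero_left h4)]

theorem isTri_XNu (h1 : ν₁ ≠ ν₂) (h2 : ν₁ ≠ -ν₂) :
    IsTri (XNu τ ν₁ ν₂) 0 1 2 (nuCoeff τ ν₁ ν₂) where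
  hki := by decide
  hkj := by decide
  hij := by decide
  det := nuCoeff_det h1 h2
  mem x := by
    rw [XNu_eq]
    rfl
  smooth x hx hs := by
    rw [XNu_eq] at hx ⊢
    exact isSmoothPoint_of_not_singularAt (nuCoeff_det h1 h2) hx hs
  node x hx hs := by
    rw [XNu_eq] at hx ⊢
    exact (isNode_iff (nuCoeff_det h1 h2)).mpr ⟨hx, hs⟩

theorem isSmooth_XNu_iff (h1 : ν₁ ≠ ν₂) (h2 : ν₁ ≠ -ν₂) :
    IsSmooth (XNu τ ν₁ ν₂) ↔ ∀ x ∈ XNu τ ν₁ ν₂, ¬ SingAt 0 1 2 x := by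
  have := isSmooth_iff (τ := τ) (nuCoeff_det (τ := τ) h1 h2)
  rw [XNu_eq]
  exact this

/-- A root of `phi₁` (`phi₂`) of order two gives a node over every pair of poles (zeros). -/
theorem phi_ne_zero_of_isSmooth (h1 : ν₁ ≠ ν₂) (h2 : ν₁ ≠ -ν₂) (hs : IsSmooth (XNu τ ν₁ ν₂))
    (a : E (τ 0)) (ha : a + a = 0) : phi₁ (nuCoeff τ ν₁ ν₂) (legendre (τ 0) a) ≠ 0 ∧
      phi₂ (nuCoeff τ ν₁ ν₂) (legendre (τ 0) a) ≠ 0 := by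
  have h := isTri_XNu (τ := τ) h1 h2
  have hs' := (isSmooth_XNu_iff h1 h2).mp hs
  have hz : ∀ {τ : UpperHalfPlane}, (zeros τ).Nonempty ∧ (poles τ).Nonempty := fun {τ} => by
    rw [← Set.encard_ne_zero, ← Set.encard_ne_zero, encard_zeros, encard_poles]
    norm_num
  constructor
  · intro h0
    obtain ⟨q, hq⟩ := (hz (τ := τ 1)).2
    obtain ⟨r, hr⟩ := (hz (τ := τ 2)).2
    obtain ⟨x, rfl, rfl, rfl⟩ := h.exists_mem a q r
    exact hs' x ((h.mem_of_phi₁_eq_zero h0).mpr (Or.inl hq)) ⟨ha, Or.inr (Or.inr ⟨hq, hr⟩)⟩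
  · intro h0
    obtain ⟨q, hq⟩ := (hz (τ := τ 1)).1
    obtain ⟨r, hr⟩ := (hz (τ := τ 2)).1
    obtain ⟨x, rfl, rfl, rfl⟩ := h.exists_mem a q r
    exact hs' x ((h.mem_of_phi₂_eq_zero h0).mpr (Or.inl hq)) ⟨ha, Or.inr (Or.inl ⟨hq, hr⟩)⟩

theorem add_half₂_add_self {τ : UpperHalfPlane} {a : E τ} (ha : a + a = 0) :
    a + half₂ τ + (a + half₂ τ) = 0 := by
  rw [add_add_add_comm, ha, half₂_add_self, add_zero]

/-- Translation by `τ / 2` on the first factor exchanges the roots of `phi₁` and `phi₂`. -/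
theorem phi_add_half₂ {a : E (τ 0)} (ha : a + a = 0) :
    (phi₁ (nuCoeff τ ν₁ ν₂) (legendre (τ 0) a) = 0 →
      phi₂ (nuCoeff τ ν₁ ν₂) (legendre (τ 0) (a + half₂ (τ 0))) = 0) ∧
    (phi₂ (nuCoeff τ ν₁ ν₂) (legendre (τ 0) a) = 0 →
      phi₁ (nuCoeff τ ν₁ ν₂) (legendre (τ 0) (a + half₂ (τ 0))) = 0) := by
  have h3 := legendre_add_half₂ a
  have h4 := (legendre_ne_zero_of_add_self ha).1
  have hb1 := bConst_ne_zero (τ := τ 1)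
  have hb2 := bConst_ne_zero (τ := τ 2)
  simp only [phi₁, phi₂, nuCoeff, Matrix.cons_val]
  set p := legendre (τ 0) a
  set p' := legendre (τ 0) (a + half₂ (τ 0))
  constructor
  · intro h
    refine (mul_eq_zero.mp (?_ : _ * p.1 = 0)).resolve_right h4
    linear_combination ν₂ * (bConst (τ 1) * bConst (τ 2)) * h3 +
      bConst (τ 0) * bConst (τ 1) * bConst (τ 2) * p'.2 * h
  · intro h
    have h' : ν₂ * p.1 + ν₁ * bConst (τ 0) * p.2 = 0 := by
      refine (mul_eq_zero.mp (?_ : _ * (bConst (τ 1) * bConst (τ 2)) = 0)).resolve_right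
        (mul_ne_zero hb1 hb2)
      linear_combination h
    refine (mul_eq_zero.mp (?_ : _ * p.1 = 0)).resolve_right h4
    linear_combination ν₁ * h3 + bConst (τ 0) * p'.2 * h'

/-- A node that is not of order two lies over a pair of zeros or poles, so its first coordinate is a
root of `phi₂` or `phi₁`; the translate by `τ / 2` is a root of the other one. -/
theorem exists_phi_eq_zero_of_not_isSmooth (h1 : ν₁ ≠ ν₂) (h2 : ν₁ ≠ -ν₂)
    (hX : NoTwoTorsion (XNu τ ν₁ ν₂)) (hs : ¬ IsSmooth (XNu τ ν₁ ν₂)) :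
    (∃ a : E (τ 0), a + a = 0 ∧ phi₁ (nuCoeff τ ν₁ ν₂) (legendre (τ 0) a) = 0) ∧
      ∃ a : E (τ 0), a + a = 0 ∧ phi₂ (nuCoeff τ ν₁ ν₂) (legendre (τ 0) a) = 0 := by
  classical
  have h := isTri_XNu (τ := τ) h1 h2
  rw [isSmooth_XNu_iff h1 h2] at hs
  push Not at hs
  obtain ⟨x, hx, hx0, hx12⟩ := hs
  have hx' : (x 1, x 2) ∈ IsTri.evenPairs (τ 1) (τ 2) := by
    refine hx12.resolve_left fun h3 => hX x hx fun l => ?_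
    rcases h.all l with rfl | rfl | rfl
    exacts [hx0, h3.1, h3.2]
  have h5 := (h.mem_iff_of_evenPairs hx').mp hx
  split_ifs at h5
  · exact ⟨⟨_, add_half₂_add_self hx0, (phi_add_half₂ hx0).2 h5⟩, _, hx0, h5⟩
  · exact ⟨⟨_, hx0, h5⟩, _, add_half₂_add_self hx0, (phi_add_half₂ hx0).1 h5⟩

/-- The points of `X̂_ν` over suitable fibres of multiplication by two. The condition on `c` and `d`
makes the equation of `X̂_ν` split into linear factors over these fibres. -/
theorem hasShape_XNu_half₂ (h1 : ν₁ ≠ ν₂) (h2 : ν₁ ≠ -ν₂) {F : Set (T τ)} {c : E (τ 1)}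
    {d : E (τ 2)}
    (hcd : ∀ y z, y + y = c → z + z = d →
      ((legendre (τ 1) y).1 * (legendre (τ 2) z).1) ^ 2 =
        (bConst (τ 1) * bConst (τ 2) * ((legendre (τ 1) y).2 * (legendre (τ 2) z).2)) ^ 2 ∧
      (legendre (τ 1) y).2 * (legendre (τ 2) z).2 ≠ 0)
    (hF : ∀ x, x ∈ F ↔ x ∈ XNu τ ν₁ ν₂ ∧ x 0 + x 0 = half₂ (τ 0) ∧ x 1 + x 1 = c ∧ x 2 + x 2 = d) :
    HasShape (XNu τ ν₁ ν₂) F 32 0 0 0 := by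
  have h := isTri_XNu (τ := τ) h1 h2
  refine hasShape_points ?_ fun x hx => h.smooth x ((hF x).mp hx).1 fun hs =>
    half₂_ne_zero (τ := τ 0) (((hF x).mp hx).2.1.symm.trans hs.1)
  have hb0 := bConst_ne_zero (τ := τ 0)
  have hb12 := mul_ne_zero (bConst_ne_zero (τ := τ 1)) (bConst_ne_zero (τ := τ 2))
  set A : E (τ 1) × E (τ 2) → ℂ := fun y => (legendre (τ 1) y.1).1 * (legendre (τ 2) y.2).1 with hA
  set B : E (τ 1) × E (τ 2) → ℂ := fun y => bConst (τ 0) * (bConst (τ 1) * bConst (τ 2) *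
    ((legendre (τ 1) y.1).2 * (legendre (τ 2) y.2).2)) with hB
  set R : Set (E (τ 1) × E (τ 2)) := {y | y + y = c} ×ˢ {z | z + z = d} with hR
  have hRc : R.encard = (16 : ℕ) := by
    rw [hR, Set.encard_prod, encard_add_self_eq, encard_add_self_eq]
    norm_num
  have hhalf : ∀ y ∈ R, ∀ t ∈ linFibre (τ 0) (A y) (B y), t + t = half₂ (τ 0) := by
    intro y hy t ht
    obtain ⟨e1, e2⟩ := hcd y.1 y.2 hy.1 hy.2
    rw [add_self_eq_half₂_iff]
    have ht' : A y * (legendre (τ 0) t).1 + B y * (legendre (τ 0) t).2 = 0 := ht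
    simp only [hA, hB] at ht'
    set Q := (legendre (τ 1) y.1).1 * (legendre (τ 2) y.2).1
    set S := (legendre (τ 1) y.1).2 * (legendre (τ 2) y.2).2
    refine mul_left_cancel₀ (pow_ne_zero 2 (mul_ne_zero hb12 e2)) ?_
    rw [← e1]
    linear_combination (Q * (legendre (τ 0) t).1 - bConst (τ 0) * (bConst (τ 1) * bConst (τ 2) * S) *
      (legendre (τ 0) t).2) * ht' - bConst (τ 0) ^ 2 * (legendre (τ 0) t).2 ^ 2 * e1
  have hmem : ∀ x : T τ, (x 1, x 2) ∈ R → x 0 + x 0 = half₂ (τ 0) →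
      (x ∈ XNu τ ν₁ ν₂ ↔ x 0 ∈ linFibre (τ 0) (A (x 1, x 2)) (B (x 1, x 2))) := by
    intro x hx hx0
    obtain ⟨e1, e2⟩ := hcd _ _ hx.1 hx.2
    rw [h.mem]
    change _ ↔ A _ * _ + B _ * _ = 0
    have hp := add_self_eq_half₂_iff.mp hx0
    simp only [tri, nuCoeff, Matrix.cons_val, hA, hB]
    simp only at e1 e2
    set p := legendre (τ 0) (x 0)
    set q := legendre (τ 1) (x 1)
    set r := legendre (τ 2) (x 2)
    -- with `ℒ₂ℒ₃ = ± b₂b₃` the equation becomes `(ν₁ ± ν₂)(ℒ₁ℒ₂ℒ₃ + b₁b₂b₃) = 0`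
    rcases sq_eq_sq_iff_eq_or_eq_neg.mp e1 with e | e
    · rw [e]
      refine Iff.trans (b := (ν₁ + ν₂) * (q.1 * r.1 * p.1 +
        bConst (τ 0) * (bConst (τ 1) * bConst (τ 2) * (q.2 * r.2)) * p.2) = 0) ?_ ?_
      · constructor
        · intro k
          linear_combination k + ν₂ * (p.1 - bConst (τ 0) * p.2) * e
        · intro k
          linear_combination k - ν₂ * (p.1 - bConst (τ 0) * p.2) * e
      · rw [mul_eq_zero, or_iff_right (fun k => h2 (eq_neg_of_add_eq_zero_left k)), e]
    · rw [e]
      refine Iff.trans (b := (ν₁ - ν₂) * (q.1 * r.1 * p.1 +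
        bConst (τ 0) * (bConst (τ 1) * bConst (τ 2) * (q.2 * r.2)) * p.2) = 0) ?_ ?_
      · constructor
        · intro k
          linear_combination k - ν₂ * (p.1 + bConst (τ 0) * p.2) * e
        · intro k
          linear_combination k + ν₂ * (p.1 + bConst (τ 0) * p.2) * e
      · rw [mul_eq_zero, or_iff_right (fun k => h1 (sub_eq_zero.mp k)), e]
  have hF' : F = {x | (x 1, x 2) ∈ R ∧ x 0 ∈ linFibre (τ 0) (A (x 1, x 2)) (B (x 1, x 2))} := by
    ext x
    rw [hF]
    constructor
    · rintro ⟨k1, k2, k3⟩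
      exact ⟨k3, (hmem x k3 k2).mp k1⟩
    · rintro ⟨k1, k2⟩
      have k3 := hhalf _ k1 _ k2
      exact ⟨(hmem x k1 k3).mpr k2, k3, k1⟩
  rw [hF']
  refine encard_linFibred h.hij h.hki.symm h.hkj.symm hRc rfl A B (fun y hy => Or.inr ?_)
    fun y hy t ht h0 => half₂_ne_zero (τ := τ 0) ?_
  · exact mul_ne_zero hb0 (mul_ne_zero hb12 (hcd _ _ hy.1 hy.2).2)
  · rw [← hhalf y hy t ht, h0]

theorem snd_ne_zero_of_sq {τ : UpperHalfPlane} {y : E τ} {a : ℂ}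
    (h : (legendre τ y).1 ^ 2 = a * (legendre τ y).2 ^ 2) : (legendre τ y).2 ≠ 0 := fun h0 =>
  legendre_ne_zero (τ := τ) (x := y) (by simpa [h0] using h) h0

end

end Burniat

end

/-! ### The hypersurfaces `X̂_μ` -/

noncomputable section

namespace Burniat

open Filter

variable {τ : Fin 3 → UpperHalfPlane}

theorem mul_mul_eq_of_ne {i j k : Fin 3} (hij : i ≠ j) (hik : i ≠ k) (hjk : j ≠ k) (f : Fin 3 → ℂ) :
    f i * f j * f k = f 0 * f 1 * f 2 := by
  have h : ∀ i j k : Fin 3, i ≠ j → i ≠ k → j ≠ k →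
      Finset.univ = ({i, j, k} : Finset (Fin 3)) := by decide
  have h2 := Fin.prod_univ_three f
  rw [h i j k hij hik hjk, Finset.prod_insert (by simp [hij, hik]),
    Finset.prod_insert (by simp [hjk]), Finset.prod_singleton] at h2
  rw [mul_assoc, h2]

section

variable {μ : ℂ}

/-- The coefficients of the trilinear form that defines `X̂_μ`. -/
def muCoeff (μ : ℂ) : Fin 4 → ℂ := ![1, -μ, 0, 0]

theorem muCoeff_det (hμ : μ ≠ 0) : muCoeff μ 0 * muCoeff μ 1 ≠ muCoeff μ 2 * muCoeff μ 3 := by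
  simpa [muCoeff] using hμ

theorem mem_XMu_iff {i j k : Fin 3} (hki : k ≠ i) (hkj : k ≠ j) (hij : i ≠ j) (x : T τ) :
    x ∈ XMu τ μ ↔ (legendre (τ k) (x k)).1 * (legendre (τ i) (x i)).1 * (legendre (τ j) (x j)).1 =
      μ * ((legendre (τ k) (x k)).2 * (legendre (τ i) (x i)).2 * (legendre (τ j) (x j)).2) := by
  rw [mul_mul_eq_of_ne hki hkj hij fun l => (legendre (τ l) (x l)).1,
    mul_mul_eq_of_ne hki hkj hij fun l => (legendre (τ l) (x l)).2]
  rfl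

/-- If two of the Legendre functions have a common zero or a common pole and the third is neither zero
nor infinite, their product is not `μ`; so the singular points of `X̂_μ` have order two. -/
theorem singAt_XMu_iff (hμ : μ ≠ 0) {i j k : Fin 3} (hki : k ≠ i) (hkj : k ≠ j) (hij : i ≠ j)
    {x : T τ} (hx : x ∈ XMu τ μ) : SingAt k i j x ↔ ∀ l, x l + x l = 0 := by
  constructor
  · rintro ⟨h0, h1⟩
    have hp := legendre_ne_zero_of_add_self h0
    rw [mem_XMu_iff hki hkj hij] at hx
    rcases h1 with ⟨h1, h2⟩ | ⟨h1, h2⟩ | ⟨h1, h2⟩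
    · intro l
      rcases eq_or_eq_or_eq_of_ne hki hkj hij l with rfl | rfl | rfl <;> assumption
    · exfalso
      have q2 : (legendre (τ i) (x i)).2 ≠ 0 := fun h => legendre_ne_zero h1 h
      have r2 : (legendre (τ j) (x j)).2 ≠ 0 := fun h => legendre_ne_zero h2 h
      rw [show (legendre (τ i) (x i)).1 = 0 from h1, mul_zero, zero_mul] at hx
      exact mul_ne_zero hμ (mul_ne_zero (mul_ne_zero hp.2 q2) r2) hx.symm
    · exfalso
      have q2 : (legendre (τ i) (x i)).1 ≠ 0 := fun h => legendre_ne_zero h h1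
      have r2 : (legendre (τ j) (x j)).1 ≠ 0 := fun h => legendre_ne_zero h h2
      rw [show (legendre (τ i) (x i)).2 = 0 from h1, mul_zero, zero_mul, mul_zero] at hx
      exact mul_ne_zero (mul_ne_zero hp.1 q2) r2 hx
  · exact fun h => ⟨h k, Or.inl ⟨h i, h j⟩⟩

theorem isTri_XMu (hμ : μ ≠ 0) {i j k : Fin 3} (hki : k ≠ i) (hkj : k ≠ j) (hij : i ≠ j) :
    IsTri (XMu τ μ) k i j (muCoeff μ) where
  hki := hki
  hkj := hkj
  hij := hij
  det := muCoeff_det hμ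
  mem x := by
    rw [mem_XMu_iff hki hkj hij]
    simp only [tri, muCoeff, Matrix.cons_val]
    constructor <;> intro h <;> linear_combination h
  smooth x hx hs := by
    rw [singAt_XMu_iff hμ hki hkj hij hx] at hs
    have hs' : ¬ SingularAt x := fun h =>
      hs ((singAt_XMu_iff hμ (by decide) (by decide) (by decide) hx).mp h)
    rw [XMu_eq] at hx ⊢
    exact isSmoothPoint_of_not_singularAt (muCoeff_det hμ) hx hs'
  node x hx hs := by
    rw [singAt_XMu_iff hμ hki hkj hij hx] at hs
    have hs' : SingularAt x :=
      (singAt_XMu_iff hμ (i := 1) (j := 2) (k := 0) (by decide) (by decide) (by decide) hx).mpr hs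
    rw [XMu_eq] at hx ⊢
    exact (isNode_iff (muCoeff_det hμ)).mpr ⟨hx, hs'⟩

theorem isSmooth_XMu_iff (hμ : μ ≠ 0) : IsSmooth (XMu τ μ) ↔ NoTwoTorsion (XMu τ μ) := by
  have h := isSmooth_iff (τ := τ) (muCoeff_det hμ)
  have e : hyper τ (muCoeff μ) = XMu τ μ := (XMu_eq τ μ).symm
  rw [e] at h
  rw [h]
  refine forall₂_congr fun x hx => not_congr ?_
  exact singAt_XMu_iff hμ (by decide) (by decide) (by decide) hx

theorem phi_muCoeff_ne_zero (hμ : μ ≠ 0) {τ : UpperHalfPlane} (a : E τ) (ha : a + a = 0) :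
    phi₁ (muCoeff μ) (legendre τ a) ≠ 0 ∧ phi₂ (muCoeff μ) (legendre τ a) ≠ 0 := by
  have := legendre_ne_zero_of_add_self ha
  simpa [phi₁, phi₂, muCoeff, hμ] using this

end

/-! ### The hypersurface `X̂_b` -/

theorem bConst_prod_ne_zero : bConst (τ 0) * bConst (τ 1) * bConst (τ 2) ≠ 0 :=
  mul_ne_zero (mul_ne_zero bConst_ne_zero bConst_ne_zero) bConst_ne_zero

/-- The points of order two at which `ℒ² = 1`. -/
def torsion₁ (τ : UpperHalfPlane) : Set (E τ) := {0, half₁ τ}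

/-- The points of order two at which `ℒ² = b⁴`. -/
def torsion₂ (τ : UpperHalfPlane) : Set (E τ) := {half₂ τ, half₁ τ + half₂ τ}

section

variable {τ : UpperHalfPlane}

theorem encard_torsion₁ : (torsion₁ τ).encard = 2 := Set.encard_pair half₁_ne_zero.symm

theorem encard_torsion₂ : (torsion₂ τ).encard = 2 :=
  Set.encard_pair fun h => half₁_ne_zero (τ := τ) (by simpa using h)

theorem add_self_eq_zero_iff_torsion {x : E τ} : x + x = 0 ↔ x ∈ torsion₁ τ ∨ x ∈ torsion₂ τ := by
  rw [add_self_eq_zero_iff, torsion₁, torsion₂]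
  simp only [Set.mem_insert_iff, Set.mem_singleton_iff]
  tauto

theorem legendre_sq_of_torsion₁ {x : E τ} (hx : x ∈ torsion₁ τ) :
    (legendre τ x).1 ^ 2 = (legendre τ x).2 ^ 2 := by
  rcases hx with rfl | rfl
  · rw [legendre_zero]
  · rw [legendre_half₁, neg_sq]

theorem legendre_sq_of_torsion₂ {x : E τ} (hx : x ∈ torsion₂ τ) :
    (legendre τ x).1 ^ 2 = (bConst τ ^ 2) ^ 2 * (legendre τ x).2 ^ 2 := by
  rcases hx with rfl | rfl
  · rw [legendre_half₂]
    ring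
  · rw [legendre_half_sum]
    ring

theorem bConst_sq_sq_ne_one : (bConst τ ^ 2) ^ 2 ≠ 1 := fun h =>
  (mul_self_eq_one_iff.mp (by rwa [← sq])).elim bConst_sq_ne_one bConst_sq_ne_neg_one

theorem disjoint_torsion : Disjoint (torsion₁ τ) (torsion₂ τ) := by
  refine Set.disjoint_left.mpr fun x h1 h2 => ?_
  have h3 := legendre_ne_zero_of_add_self (add_self_eq_zero_iff_torsion.mpr (Or.inl h1))
  refine bConst_sq_sq_ne_one (τ := τ) (mul_right_cancel₀ (pow_ne_zero 2 h3.2) ?_)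
  rw [← legendre_sq_of_torsion₂ h2, legendre_sq_of_torsion₁ h1, one_mul]

/-- A linear form `Qℒ = R` has a root of order two if and only if `Q² = R²` or `b⁴Q² = R²`. -/
theorem exists_torsion_mem_linFibre_iff {Q R : ℂ} :
    (∃ t ∈ linFibre τ Q (-R), t + t = 0) ↔ Q ^ 2 = R ^ 2 ∨ (bConst τ ^ 2) ^ 2 * Q ^ 2 = R ^ 2 := by
  constructor
  · rintro ⟨t, ht, h0⟩
    have h2 := pow_ne_zero 2 (legendre_ne_zero_of_add_self h0).2
    have ht' : Q * (legendre τ t).1 + -R * (legendre τ t).2 = 0 := ht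
    have e : Q ^ 2 * (legendre τ t).1 ^ 2 = R ^ 2 * (legendre τ t).2 ^ 2 := by
      linear_combination (Q * (legendre τ t).1 + R * (legendre τ t).2) * ht'
    rcases add_self_eq_zero_iff_torsion.mp h0 with h1 | h1
    · rw [legendre_sq_of_torsion₁ h1] at e
      exact Or.inl (mul_right_cancel₀ h2 e)
    · rw [legendre_sq_of_torsion₂ h1] at e
      refine Or.inr (mul_right_cancel₀ h2 ?_)
      linear_combination e
  · have mem : ∀ t : E τ, Q * (legendre τ t).1 + -R * (legendre τ t).2 = 0 → t ∈ linFibre τ Q (-R) :=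
      fun t ht => ht
    rintro (h | h)
    · rcases sq_eq_sq_iff_eq_or_eq_neg.mp h with h | h
      · exact ⟨0, mem _ (by rw [legendre_zero, h]; ring), add_zero _⟩
      · exact ⟨half₁ τ, mem _ (by rw [legendre_half₁, h]; ring), half₁_add_self⟩
    · rw [← mul_pow] at h
      rcases sq_eq_sq_iff_eq_or_eq_neg.mp h with h | h
      · refine ⟨half₂ τ, mem _ ?_, half₂_add_self⟩
        rw [legendre_half₂]
        linear_combination (legendre τ (half₂ τ)).2 * h
      · refine ⟨half₁ τ + half₂ τ, mem _ ?_, ?_⟩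
        · rw [legendre_half_sum]
          linear_combination -(legendre τ (half₁ τ + half₂ τ)).2 * h
        · exact add_self_eq_zero_iff.mpr (Or.inr (Or.inr (Or.inr rfl)))

end

section

variable {τ₁ τ₂ τ₃ : UpperHalfPlane}

/-- The pairs of points of order two with the same value of `ℒ²` relative to `b⁴`. -/
def samePairs (τ₁ τ₂ : UpperHalfPlane) : Set (E τ₁ × E τ₂) :=
  torsion₁ τ₁ ×ˢ torsion₁ τ₂ ∪ torsion₂ τ₁ ×ˢ torsion₂ τ₂

/-- The complement of `samePairs` in the set of pairs of points of order two. -/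
def diffPairs (τ₁ τ₂ : UpperHalfPlane) : Set (E τ₁ × E τ₂) :=
  torsion₁ τ₁ ×ˢ torsion₂ τ₂ ∪ torsion₂ τ₁ ×ˢ torsion₁ τ₂

theorem encard_samePairs : (samePairs τ₁ τ₂).encard = (8 : ℕ) := by
  rw [samePairs, Set.encard_union_eq, Set.encard_prod, Set.encard_prod, encard_torsion₁,
    encard_torsion₁, encard_torsion₂, encard_torsion₂]
  · norm_num
  · exact Set.disjoint_left.mpr fun x h1 h2 => Set.disjoint_left.mp disjoint_torsion h1.1 h2.1

theorem encard_diffPairs : (diffPairs τ₁ τ₂).encard = (8 : ℕ) := by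
  rw [diffPairs, Set.encard_union_eq, Set.encard_prod, Set.encard_prod, encard_torsion₁,
    encard_torsion₁, encard_torsion₂, encard_torsion₂]
  · norm_num
  · exact Set.disjoint_left.mpr fun x h1 h2 => Set.disjoint_left.mp disjoint_torsion h1.1 h2.1

theorem mem_pairs_iff {y : E τ₁ × E τ₂} : (y.1 + y.1 = 0 ∧ y.2 + y.2 = 0) ↔
    y ∈ samePairs τ₁ τ₂ ∨ y ∈ diffPairs τ₁ τ₂ := by
  rw [add_self_eq_zero_iff_torsion, add_self_eq_zero_iff_torsion]
  simp only [samePairs, diffPairs, Set.mem_union, Set.mem_prod]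
  tauto

/-- The pair `y` can be completed to a point of order two of the hypersurface
`ℒ₁ℒ₂ℒ₃ = b₁b₂b₃`. -/
def IsCritical (τ₃ : UpperHalfPlane) (y : E τ₁ × E τ₂) : Prop :=
  ∃ t ∈ linFibre τ₃ ((legendre τ₁ y.1).1 * (legendre τ₂ y.2).1)
    (-(bConst τ₁ * bConst τ₂ * bConst τ₃ * ((legendre τ₁ y.1).2 * (legendre τ₂ y.2).2))), t + t = 0

theorem isCritical_iff_of_sq {y : E τ₁ × E τ₂} {u v : ℂ} (h1 : y.1 + y.1 = 0) (h2 : y.2 + y.2 = 0)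
    (hu : (legendre τ₁ y.1).1 ^ 2 = u * (legendre τ₁ y.1).2 ^ 2)
    (hv : (legendre τ₂ y.2).1 ^ 2 = v * (legendre τ₂ y.2).2 ^ 2) :
    IsCritical τ₃ y ↔ u * v = bConst τ₁ ^ 2 * bConst τ₂ ^ 2 * bConst τ₃ ^ 2 ∨
      bConst τ₃ ^ 2 * (u * v) = bConst τ₁ ^ 2 * bConst τ₂ ^ 2 := by
  have hq := pow_ne_zero 2 (legendre_ne_zero_of_add_self h1).2
  have hr := pow_ne_zero 2 (legendre_ne_zero_of_add_self h2).2
  have hb := pow_ne_zero 2 (bConst_ne_zero (τ := τ₃))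
  rw [IsCritical, exists_torsion_mem_linFibre_iff, mul_pow, hu, hv]
  refine or_congr ?_ ?_
  · rw [← mul_left_inj' (mul_ne_zero hq hr)]
    constructor <;> intro h
    · refine mul_right_cancel₀ (mul_ne_zero hq hr) (mul_right_cancel₀ (mul_ne_zero hq hr) ?_)
      linear_combination h
    · linear_combination (legendre τ₁ y.1).2 ^ 2 * (legendre τ₂ y.2).2 ^ 2 *
        ((legendre τ₁ y.1).2 ^ 2 * (legendre τ₂ y.2).2 ^ 2) * h
  · constructor <;> intro h
    · refine mul_right_cancel₀ (mul_ne_zero hb (mul_ne_zero hq hr)) ?_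
      linear_combination h
    · linear_combination bConst τ₃ ^ 2 * ((legendre τ₁ y.1).2 ^ 2 * (legendre τ₂ y.2).2 ^ 2) * h

/-- The condition on the constants for all pairs in `samePairs` to be critical. -/
def SameCond (τ₁ τ₂ τ₃ : UpperHalfPlane) : Prop :=
  bConst τ₁ ^ 2 * bConst τ₂ ^ 2 * bConst τ₃ ^ 2 = 1 ∨ bConst τ₃ ^ 2 = bConst τ₁ ^ 2 * bConst τ₂ ^ 2

/-- The condition on the constants for all pairs in `diffPairs` to be critical. -/
def DiffCond (τ₁ τ₂ τ₃ : UpperHalfPlane) : Prop :=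
  bConst τ₁ ^ 2 = bConst τ₂ ^ 2 * bConst τ₃ ^ 2 ∨ bConst τ₂ ^ 2 = bConst τ₁ ^ 2 * bConst τ₃ ^ 2

theorem isCritical_iff_of_samePairs {y : E τ₁ × E τ₂} (hy : y ∈ samePairs τ₁ τ₂) :
    IsCritical τ₃ y ↔ SameCond τ₁ τ₂ τ₃ := by
  obtain ⟨h1, h2⟩ := mem_pairs_iff.mpr (Or.inl hy)
  have hb := mul_ne_zero (pow_ne_zero 2 (bConst_ne_zero (τ := τ₁)))
    (pow_ne_zero 2 (bConst_ne_zero (τ := τ₂)))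
  rcases hy with hy | hy
  · rw [isCritical_iff_of_sq (u := 1) (v := 1) h1 h2
      (by rw [one_mul, legendre_sq_of_torsion₁ hy.1])
      (by rw [one_mul, legendre_sq_of_torsion₁ hy.2]), SameCond, one_mul, mul_one, eq_comm]
  · rw [isCritical_iff_of_sq h1 h2 (legendre_sq_of_torsion₂ hy.1) (legendre_sq_of_torsion₂ hy.2),
      SameCond, or_comm]
    refine or_congr ?_ ?_
    · constructor <;> intro h
      · refine mul_left_cancel₀ hb ?_
        linear_combination h
      · linear_combination bConst τ₁ ^ 2 * bConst τ₂ ^ 2 * h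
    · constructor <;> intro h
      · refine mul_left_cancel₀ hb ?_
        linear_combination -h
      · linear_combination -(bConst τ₁ ^ 2 * bConst τ₂ ^ 2) * h

theorem isCritical_iff_of_diffPairs {y : E τ₁ × E τ₂} (hy : y ∈ diffPairs τ₁ τ₂) :
    IsCritical τ₃ y ↔ DiffCond τ₁ τ₂ τ₃ := by
  obtain ⟨h1, h2⟩ := mem_pairs_iff.mpr (Or.inr hy)
  have hb1 := pow_ne_zero 2 (bConst_ne_zero (τ := τ₁))
  have hb2 := pow_ne_zero 2 (bConst_ne_zero (τ := τ₂))
  rcases hy with hy | hy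
  · rw [isCritical_iff_of_sq (u := 1) h1 h2 (by rw [one_mul, legendre_sq_of_torsion₁ hy.1])
      (legendre_sq_of_torsion₂ hy.2), DiffCond, or_comm]
    refine or_congr ?_ ?_
    · constructor <;> intro h
      · refine mul_left_cancel₀ hb2 ?_
        linear_combination -h
      · linear_combination -bConst τ₂ ^ 2 * h
    · constructor <;> intro h
      · refine mul_left_cancel₀ hb2 ?_
        linear_combination h
      · linear_combination bConst τ₂ ^ 2 * h
  · rw [isCritical_iff_of_sq (v := 1) h1 h2 (legendre_sq_of_torsion₂ hy.1)
      (by rw [one_mul, legendre_sq_of_torsion₁ hy.2]), DiffCond]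
    refine or_congr ?_ ?_
    · constructor <;> intro h
      · refine mul_left_cancel₀ hb1 ?_
        linear_combination h
      · linear_combination bConst τ₁ ^ 2 * h
    · constructor <;> intro h
      · refine mul_left_cancel₀ hb1 ?_
        linear_combination -h
      · linear_combination -bConst τ₁ ^ 2 * h

/-- The two conditions exclude each other because `b⁴ ≠ 1`. -/
theorem not_sameCond_and_diffCond (h1 : SameCond τ₁ τ₂ τ₃) (h2 : DiffCond τ₁ τ₂ τ₃) : False := by
  have n1 := bConst_sq_sq_ne_one (τ := τ₁)
  have n2 := bConst_sq_sq_ne_one (τ := τ₂)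
  have z1 := pow_ne_zero 2 (bConst_ne_zero (τ := τ₁))
  have z2 := pow_ne_zero 2 (bConst_ne_zero (τ := τ₂))
  rcases h1 with h1 | h1 <;> rcases h2 with h2 | h2
  · exact n1 (by linear_combination h1 + bConst τ₁ ^ 2 * h2)
  · exact n2 (by linear_combination h1 + bConst τ₂ ^ 2 * h2)
  · exact n2 (mul_left_cancel₀ z1 (by linear_combination -h2 - bConst τ₂ ^ 2 * h1))
  · exact n1 (mul_left_cancel₀ z2 (by linear_combination -h2 - bConst τ₁ ^ 2 * h1))

end

theorem mem_XB_iff {i j k : Fin 3} (hij : i ≠ j) (hik : i ≠ k) (hjk : j ≠ k) (x : T τ) :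
    x ∈ XB τ ↔ x k ∈ linFibre (τ k) ((legendre (τ i) (x i)).1 * (legendre (τ j) (x j)).1)
      (-(bConst (τ i) * bConst (τ j) * bConst (τ k) *
        ((legendre (τ i) (x i)).2 * (legendre (τ j) (x j)).2))) := by
  rw [XB, mem_XMu_iff hij hik hjk, mul_mul_eq_of_ne hij hik hjk fun l => bConst (τ l)]
  change _ ↔ _ * _ + _ * _ = 0
  constructor <;> intro h <;> linear_combination h

/-- If eight pairs of points of order two in the factors `i, j` are critical and the other eight are
not, the locus of `X̂_b` over these pairs consists of `16` points and `8` nodes. -/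
theorem hasShape_XB_of_pairs {i j k : Fin 3} (hij : i ≠ j) (hik : i ≠ k) (hjk : j ≠ k)
    {F : Set (T τ)} (hF : ∀ x, x ∈ F ↔ x ∈ XB τ ∧ x i + x i = 0 ∧ x j + x j = 0)
    {R R' : Set (E (τ i) × E (τ j))} (hR : R.encard = (8 : ℕ)) (hR' : R'.encard = (8 : ℕ))
    (hRR' : ∀ y : E (τ i) × E (τ j), (y.1 + y.1 = 0 ∧ y.2 + y.2 = 0) ↔ y ∈ R ∨ y ∈ R')
    (hc : ∀ y ∈ R, IsCritical (τ k) y) (hc' : ∀ y ∈ R', ¬ IsCritical (τ k) y) :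
    HasShape (XB τ) F 16 8 0 0 := by
  have h := isTri_XMu (τ := τ) (bConst_prod_ne_zero (τ := τ)) hik.symm hjk.symm hij
  set A : E (τ i) × E (τ j) → ℂ := fun y => (legendre (τ i) y.1).1 * (legendre (τ j) y.2).1 with hA
  set B : E (τ i) × E (τ j) → ℂ := fun y => -(bConst (τ i) * bConst (τ j) * bConst (τ k) *
    ((legendre (τ i) y.1).2 * (legendre (τ j) y.2).2)) with hB
  have hAB : ∀ y : E (τ i) × E (τ j), y.1 + y.1 = 0 ∧ y.2 + y.2 = 0 → A y ≠ 0 ∨ B y ≠ 0 :=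
    fun y hy => Or.inl (mul_ne_zero (legendre_ne_zero_of_add_self hy.1).1
      (legendre_ne_zero_of_add_self hy.2).1)
  have hP := encard_linFibred (τ := τ) hij hik hjk hR' (N := 16) rfl A B
    (fun y hy => hAB y ((hRR' y).mpr (Or.inr hy))) fun y hy t ht h0 => hc' y hy ⟨t, ht, h0⟩
  have hN := encard_linFibred_of_branch (τ := τ) hij hik hjk hR A B
    (fun y hy => hAB y ((hRR' y).mpr (Or.inl hy))) hc
  refine hasShape_points_nodes hP (fun x hx => ?_) hN (fun x hx => ?_) fun x => ?_
  · refine h.smooth x ((mem_XB_iff hij hik hjk x).mpr hx.2) fun hs => hc' _ hx.1 ?_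
    exact ⟨x k, hx.2, hs.1⟩
  · have h0 := (hRR' _).mpr (Or.inl hx.1)
    obtain ⟨t, ht, ht0⟩ := hc _ hx.1
    obtain ⟨z, hz⟩ := Set.encard_eq_one.mp (encard_linFibre_of_branch (hAB _ h0) ht ht0)
    have e1 : x k ∈ ({z} : Set (E (τ k))) := hz ▸ hx.2
    have e2 : t ∈ ({z} : Set (E (τ k))) := hz ▸ ht
    refine h.node x ((mem_XB_iff hij hik hjk x).mpr hx.2) ⟨?_, Or.inl h0⟩
    rw [Set.mem_singleton_iff.mp e1, ← Set.mem_singleton_iff.mp e2, ht0]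
  · rw [hF, mem_XB_iff hij hik hjk x, hRR' (x i, x j)]
    simp only [Set.mem_ofPred_eq, hA, hB]
    tauto

/-- A singular `X̂_b` contains a point of order two. It makes its own class of pairs critical, and
the other class is not, as the conditions on the constants exclude each other. -/
theorem hasShape_XB_of_not_isSmooth {i j k : Fin 3} (hij : i ≠ j) (hik : i ≠ k) (hjk : j ≠ k)
    (hs : ¬ IsSmooth (XB τ)) {F : Set (T τ)}
    (hF : ∀ x, x ∈ F ↔ x ∈ XB τ ∧ x i + x i = 0 ∧ x j + x j = 0) :
    HasShape (XB τ) F 16 8 0 0 := by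
  rw [XB, isSmooth_XMu_iff bConst_prod_ne_zero] at hs
  unfold NoTwoTorsion at hs
  push Not at hs
  obtain ⟨x, hx, h0⟩ := hs
  have hc : IsCritical (τ k) (x i, x j) := ⟨x k, (mem_XB_iff hij hik hjk x).mp hx, h0 k⟩
  rcases (mem_pairs_iff (y := (x i, x j))).mp ⟨h0 i, h0 j⟩ with hy | hy
  · have h1 := (isCritical_iff_of_samePairs hy).mp hc
    exact hasShape_XB_of_pairs hij hik hjk hF encard_samePairs encard_diffPairs
      (fun y => mem_pairs_iff) (fun y hy => (isCritical_iff_of_samePairs hy).mpr h1)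
      fun y hy h2 => not_sameCond_and_diffCond h1 ((isCritical_iff_of_diffPairs hy).mp h2)
  · have h1 := (isCritical_iff_of_diffPairs hy).mp hc
    exact hasShape_XB_of_pairs hij hik hjk hF encard_diffPairs encard_samePairs
      (fun y => mem_pairs_iff.trans or_comm) (fun y hy => (isCritical_iff_of_diffPairs hy).mpr h1)
      fun y hy h2 => not_sameCond_and_diffCond ((isCritical_iff_of_samePairs hy).mp h2) h1

end Burniat

end

/-! ### The elements of the tables -/

noncomputable section

namespace Burniat

variable {τ : Fin 3 → UpperHalfPlane}

section

variable {X : Set (T τ)} {x : T τ}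

theorem mem_fixOn_g₁ : x ∈ fixOn X g₁ ↔ x ∈ X ∧ x 2 + x 2 = 0 := by
  simp [mem_fixOn, g₁, actE_zero, actE_100]

theorem mem_fixOn_g₂ : x ∈ fixOn X g₂ ↔ x ∈ X ∧ x 1 + x 1 = 0 := by
  simp [mem_fixOn, g₂, actE_zero, actE_100]

theorem mem_fixOn_g₃ : x ∈ fixOn X g₃ ↔ x ∈ X ∧ x 0 + x 0 = 0 := by
  simp [mem_fixOn, g₃, actE_zero, actE_100]

theorem mem_fixOn_g₄ : x ∈ fixOn X g₄ ↔ x ∈ X ∧ x 1 + x 1 = 0 ∧ x 2 + x 2 = 0 := by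
  simp [mem_fixOn, g₄, actE_zero, actE_100]

theorem mem_fixOn_g₅ : x ∈ fixOn X g₅ ↔ x ∈ X ∧ x 0 + x 0 = 0 ∧ x 2 + x 2 = 0 := by
  simp [mem_fixOn, g₅, actE_zero, actE_100]

theorem mem_fixOn_g₆ : x ∈ fixOn X g₆ ↔ x ∈ X ∧ x 0 + x 0 = 0 ∧ x 1 + x 1 = 0 := by
  simp [mem_fixOn, g₆, actE_zero, actE_100]

theorem mem_fixOn_g₇ :
    x ∈ fixOn X g₇ ↔ x ∈ X ∧ x 1 + x 1 = half₁ (τ 1) ∧ x 2 + x 2 = half₁ (τ 2) := by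
  simp [mem_fixOn, g₇, actE_zero, actE_001]

theorem mem_fixOn_g₈ :
    x ∈ fixOn X g₈ ↔ x ∈ X ∧ x 0 + x 0 = half₁ (τ 0) ∧ x 2 + x 2 = half₁ (τ 2) := by
  simp [mem_fixOn, g₈, actE_zero, actE_001]

theorem mem_fixOn_g₉ :
    x ∈ fixOn X g₉ ↔ x ∈ X ∧ x 0 + x 0 = half₁ (τ 0) ∧ x 1 + x 1 = half₁ (τ 1) := by
  simp [mem_fixOn, g₉, actE_zero, actE_001]

theorem mem_fixOn_g₁₁ : x ∈ fixOn X g₁₁ ↔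
    x ∈ X ∧ x 0 + x 0 = 0 ∧ x 1 + x 1 = half₁ (τ 1) ∧ x 2 + x 2 = half₁ (τ 2) := by
  simp [mem_fixOn, g₁₁, actE_100, actE_001]

theorem mem_fixOn_g₁₂ : x ∈ fixOn X g₁₂ ↔
    x ∈ X ∧ x 1 + x 1 = 0 ∧ x 0 + x 0 = half₁ (τ 0) ∧ x 2 + x 2 = half₁ (τ 2) := by
  simp [mem_fixOn, g₁₂, actE_100, actE_001, and_left_comm]

theorem mem_fixOn_g₁₃ : x ∈ fixOn X g₁₃ ↔
    x ∈ X ∧ x 2 + x 2 = 0 ∧ x 0 + x 0 = half₁ (τ 0) ∧ x 1 + x 1 = half₁ (τ 1) := by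
  simp [mem_fixOn, g₁₃, actE_100, actE_001]
  tauto

theorem mem_fixOn_g₁₄ : x ∈ fixOn X g₁₄ ↔ x ∈ X ∧ x 0 + x 0 = half₂ (τ 0) ∧
    x 1 + x 1 = half₂ (τ 1) ∧ x 2 + x 2 = half₂ (τ 2) := by
  simp [mem_fixOn, g₁₄, actE_010]

theorem mem_fixOn_g₁₅ : x ∈ fixOn X g₁₅ ↔ x ∈ X ∧ x 0 + x 0 = half₂ (τ 0) ∧
    x 1 + x 1 = half₁ (τ 1) + half₂ (τ 1) ∧ x 2 + x 2 = half₁ (τ 2) + half₂ (τ 2) := by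
  simp [mem_fixOn, g₁₅, actE_010, actE_111]

end

/-- The element acting by `z ↦ -z` on `T`; its fixed points are the points of order two. -/
def gNeg : G := ![![1, 0, 0], ![1, 0, 0], ![1, 0, 0]]

theorem gNeg_mem_G₁ : gNeg ∈ G₁ := AddSubgroup.subset_closure (Or.inl rfl)

theorem gNeg_mem_G₂ : gNeg ∈ G₂ := by
  have h1 : (![![1, 0, 0], ![0, 0, 1], ![1, 0, 1]] : G) ∈ G₂ :=
    AddSubgroup.subset_closure (Or.inl rfl)
  have h2 : (![![0, 0, 0], ![1, 0, 1], ![0, 0, 1]] : G) ∈ G₂ :=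
    AddSubgroup.subset_closure (Or.inr (Or.inr rfl))
  have : gNeg = ![![1, 0, 0], ![0, 0, 1], ![1, 0, 1]] + ![![0, 0, 0], ![1, 0, 1], ![0, 0, 1]] := by
    decide
  rw [this]
  exact add_mem h1 h2

theorem not_nonempty_fixOn_gNeg {X : Set (T τ)} (hX : NoTwoTorsion X) :
    ¬ (fixOn X gNeg).Nonempty := by
  rintro ⟨x, hx⟩
  obtain ⟨h, h0, h1, h2⟩ := mem_fixOn.mp hx
  refine hX x h fun l => ?_
  fin_cases l
  exacts [actE_100.mp h0, actE_100.mp h1, actE_100.mp h2]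

/-- The only consequence of freeness that matters: the fixed points of `gNeg` have order two. -/
theorem noTwoTorsion_of_actsFreely {H : AddSubgroup G} {X : Set (T τ)} (hH : gNeg ∈ H)
    (h : ActsFreely H X) : NoTwoTorsion X := by
  intro x hx h0
  refine h _ hH (by decide) x hx ?_
  exact (mem_fixOn.mpr ⟨hx, actE_100.mpr (h0 0), actE_100.mpr (h0 1), actE_100.mpr (h0 2)⟩).2

/-- Every component of `g` is zero or acts by `z ↦ -z + c`, a necessary condition for `g` to have a
fixed point. -/
def HasParity (g : G) : Prop := ∀ l, g l = 0 ∨ g l 0 + g l 1 + g l 2 = 1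

theorem hasParity_of_nonempty {X : Set (T τ)} {g : G} (h : (fixOn X g).Nonempty) : HasParity g :=
  fun l => eq_zero_or_sum_eq_one_of_actE_eq (fixOn_coord h.some_mem l)

set_option synthInstance.maxSize 1000 in
set_option synthInstance.maxHeartbeats 200000 in
theorem eq_of_hasParity_of_mem_calG1' {g : G} (hg : g ∈ calG1') (h0 : g ≠ 0) (hp : HasParity g)
    (hn : g ≠ gNeg) : g ∈ ({g₁, g₂, g₃, g₄, g₅, g₆, g₇, g₁₁, g₁₄, g₁₅} : Set G) := by
  have key : ∀ a : Fin 3 → ZMod 2, (a = 0 ∨ a 0 + a 1 + a 2 = 1) → a 2 = 0 →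
      ∀ b : Fin 3 → ZMod 2, (b = 0 ∨ b 0 + b 1 + b 2 = 1) → a 1 = b 1 →
      ∀ d : Fin 3 → ZMod 2, (d = 0 ∨ d 0 + d 1 + d 2 = 1) → b 1 = d 1 → b 2 + d 2 = 0 →
      (![a, b, d] : G) ≠ 0 → (![a, b, d] : G) ≠ gNeg →
        (![a, b, d] : G) ∈ [g₁, g₂, g₃, g₄, g₅, g₆, g₇, g₁₁, g₁₄, g₁₅] := by
    decide +kernel
  have e : g = ![g 0, g 1, g 2] := by ext l; fin_cases l <;> rfl
  have := key _ (hp 0) hg.2.2.1 _ (hp 1) hg.1 _ (hp 2) hg.2.1 hg.2.2.2 (e ▸ h0) (e ▸ hn)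
  rw [← e] at this
  simpa only [List.mem_cons, List.not_mem_nil, or_false, Set.mem_insert_iff,
    Set.mem_singleton_iff] using this

set_option synthInstance.maxSize 1000 in
set_option synthInstance.maxHeartbeats 200000 in
theorem eq_of_hasParity_of_mem_calG1 {g : G} (hg : g ∈ calG1) (h0 : g ≠ 0) (hp : HasParity g)
    (hn : g ≠ gNeg) : g ∈ ({g₁, g₂, g₃, g₄, g₅, g₆, g₇, g₈, g₉, g₁₁, g₁₂, g₁₃} : Set G) := by
  have key : ∀ a : Fin 3 → ZMod 2, (a = 0 ∨ a 0 + a 1 + a 2 = 1) → a 1 = 0 →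
      ∀ b : Fin 3 → ZMod 2, (b = 0 ∨ b 0 + b 1 + b 2 = 1) → b 1 = 0 →
      ∀ d : Fin 3 → ZMod 2, (d = 0 ∨ d 0 + d 1 + d 2 = 1) → d 1 = 0 → a 2 + b 2 + d 2 = 0 →
      (![a, b, d] : G) ≠ 0 → (![a, b, d] : G) ≠ gNeg →
        (![a, b, d] : G) ∈ [g₁, g₂, g₃, g₄, g₅, g₆, g₇, g₈, g₉, g₁₁, g₁₂, g₁₃] := by
    decide +kernel
  have e : g = ![g 0, g 1, g 2] := by ext l; fin_cases l <;> rfl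
  have := key _ (hp 0) hg.1 _ (hp 1) hg.2.1 _ (hp 2) hg.2.2.1 hg.2.2.2 (e ▸ h0) (e ▸ hn)
  rw [← e] at this
  simpa only [List.mem_cons, List.not_mem_nil, or_false, Set.mem_insert_iff,
    Set.mem_singleton_iff] using this

theorem mem_calG1'_of_mem : ∀ g ∈ ({g₁, g₂, g₃, g₄, g₅, g₆, g₇, g₁₁, g₁₄, g₁₅} : Set G),
    g ∈ calG1' ∧ g ≠ 0 := by
  rintro g (rfl | rfl | rfl | rfl | rfl | rfl | rfl | rfl | rfl | rfl) <;>
    exact ⟨⟨by decide, by decide, by decide, by decide⟩, by decide⟩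

theorem mem_calG1_of_mem : ∀ g ∈ ({g₁, g₂, g₃, g₄, g₅, g₆, g₇, g₈, g₉, g₁₁, g₁₂, g₁₃} : Set G),
    g ∈ calG1 ∧ g ≠ 0 := by
  rintro g (rfl | rfl | rfl | rfl | rfl | rfl | rfl | rfl | rfl | rfl | rfl | rfl) <;>
    exact ⟨⟨by decide, by decide, by decide, by decide⟩, by decide⟩

set_option synthInstance.maxSize 1000 in
set_option synthInstance.maxHeartbeats 200000 in
theorem setOf_calG0_hasFixDimOne (τ : Fin 3 → UpperHalfPlane) :
    {g | g ∈ calG0 ∧ HasFixDimOne τ g} = {g₄, g₅, g₆, g₇, g₈, g₉} := by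
  have key : ∀ i j k : Fin 3, i ≠ j → i ≠ k → j ≠ k →
      ∀ a b d : Fin 3 → ZMod 2, a 1 = b 1 ∧ b 1 = d 1 ∧ a 2 + b 2 + d 2 = 0 →
      ![a, b, d] k = 0 → ![a, b, d] i 0 + ![a, b, d] i 1 + ![a, b, d] i 2 = 1 →
      ![a, b, d] j 0 + ![a, b, d] j 1 + ![a, b, d] j 2 = 1 →
      (![a, b, d] : G) ∈ [g₄, g₅, g₆, g₇, g₈, g₉] := by
    decide +kernel
  have key' : ∀ g, (g = g₄ ∨ g = g₅ ∨ g = g₆ ∨ g = g₇ ∨ g = g₈ ∨ g = g₉) →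
      (g 0 1 = g 1 1 ∧ g 1 1 = g 2 1 ∧ g 0 2 + g 1 2 + g 2 2 = 0) ∧
      ∃ i j k : Fin 3, i ≠ j ∧ i ≠ k ∧ j ≠ k ∧ g k = 0 ∧ g i 0 + g i 1 + g i 2 = 1 ∧
        g j 0 + g j 1 + g j 2 = 1 := by
    rintro g (rfl | rfl | rfl | rfl | rfl | rfl) <;> decide +kernel
  ext g
  change _ ∧ HasFixDimOne τ g ↔ g = g₄ ∨ g = g₅ ∨ g = g₆ ∨ g = g₇ ∨ g = g₈ ∨ g = g₉
  rw [hasFixDimOne_iff]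
  refine ⟨fun ⟨h, i, j, k, hij, hik, hjk, hk, hi, hj⟩ => ?_, key' g⟩
  have e : g = ![g 0, g 1, g 2] := by ext l; fin_cases l <;> rfl
  have := key i j k hij hik hjk (g 0) (g 1) (g 2) h
  rw [← e] at this
  simpa only [List.mem_cons, List.not_mem_nil, or_false] using this hk hi hj

end Burniat

end

/-! ### Elements with fixed points -/

noncomputable section

namespace Burniat

variable {τ : Fin 3 → UpperHalfPlane}

section

variable {ν₁ ν₂ : ℂ}

theorem hasShape_XNu_g₁₄ (h1 : ν₁ ≠ ν₂) (h2 : ν₁ ≠ -ν₂) :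
    HasShape (XNu τ ν₁ ν₂) (fixOn (XNu τ ν₁ ν₂) g₁₄) 32 0 0 0 := by
  refine hasShape_XNu_half₂ h1 h2 (fun y z hy hz => ?_) fun x => mem_fixOn_g₁₄
  have h3 := add_self_eq_half₂_iff.mp hy
  have h4 := add_self_eq_half₂_iff.mp hz
  refine ⟨?_, mul_ne_zero (snd_ne_zero_of_sq h3) (snd_ne_zero_of_sq h4)⟩
  rw [mul_pow, h3, h4]
  ring

theorem hasShape_XNu_g₁₅ (h1 : ν₁ ≠ ν₂) (h2 : ν₁ ≠ -ν₂) :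
    HasShape (XNu τ ν₁ ν₂) (fixOn (XNu τ ν₁ ν₂) g₁₅) 32 0 0 0 := by
  refine hasShape_XNu_half₂ h1 h2 (fun y z hy hz => ?_) fun x => mem_fixOn_g₁₅
  have h3 := add_self_eq_half_sum_iff.mp hy
  have h4 := add_self_eq_half_sum_iff.mp hz
  rw [← neg_mul] at h3 h4
  refine ⟨?_, mul_ne_zero (snd_ne_zero_of_sq h3) (snd_ne_zero_of_sq h4)⟩
  rw [mul_pow, h3, h4]
  ring

theorem IsGamma.nonempty {X F : Set (T τ)} (h : IsGamma X F) : F.Nonempty := by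
  obtain ⟨C₁, C₂, Ds, hC₁, -, -, -, -, -, -, -, -, rfl⟩ := h
  exact hC₁.2.1.nonempty.mono fun x hx => Or.inl (Or.inl hx)

theorem setOf_calG1'_fixOn_nonempty {X : Set (T τ)} (hX : NoTwoTorsion X)
    (h : ∀ g ∈ ({g₁, g₂, g₃, g₄, g₅, g₆, g₇, g₁₁, g₁₄, g₁₅} : Set G), (fixOn X g).Nonempty) :
    {g | g ∈ calG1' ∧ g ≠ 0 ∧ (fixOn X g).Nonempty} =
      {g₁, g₂, g₃, g₄, g₅, g₆, g₇, g₁₁, g₁₄, g₁₅} := by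
  ext g
  constructor
  · rintro ⟨hg, h0, hn⟩
    refine eq_of_hasParity_of_mem_calG1' hg h0 (hasParity_of_nonempty hn) ?_
    rintro rfl
    exact not_nonempty_fixOn_gNeg hX hn
  · exact fun hg => ⟨(mem_calG1'_of_mem g hg).1, (mem_calG1'_of_mem g hg).2, h g hg⟩

theorem setOf_calG1_fixOn_nonempty {X : Set (T τ)} (hX : NoTwoTorsion X)
    (h : ∀ g ∈ ({g₁, g₂, g₃, g₄, g₅, g₆, g₇, g₈, g₉, g₁₁, g₁₂, g₁₃} : Set G),
      (fixOn X g).Nonempty) :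
    {g | g ∈ calG1 ∧ g ≠ 0 ∧ (fixOn X g).Nonempty} =
      {g₁, g₂, g₃, g₄, g₅, g₆, g₇, g₈, g₉, g₁₁, g₁₂, g₁₃} := by
  ext g
  constructor
  · rintro ⟨hg, h0, hn⟩
    refine eq_of_hasParity_of_mem_calG1 hg h0 (hasParity_of_nonempty hn) ?_
    rintro rfl
    exact not_nonempty_fixOn_gNeg hX hn
  · exact fun hg => ⟨(mem_calG1_of_mem g hg).1, (mem_calG1_of_mem g hg).2, h g hg⟩

end

end Burniat

end

theorem mainTheorem6 (τ : Fin 3 → UpperHalfPlane) :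
    -- the hypersurfaces `X̂_ν` with the group `G₁`
    (∀ ν₁ ν₂ : ℂ, ν₁ ≠ ν₂ → ν₁ ≠ -ν₂ → ActsFreely G₁ (XNu τ ν₁ ν₂) →
      {g | g ∈ calG1' ∧ g ≠ 0 ∧ (fixOn (XNu τ ν₁ ν₂) g).Nonempty} =
        {g₁, g₂, g₃, g₄, g₅, g₆, g₇, g₁₁, g₁₄, g₁₅} ∧
      (∀ g ∈ ({g₁, g₂} : Set G), HasShape (XNu τ ν₁ ν₂) (fixOn (XNu τ ν₁ ν₂) g) 0 0 0 4) ∧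
      (IsSmooth (XNu τ ν₁ ν₂) →
        HasShape (XNu τ ν₁ ν₂) (fixOn (XNu τ ν₁ ν₂) g₃) 0 0 0 4) ∧
      (¬ IsSmooth (XNu τ ν₁ ν₂) →
        IsGamma (XNu τ ν₁ ν₂) (fixOn (XNu τ ν₁ ν₂) g₃)) ∧
      (∀ g ∈ ({g₄, g₅, g₆} : Set G),
        HasShape (XNu τ ν₁ ν₂) (fixOn (XNu τ ν₁ ν₂) g) 32 0 0 0) ∧
      (IsSmooth (XNu τ ν₁ ν₂) →
        HasShape (XNu τ ν₁ ν₂) (fixOn (XNu τ ν₁ ν₂) g₇) 16 0 8 0) ∧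
      (¬ IsSmooth (XNu τ ν₁ ν₂) →
        HasShape (XNu τ ν₁ ν₂) (fixOn (XNu τ ν₁ ν₂) g₇) 0 8 8 0) ∧
      (IsSmooth (XNu τ ν₁ ν₂) →
        HasShape (XNu τ ν₁ ν₂) (fixOn (XNu τ ν₁ ν₂) g₁₁) 32 0 0 0) ∧
      (¬ IsSmooth (XNu τ ν₁ ν₂) →
        HasShape (XNu τ ν₁ ν₂) (fixOn (XNu τ ν₁ ν₂) g₁₁) 32 8 0 0) ∧
      (∀ g ∈ ({g₁₄, g₁₅} : Set G),
        HasShape (XNu τ ν₁ ν₂) (fixOn (XNu τ ν₁ ν₂) g) 32 0 0 0)) ∧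
    -- the hypersurfaces `X̂_μ` with the group `G₂`
    (∀ μ : ℂ, μ ≠ 0 → ActsFreely G₂ (XMu τ μ) →
      {g | g ∈ calG1 ∧ g ≠ 0 ∧ (fixOn (XMu τ μ) g).Nonempty} =
        {g₁, g₂, g₃, g₄, g₅, g₆, g₇, g₈, g₉, g₁₁, g₁₂, g₁₃} ∧
      (∀ g ∈ ({g₁, g₂, g₃} : Set G), HasShape (XMu τ μ) (fixOn (XMu τ μ) g) 0 0 0 4) ∧
      (∀ g ∈ ({g₄, g₅, g₆} : Set G), HasShape (XMu τ μ) (fixOn (XMu τ μ) g) 32 0 0 0) ∧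
      (∀ g ∈ ({g₇, g₈, g₉} : Set G), HasShape (XMu τ μ) (fixOn (XMu τ μ) g) 16 0 8 0) ∧
      (∀ g ∈ ({g₁₁, g₁₂, g₁₃} : Set G),
        HasShape (XMu τ μ) (fixOn (XMu τ μ) g) 32 0 0 0)) ∧
    -- the hypersurface `X̂_b` with the group `G₃` or `G₄`
    (ActsFreely G₃ (XB τ) ∨ ActsFreely G₄ (XB τ) →
      {g | g ∈ calG0 ∧ HasFixDimOne τ g} = {g₄, g₅, g₆, g₇, g₈, g₉} ∧
      (∀ g ∈ ({g₄, g₅, g₆} : Set G),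
        (IsSmooth (XB τ) → HasShape (XB τ) (fixOn (XB τ) g) 32 0 0 0) ∧
        (¬ IsSmooth (XB τ) → HasShape (XB τ) (fixOn (XB τ) g) 16 8 0 0)) ∧
      (∀ g ∈ ({g₇, g₈, g₉} : Set G), HasShape (XB τ) (fixOn (XB τ) g) 16 0 8 0)) := by
  refine ⟨fun ν₁ ν₂ h1 h2 hfree => ?_, fun μ hμ hfree => ?_, fun _ => ?_⟩
  · have hX := noTwoTorsion_of_actsFreely gNeg_mem_G₁ hfree
    have h := isTri_XNu (τ := τ) h1 h2
    have s₁ : HasShape (XNu τ ν₁ ν₂) (fixOn (XNu τ ν₁ ν₂) g₁) 0 0 0 4 :=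
      h.hasShape_slices_right hX fun x => mem_fixOn_g₁
    have s₂ : HasShape (XNu τ ν₁ ν₂) (fixOn (XNu τ ν₁ ν₂) g₂) 0 0 0 4 :=
      h.symm.hasShape_slices_right hX fun x => mem_fixOn_g₂
    have s₄ : HasShape (XNu τ ν₁ ν₂) (fixOn (XNu τ ν₁ ν₂) g₄) 32 0 0 0 :=
      h.hasShape_pairs_right hX fun x => mem_fixOn_g₄
    have s₅ : HasShape (XNu τ ν₁ ν₂) (fixOn (XNu τ ν₁ ν₂) g₅) 32 0 0 0 :=
      h.hasShape_pairs_left hX fun x => mem_fixOn_g₅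
    have s₆ : HasShape (XNu τ ν₁ ν₂) (fixOn (XNu τ ν₁ ν₂) g₆) 32 0 0 0 :=
      h.symm.hasShape_pairs_left hX fun x => mem_fixOn_g₆
    have s₁₄ := hasShape_XNu_g₁₄ (τ := τ) h1 h2
    have s₁₅ := hasShape_XNu_g₁₅ (τ := τ) h1 h2
    have s₃ : IsSmooth (XNu τ ν₁ ν₂) →
        HasShape (XNu τ ν₁ ν₂) (fixOn (XNu τ ν₁ ν₂) g₃) 0 0 0 4 := fun hs =>
      h.hasShape_slices_left hX (phi_ne_zero_of_isSmooth h1 h2 hs) hs fun x => mem_fixOn_g₃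
    have t₃ : ¬ IsSmooth (XNu τ ν₁ ν₂) → IsGamma (XNu τ ν₁ ν₂) (fixOn (XNu τ ν₁ ν₂) g₃) :=
      fun hs => h.isGamma hX (exists_phi_eq_zero_of_not_isSmooth h1 h2 hX hs).1
        (exists_phi_eq_zero_of_not_isSmooth h1 h2 hX hs).2 fun x => mem_fixOn_g₃
    have s₇ : IsSmooth (XNu τ ν₁ ν₂) →
        HasShape (XNu τ ν₁ ν₂) (fixOn (XNu τ ν₁ ν₂) g₇) 16 0 8 0 := fun hs =>
      h.hasShape_zeros_poles_of_smooth (phi_ne_zero_of_isSmooth h1 h2 hs) fun x => mem_fixOn_g₇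
    have t₇ : ¬ IsSmooth (XNu τ ν₁ ν₂) →
        HasShape (XNu τ ν₁ ν₂) (fixOn (XNu τ ν₁ ν₂) g₇) 0 8 8 0 := fun hs =>
      h.hasShape_zeros_poles_of_singular (exists_phi_eq_zero_of_not_isSmooth h1 h2 hX hs).1
        (exists_phi_eq_zero_of_not_isSmooth h1 h2 hX hs).2 fun x => mem_fixOn_g₇
    have s₁₁ : IsSmooth (XNu τ ν₁ ν₂) →
        HasShape (XNu τ ν₁ ν₂) (fixOn (XNu τ ν₁ ν₂) g₁₁) 32 0 0 0 := fun hs =>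
      h.hasShape_zeros_poles_torsion_of_smooth (phi_ne_zero_of_isSmooth h1 h2 hs)
        fun x => mem_fixOn_g₁₁
    have t₁₁ : ¬ IsSmooth (XNu τ ν₁ ν₂) →
        HasShape (XNu τ ν₁ ν₂) (fixOn (XNu τ ν₁ ν₂) g₁₁) 32 8 0 0 := fun hs =>
      h.hasShape_zeros_poles_torsion_of_singular
        (exists_phi_eq_zero_of_not_isSmooth h1 h2 hX hs).1
        (exists_phi_eq_zero_of_not_isSmooth h1 h2 hX hs).2 fun x => mem_fixOn_g₁₁
    refine ⟨setOf_calG1'_fixOn_nonempty hX ?_, ?_, s₃, t₃, ?_, s₇, t₇, s₁₁, t₁₁, ?_⟩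
    · rintro g (rfl | rfl | rfl | rfl | rfl | rfl | rfl | rfl | rfl | rfl)
      · exact s₁.nonempty (by norm_num)
      · exact s₂.nonempty (by norm_num)
      · by_cases hs : IsSmooth (XNu τ ν₁ ν₂)
        · exact (s₃ hs).nonempty (by norm_num)
        · exact (t₃ hs).nonempty
      · exact s₄.nonempty (by norm_num)
      · exact s₅.nonempty (by norm_num)
      · exact s₆.nonempty (by norm_num)
      · by_cases hs : IsSmooth (XNu τ ν₁ ν₂)
        · exact (s₇ hs).nonempty (by norm_num)
        · exact (t₇ hs).nonempty (by norm_num)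
      · by_cases hs : IsSmooth (XNu τ ν₁ ν₂)
        · exact (s₁₁ hs).nonempty (by norm_num)
        · exact (t₁₁ hs).nonempty (by norm_num)
      · exact s₁₄.nonempty (by norm_num)
      · exact s₁₅.nonempty (by norm_num)
    · rintro g (rfl | rfl) <;> assumption
    · rintro g (rfl | rfl | rfl) <;> assumption
    · rintro g (rfl | rfl) <;> assumption
  · have hX := noTwoTorsion_of_actsFreely gNeg_mem_G₂ hfree
    have hs := (isSmooth_XMu_iff hμ).mpr hX
    have h₀ := isTri_XMu (τ := τ) hμ (i := 1) (j := 2) (k := 0) (by decide) (by decide) (by decide)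
    have h₁ := isTri_XMu (τ := τ) hμ (i := 0) (j := 2) (k := 1) (by decide) (by decide) (by decide)
    have h₂ := isTri_XMu (τ := τ) hμ (i := 0) (j := 1) (k := 2) (by decide) (by decide) (by decide)
    have hφ := fun l => phi_muCoeff_ne_zero hμ (τ := τ l)
    have A : ∀ g ∈ ({g₁, g₂, g₃} : Set G), HasShape (XMu τ μ) (fixOn (XMu τ μ) g) 0 0 0 4 := by
      rintro g (rfl | rfl | rfl)
      · exact h₂.hasShape_slices_left hX (hφ 2) hs fun x => mem_fixOn_g₁
      · exact h₁.hasShape_slices_left hX (hφ 1) hs fun x => mem_fixOn_g₂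
      · exact h₀.hasShape_slices_left hX (hφ 0) hs fun x => mem_fixOn_g₃
    have B : ∀ g ∈ ({g₄, g₅, g₆} : Set G), HasShape (XMu τ μ) (fixOn (XMu τ μ) g) 32 0 0 0 := by
      rintro g (rfl | rfl | rfl)
      · exact h₀.hasShape_pairs_right hX fun x => mem_fixOn_g₄
      · exact h₁.hasShape_pairs_right hX fun x => mem_fixOn_g₅
      · exact h₂.hasShape_pairs_right hX fun x => mem_fixOn_g₆
    have C : ∀ g ∈ ({g₇, g₈, g₉} : Set G), HasShape (XMu τ μ) (fixOn (XMu τ μ) g) 16 0 8 0 := by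
      rintro g (rfl | rfl | rfl)
      · exact h₀.hasShape_zeros_poles_of_smooth (hφ 0) fun x => mem_fixOn_g₇
      · exact h₁.hasShape_zeros_poles_of_smooth (hφ 1) fun x => mem_fixOn_g₈
      · exact h₂.hasShape_zeros_poles_of_smooth (hφ 2) fun x => mem_fixOn_g₉
    have D : ∀ g ∈ ({g₁₁, g₁₂, g₁₃} : Set G),
        HasShape (XMu τ μ) (fixOn (XMu τ μ) g) 32 0 0 0 := by
      rintro g (rfl | rfl | rfl)
      · exact h₀.hasShape_zeros_poles_torsion_of_smooth (hφ 0) fun x => mem_fixOn_g₁₁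
      · exact h₁.hasShape_zeros_poles_torsion_of_smooth (hφ 1) fun x => mem_fixOn_g₁₂
      · exact h₂.hasShape_zeros_poles_torsion_of_smooth (hφ 2) fun x => mem_fixOn_g₁₃
    refine ⟨setOf_calG1_fixOn_nonempty hX fun g hg => ?_, A, B, C, D⟩
    have hg' : (g ∈ ({g₁, g₂, g₃} : Set G) ∨ g ∈ ({g₄, g₅, g₆} : Set G)) ∨
        g ∈ ({g₇, g₈, g₉} : Set G) ∨ g ∈ ({g₁₁, g₁₂, g₁₃} : Set G) := by
      simp only [Set.mem_insert_iff, Set.mem_singleton_iff] at hg ⊢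
      tauto
    rcases hg' with (hg | hg) | hg | hg
    · exact (A g hg).nonempty (by norm_num)
    · exact (B g hg).nonempty (by norm_num)
    · exact (C g hg).nonempty (by norm_num)
    · exact (D g hg).nonempty (by norm_num)
  · have hb := bConst_prod_ne_zero (τ := τ)
    have h₀ : IsTri (XB τ) _ _ _ _ :=
      isTri_XMu (τ := τ) hb (i := 1) (j := 2) (k := 0) (by decide) (by decide) (by decide)
    have h₁ : IsTri (XB τ) _ _ _ _ :=
      isTri_XMu (τ := τ) hb (i := 0) (j := 2) (k := 1) (by decide) (by decide) (by decide)
    have h₂ : IsTri (XB τ) _ _ _ _ :=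
      isTri_XMu (τ := τ) hb (i := 0) (j := 1) (k := 2) (by decide) (by decide) (by decide)
    have hφ := fun l => phi_muCoeff_ne_zero hb (τ := τ l)
    refine ⟨setOf_calG0_hasFixDimOne τ, ?_, ?_⟩
    · rintro g (rfl | rfl | rfl)
      · exact ⟨fun hs => h₀.hasShape_pairs_right ((isSmooth_XMu_iff hb).mp hs)
            fun x => mem_fixOn_g₄,
          fun hs => hasShape_XB_of_not_isSmooth (k := 0) (by decide) (by decide) (by decide) hs
            fun x => mem_fixOn_g₄⟩
      · exact ⟨fun hs => h₁.hasShape_pairs_right ((isSmooth_XMu_iff hb).mp hs)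
            fun x => mem_fixOn_g₅,
          fun hs => hasShape_XB_of_not_isSmooth (k := 1) (by decide) (by decide) (by decide) hs
            fun x => mem_fixOn_g₅⟩
      · exact ⟨fun hs => h₂.hasShape_pairs_right ((isSmooth_XMu_iff hb).mp hs)
            fun x => mem_fixOn_g₆,
          fun hs => hasShape_XB_of_not_isSmooth (k := 2) (by decide) (by decide) (by decide) hs
            fun x => mem_fixOn_g₆⟩
    · rintro g (rfl | rfl | rfl)
      · exact h₀.hasShape_zeros_poles_of_smooth (hφ 0) fun x => mem_fixOn_g₇
      · exact h₁.hasShape_zeros_poles_of_smooth (hφ 1) fun x => mem_fixOn_g₈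
      · exact h₂.hasShape_zeros_poles_of_smooth (hφ 2) fun x => mem_fixOn_g₉
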